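/- Let $n\ge 2$, let $D\subset\mathbb R^n$ be a bounded open set with $C^\infty$-smooth boundary, and let $\Sigma=\partial D$, a compact $C^\infty$ hypersurface without boundary, with outward unit normal field $\nu$ and $(n-1)$-dimensional surface (Hausdorff) measure $\mathrm ds$. The principal curvatures $\kappa_1,\dots,\kappa_{n-1}$ of $\Sigma$ are the eigenvalues of the shape operator $SX=\nabla_X\nu$, and $H_p=\sum_{1\le j_1<\dots<j_p\le n-1}\kappa_{j_1}\cdots\kappa_{j_p}$ (so $H_p=0$ for $p\ge n$). For $\varepsilon>0$ put $\phi_\varepsilon(s,t)=s+\varepsilon t\,\nu(s)$ and $\Omega_\varepsilon=\phi_\varepsilon(\Sigma\times(-1,1))$. Let $N=2^{\lfloor (n+1)/2\rfloor}$, let $\alpha_1,\dots,\alpha_{n+1}$ be Hermitian $N\times N$ matrices with $\alpha_j\alpha_k+\alpha_k\alpha_j=2\delta_{j,k}$ for all $j,k$, put $\Gamma(x)=\sum_{j=1}^n x_j\alpha_j$ for $x\in\mathbb R^n$, and let $m\ge 0$. For $\varepsilon$ so small that $\Omega_\varepsilon$ is a smooth domain, with outward unit normal $\nu_\varepsilon$,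 let $$\mathscr D_\varepsilon u=-i\sum_{j=1}^n\alpha_j\partial_ju+m\,\alpha_{n+1}u,\qquad \mathrm{dom}\,\mathscr D_\varepsilon=\{u\in H^1(\Omega_\varepsilon,\mathbb C^N):\ -i\alpha_{n+1}\Gamma(\nu_\varepsilon)u=u\ \text{on}\ \partial\Omega_\varepsilon\},$$ the boundary condition being understood in the sense of traces. For a number $c>0$ let $$\begin{aligned}c_\varepsilon^{\pm}[w]={}&(1\pm c\varepsilon)\int_{\Sigma\times(-1,1)}|\nabla_\Sigma w|^2\,\mathrm ds\,\mathrm dt+\int_{\Sigma\times(-1,1)}\Big(H_2-\frac{H_1^2}{4}\Big)|w|^2\,\mathrm ds\,\mathrm dt\\&+\frac1{\varepsilon^2}\Big[\int_{\Sigma\times(-1,1)}|\partial_tw|^2\,\mathrm ds\,\mathrm dt+(m\varepsilon\pm c\varepsilon^3)\int_\Sigma\big(|w(s,-1)|^2+|w(s,1)|^2\big)\,\mathrm ds\Big]\\&+(m^2\pm c\varepsilon)\int_{\Sigma\times(-1,1)}|w|^2\,\mathrm ds\,\mathrm dt,\end{aligned}$$ $$\mathrm{dom}\,c_\varepsilon^\pm=\{w\in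 H^1(\Sigma\times(-1,1),\mathbb C^N):\ -i\alpha_{n+1}\Gamma(\nu)w(\cdot,1)=w(\cdot,1),\ -i\alpha_{n+1}\Gamma(\nu)w(\cdot,-1)=-w(\cdot,-1)\},$$ where $\nabla_\Sigma$ is the surface gradient on $\Sigma$. Then there exist $\varepsilon_0>0$ and $c>0$ such that for every $\varepsilon\in(0,\varepsilon_0)$ there is a unitary map $\mathcal U:L^2(\Omega_\varepsilon,\mathbb C^N)\to L^2(\Sigma\times(-1,1),\mathbb C^N,\mathrm ds\,\mathrm dt)$ such that for all $u\in\mathrm{dom}\,\mathscr D_\varepsilon$ one has $\mathcal Uu\in\mathrm{dom}\,c_\varepsilon^\pm$ and $$c_\varepsilon^-[\mathcal Uu]\le\|\mathscr D_\varepsilon u\|^2_{L^2(\Omega_\varepsilon,\mathbb C^N)}\le c_\varepsilon^+[\mathcal Uu].$$ -/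

import Mathlib

open MeasureTheory Set Filter Topology
open scoped ContDiff ENNReal InnerProductSpace Gradient

namespace ThinShell

noncomputable section

/-- Euclidean space `ℝⁿ`. -/
abbrev E (n : ℕ) := EuclideanSpace ℝ (Fin n)

/-- The Hermitian space `ℂᴺ` of spinors. -/
abbrev Spinor (N : ℕ) := EuclideanSpace ℂ (Fin N)

/-- The `j`-th canonical basis vector of `ℝⁿ`. -/
def stdVec {n : ℕ} (j : Fin n) : E n := EuclideanSpace.single j (1 : ℝ)

/-! ### Smooth domains, outward unit normals, curvatures -/

/-- `f` is a smooth defining function of the set `U` in the open neighbourhood `V` of `x`: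
it has no critical point in `V` and `U ∩ V = {f < 0}`. -/
def IsLocalDefiningFunction {n : ℕ} (U : Set (E n)) (x : E n) (V : Set (E n)) (f : E n → ℝ) :
    Prop :=
  IsOpen V ∧ x ∈ V ∧ ContDiffOn ℝ ∞ f V ∧ (∀ y ∈ V, ∇ f y ≠ 0) ∧ ∀ y ∈ V, (y ∈ U ↔ f y < 0)

/-- Bounded open sets with `C^∞` boundary. The boundary `frontier D` is then a compact smooth
hypersurface without boundary, and `D` lies locally on one side of it. -/
def IsSmoothBoundedDomain {n : ℕ} (D : Set (E n)) : Prop :=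
  IsOpen D ∧ Bornology.IsBounded D ∧
    ∀ s ∈ frontier D, ∃ (V : Set (E n)) (f : E n → ℝ), IsLocalDefiningFunction D s V f

open Classical in
/-- The outward unit normal of `U` at a point `x` of its boundary, namely `∇f / |∇f|` at `x` for a
local defining function `f` of `U` near `x` (the value does not depend on `f`); it is `0` at all
the points where there is none. -/
def outerNormal {n : ℕ} (U : Set (E n)) (x : E n) : E n :=
  if h : x ∈ frontier U ∧ ∃ f : E n → ℝ, ∃ V : Set (E n), IsLocalDefiningFunction U x V f then
    ‖∇ h.2.choose x‖⁻¹ • ∇ h.2.choose x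
  else 0

/-- The tangent space `ν(s)^⊥` of the hypersurface `∂D` at `s`. -/
abbrev tangentSpaceAt {n : ℕ} (D : Set (E n)) (s : E n) : Submodule ℝ (E n) :=
  (Submodule.span ℝ {outerNormal D s})ᗮ

/-- The shape operator `S X = ∇_X ν` of `∂D` at `s`, where `ν` is the outward unit normal of `D`,
differentiated along `∂D`. (As `|ν| = 1`, the derivative takes values in the tangent space
already; the projection only records this in the type.) -/
def shapeOperator {n : ℕ} (D : Set (E n)) (s : E n) :
    tangentSpaceAt D s →ₗ[ℝ] tangentSpaceAt D s :=
  ((tangentSpaceAt D s).orthogonalProjectionOnto ∘L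
    (fderivWithin ℝ (outerNormal D) (frontier D) s ∘L (tangentSpaceAt D s).subtypeL)).toLinearMap

/-- The principal curvatures of `∂D` at `s`: the eigenvalues of the (symmetric) shape operator,
counted with multiplicity. -/
def principalCurvatures {n : ℕ} (D : Set (E n)) (s : E n) : Multiset ℝ :=
  (shapeOperator D s).charpoly.roots

/-- The `p`-th mean curvature `H_p` of `∂D`: the `p`-th elementary symmetric function of the
principal curvatures (it is `0` for `p ≥ n`). -/
def meanCurvature {n : ℕ} (D : Set (E n)) (p : ℕ) (s : E n) : ℝ :=
  (principalCurvatures D s).esymm p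

/-- The surface measure of `∂D`: the `(n-1)`-dimensional Hausdorff measure, with its Euclidean
normalization. -/
def surfaceMeasure {n : ℕ} (D : Set (E n)) : Measure (E n) :=
  (μHE[n - 1] : Measure (E n)).restrict (frontier D)

/-! ### Dirac matrices -/

/-- Hermitian matrices `α_1, …, α_{n+1}` with `α_j α_k + α_k α_j = 2 δ_{jk}`. The index `j : Fin n`
of `α_j` with `j ≤ n` is embedded by `Fin.castSucc`, and `α_{n+1}` has the index `Fin.last n`. -/
def IsDiracFamily {n N : ℕ} (α : Fin (n + 1) → Matrix (Fin N) (Fin N) ℂ) : Prop :=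
  (∀ j, (α j).IsHermitian) ∧ ∀ j k, α j * α k + α k * α j = if j = k then 2 else 0

/-- `Γ(x) = ∑_{j ≤ n} x_j α_j`. -/
def Gam {n N : ℕ} (α : Fin (n + 1) → Matrix (Fin N) (Fin N) ℂ) (x : E n) :
    Matrix (Fin N) (Fin N) ℂ :=
  ∑ j : Fin n, ((x j : ℝ) : ℂ) • α j.castSucc

/-- The action of a matrix on spinors. -/
abbrev act {N : ℕ} (A : Matrix (Fin N) (Fin N) ℂ) : Spinor N →L[ℂ] Spinor N :=
  Matrix.toEuclideanCLM (n := Fin N) (𝕜 := ℂ) A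

/-- The matrix `-i α_{n+1} Γ(x)` of the infinite mass boundary condition. -/
def bdryMatrix {n N : ℕ} (α : Fin (n + 1) → Matrix (Fin N) (Fin N) ℂ) (x : E n) :
    Matrix (Fin N) (Fin N) ℂ :=
  (-Complex.I) • (α (Fin.last n) * Gam α x)

/-! ### The Dirac operator in an open set -/

/-- `L²(Ω, ℂᴺ)`. -/
abbrev L2Domain (n N : ℕ) (Ω : Set (E n)) := Lp (Spinor N) 2 (volume.restrict Ω : Measure (E n))

/-- `L²(∂Ω, ℂᴺ)`. -/
abbrev L2Boundary (n N : ℕ) (Ω : Set (E n)) := Lp (Spinor N) 2 (surfaceMeasure Ω)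

/-- `g = ∂_j u` in the sense of distributions in `Ω`. -/
def IsWeakPartial {n N : ℕ} {Ω : Set (E n)} (u : L2Domain n N Ω) (j : Fin n)
    (g : L2Domain n N Ω) : Prop :=
  ∀ φ : E n → ℝ, ContDiff ℝ ∞ φ → HasCompactSupport φ → tsupport φ ⊆ Ω →
    ∫ x in Ω, fderiv ℝ φ x (stdVec j) • u x = -∫ x in Ω, φ x • g x

/-- `u ∈ H¹(Ω, ℂᴺ)`. -/
def MemH1 {n N : ℕ} {Ω : Set (E n)} (u : L2Domain n N Ω) : Prop :=
  ∀ j, ∃ g, IsWeakPartial u j g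

open Classical in
/-- The weak derivative `∂_j u ∈ L²(Ω, ℂᴺ)` (and `0` if there is none). -/
def weakPartial {n N : ℕ} {Ω : Set (E n)} (u : L2Domain n N Ω) (j : Fin n) : L2Domain n N Ω :=
  if h : ∃ g, IsWeakPartial u j g then h.choose else 0

/-- `τ ∈ L²(∂Ω, ℂᴺ)` is the trace of `u ∈ H¹(Ω, ℂᴺ)` on `∂Ω`, for a bounded open set `Ω`: the trace
map is the extension by continuity of the restriction to `∂Ω` of functions which are smooth up to
the boundary. -/
def IsTrace {n N : ℕ} {Ω : Set (E n)} (u : L2Domain n N Ω) (τ : L2Boundary n N Ω) : Prop :=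
  MemH1 u ∧ ∃ f : ℕ → E n → Spinor N, (∀ k, ContDiff ℝ ∞ (f k)) ∧
    Tendsto (fun k => eLpNorm (fun x => f k x - u x) 2 (volume.restrict Ω)) atTop (𝓝 0) ∧
    (∀ j, Tendsto (fun k => eLpNorm (fun x => fderiv ℝ (f k) x (stdVec j) - weakPartial u j x) 2
      (volume.restrict Ω)) atTop (𝓝 0)) ∧
    Tendsto (fun k => eLpNorm (fun x => f k x - τ x) 2 (surfaceMeasure Ω)) atTop (𝓝 0)

/-- The domain of the Dirac operator in `Ω` with infinite mass boundary conditions: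
`u ∈ H¹(Ω, ℂᴺ)` with `-i α_{n+1} Γ(ν_Ω) u = u` on `∂Ω`, where `ν_Ω` is the outward unit normal. -/
def MemDomDirac {n N : ℕ} {Ω : Set (E n)} (α : Fin (n + 1) → Matrix (Fin N) (Fin N) ℂ)
    (u : L2Domain n N Ω) : Prop :=
  MemH1 u ∧ ∃ τ : L2Boundary n N Ω, IsTrace u τ ∧
    ∀ᵐ x ∂(surfaceMeasure Ω), act (bdryMatrix α (outerNormal Ω x)) (τ x) = τ x

/-- The Dirac operator `-i ∑_j α_j ∂_j u + m α_{n+1} u`. -/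
def diracOp {n N : ℕ} {Ω : Set (E n)} (α : Fin (n + 1) → Matrix (Fin N) (Fin N) ℂ) (m : ℝ)
    (u : L2Domain n N Ω) : L2Domain n N Ω :=
  (-Complex.I) • (∑ j : Fin n, (act (α j.castSucc)).compLp (weakPartial u j))
    + (m : ℂ) • (act (α (Fin.last n))).compLp u

/-! ### The shell -/

/-- The map `φ_ε(s, t) = s + ε t ν(s)`. -/
def tubeMap {n : ℕ} (D : Set (E n)) (ε : ℝ) (p : E n × ℝ) : E n :=
  p.1 + (ε * p.2) • outerNormal D p.1

/-- The shell `Ω_ε = φ_ε(∂D × (-1, 1))`. -/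
def shell {n : ℕ} (D : Set (E n)) (ε : ℝ) : Set (E n) :=
  tubeMap D ε '' (frontier D ×ˢ Ioo (-1 : ℝ) 1)

/-! ### Sobolev functions on the cylinder `∂D × (-1, 1)` -/

/-- The measure `ds dt` on `∂D × (-1, 1)`. -/
def cylMeasure {n : ℕ} (D : Set (E n)) : Measure (E n × ℝ) :=
  (surfaceMeasure D).prod (volume.restrict (Ioo (-1 : ℝ) 1))

/-- `L²(∂D × (-1, 1), ℂᴺ, ds dt)`. -/
abbrev L2Cyl (n N : ℕ) (D : Set (E n)) := Lp (Spinor N) 2 (cylMeasure D)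

/-- `h = ∂_t w` in the sense of distributions in `∂D × (-1, 1)`. -/
def IsWeakDt {n N : ℕ} {D : Set (E n)} (w h : L2Cyl n N D) : Prop :=
  ∀ ψ : E n × ℝ → ℝ, ContDiff ℝ ∞ ψ → HasCompactSupport ψ →
    tsupport ψ ⊆ univ ×ˢ Ioo (-1 : ℝ) 1 →
    ∫ p, deriv (fun t => ψ (p.1, t)) p.2 • w p ∂(cylMeasure D)
      = -∫ p, ψ p • h p ∂(cylMeasure D)

/-- The surface divergence at `(s, t)`, with respect to `s ∈ ∂D`, of a vector field `X`:
`div X - ⟨(∂_ν X), ν⟩`. -/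
def surfDiv {n : ℕ} (D : Set (E n)) (X : E n × ℝ → E n) (p : E n × ℝ) : ℝ :=
  (∑ j : Fin n, fderiv ℝ (fun y => X (y, p.2)) p.1 (stdVec j) j)
    - ⟪fderiv ℝ (fun y => X (y, p.2)) p.1 (outerNormal D p.1), outerNormal D p.1⟫_ℝ

/-- `G = ∇_Σ w` for `Σ = ∂D`, in the sense of distributions in `Σ × (-1, 1)`: `G` is tangent to
`Σ` and `∫ w div_Σ X = -∫ ⟨X, G⟩` for all smooth compactly supported fields `X` which are tangent to
`Σ`. Here `G = (G_1, …, G_n)` with respect to the canonical basis of `ℝⁿ`, each `G_j` with values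
in `ℂᴺ`. -/
def IsWeakSurfGrad {n N : ℕ} {D : Set (E n)} (w : L2Cyl n N D) (G : Fin n → L2Cyl n N D) : Prop :=
  (∀ᵐ p ∂(cylMeasure D), ∑ j, outerNormal D p.1 j • G j p = 0) ∧
  ∀ X : E n × ℝ → E n, ContDiff ℝ ∞ X → HasCompactSupport X →
    tsupport X ⊆ univ ×ˢ Ioo (-1 : ℝ) 1 →
    (∀ p, p.1 ∈ frontier D → ⟪X p, outerNormal D p.1⟫_ℝ = 0) →
    ∫ p, surfDiv D X p • w p ∂(cylMeasure D) = -∫ p, ∑ j, X p j • G j p ∂(cylMeasure D)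

/-- `w ∈ H¹(∂D × (-1, 1), ℂᴺ)`. -/
def MemH1Cyl {n N : ℕ} {D : Set (E n)} (w : L2Cyl n N D) : Prop :=
  (∃ G, IsWeakSurfGrad w G) ∧ ∃ h, IsWeakDt w h

open Classical in
/-- The surface gradient of `w`, by its components (and `0` if there is none). -/
def surfGrad {n N : ℕ} {D : Set (E n)} (w : L2Cyl n N D) : Fin n → L2Cyl n N D :=
  if h : ∃ G, IsWeakSurfGrad w G then h.choose else 0

open Classical in
/-- The derivative `∂_t w` (and `0` if there is none). -/
def weakDt {n N : ℕ} {D : Set (E n)} (w : L2Cyl n N D) : L2Cyl n N D :=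
  if h : ∃ h, IsWeakDt w h then h.choose else 0

/-- The `j`-th component of the surface gradient of a smooth function `f`: the derivative of `f` in
the direction of the tangential part `e_j - ν_j ν` of `e_j`. -/
def classicalSurfGrad {n N : ℕ} (D : Set (E n)) (f : E n × ℝ → Spinor N) (j : Fin n)
    (p : E n × ℝ) : Spinor N :=
  fderiv ℝ (fun y => f (y, p.2)) p.1 (stdVec j - outerNormal D p.1 j • outerNormal D p.1)

/-- `τ ∈ L²(∂D, ℂᴺ)` is the trace `w(·, t₀)`, with `t₀ ∈ {-1, 1}`, of `w ∈ H¹(∂D × (-1, 1), ℂᴺ)`: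
again by continuous extension from functions which are smooth up to the boundary. -/
def IsEndTrace {n N : ℕ} {D : Set (E n)} (w : L2Cyl n N D) (t₀ : ℝ) (τ : L2Boundary n N D) :
    Prop :=
  MemH1Cyl w ∧ ∃ f : ℕ → E n × ℝ → Spinor N, (∀ k, ContDiff ℝ ∞ (f k)) ∧
    Tendsto (fun k => eLpNorm (fun p => f k p - w p) 2 (cylMeasure D)) atTop (𝓝 0) ∧
    (∀ j, Tendsto (fun k => eLpNorm (fun p => classicalSurfGrad D (f k) j p - surfGrad w j p) 2
      (cylMeasure D)) atTop (𝓝 0)) ∧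
    Tendsto (fun k => eLpNorm (fun p => deriv (fun t => f k (p.1, t)) p.2 - weakDt w p) 2
      (cylMeasure D)) atTop (𝓝 0) ∧
    Tendsto (fun k => eLpNorm (fun s => f k (s, t₀) - τ s) 2 (surfaceMeasure D)) atTop (𝓝 0)

open Classical in
/-- The trace `w(·, t₀)`, `t₀ ∈ {-1, 1}` (and `0` if there is none). -/
def endTrace {n N : ℕ} {D : Set (E n)} (w : L2Cyl n N D) (t₀ : ℝ) : L2Boundary n N D :=
  if h : ∃ τ, IsEndTrace w t₀ τ then h.choose else 0

/-- The common domain of the forms `c_ε^±`: the `w ∈ H¹(∂D × (-1, 1), ℂᴺ)` such that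
`-i α_{n+1} Γ(ν) w(·, ±1) = ± w(·, ±1)`. -/
def MemDomForm {n N : ℕ} {D : Set (E n)} (α : Fin (n + 1) → Matrix (Fin N) (Fin N) ℂ)
    (w : L2Cyl n N D) : Prop :=
  MemH1Cyl w ∧ ∀ t₀ ∈ ({-1, 1} : Set ℝ), ∃ τ : L2Boundary n N D, IsEndTrace w t₀ τ ∧
    ∀ᵐ s ∂(surfaceMeasure D), act (bdryMatrix α (outerNormal D s)) (τ s) = (t₀ : ℂ) • τ s

/-- The value `c_ε^±[w]` of the quadratic form, with `sgn = 1` for `c_ε^+` and `sgn = -1` for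
`c_ε^-`; all norms are `L²` norms. -/
def cForm {n N : ℕ} {D : Set (E n)} (m c ε sgn : ℝ) (w : L2Cyl n N D) : ℝ :=
  (1 + sgn * c * ε) * (∑ j, ‖surfGrad w j‖ ^ 2)
    + (∫ p, (meanCurvature D 2 p.1 - meanCurvature D 1 p.1 ^ 2 / 4) * ‖w p‖ ^ 2 ∂(cylMeasure D))
    + 1 / ε ^ 2 * (‖weakDt w‖ ^ 2
        + (m * ε + sgn * c * ε ^ 3) * (‖endTrace w (-1)‖ ^ 2 + ‖endTrace w 1‖ ^ 2))
    + (m ^ 2 + sgn * c * ε) * ‖w‖ ^ 2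

end

end ThinShell

open ThinShell

/-! Put `B_j = -i α_{n+1} α_j`. These operators are symmetric and satisfy the Clifford relations,
the boundary condition reads `B(N) u = u` with `N` the outward normal of the shell, and `α_{n+1} B_j
= -i α_j`; hence the norm of the Dirac operator at `u` is `‖∑ B_j ∂_j u + m u‖` (`norm_diracOp`).
Let `d` be the signed distance to `∂D` and `ν = ∇d`, so that `N = ±ν` on the components `d = ±ε`.

Expand the square. The cross term is, by the divergence theorem and the boundary condition, `m`
times the boundary integral of `|u|²` (`two_mul_inner_diracL2`). The difference `‖∑ B_j ∂_j u‖² -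
‖∇u‖²` is the boundary integral of `⟨u, K u⟩`, outer minus inner component, with the tangential
Dirac operator `K = B(ν) ∑ B_k ∂_k - ∂_ν` (`Tube.integral_dirac_sub`). As `K` anticommutes with
`B(ν)` up to the mean curvature `h = div ν` (`Tube.tangDirac_cliff`), the condition `B(ν) u = ±u`
formally gives `⟨u, K u⟩ = h |u|² / 2`. Writing this boundary term as a volume integral and
completing the square yields (`Tube.norm_diracL2_sq`) `‖∑ B_j ∂_j u‖² = ‖∇_tan u‖² + ‖∂_ν u + (h/2)
u‖² + ∫ (h²/4 + ∂_ν h/2) |u|²`.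

For `u ∈ H¹` the trace of `K u` is not a function, and the smooth approximations of `u` need not
satisfy the boundary condition. Therefore the formal computation is replaced by a polarization: `z =
B(ν) u + u` has zero trace on the inner component and `v = B(ν) u - u` on the outer one. A linear
cutoff splits the form at `(z, v)` into two pieces, each of which can be written with a derivative
on one factor only and the vanishing trace of the other, so the form vanishes at `(z, v)`
(`Tube.two_mul_dform`).

The unitary map is `u ↦ √(ε J) · u(s + ε t ν)`, where `J(s, r) = det (1 + r A(s))` is the Jacobian
of the normal map and `A` the derivative of `ν`. Because `∂_r J = h J`, the `t`-derivative of the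
image is `ε` times the image of `∂_ν u + (h/2) u`; this part and the boundary part of the forms are
reproduced exactly. The tangential gradients differ by a relative error `O(ε)`, since `J = 1` at `r
= 0` and the normal map is `O(ε)`-close to the identity on tangent vectors. The potential equals
`H_2 - H_1²/4` on `∂D`, because `∂_ν h = -tr A²`, and varies by `O(ε)` in the shell.
`Tube.form_bounds` collects these errors.

Two foundations carry this. The first is a tubular neighbourhood, from a global defining function
and the inverse function theorem (`IsSmoothBoundedDomain.nonempty_tube`). The second is the change
of variables between volume and the Hausdorff measure on `∂D` (`Tube.lintegral_tube`), from which
the divergence theorems follow by testing on the whole space. Weak derivatives and traces of the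
transformed function are found by passing to the limit in the smooth approximations contained in the
definition of a trace (`Tube.IsPullback.convergesH1`). -/

namespace ThinShell

noncomputable section

/-! ### Local defining functions and independence of the normal from them. -/

section LocalTheory

variable {n : ℕ} {U : Set (E n)} {x : E n} {V : Set (E n)} {f : E n → ℝ}

theorem IsLocalDefiningFunction.mono_point (h : IsLocalDefiningFunction U x V f) {y : E n}
    (hy : y ∈ V) : IsLocalDefiningFunction U y V f :=
  ⟨h.1, hy, h.2.2⟩

theorem IsLocalDefiningFunction.contDiffAt (h : IsLocalDefiningFunction U x V f) {y : E n}
    (hy : y ∈ V) : ContDiffAt ℝ ∞ f y :=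
  h.2.2.1.contDiffAt (h.1.mem_nhds hy)

theorem IsLocalDefiningFunction.hasGradientAt (h : IsLocalDefiningFunction U x V f) {y : E n}
    (hy : y ∈ V) : HasGradientAt f (∇ f y) y :=
  ((h.contDiffAt hy).differentiableAt (by simp)).hasGradientAt

/-- A function with gradient `a` at a zero `x` is negative at `x + t v` for small `t > 0` if
`⟪a, v⟫ < 0`. -/
theorem eventually_neg_of_inner_neg {f : E n → ℝ} {x a v : E n} (hf : HasGradientAt f a x)
    (h0 : f x = 0) (hv : ⟪a, v⟫_ℝ < 0) : ∀ᶠ t in 𝓝[>] (0 : ℝ), f (x + t • v) < 0 := by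
  have h1 : HasDerivAt (fun t : ℝ => f (x + t • v)) ⟪a, v⟫_ℝ 0 := by
    have hl : HasDerivAt (fun t : ℝ => x + t • v) v 0 := by
      simpa using ((hasDerivAt_id (0 : ℝ)).smul_const v).const_add x
    have h2 : HasFDerivAt f (InnerProductSpace.toDual ℝ (E n) a) (x + (0 : ℝ) • v) := by
      simpa using hf.hasFDerivAt
    exact h2.comp_hasDerivAt (0 : ℝ) hl
  have h3 := (hasDerivAt_iff_tendsto_slope.1 h1).eventually (gt_mem_nhds hv)
  have h4 := nhdsWithin_mono (0 : ℝ) (fun t (ht : 0 < t) => ht.ne') h3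
  filter_upwards [h4, self_mem_nhdsWithin] with t ht ht0
  have ht0' : 0 < t := ht0
  simp only [slope, sub_zero, zero_smul, add_zero, h0, vsub_eq_sub, smul_eq_mul] at ht
  have := mul_neg_iff.1 ht
  rcases this with h | h
  · exact h.2
  · exact absurd h.1 (not_lt.2 (by positivity))

theorem tendsto_line (x v : E n) : Tendsto (fun t : ℝ => x + t • v) (𝓝[>] 0) (𝓝 x) := by
  have : Continuous fun t : ℝ => x + t • v := by fun_prop
  simpa using (this.tendsto 0).mono_left nhdsWithin_le_nhds

/-- Where `f ≠ 0` its sign is constant nearby, so the point is interior or exterior. At a zero, `f`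
becomes negative along `-∇f`, which is nonzero, so the point is a limit of points of `U` without
belonging to `U`. -/
theorem IsLocalDefiningFunction.mem_frontier_iff (h : IsLocalDefiningFunction U x V f) {y : E n}
    (hy : y ∈ V) : y ∈ frontier U ↔ f y = 0 := by
  have hc : ContinuousAt f y := (h.contDiffAt hy).continuousAt
  have hV : V ∈ 𝓝 y := h.1.mem_nhds hy
  constructor
  · intro hyf
    rcases lt_trichotomy (f y) 0 with h0 | h0 | h0
    · exfalso
      apply hyf.2
      rw [mem_interior_iff_mem_nhds]
      filter_upwards [hc.eventually (gt_mem_nhds h0), hV] with z hz hzV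
      exact (h.2.2.2.2 z hzV).2 hz
    · exact h0
    · exfalso
      have h1 := mem_closure_iff_frequently.1 hyf.1
      apply h1
      filter_upwards [hc.eventually (lt_mem_nhds h0), hV] with z hz hzV hzU
      exact absurd ((h.2.2.2.2 z hzV).1 hzU) (not_lt.2 hz.le)
  · intro h0
    constructor
    · have hneg : ⟪∇ f y, -∇ f y⟫_ℝ < 0 := by
        rw [inner_neg_right, real_inner_self_eq_norm_sq]
        have := norm_pos_iff.2 (h.2.2.2.1 y hy)
        nlinarith
      have h1 := eventually_neg_of_inner_neg (h.hasGradientAt hy) h0 hneg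
      refine mem_closure_of_tendsto (tendsto_line y (-∇ f y)) ?_
      filter_upwards [h1, (tendsto_line y (-∇ f y)).eventually hV] with t ht htV
      exact (h.2.2.2.2 _ htV).2 ht
    · intro hi
      have := (h.2.2.2.2 y hy).1 (interior_subset hi)
      linarith

/-- If `{f < 0} ⊆ {g < 0}` near a common zero, the gradients have the same direction. -/
theorem normalize_gradient_eq {f g : E n → ℝ} {x a b : E n} (hf : HasGradientAt f a x)
    (hg : HasGradientAt g b x) (ha : a ≠ 0) (hb : b ≠ 0) (hf0 : f x = 0) (hg0 : g x = 0)
    (h : ∀ᶠ y in 𝓝 x, f y < 0 → g y < 0) : ‖a‖⁻¹ • a = ‖b‖⁻¹ • b := by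
  have key : ∀ v : E n, ⟪a, v⟫_ℝ < 0 → ⟪b, v⟫_ℝ ≤ 0 := by
    intro v hv
    by_contra hcon
    push Not at hcon
    have h1 := eventually_neg_of_inner_neg hf hf0 hv
    have hg' : HasGradientAt (fun y => -g y) (-b) x := by
      have h3 := hg.hasFDerivAt.neg
      rw [hasGradientAt_iff_hasFDerivAt, map_neg]
      exact h3
    have h2 := eventually_neg_of_inner_neg hg' (by simp [hg0])
      (show ⟪-b, v⟫_ℝ < 0 by rw [inner_neg_left]; linarith)
    obtain ⟨t, ht1, ht2, ht3⟩ := (h1.and (h2.and ((tendsto_line x v).eventually h))).exists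
    have := ht3 ht1
    linarith
  have hna : 0 < ‖a‖ := norm_pos_iff.2 ha
  have hnb : 0 < ‖b‖ := norm_pos_iff.2 hb
  -- test with `v = |a| b - |b| a`
  have h1 : ‖a‖ * ‖b‖ ≤ ⟪a, b⟫_ℝ := by
    by_contra hcon
    push Not at hcon
    have h2 : ⟪a, ‖a‖ • b - ‖b‖ • a⟫_ℝ < 0 := by
      rw [inner_sub_right, real_inner_smul_right, real_inner_smul_right,
        real_inner_self_eq_norm_sq]
      nlinarith
    have h3 := key _ h2
    rw [inner_sub_right, real_inner_smul_right, real_inner_smul_right,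
      real_inner_self_eq_norm_sq, real_inner_comm] at h3
    nlinarith
  have h2 : ⟪a, b⟫_ℝ = ‖a‖ * ‖b‖ := le_antisymm (real_inner_le_norm a b) h1
  rw [inner_eq_norm_mul_iff_real] at h2
  have h3 : ‖a‖⁻¹ • a = (‖a‖⁻¹ * ‖b‖⁻¹) • (‖b‖ • a) := by
    rw [smul_smul]; congr 1; field_simp
  rw [h3, h2, smul_smul]; congr 1; field_simp

/-- The choice made in `outerNormal` is harmless: two defining functions are negative on the same
set near `x`, so their gradients are positive multiples of each other. -/
theorem IsLocalDefiningFunction.outerNormal_eq (h : IsLocalDefiningFunction U x V f)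
    (hx : x ∈ frontier U) : outerNormal U x = ‖∇ f x‖⁻¹ • ∇ f x := by
  have hex : x ∈ frontier U ∧ ∃ f : E n → ℝ, ∃ V : Set (E n), IsLocalDefiningFunction U x V f :=
    ⟨hx, f, V, h⟩
  rw [outerNormal, dif_pos hex]
  obtain ⟨V', h'⟩ := hex.2.choose_spec
  refine normalize_gradient_eq (h'.hasGradientAt h'.2.1) (h.hasGradientAt h.2.1)
    (h'.2.2.2.1 x h'.2.1) (h.2.2.2.1 x h.2.1) ((h'.mem_frontier_iff h'.2.1).1 hx)
    ((h.mem_frontier_iff h.2.1).1 hx) ?_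
  filter_upwards [h.1.mem_nhds h.2.1, h'.1.mem_nhds h'.2.1] with y hy hy' hlt
  exact (h.2.2.2.2 y hy).1 ((h'.2.2.2.2 y hy').2 hlt)

/-- The normalized defining function `f / |∇f|`. -/
theorem IsLocalDefiningFunction.contDiffOn_normalized (h : IsLocalDefiningFunction U x V f) :
    ContDiffOn ℝ ∞ (fun y => ‖∇ f y‖⁻¹ * f y) V := by
  have h1 : ContDiffOn ℝ ∞ (fun y => fderiv ℝ f y) V :=
    h.2.2.1.fderiv_of_isOpen h.1 (by simp)
  have h2 : ContDiffOn ℝ ∞ (fun y => ∇ f y) V :=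
    ((InnerProductSpace.toDual ℝ (E n)).symm.contDiff (n := ∞)).comp_contDiffOn h1
  have h3 : ContDiffOn ℝ ∞ (fun y => ‖∇ f y‖⁻¹) V :=
    (h2.norm ℝ h.2.2.2.1).inv (fun y hy => norm_ne_zero_iff.2 (h.2.2.2.1 y hy))
  exact h3.mul h.2.2.1

/-- In the product rule the derivative of `‖∇f‖⁻¹` is multiplied by `f`, which is zero on the
boundary. -/
theorem IsLocalDefiningFunction.fderiv_normalized (h : IsLocalDefiningFunction U x V f) {y : E n}
    (hy : y ∈ V) (hyf : y ∈ frontier U) (v : E n) :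
    fderiv ℝ (fun y => ‖∇ f y‖⁻¹ * f y) y v = ⟪outerNormal U y, v⟫_ℝ := by
  have hV := h.1.mem_nhds hy
  have h1 : ContDiffOn ℝ ∞ (fun y => fderiv ℝ f y) V :=
    h.2.2.1.fderiv_of_isOpen h.1 (by simp)
  have h2 : ContDiffOn ℝ ∞ (fun y => ∇ f y) V :=
    ((InnerProductSpace.toDual ℝ (E n)).symm.contDiff (n := ∞)).comp_contDiffOn h1
  have h3 : ContDiffOn ℝ ∞ (fun y => ‖∇ f y‖⁻¹) V :=
    (h2.norm ℝ h.2.2.2.1).inv (fun y hy => norm_ne_zero_iff.2 (h.2.2.2.1 y hy))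
  have h4 : HasFDerivAt (fun y => ‖∇ f y‖⁻¹) (fderiv ℝ (fun y => ‖∇ f y‖⁻¹) y) y :=
    ((h3.contDiffAt hV).differentiableAt (by simp)).hasFDerivAt
  have h5 := h4.mul (h.hasGradientAt hy).hasFDerivAt
  have h0 : f y = 0 := (h.mem_frontier_iff hy).1 hyf
  have h6 : HasFDerivAt (fun y => ‖∇ f y‖⁻¹ * f y) _ y := h5
  rw [h6.fderiv, (h.mono_point hy).outerNormal_eq hyf]
  simp [h0, real_inner_smul_left]

theorem IsLocalDefiningFunction.norm_outerNormal (h : IsLocalDefiningFunction U x V f)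
    (hx : x ∈ frontier U) : ‖outerNormal U x‖ = 1 := by
  rw [h.outerNormal_eq hx, norm_smul, norm_inv, norm_norm,
    inv_mul_cancel₀ (norm_ne_zero_iff.2 (h.2.2.2.1 x h.2.1))]

end LocalTheory

/-! ### A global defining function, by a partition of unity. -/

section GlobalDefiningFunction

variable {n : ℕ} {D : Set (E n)}

theorem IsSmoothBoundedDomain.isCompact_frontier (hD : IsSmoothBoundedDomain D) :
    IsCompact (frontier D) :=
  Metric.isCompact_of_isClosed_isBounded isClosed_frontier
    (hD.2.1.closure.subset frontier_subset_closure)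

theorem IsSmoothBoundedDomain.norm_outerNormal (hD : IsSmoothBoundedDomain D) {s : E n}
    (hs : s ∈ frontier D) : ‖outerNormal D s‖ = 1 := by
  obtain ⟨V, f, h⟩ := hD.2.2 s hs
  exact h.norm_outerNormal hs

open scoped Manifold in
/-- A smooth function on the whole space which vanishes near `∂D` exactly on `∂D`, where its
gradient is the outward unit normal. -/
theorem IsSmoothBoundedDomain.exists_defining_function (hD : IsSmoothBoundedDomain D) :
    ∃ ρ : E n → ℝ, ContDiff ℝ ∞ ρ ∧ (∃ O : Set (E n), IsOpen O ∧ frontier D ⊆ O ∧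
      ∀ y ∈ O, ρ y = 0 → y ∈ frontier D) ∧ (∀ s ∈ frontier D, ρ s = 0) ∧
      ∀ s ∈ frontier D, ∀ v, fderiv ℝ ρ s v = ⟪outerNormal D s, v⟫_ℝ := by
  choose! V f hf using hD.2.2
  obtain ⟨t, htD⟩ := hD.isCompact_frontier.elim_nhds_subcover' (fun s _ => V s)
    (fun s hs => (hf s hs).1.mem_nhds (hf s hs).2.1)
  let W : t → Set (E n) := fun i => V i.1
  have hW : ∀ i : t, IsLocalDefiningFunction D i.1.1 (W i) (f i.1) := fun i => hf _ i.1.2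
  have hcov : frontier D ⊆ ⋃ i, W i := by
    intro s hs
    obtain ⟨i, hi, hsi⟩ := mem_iUnion₂.1 (htD hs)
    exact mem_iUnion.2 ⟨⟨i, hi⟩, hsi⟩
  obtain ⟨χ, hχ⟩ := SmoothPartitionOfUnity.exists_isSubordinate 𝓘(ℝ, E n)
    (isClosed_frontier (s := D)) W (fun i => (hW i).1) hcov
  let g : t → E n → ℝ := fun i y => ‖∇ (f i.1) y‖⁻¹ * f i.1 y
  let ρ : E n → ℝ := fun y => ∑ i, χ i y * g i y
  have hχs : ∀ i, ContDiff ℝ ∞ (χ i) := fun i => (χ i).contMDiff.contDiff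
  have hterm : ∀ i, ContDiff ℝ ∞ (fun y => χ i y * g i y) := by
    intro i
    rw [contDiff_iff_contDiffAt]
    intro y
    by_cases hy : y ∈ tsupport (χ i)
    · have hyW := hχ i hy
      exact (hχs i).contDiffAt.mul ((hW i).contDiffOn_normalized.contDiffAt
        ((hW i).1.mem_nhds hyW))
    · have : (fun y => χ i y * g i y) =ᶠ[𝓝 y] fun _ => 0 := by
        filter_upwards [notMem_tsupport_iff_eventuallyEq.1 hy] with z hz
        simp [hz]
      exact contDiffAt_const.congr_of_eventuallyEq this
  have hρ : ContDiff ℝ ∞ ρ := ContDiff.sum fun i _ => hterm i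
  have hsum : ∀ s ∈ frontier D, ∑ i, χ i s = 1 := by
    intro s hs
    have := χ.sum_eq_one hs
    rwa [finsum_eq_sum_of_fintype] at this
  have hgz : ∀ s ∈ frontier D, ∀ i, χ i s * g i s = 0 := by
    intro s hs i
    by_cases hy : s ∈ tsupport (χ i)
    · have : f i.1 s = 0 := ((hW i).mem_frontier_iff (hχ i hy)).1 hs
      simp [g, this]
    · simp [image_eq_zero_of_notMem_tsupport hy]
  -- Near `∂D` means here: where at least one function of the partition is positive. The sum is `1`
  -- on `∂D`, so this open set contains it.
  refine ⟨ρ, hρ, ⟨{y | 0 < ∑ i, χ i y}, ?_, ?_, ?_⟩, ?_, ?_⟩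
  · exact isOpen_lt continuous_const (continuous_finsetSum _ fun i _ => (hχs i).continuous)
  · intro s hs
    rw [mem_ofPred_eq, hsum s hs]
    norm_num
  · intro y hy hy0
    have hy' : 0 < ∑ i, χ i y := hy
    obtain ⟨i, -, hi⟩ := Finset.exists_lt_of_sum_lt (s := Finset.univ) (f := fun _ : t => (0 : ℝ))
      (g := fun i => χ i y) (by simpa using hy')
    have hpos : ∀ j, χ j y ≠ 0 → y ∈ W j := fun j hj => hχ j (subset_tsupport _ hj)
    have hgrad : ∀ j, y ∈ W j → 0 < ‖∇ (f j.1) y‖⁻¹ := fun j hj =>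
      inv_pos.2 (norm_pos_iff.2 ((hW j).2.2.2.1 y hj))
    -- Off `∂D` no cancellation is possible: at a point of `D` all local defining functions in use
    -- are negative, at a point outside the closure they are all positive.
    by_contra hyf
    by_cases hyD : y ∈ D
    · have : ρ y < 0 := by
        refine Finset.sum_neg' (fun j _ => ?_) ⟨i, Finset.mem_univ _, ?_⟩
        · by_cases hj : χ j y = 0
          · simp [hj]
          · exact mul_nonpos_of_nonneg_of_nonpos (χ.nonneg j y)
              (mul_nonpos_of_nonneg_of_nonpos (hgrad j (hpos j hj)).le
                (((hW j).2.2.2.2 y (hpos j hj)).1 hyD).le)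
        · exact mul_neg_of_pos_of_neg hi (mul_neg_of_pos_of_neg (hgrad i (hpos i hi.ne'))
            (((hW i).2.2.2.2 y (hpos i hi.ne')).1 hyD))
      exact absurd hy0 this.ne
    · have hfpos : ∀ j, y ∈ W j → 0 < f j.1 y := fun j hj => by
        rcases lt_trichotomy (f j.1 y) 0 with h | h | h
        · exact absurd (((hW j).2.2.2.2 y hj).2 h) hyD
        · exact absurd (((hW j).mem_frontier_iff hj).2 h) hyf
        · exact h
      have : 0 < ρ y := by
        refine Finset.sum_pos' (fun j _ => ?_) ⟨i, Finset.mem_univ _, ?_⟩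
        · by_cases hj : χ j y = 0
          · simp [hj]
          · exact mul_nonneg (χ.nonneg j y)
              (mul_nonneg (hgrad j (hpos j hj)).le (hfpos j (hpos j hj)).le)
        · exact mul_pos hi (mul_pos (hgrad i (hpos i hi.ne')) (hfpos i (hpos i hi.ne')))
      exact absurd hy0 this.ne'
  · intro s hs
    exact Finset.sum_eq_zero fun i _ => hgz s hs i
  · intro s hs v
    -- Every normalized function vanishes on `∂D`, so the derivatives of the partition functions do
    -- not contribute and each term has derivative `χ_i ⟨ν, ·⟩`.
    have hd : ∀ i, HasFDerivAt (fun y => χ i y * g i y)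
        (χ i s • InnerProductSpace.toDual ℝ (E n) (outerNormal D s)) s := by
      intro i
      by_cases hy : s ∈ tsupport (χ i)
      · have hsW := hχ i hy
        have hg : HasFDerivAt (g i) (fderiv ℝ (g i) s) s :=
          (((hW i).contDiffOn_normalized.contDiffAt ((hW i).1.mem_nhds hsW)).differentiableAt
            (by simp)).hasFDerivAt
        have hgv : fderiv ℝ (g i) s = InnerProductSpace.toDual ℝ (E n) (outerNormal D s) := by
          ext v
          exact (hW i).fderiv_normalized hsW hs v
        have hg0 : g i s = 0 := by
          have : f i.1 s = 0 := ((hW i).mem_frontier_iff hsW).1 hs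
          simp [g, this]
        have := ((hχs i).differentiable (by simp) s).hasFDerivAt.mul hg
        rw [hg0, hgv, zero_smul, add_zero] at this
        exact this
      · have h0 : (fun y => χ i y * g i y) =ᶠ[𝓝 s] fun _ => 0 := by
          filter_upwards [notMem_tsupport_iff_eventuallyEq.1 hy] with z hz
          simp [hz]
        rw [image_eq_zero_of_notMem_tsupport hy, zero_smul]
        exact (hasFDerivAt_const (0 : ℝ) s).congr_of_eventuallyEq h0
    have : HasFDerivAt ρ (∑ i, χ i s • InnerProductSpace.toDual ℝ (E n) (outerNormal D s)) s :=
      HasFDerivAt.fun_sum fun i _ => hd i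
    rw [this.fderiv, ← Finset.sum_smul, hsum s hs, one_smul]
    rfl

end GlobalDefiningFunction

end

end ThinShell

/-! ### The inverse function theorem near a compact set, and the tubular neighbourhood. -/

namespace ThinShell

noncomputable section

section SmoothInverse

variable {F : Type*} [NormedAddCommGroup F] [NormedSpace ℝ F] [CompleteSpace F]

/-- A smooth map which is injective on a compact set and has invertible derivatives there has a
smooth inverse near the image of this compact set. -/
theorem exists_smooth_inverse_near_compact {G : F → F} (hG : ContDiff ℝ ∞ G) {K : Set F}
    (hK : IsCompact K) (hinj : InjOn G K)
    (hder : ∀ p ∈ K, ∃ e : F ≃L[ℝ] F, HasFDerivAt G (e : F →L[ℝ] F) p) :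
    ∃ (N : Set F) (I : F → F), IsOpen N ∧ K ⊆ N ∧ (∀ p ∈ N, I (G p) = p) ∧
      ∀ p ∈ N, ContDiffAt ℝ ∞ I (G p) ∧ ∀ᶠ z in 𝓝 (G p), I z ∈ N ∧ G (I z) = z := by
  have hloc : ∀ p, (∃ e : F ≃L[ℝ] F, HasFDerivAt G (e : F →L[ℝ] F) p) →
      ∃ u ∈ 𝓝 p, InjOn G u := by
    rintro p ⟨e, he⟩
    refine ⟨_, ((hG.contDiffAt.toOpenPartialHomeomorph G he (by simp)).open_source.mem_nhds
      (hG.contDiffAt.mem_toOpenPartialHomeomorph_source he (by simp))), ?_⟩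
    exact (hG.contDiffAt.toOpenPartialHomeomorph G he (by simp)).injOn
  obtain ⟨t, hto, hKt, hinjt⟩ := hinj.exists_isOpen_superset hK
    (fun x _ => hG.continuous.continuousAt) (fun p hp => hloc p (hder p hp))
  have hfd : Continuous (fderiv ℝ G) := hG.continuous_fderiv (by simp)
  let R : Set F := fderiv ℝ G ⁻¹' (range ((↑) : (F ≃L[ℝ] F) → F →L[ℝ] F))
  have hR : IsOpen R := ContinuousLinearEquiv.isOpen.preimage hfd
  have hRe : ∀ p ∈ R, ∃ e : F ≃L[ℝ] F, HasFDerivAt G (e : F →L[ℝ] F) p := by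
    rintro p ⟨e, he⟩
    exact ⟨e, he ▸ (hG.differentiable (by simp) p).hasFDerivAt⟩
  have hKR : K ⊆ R := by
    intro p hp
    obtain ⟨e, he⟩ := hder p hp
    exact ⟨e, he.fderiv.symm⟩
  have hNinj : InjOn G (t ∩ R) := hinjt.mono inter_subset_left
  by_cases hne : Nonempty F
  swap
  · exact absurd ⟨0⟩ hne
  have hleft : ∀ p ∈ t ∩ R, Function.invFunOn G (t ∩ R) (G p) = p :=
    fun p hp => hNinj.leftInvOn_invFunOn hp
  refine ⟨t ∩ R, Function.invFunOn G (t ∩ R), hto.inter hR, subset_inter hKt hKR, hleft, ?_⟩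
  intro p hp
  obtain ⟨e, he⟩ := hRe p hp.2
  let φ := hG.contDiffAt.toOpenPartialHomeomorph G he (n := ∞) (by simp)
  have hφp : p ∈ φ.source := hG.contDiffAt.mem_toOpenPartialHomeomorph_source he (by simp)
  have htar : φ.target ∈ 𝓝 (G p) := φ.open_target.mem_nhds (φ.map_source hφp)
  have hsymm : φ.symm (G p) = p := φ.left_inv hφp
  have hcont : ContinuousAt φ.symm (G p) := φ.symm.continuousAt (φ.map_source hφp)
  have hmem : ∀ᶠ z in 𝓝 (G p), φ.symm z ∈ t ∩ R :=
    hcont.eventually_mem (by rw [hsymm]; exact (hto.inter hR).mem_nhds hp)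
  -- The local inverse takes its values in the set where `G` is injective, so it coincides with the
  -- globally chosen inverse and transfers its smoothness.
  have hev : ∀ᶠ z in 𝓝 (G p), G (φ.symm z) = z ∧ Function.invFunOn G (t ∩ R) z = φ.symm z := by
    filter_upwards [htar, hmem] with z hz hzN
    have h1 : G (φ.symm z) = z := φ.right_inv hz
    refine ⟨h1, ?_⟩
    conv_lhs => rw [← h1]
    exact hleft _ hzN
  constructor
  · have h1 : ContDiffAt ℝ ∞ φ.symm (G p) := hG.contDiffAt.to_localInverse he (by simp)
    exact h1.congr_of_eventuallyEq (hev.mono fun z hz => hz.2)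
  · filter_upwards [hev, hmem] with z hz hzN
    rw [hz.2]
    exact ⟨hzN, hz.1⟩

end SmoothInverse

open scoped Manifold in
/-- Smooth cutoff functions. -/
theorem exists_smooth_cutoff {n : ℕ} {K W : Set (E n)} (hK : IsCompact K) (hW : IsOpen W)
    (hKW : K ⊆ W) : ∃ η : E n → ℝ, ContDiff ℝ ∞ η ∧ HasCompactSupport η ∧ tsupport η ⊆ W ∧
      ∀ x ∈ K, η x = 1 := by
  obtain ⟨L, hL, hKL, hLW⟩ := exists_compact_between hK hW hKW
  obtain ⟨f, hf0, hf1, -⟩ := exists_contMDiffMap_zero_one_of_isClosed 𝓘(ℝ, E n)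
    (isOpen_interior (s := L)).isClosed_compl hK.isClosed
    (disjoint_left.2 fun x hx hx' => hx (hKL hx'))
  have hsupp : tsupport f ⊆ L := by
    refine closure_minimal (fun x hx => ?_) hL.isClosed
    by_contra hxL
    exact hx (hf0 fun hxi => hxL (interior_subset hxi))
  exact ⟨f, f.contMDiff.contDiff, HasCompactSupport.of_support_subset_isCompact hL
    (subset_closure.trans hsupp), hsupp.trans hLW, fun x hx => hf1 hx⟩

theorem contDiff_smul_of_tsupport {n : ℕ} {F : Type*} [NormedAddCommGroup F] [NormedSpace ℝ F]
    {W : Set (E n)} {η : E n → ℝ} {f : E n → F} (hη : ContDiff ℝ ∞ η) (hs : tsupport η ⊆ W)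
    (hf : ∀ x ∈ W, ContDiffAt ℝ ∞ f x) : ContDiff ℝ ∞ (fun x => η x • f x) := by
  rw [contDiff_iff_contDiffAt]
  intro x
  by_cases hx : x ∈ tsupport η
  · exact hη.contDiffAt.smul (hf x (hs hx))
  · have : (fun x => η x • f x) =ᶠ[𝓝 x] fun _ => 0 := by
      filter_upwards [notMem_tsupport_iff_eventuallyEq.1 hx] with z hz
      simp [hz]
    exact contDiffAt_const.congr_of_eventuallyEq this

/-- The points at signed distance less than `a` from `∂D`, along the normals. -/
def tubeSet {n : ℕ} (D : Set (E n)) (a : ℝ) : Set (E n) :=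
  {x | ∃ s ∈ frontier D, ∃ r : ℝ, |r| < a ∧ x = s + r • outerNormal D s}

/-- A tubular neighbourhood of `∂D`, with smooth functions on the whole space which extend the
signed distance `d`, the projection `π` to `∂D` and the unit normal field `nu = ∇d`. -/
structure Tube {n : ℕ} (D : Set (E n)) where
  δ : ℝ
  d : E n → ℝ
  π : E n → E n
  nu : E n → E n
  cut : E n → ℝ
  δ_pos : 0 < δ
  isCompact_frontier : IsCompact (frontier D)
  norm_outerNormal : ∀ s ∈ frontier D, ‖outerNormal D s‖ = 1
  contDiff_d : ContDiff ℝ ∞ d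
  contDiff_π : ContDiff ℝ ∞ π
  contDiff_nu : ContDiff ℝ ∞ nu
  contDiff_cut : ContDiff ℝ ∞ cut
  hasCompactSupport_π : HasCompactSupport π
  hasCompactSupport_cut : HasCompactSupport cut
  isOpen_tube : IsOpen (tubeSet D δ)
  d_apply : ∀ s ∈ frontier D, ∀ r : ℝ, |r| < δ → d (s + r • outerNormal D s) = r
  π_apply : ∀ s ∈ frontier D, ∀ r : ℝ, |r| < δ → π (s + r • outerNormal D s) = s
  nu_apply : ∀ s ∈ frontier D, ∀ r : ℝ, |r| < δ → nu (s + r • outerNormal D s) = outerNormal D s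
  fderiv_d : ∀ x ∈ tubeSet D δ, ∀ v, fderiv ℝ d x v = ⟪nu x, v⟫_ℝ
  cut_eq_one : ∀ x ∈ tubeSet D (δ / 2), cut x = 1
  tsupport_cut : tsupport cut ⊆ tubeSet D δ

/-- The normal coordinates are obtained without charts of `∂D`: the hypersurface is kept as the
condition `ρ = 0`, so that the inverse function theorem applies in `E n × ℝ`, and `π`, `d` are the
components of the inverse restricted to second coordinate `0`. -/
theorem IsSmoothBoundedDomain.nonempty_tube {n : ℕ} {D : Set (E n)}
    (hD : IsSmoothBoundedDomain D) : Nonempty (Tube D) := by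
  obtain ⟨ρ, hρ, ⟨O, hO, hDO, hρO⟩, hρ0, hρν⟩ := hD.exists_defining_function
  let N : E n → E n := fun y => ∇ ρ y
  have hN : ContDiff ℝ ∞ N :=
    ((InnerProductSpace.toDual ℝ (E n)).symm.contDiff (n := ∞)).comp
      (hρ.fderiv_right (m := ∞) (by simp))
  have hNinner : ∀ y v, fderiv ℝ ρ y v = ⟪N y, v⟫_ℝ := by
    intro y v
    have := (hρ.differentiable (by simp) y).hasGradientAt.hasFDerivAt.fderiv
    rw [this]; rfl
  have hNν : ∀ s ∈ frontier D, N s = outerNormal D s := fun s hs =>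
    ext_inner_right ℝ fun v => by rw [← hNinner, hρν s hs]
  have hNn : ∀ s ∈ frontier D, ⟪N s, N s⟫_ℝ = 1 := fun s hs => by
    rw [real_inner_self_eq_norm_sq, hNν s hs, hD.norm_outerNormal hs, one_pow]
  -- The derivative at `(s, 0)` is `(v, σ) ↦ (v + σ N, ⟨N, v⟩)`, with inverse `(w, τ) ↦ (w - (⟨N, w⟩
  -- - τ) N, ⟨N, w⟩ - τ)` because `|N| = 1`.
  let G : E n × ℝ → E n × ℝ := fun p => (p.1 + p.2 • N p.1, ρ p.1)
  have hG : ContDiff ℝ ∞ G := by fun_prop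
  let K : Set (E n × ℝ) := frontier D ×ˢ {0}
  have hK : IsCompact K := hD.isCompact_frontier.prod isCompact_singleton
  have hGinj : InjOn G K := by
    rintro ⟨y, r⟩ ⟨hy, hr⟩ ⟨y', r'⟩ ⟨hy', hr'⟩ h
    simp only [mem_singleton_iff] at hr hr'
    subst hr hr'
    simpa [G] using (congrArg Prod.fst h)
  have hder : ∀ p ∈ K, ∃ e : (E n × ℝ) ≃L[ℝ] (E n × ℝ),
      HasFDerivAt G (e : (E n × ℝ) →L[ℝ] (E n × ℝ)) p := by
    rintro ⟨s, r⟩ ⟨hs, hr⟩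
    simp only [mem_singleton_iff] at hr
    subst hr
    let fst := ContinuousLinearMap.fst ℝ (E n) ℝ
    let snd := ContinuousLinearMap.snd ℝ (E n) ℝ
    let f₁ : (E n × ℝ) →L[ℝ] (E n × ℝ) :=
      (fst + snd.smulRight (N s)).prod ((innerSL ℝ (N s)).comp fst)
    let f₂ : (E n × ℝ) →L[ℝ] (E n × ℝ) :=
      (fst - ((innerSL ℝ (N s)).comp fst - snd).smulRight (N s)).prod
        ((innerSL ℝ (N s)).comp fst - snd)
    have hNs : ‖N s‖ = 1 := by rw [hNν s hs, hD.norm_outerNormal hs]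
    have h1 : Function.LeftInverse f₂ f₁ := by
      rintro ⟨v, σ⟩
      simp [f₁, f₂, fst, snd, inner_add_right, real_inner_smul_right, hNs]
    have h2 : Function.RightInverse f₂ f₁ := by
      rintro ⟨v, σ⟩
      simp [f₁, f₂, fst, snd, inner_sub_right, real_inner_smul_right, hNs]
    refine ⟨ContinuousLinearEquiv.equivOfInverse f₁ f₂ h1 h2, ?_⟩
    have hNd : HasFDerivAt N (fderiv ℝ N s) s := (hN.differentiable (by simp) s).hasFDerivAt
    have hfst : HasFDerivAt (fun p : E n × ℝ => p.1) fst (s, (0 : ℝ)) := hasFDerivAt_fst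
    have hsnd : HasFDerivAt (fun p : E n × ℝ => p.2) snd (s, (0 : ℝ)) := hasFDerivAt_snd
    have hN1 : HasFDerivAt (fun p : E n × ℝ => N p.1) ((fderiv ℝ N s).comp fst) (s, (0 : ℝ)) :=
      HasFDerivAt.comp (s, (0 : ℝ)) (f := fun p : E n × ℝ => p.1) hNd hfst
    have hρ1 : HasFDerivAt (fun p : E n × ℝ => ρ p.1) ((fderiv ℝ ρ s).comp fst) (s, (0 : ℝ)) :=
      HasFDerivAt.comp (s, (0 : ℝ)) (f := fun p : E n × ℝ => p.1)
        (hρ.differentiable (by simp) s).hasFDerivAt hfst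
    have h3 := (hfst.add (hsnd.smul hN1)).prodMk hρ1
    refine HasFDerivAt.congr_fderiv h3 ?_
    ext v <;> simp [f₁, fst, snd, hNinner]
  obtain ⟨Nn, I, hNo, hKN, hIG, hI⟩ := exists_smooth_inverse_near_compact hG hK hGinj hder
  have hN'o : IsOpen (Nn ∩ (O ×ˢ univ)) := hNo.inter (hO.prod isOpen_univ)
  have hKN' : K ⊆ Nn ∩ (O ×ˢ univ) :=
    subset_inter hKN fun p hp => ⟨hDO hp.1, mem_univ _⟩
  obtain ⟨δ₁, hδ₁, hthick⟩ := hK.exists_thickening_subset_open hN'o hKN'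
  have hmemN : ∀ s ∈ frontier D, ∀ r : ℝ, |r| < δ₁ → (s, r) ∈ Nn := by
    intro s hs r hr
    refine (hthick ?_).1
    rw [Metric.mem_thickening_iff]
    exact ⟨(s, 0), ⟨hs, rfl⟩, by simpa [Prod.dist_eq] using hr⟩
  have hGs : ∀ s ∈ frontier D, ∀ r : ℝ, G (s, r) = (s + r • outerNormal D s, 0) := by
    intro s hs r
    simp [G, hNν s hs, hρ0 s hs]
  have hIs : ∀ s ∈ frontier D, ∀ r : ℝ, |r| < δ₁ →
      I (s + r • outerNormal D s, 0) = (s, r) := by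
    intro s hs r hr
    rw [← hGs s hs r, hIG _ (hmemN s hs r hr)]
  -- near points of the tube, the inverse gives points of the boundary
  have hnear : ∀ x ∈ tubeSet D δ₁, ∀ᶠ x' in 𝓝 x, (I (x', 0)).1 ∈ frontier D ∧
      |(I (x', 0)).2| < δ₁ ∧ x' = (I (x', 0)).1 + (I (x', 0)).2 • outerNormal D (I (x', 0)).1 := by
    rintro x ⟨s, hs, r, hr, rfl⟩
    have h1 := hI _ (hmemN s hs r hr)
    rw [hGs s hs r] at h1
    have hcx : Continuous fun x' : E n => (x', (0 : ℝ)) := by fun_prop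
    have h2 := (hcx.tendsto (s + r • outerNormal D s)).eventually h1.2
    have h3 : ContinuousAt (fun x' : E n => I (x', 0)) (s + r • outerNormal D s) :=
      ContinuousAt.comp (f := fun x' : E n => (x', (0 : ℝ))) h1.1.continuousAt hcx.continuousAt
    have h4 : O ×ˢ Ioo (-δ₁) δ₁ ∈ 𝓝 (I (s + r • outerNormal D s, 0)) := by
      rw [hIs s hs r hr]
      exact (hO.prod isOpen_Ioo).mem_nhds ⟨hDO hs, abs_lt.1 hr⟩
    filter_upwards [h2, h3.eventually_mem h4] with x' hx' hx''
    have h5 : ρ (I (x', 0)).1 = 0 := congrArg Prod.snd hx'.2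
    have h6 := hρO _ hx''.1 h5
    refine ⟨h6, abs_lt.2 hx''.2, ?_⟩
    rw [← hNν _ h6]
    exact (congrArg Prod.fst hx'.2).symm
  have hopen : IsOpen (tubeSet D δ₁) := by
    rw [isOpen_iff_mem_nhds]
    intro x hx
    filter_upwards [hnear x hx] with x' hx'
    exact ⟨_, hx'.1, _, hx'.2.1, hx'.2.2⟩
  have hIsm : ∀ x ∈ tubeSet D δ₁, ContDiffAt ℝ ∞ (fun x' : E n => I (x', 0)) x := by
    rintro x ⟨s, hs, r, hr, rfl⟩
    have h1 := (hI _ (hmemN s hs r hr)).1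
    rw [hGs s hs r] at h1
    exact ContDiffAt.comp (f := fun x' : E n => (x', (0 : ℝ))) _ h1
      (contDiff_id.prodMk contDiff_const).contDiffAt
  let d₀ : E n → ℝ := fun x => (I (x, 0)).2
  let π₀ : E n → E n := fun x => (I (x, 0)).1
  have hd₀ : ∀ x ∈ tubeSet D δ₁, ContDiffAt ℝ ∞ d₀ x := fun x hx => (hIsm x hx).snd
  have hπ₀ : ∀ x ∈ tubeSet D δ₁, ContDiffAt ℝ ∞ π₀ x := fun x hx => (hIsm x hx).fst
  have hgrad : ∀ x ∈ tubeSet D δ₁, ∀ v, fderiv ℝ d₀ x v = ⟪N (π₀ x), v⟫_ℝ := by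
    intro x hx v
    have e1 : HasFDerivAt d₀ (fderiv ℝ d₀ x) x :=
      ((hd₀ x hx).differentiableAt (by simp)).hasFDerivAt
    have e2 : HasFDerivAt π₀ (fderiv ℝ π₀ x) x :=
      ((hπ₀ x hx).differentiableAt (by simp)).hasFDerivAt
    have e3 : HasFDerivAt (fun x => N (π₀ x)) ((fderiv ℝ N (π₀ x)).comp (fderiv ℝ π₀ x)) x :=
      (hN.differentiable (by simp) _).hasFDerivAt.comp x e2
    -- `ρ ∘ π₀ = 0`
    have e4 : ⟪N (π₀ x), fderiv ℝ π₀ x v⟫_ℝ = 0 := by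
      have h1 : HasFDerivAt (fun x => ρ (π₀ x)) ((fderiv ℝ ρ (π₀ x)).comp (fderiv ℝ π₀ x)) x :=
        (hρ.differentiable (by simp) _).hasFDerivAt.comp x e2
      have h2 : (fun x => ρ (π₀ x)) =ᶠ[𝓝 x] fun _ => 0 := by
        filter_upwards [hnear x hx] with x' hx'
        exact hρ0 _ hx'.1
      have h3 := h1.unique ((hasFDerivAt_const (0 : ℝ) x).congr_of_eventuallyEq h2)
      rw [← hNinner]
      simpa using congrArg (fun L => L v) h3
    have e5 : ⟪N (π₀ x), fderiv ℝ N (π₀ x) (fderiv ℝ π₀ x v)⟫_ℝ = 0 := by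
      have h1 := e3.inner ℝ e3
      have h2 : (fun x => ⟪N (π₀ x), N (π₀ x)⟫_ℝ) =ᶠ[𝓝 x] fun _ => 1 := by
        filter_upwards [hnear x hx] with x' hx'
        exact hNn _ hx'.1
      have h3 := h1.unique ((hasFDerivAt_const (1 : ℝ) x).congr_of_eventuallyEq h2)
      have h4 := congrArg (fun L => L v) h3
      simp only [ContinuousLinearMap.comp_apply, ContinuousLinearMap.prod_apply,
        fderivInnerCLM_apply, zero_apply] at h4
      rw [real_inner_comm (N (π₀ x))] at h4
      linarith
    -- Differentiate `x = π + d N(π)` and pair with `N(π)`. The derivatives of `π` and of `N(π)` are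
    -- orthogonal to `N(π)`, by `ρ(π) = 0` and `|N(π)| = 1`, so only the derivative of `d` survives.
    have e6 : HasFDerivAt (fun x => π₀ x + d₀ x • N (π₀ x)) _ x := e2.add (e1.smul e3)
    have e7 : (fun x => π₀ x + d₀ x • N (π₀ x)) =ᶠ[𝓝 x] fun x => x := by
      filter_upwards [hnear x hx] with x' hx'
      rw [hNν _ hx'.1]
      exact hx'.2.2.symm
    have e8 := e6.unique ((hasFDerivAt_id x).congr_of_eventuallyEq e7)
    have e9 := congrArg (fun L => ⟪N (π₀ x), L v⟫_ℝ) e8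
    have hx' := (hnear x hx).self_of_nhds
    simp only [add_apply, smul_apply,
      ContinuousLinearMap.comp_apply, ContinuousLinearMap.smulRight_apply, inner_add_right,
      real_inner_smul_right, e4, e5, ContinuousLinearMap.id_apply] at e9
    have e10 : ⟪N (π₀ x), N (π₀ x)⟫_ℝ = 1 := hNn _ hx'.1
    rw [e10] at e9
    linarith
  have hclosed : ∀ a < δ₁, ∃ C : Set (E n), IsCompact C ∧ tubeSet D a ⊆ C ∧ C ⊆ tubeSet D δ₁ := by
    intro a ha
    refine ⟨(fun p : E n × ℝ => p.1 + p.2 • N p.1) '' (frontier D ×ˢ Icc (-a) a),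
      (hD.isCompact_frontier.prod isCompact_Icc).image (by fun_prop), ?_, ?_⟩
    · rintro x ⟨s, hs, r, hr, rfl⟩
      exact ⟨(s, r), ⟨hs, abs_le.1 hr.le⟩, by simp [hNν s hs]⟩
    · rintro x ⟨⟨s, r⟩, ⟨hs, hr⟩, rfl⟩
      exact ⟨s, hs, r, (abs_le.2 hr).trans_lt ha, by simp [hNν s hs]⟩
  obtain ⟨C, hC, hC1, hC2⟩ := hclosed (δ₁ / 2) (by linarith)
  obtain ⟨η, hη, hηc, hηs, hη1⟩ := exists_smooth_cutoff hC hopen hC2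
  have hsub : tubeSet D (δ₁ / 2) ⊆ tubeSet D δ₁ := hC1.trans hC2
  have hopen2 : IsOpen (tubeSet D (δ₁ / 2)) := by
    rw [isOpen_iff_mem_nhds]
    intro x hx
    have hxr : |d₀ x| < δ₁ / 2 := by
      obtain ⟨s, hs, r, hr, rfl⟩ := hx
      simpa only [d₀, hIs s hs r (by linarith)] using hr
    have h1 := (hd₀ x (hsub hx)).continuousAt.abs.eventually (gt_mem_nhds hxr)
    filter_upwards [hnear x (hsub hx), h1] with x' hx' hx''
    exact ⟨_, hx'.1, _, hx'', hx'.2.2⟩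
  have hclosed2 : ∃ C : Set (E n), IsCompact C ∧ tubeSet D (δ₁ / 2 / 2) ⊆ C ∧
      C ⊆ tubeSet D (δ₁ / 2) := by
    refine ⟨(fun p : E n × ℝ => p.1 + p.2 • N p.1) '' (frontier D ×ˢ Icc (-(δ₁ / 2 / 2))
      (δ₁ / 2 / 2)), (hD.isCompact_frontier.prod isCompact_Icc).image (by fun_prop), ?_, ?_⟩
    · rintro x ⟨s, hs, r, hr, rfl⟩
      exact ⟨(s, r), ⟨hs, abs_le.1 hr.le⟩, by simp [hNν s hs]⟩
    · rintro x ⟨⟨s, r⟩, ⟨hs, hr⟩, rfl⟩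
      exact ⟨s, hs, r, (abs_le.2 hr).trans_lt (by linarith), by simp [hNν s hs]⟩
  obtain ⟨C', hC', hC1', hC2'⟩ := hclosed2
  obtain ⟨η', hη', hηc', hηs', hη1'⟩ := exists_smooth_cutoff hC' hopen2 hC2'
  have hπ : ContDiff ℝ ∞ (fun x => η x • π₀ x) := contDiff_smul_of_tsupport hη hηs hπ₀
  have hone : ∀ s ∈ frontier D, ∀ r : ℝ, |r| < δ₁ / 2 → η (s + r • outerNormal D s) = 1 :=
    fun s hs r hr => hη1 _ (hC1 ⟨s, hs, r, hr, rfl⟩)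
  -- On the tube of radius `δ₁ / 2` the cutoff `η` is `1`, so the globally smooth products agree
  -- there with the true distance and projection. The second cutoff `η'` is needed later to extend
  -- test functions by zero.
  refine ⟨{ δ := δ₁ / 2, d := fun x => η x • d₀ x, π := fun x => η x • π₀ x,
            nu := fun x => N (η x • π₀ x), cut := η', δ_pos := by linarith
            isCompact_frontier := hD.isCompact_frontier
            norm_outerNormal := fun s hs => hD.norm_outerNormal hs
            contDiff_d := contDiff_smul_of_tsupport hη hηs hd₀
            contDiff_π := hπ
            contDiff_nu := hN.comp hπ
            contDiff_cut := hη'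
            hasCompactSupport_π := hηc.smul_right
            hasCompactSupport_cut := hηc'
            isOpen_tube := hopen2
            d_apply := ?_, π_apply := ?_, nu_apply := ?_, fderiv_d := ?_
            cut_eq_one := fun x hx => hη1' x (hC1' hx)
            tsupport_cut := hηs' }⟩
  · intro s hs r hr
    simp only [hone s hs r hr, one_smul, d₀, hIs s hs r (by linarith)]
  · intro s hs r hr
    simp only [hone s hs r hr, one_smul, π₀, hIs s hs r (by linarith)]
  · intro s hs r hr
    simp only [hone s hs r hr, one_smul, π₀, hIs s hs r (by linarith), hNν s hs]
  · intro x hx v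
    have h1 : (fun x => η x • d₀ x) =ᶠ[𝓝 x] d₀ := by
      filter_upwards [hopen2.mem_nhds hx] with x' hx'
      simp [hη1 _ (hC1 hx')]
    rw [h1.fderiv_eq, hgrad x (hsub hx), hη1 _ (hC1 hx), one_smul]

end

end ThinShell

/-! ### Derivative of the normal field, Jacobian and mean curvature of the parallel surfaces. -/

namespace ThinShell

noncomputable section

theorem contDiff_clm_det {n : ℕ} {F : Type*} [NormedAddCommGroup F] [NormedSpace ℝ F]
    {L : F → E n →L[ℝ] E n} (hL : ContDiff ℝ ∞ L) : ContDiff ℝ ∞ (fun x => (L x).det) := by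
  let b := (EuclideanSpace.basisFun (Fin n) ℝ).toBasis
  have h : (fun x => (L x).det) = fun x => Matrix.det (Matrix.of fun i j => L x (b j) i) := by
    funext x
    rw [ContinuousLinearMap.det, ← LinearMap.det_toMatrix b]
    congr 1
    ext i j
    simp [LinearMap.toMatrix_apply, b]
  rw [h]
  simp only [Matrix.det_apply]
  refine ContDiff.sum fun σ _ => ContDiff.const_smul _ (contDiff_prod fun i _ => ?_)
  have h1 : ContDiff ℝ ∞ (fun x => L x (b i)) := hL.clm_apply contDiff_const
  exact contDiff_euclidean.1 h1 _

theorem clm_det_mul {n : ℕ} (A B : E n →L[ℝ] E n) : (A * B).det = A.det * B.det := by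
  simp only [ContinuousLinearMap.det]
  exact LinearMap.det_comp _ _

theorem clm_det_one {n : ℕ} : (1 : E n →L[ℝ] E n).det = 1 := by
  simp only [ContinuousLinearMap.det]
  exact LinearMap.det_id

/-- The orthogonal projection to `v^⊥`, for a unit vector `v`. -/
def perp {n : ℕ} (v : E n) : E n →L[ℝ] E n :=
  ContinuousLinearMap.id ℝ (E n) - (innerSL ℝ v).smulRight v

@[simp] theorem perp_apply {n : ℕ} (v w : E n) : perp v w = w - ⟪v, w⟫_ℝ • v := by
  simp [perp]

namespace Tube

variable {n : ℕ} {D : Set (E n)} (T : Tube D)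

/-- The derivative of the extended normal field. -/
def A (x : E n) : E n →L[ℝ] E n := fderiv ℝ T.nu x

/-- The Jacobian of the normal map `s ↦ s + r ν(s)`. -/
def J (y : E n) (r : ℝ) : ℝ := (1 + r • T.A y).det

theorem contDiff_A : ContDiff ℝ ∞ T.A := T.contDiff_nu.fderiv_right (by simp)

theorem contDiff_J : ContDiff ℝ ∞ (fun p : E n × ℝ => T.J p.1 p.2) := by
  have h : ContDiff ℝ ∞ (fun p : E n × ℝ => 1 + p.2 • T.A p.1) :=
    contDiff_const.add (contDiff_snd.smul (T.contDiff_A.comp contDiff_fst))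
  exact contDiff_clm_det h

theorem continuous_J : Continuous (fun p : E n × ℝ => T.J p.1 p.2) := T.contDiff_J.continuous

@[simp] theorem J_zero (y : E n) : T.J y 0 = 1 := by
  have h : (1 + (0 : ℝ) • T.A y : E n →L[ℝ] E n) = 1 := by ext v; simp
  rw [J, h, clm_det_one]

theorem hasFDerivAt_nu (x : E n) : HasFDerivAt T.nu (T.A x) x :=
  (T.contDiff_nu.differentiable (by simp) x).hasFDerivAt

theorem hasFDerivAt_π (x : E n) : HasFDerivAt T.π (fderiv ℝ T.π x) x :=
  (T.contDiff_π.differentiable (by simp) x).hasFDerivAt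

theorem hasFDerivAt_d {x : E n} (hx : x ∈ tubeSet D T.δ) :
    HasFDerivAt T.d (innerSL ℝ (T.nu x)) x := by
  refine (T.contDiff_d.differentiable (by simp) x).hasFDerivAt.congr_fderiv ?_
  ext v
  rw [T.fderiv_d x hx]
  rfl

theorem mem_tube {s : E n} (hs : s ∈ frontier D) {r : ℝ} (hr : |r| < T.δ) :
    s + r • outerNormal D s ∈ tubeSet D T.δ := ⟨s, hs, r, hr, rfl⟩

theorem frontier_subset {s : E n} (hs : s ∈ frontier D) : s ∈ tubeSet D T.δ :=
  ⟨s, hs, 0, by simpa using T.δ_pos, by simp⟩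

theorem nu_eq {s : E n} (hs : s ∈ frontier D) : T.nu s = outerNormal D s := by
  simpa using T.nu_apply s hs 0 (by simpa using T.δ_pos)

theorem d_eq {s : E n} (hs : s ∈ frontier D) : T.d s = 0 := by
  simpa using T.d_apply s hs 0 (by simpa using T.δ_pos)

theorem π_eq {s : E n} (hs : s ∈ frontier D) : T.π s = s := by
  simpa using T.π_apply s hs 0 (by simpa using T.δ_pos)

theorem π_mem {x : E n} (hx : x ∈ tubeSet D T.δ) : T.π x ∈ frontier D := by
  obtain ⟨s, hs, r, hr, rfl⟩ := hx
  rwa [T.π_apply s hs r hr]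

theorem abs_d_lt {x : E n} (hx : x ∈ tubeSet D T.δ) : |T.d x| < T.δ := by
  obtain ⟨s, hs, r, hr, rfl⟩ := hx
  rwa [T.d_apply s hs r hr]

theorem nu_eq_of_mem {x : E n} (hx : x ∈ tubeSet D T.δ) : T.nu x = outerNormal D (T.π x) := by
  obtain ⟨s, hs, r, hr, rfl⟩ := hx
  rw [T.nu_apply s hs r hr, T.π_apply s hs r hr]

theorem eq_of_mem {x : E n} (hx : x ∈ tubeSet D T.δ) :
    x = T.π x + T.d x • outerNormal D (T.π x) := by
  obtain ⟨s, hs, r, hr, rfl⟩ := hx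
  rw [T.d_apply s hs r hr, T.π_apply s hs r hr]

theorem norm_nu {x : E n} (hx : x ∈ tubeSet D T.δ) : ‖T.nu x‖ = 1 := by
  rw [T.nu_eq_of_mem hx, T.norm_outerNormal _ (T.π_mem hx)]

theorem inner_nu_nu {x : E n} (hx : x ∈ tubeSet D T.δ) : ⟪T.nu x, T.nu x⟫_ℝ = 1 := by
  rw [real_inner_self_eq_norm_sq, T.norm_nu hx, one_pow]

theorem tubeSet_eq {a : ℝ} (ha : a ≤ T.δ) :
    tubeSet D a = tubeSet D T.δ ∩ {x | |T.d x| < a} := by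
  ext x
  constructor
  · rintro ⟨s, hs, r, hr, rfl⟩
    have hr' := hr.trans_le ha
    exact ⟨T.mem_tube hs hr', by simpa [T.d_apply s hs r hr'] using hr⟩
  · rintro ⟨hx, hxa⟩
    exact ⟨_, T.π_mem hx, _, hxa, T.eq_of_mem hx⟩

theorem isOpen_tubeSet {a : ℝ} (ha : a ≤ T.δ) : IsOpen (tubeSet D a) := by
  rw [T.tubeSet_eq ha]
  exact T.isOpen_tube.inter (isOpen_lt T.contDiff_d.continuous.abs continuous_const)

theorem isBounded_tubeSet (T : Tube D) (a : ℝ) : Bornology.IsBounded (tubeSet D a) := by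
  have h : IsCompact ((fun p : E n × ℝ => p.1 + p.2 • T.nu p.1) '' (frontier D ×ˢ Icc (-a) a)) :=
    (T.isCompact_frontier.prod isCompact_Icc).image
      (continuous_fst.add (continuous_snd.smul (T.contDiff_nu.continuous.comp continuous_fst)))
  refine h.isBounded.subset ?_
  rintro x ⟨s, hs, r, hr, rfl⟩
  exact ⟨(s, r), ⟨hs, abs_le.1 hr.le⟩, by simp [T.nu_eq hs]⟩

/-- Moving along the normals: for `y` near `s ∈ ∂D` and `|r| < δ`. -/
theorem eventually_shift {s : E n} (hs : s ∈ frontier D) {r : ℝ} (hr : |r| < T.δ) :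
    ∀ᶠ y in 𝓝 s, T.nu (y + r • T.nu y) = T.nu y ∧ T.π (y + r • T.nu y) = T.π y := by
  have h1 : ∀ᶠ y in 𝓝 s, |T.d y| + |r| < T.δ := by
    have : ContinuousAt (fun y => |T.d y| + |r|) s :=
      (T.contDiff_d.continuous.abs.add continuous_const).continuousAt
    exact this.eventually (gt_mem_nhds (by simpa [T.d_eq hs] using hr))
  filter_upwards [h1, T.isOpen_tube.mem_nhds (T.frontier_subset hs)] with y hy hyT
  obtain ⟨s', hs', ρ, hρ, rfl⟩ := hyT
  rw [T.d_apply s' hs' ρ hρ] at hy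
  have hsum : |ρ + r| < T.δ := (abs_add_le _ _).trans_lt hy
  rw [T.nu_apply s' hs' ρ hρ, add_assoc, ← add_smul, T.nu_apply s' hs' _ hsum,
    T.π_apply s' hs' _ hsum, T.π_apply s' hs' ρ hρ]
  exact ⟨rfl, rfl⟩

theorem hasFDerivAt_shift (y : E n) (r : ℝ) :
    HasFDerivAt (fun y => y + r • T.nu y) (1 + r • T.A y) y :=
  (hasFDerivAt_id y).add ((T.hasFDerivAt_nu y).const_smul r)

/-- Differentiate `ν(y + r ν(y)) = ν(y)` at `y = s`. This is the Riccati equation for the shape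
operators of the parallel surfaces in integrated form; it gives both `∂_r J = h J` and `∂_ν h = -tr
A²`. -/
theorem A_shift {s : E n} (hs : s ∈ frontier D) {r : ℝ} (hr : |r| < T.δ) :
    T.A (s + r • outerNormal D s) * (1 + r • T.A s) = T.A s := by
  have h1 : HasFDerivAt (fun y => T.nu (y + r • T.nu y))
      ((T.A (s + r • T.nu s)).comp (1 + r • T.A s)) s :=
    (T.hasFDerivAt_nu (s + r • T.nu s)).comp s (T.hasFDerivAt_shift s r)
  have h2 : (fun y => T.nu (y + r • T.nu y)) =ᶠ[𝓝 s] T.nu :=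
    (T.eventually_shift hs hr).mono fun y hy => hy.1
  rw [T.nu_eq hs] at h1
  exact h1.unique ((T.hasFDerivAt_nu s).congr_of_eventuallyEq h2)

theorem fderiv_π_shift {s : E n} (hs : s ∈ frontier D) {r : ℝ} (hr : |r| < T.δ) :
    fderiv ℝ T.π (s + r • outerNormal D s) * (1 + r • T.A s) = fderiv ℝ T.π s := by
  have h1 : HasFDerivAt (fun y => T.π (y + r • T.nu y))
      ((fderiv ℝ T.π (s + r • T.nu s)).comp (1 + r • T.A s)) s :=
    (T.hasFDerivAt_π (s + r • T.nu s)).comp s (T.hasFDerivAt_shift s r)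
  have h2 : (fun y => T.π (y + r • T.nu y)) =ᶠ[𝓝 s] T.π :=
    (T.eventually_shift hs hr).mono fun y hy => hy.2
  rw [T.nu_eq hs] at h1
  exact h1.unique ((T.hasFDerivAt_π s).congr_of_eventuallyEq h2)

/-- Differentiate `y = π(y) + d(y) ν(y)`: on `∂D` the derivative of `ν` is multiplied by `d = 0`. -/
theorem fderiv_π_frontier {s : E n} (hs : s ∈ frontier D) :
    fderiv ℝ T.π s = perp (outerNormal D s) := by
  have hsT := T.frontier_subset hs
  have h1 : HasFDerivAt (fun y => T.π y + T.d y • T.nu y)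
      (fderiv ℝ T.π s + (T.d s • T.A s + (innerSL ℝ (T.nu s)).smulRight (T.nu s))) s :=
    (T.hasFDerivAt_π s).add ((T.hasFDerivAt_d hsT).smul (T.hasFDerivAt_nu s))
  have h2 : (fun y => T.π y + T.d y • T.nu y) =ᶠ[𝓝 s] id := by
    filter_upwards [T.isOpen_tube.mem_nhds hsT] with y hy
    rw [T.nu_eq_of_mem hy]
    exact (T.eq_of_mem hy).symm
  have h3 := h1.unique ((hasFDerivAt_id s).congr_of_eventuallyEq h2)
  ext1 v
  have h4 := congrArg (fun L => L v) h3
  simp only [T.d_eq hs, T.nu_eq hs, add_apply, smul_apply, zero_smul, zero_add,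
    ContinuousLinearMap.smulRight_apply, innerSL_apply_apply, ContinuousLinearMap.id_apply] at h4
  rw [perp_apply]
  exact eq_sub_of_add_eq h4

/-- The derivative of the normal field is a Hessian. -/
theorem inner_A_comm {x : E n} (hx : x ∈ tubeSet D T.δ) (v w : E n) :
    ⟪T.A x v, w⟫_ℝ = ⟪v, T.A x w⟫_ℝ := by
  have hsymm : IsSymmSndFDerivAt ℝ T.d x :=
    T.contDiff_d.contDiffAt.isSymmSndFDerivAt (by simp; exact WithTop.coe_le_coe.2 le_top)
  have key : ∀ v w : E n, fderiv ℝ (fderiv ℝ T.d) x v w = ⟪T.A x v, w⟫_ℝ := by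
    intro v w
    have h1 : HasFDerivAt (fderiv ℝ T.d) (fderiv ℝ (fderiv ℝ T.d) x) x :=
      ((T.contDiff_d.fderiv_right (m := ∞) (by simp)).differentiable (by simp) x).hasFDerivAt
    have h2 : HasFDerivAt (fun y => innerSL ℝ (T.nu y)) ((innerSL ℝ).comp (T.A x)) x :=
      (innerSL ℝ : E n →L[ℝ] _).hasFDerivAt.comp x (T.hasFDerivAt_nu x)
    have h3 : fderiv ℝ T.d =ᶠ[𝓝 x] fun y => innerSL ℝ (T.nu y) := by
      filter_upwards [T.isOpen_tube.mem_nhds hx] with y hy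
      exact (T.hasFDerivAt_d hy).fderiv
    rw [h1.unique (h2.congr_of_eventuallyEq h3)]
    rfl
  rw [← key, hsymm v w, key, real_inner_comm]

/-- The normal field is constant along the normal lines. -/
theorem A_nu {x : E n} (hx : x ∈ tubeSet D T.δ) : T.A x (T.nu x) = 0 := by
  obtain ⟨s, hs, r, hr, rfl⟩ := hx
  rw [T.nu_apply s hs r hr]
  set ν := outerNormal D s
  have hl : HasDerivAt (fun t : ℝ => s + t • ν) ν r := by
    simpa using ((hasDerivAt_id r).smul_const ν).const_add s
  have h1 : HasDerivAt (fun t : ℝ => T.nu (s + t • ν)) (T.A (s + r • ν) ν) r :=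
    (T.hasFDerivAt_nu (s + r • ν)).comp_hasDerivAt r hl
  have h2 : (fun t : ℝ => T.nu (s + t • ν)) =ᶠ[𝓝 r] fun _ => ν := by
    filter_upwards [continuous_abs.continuousAt.eventually (gt_mem_nhds hr)] with t ht
    exact T.nu_apply s hs t ht
  exact h1.unique ((hasDerivAt_const r ν).congr_of_eventuallyEq h2)

theorem inner_nu_A {x : E n} (hx : x ∈ tubeSet D T.δ) (v : E n) : ⟪T.nu x, T.A x v⟫_ℝ = 0 := by
  rw [← T.inner_A_comm hx, T.A_nu hx, inner_zero_left]

/-- By `fderiv_π_shift`, a kernel vector of `1 + r A` is annihilated by the projection to the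
tangent space, hence normal. But `A` vanishes on normal vectors, so `1 + r A` is the identity on it.
-/
theorem J_ne_zero {s : E n} (hs : s ∈ frontier D) {r : ℝ} (hr : |r| < T.δ) : T.J s r ≠ 0 := by
  have hsT := T.frontier_subset hs
  have hinj : LinearMap.ker ((1 + r • T.A s : E n →L[ℝ] E n) : E n →ₗ[ℝ] E n) = ⊥ := by
    rw [LinearMap.ker_eq_bot']
    intro v hv
    have hv' : (1 + r • T.A s) v = 0 := hv
    have h1 := congrArg (fun L => L v) (T.fderiv_π_shift hs hr)
    simp only [mul_apply_eq_comp, hv', map_zero, T.fderiv_π_frontier hs,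
      perp_apply] at h1
    have h2 : v = ⟪outerNormal D s, v⟫_ℝ • outerNormal D s := (sub_eq_zero.1 h1.symm)
    have h3 : T.A s v = 0 := by
      rw [h2, map_smul, ← T.nu_eq hs, T.A_nu hsT, smul_zero]
    simpa [h3] using hv'
  have := LinearEquiv.isUnit_det' (LinearEquiv.ofInjectiveEndo _ (LinearMap.ker_eq_bot.1 hinj))
  exact this.ne_zero

/-- `J` is `1` at `r = 0`, and it cannot change sign on an interval without zeros. -/
theorem J_pos {s : E n} (hs : s ∈ frontier D) {r : ℝ} (hr : |r| < T.δ) : 0 < T.J s r := by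
  have hc : Continuous (T.J s) :=
    T.continuous_J.comp (continuous_const.prodMk continuous_id)
  by_contra hneg
  push Not at hneg
  have h0 : |(0 : ℝ)| < T.δ := by simpa using T.δ_pos
  have hpre : IsPreconnected (Ioo (-T.δ) T.δ) := isPreconnected_Ioo
  have := hpre.intermediate_value (abs_lt.1 hr) (abs_lt.1 h0) hc.continuousOn
    (show (0 : ℝ) ∈ Icc (T.J s r) (T.J s 0) from ⟨hneg, by simp⟩)
  obtain ⟨t, ht, ht0⟩ := this
  exact T.J_ne_zero hs (abs_lt.2 ht) ht0

/-- The mean curvature of the parallel surfaces, `div nu`. -/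
def h (x : E n) : ℝ := LinearMap.trace ℝ (E n) (T.A x)

theorem h_eq_sum (x : E n) : T.h x = ∑ j, T.A x (stdVec j) j := by
  rw [h, LinearMap.trace_eq_matrix_trace ℝ (EuclideanSpace.basisFun (Fin n) ℝ).toBasis]
  simp [Matrix.trace, LinearMap.toMatrix_apply, stdVec]

theorem contDiff_h : ContDiff ℝ ∞ T.h := by
  have : T.h = fun x => ∑ j, T.A x (stdVec j) j := funext T.h_eq_sum
  rw [this]
  refine ContDiff.sum fun j _ => ?_
  exact contDiff_euclidean.1 (T.contDiff_A.clm_apply contDiff_const) j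

/-- The derivative of `r ↦ det (1 + r M)` at `0` is the trace of `M`. -/
theorem hasDerivAt_det_one_add_smul (M : E n →L[ℝ] E n) :
    HasDerivAt (fun r : ℝ => (1 + r • M).det) (LinearMap.trace ℝ (E n) M) 0 := by
  let b := (EuclideanSpace.basisFun (Fin n) ℝ).toBasis
  have h : (fun r : ℝ => (1 + r • M).det)
      = fun r : ℝ => Matrix.det (1 + r • LinearMap.toMatrix b b (M : E n →ₗ[ℝ] E n)) := by
    funext r
    rw [ContinuousLinearMap.det, ← LinearMap.det_toMatrix b]
    congr 1
    rw [← LinearMap.toMatrix_one b, ← map_smul, ← map_add]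
    rfl
  rw [h, LinearMap.trace_eq_matrix_trace ℝ b]
  set X := LinearMap.toMatrix b b (M : E n →ₗ[ℝ] E n)
  have h2 := Matrix.derivative_det_one_add_X_smul X
  have h3 : (fun r : ℝ => Matrix.det (1 + r • X)) = fun r : ℝ =>
      (Matrix.det (1 + (Polynomial.X : Polynomial ℝ) • X.map Polynomial.C)).eval r := by
    funext r
    rw [← Polynomial.coe_evalRingHom, RingHom.map_det]
    congr 1
    ext i j
    by_cases hij : i = j <;> simp [hij] <;> ring
  rw [h3, ← h2]
  exact Polynomial.hasDerivAt _ _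

/-- By `A_shift`, `1 + t A(s) = (1 + (t - r) A(s + r ν)) (1 + r A(s))`. Thus the derivative at `r`
reduces to that of `det (1 + τ M)` at `τ = 0`, which is the trace. -/
theorem hasDerivAt_J {s : E n} (hs : s ∈ frontier D) {r : ℝ} (hr : |r| < T.δ) :
    HasDerivAt (T.J s) (T.h (s + r • outerNormal D s) * T.J s r) r := by
  have h1 : T.J s = fun t => (1 + (t - r) • T.A (s + r • outerNormal D s)).det * T.J s r := by
    funext t
    rw [J, J, ← clm_det_mul]
    congr 1
    ext1 v
    have h2 := congrArg (fun L => L v) (T.A_shift hs hr)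
    simp only [mul_apply_eq_comp] at h2
    have h3 : ∀ (L M : E n →L[ℝ] E n) (c : ℝ), ((1 + c • L) * M) v = M v + c • L (M v) := by
      intro L M c; simp
    rw [h3, h2]
    simp [sub_smul]
  have h2 : HasDerivAt (fun t : ℝ => t - r) 1 r := (hasDerivAt_id r).sub_const r
  have h3 := hasDerivAt_det_one_add_smul (T.A (s + r • outerNormal D s))
  have h4 : HasDerivAt (fun t : ℝ => (1 + (t - r) • T.A (s + r • outerNormal D s)).det)
      (T.h (s + r • outerNormal D s)) r := by
    have h3' : HasDerivAt (fun r' : ℝ => (1 + r' • T.A (s + r • outerNormal D s)).det)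
        (T.h (s + r • outerNormal D s)) (r - r) := by simpa [h] using h3
    have h6 := HasDerivAt.comp r (h := fun t => t - r) h3' h2
    rw [mul_one] at h6
    exact h6
  have h5 := h4.mul_const (T.J s r)
  exact h5.congr_of_eventuallyEq (Eventually.of_forall fun t => congrFun h1 t)

end Tube

end

end ThinShell

/-! ### The Hausdorff measure on `∂D` and the change of variables in the tube. -/

namespace ThinShell

noncomputable section

theorem euclideanHausdorffMeasure_image_le {X Y : Type*} [MetricSpace X] [MetricSpace Y]
    [MeasurableSpace X] [BorelSpace X] [MeasurableSpace Y] [BorelSpace Y] {K : NNReal} {f : X → Y}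
    {s : Set X} (h : LipschitzOnWith K f s) (k : ℕ) :
    (μHE[k] : Measure Y) (f '' s) ≤ (K : ℝ≥0∞) ^ k * (μHE[k] : Measure X) s := by
  rw [Measure.euclideanHausdorffMeasure_def, Measure.euclideanHausdorffMeasure_def,
    Measure.smul_apply, Measure.smul_apply]
  have := h.hausdorffMeasure_image_le (d := (k : ℝ)) (by positivity)
  rw [ENNReal.rpow_natCast] at this
  rw [mul_smul_comm]
  gcongr

section Perp

variable {n : ℕ} {v : E n}

theorem inner_perp (hv : ‖v‖ = 1) (w : E n) : ⟪v, perp v w⟫_ℝ = 0 := by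
  simp [inner_sub_right, real_inner_smul_right, hv]

theorem norm_perp_le (hv : ‖v‖ = 1) (w : E n) : ‖perp v w‖ ≤ ‖w‖ := by
  have h1 : ‖w‖ ^ 2 = ‖perp v w‖ ^ 2 + ⟪v, w⟫_ℝ ^ 2 := by
    have h2 : w = perp v w + ⟪v, w⟫_ℝ • v := by simp
    have h3 := norm_add_sq_real (perp v w) (⟪v, w⟫_ℝ • v)
    rw [← h2, real_inner_smul_right, real_inner_comm v (perp v w), inner_perp hv,
      norm_smul, hv] at h3
    simpa using h3
  exact le_of_sq_le_sq (by nlinarith [sq_nonneg (⟪v, w⟫_ℝ)]) (norm_nonneg w)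

/-- Fubini along `v`: the slice of the prism at height `x ∈ I` is a translate of `P`, and the other
slices are empty. -/
theorem volume_prism (hv : ‖v‖ = 1) {P : Set (E n)} (hP : ∀ w ∈ P, ⟪v, w⟫_ℝ = 0) {I : Set ℝ}
    (hI : MeasurableSet I)
    (hm : MeasurableSet ((fun p : E n × ℝ => p.1 + p.2 • v) '' (P ×ˢ I))) :
    volume ((fun p : E n × ℝ => p.1 + p.2 • v) '' (P ×ˢ I))
      = (μHE[n - 1] : Measure (E n)) P * volume I := by
  have hv0 : v ≠ 0 := by intro h; simp [h] at hv
  have h := EuclideanGeometry.euclideanHausdorffMeasure_eq_lintegral (0 : E n) hv0 hm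
  rw [show Module.finrank ℝ (E n) = n by simp] at h
  rw [EuclideanSpace.euclideanHausdorffMeasure_eq_volume] at h
  have hslice : ∀ x : ℝ, (μHE[n - 1] : Measure (E n))
      ((fun p : E n × ℝ => p.1 + p.2 • v) '' (P ×ˢ I) ∩
        AffineSubspace.mk' (x • v +ᵥ (0 : E n)) (ℝ ∙ v)ᗮ)
      = I.indicator (fun _ => (μHE[n - 1] : Measure (E n)) P) x := by
    intro x
    have hmem : ∀ z : E n, z ∈ (AffineSubspace.mk' (x • v +ᵥ (0 : E n)) (ℝ ∙ v)ᗮ) ↔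
        ⟪v, z⟫_ℝ = x := by
      intro z
      rw [AffineSubspace.mem_mk', Submodule.mem_orthogonal_singleton_iff_inner_right]
      simp [inner_sub_right, real_inner_smul_right, hv, sub_eq_zero]
    by_cases hx : x ∈ I
    · rw [indicator_of_mem hx]
      have : (fun p : E n × ℝ => p.1 + p.2 • v) '' (P ×ˢ I) ∩
          AffineSubspace.mk' (x • v +ᵥ (0 : E n)) (ℝ ∙ v)ᗮ = (fun w => x • v + w) '' P := by
        ext z
        constructor
        · rintro ⟨⟨⟨w, r⟩, ⟨hw, hr⟩, rfl⟩, hz⟩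
          have := (hmem _).1 hz
          simp only [inner_add_right, hP w hw, real_inner_smul_right, real_inner_self_eq_norm_sq,
            hv] at this
          have hrx : r = x := by linarith
          exact ⟨w, hw, by simp [hrx, add_comm]⟩
        · rintro ⟨w, hw, rfl⟩
          refine ⟨⟨(w, x), ⟨hw, hx⟩, add_comm _ _⟩, (hmem _).2 ?_⟩
          simp [inner_add_right, hP w hw, real_inner_smul_right, hv]
      rw [this]
      exact (isometry_add_left (x • v)).euclideanHausdorffMeasure_image P
    · rw [indicator_of_notMem hx]
      have : (fun p : E n × ℝ => p.1 + p.2 • v) '' (P ×ˢ I) ∩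
          AffineSubspace.mk' (x • v +ᵥ (0 : E n)) (ℝ ∙ v)ᗮ = ∅ := by
        refine eq_empty_of_forall_notMem ?_
        rintro _ ⟨⟨⟨w, r⟩, ⟨hw, hr⟩, rfl⟩, hz⟩
        have := (hmem _).1 hz
        simp only [inner_add_right, hP w hw, real_inner_smul_right, real_inner_self_eq_norm_sq,
          hv] at this
        exact hx (by rwa [show x = r by linarith])
      rw [this, measure_empty]
  rw [h]
  simp_rw [hslice]
  rw [lintegral_indicator_const hI]
  simp [enorm_eq_nnnorm, show ‖v‖₊ = 1 from NNReal.eq hv]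

end Perp

/-- Local comparison of measures with all constants larger than `1` gives a global comparison. -/
theorem measure_le_of_locally_le {X : Type*} [TopologicalSpace X] [MeasurableSpace X]
    [OpensMeasurableSpace X] {μ₁ μ₂ : Measure X} {K : Set X} (hK : IsCompact K)
    (h : ∀ κ : ℝ≥0∞, 1 < κ → ∀ s ∈ K, ∃ V, IsOpen V ∧ s ∈ V ∧ ∀ A, MeasurableSet A → A ⊆ K ∩ V →
      μ₁ A ≤ κ * μ₂ A) {A : Set X} (hA : MeasurableSet A) (hAK : A ⊆ K) : μ₁ A ≤ μ₂ A := by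
  have h1 : ∀ κ : ℝ≥0∞, 1 < κ → μ₁ A ≤ κ * μ₂ A := by
    intro κ hκ
    -- Compactness induction. The auxiliary set is kept measurable so that, for a union, the set to
    -- be estimated can be cut along it into two pieces.
    have h2 : ∃ S', K ⊆ S' ∧ MeasurableSet S' ∧
        ∀ A, MeasurableSet A → A ⊆ K ∩ S' → μ₁ A ≤ κ * μ₂ A := by
      refine hK.induction_on (p := fun S => ∃ S', S ⊆ S' ∧ MeasurableSet S' ∧
        ∀ A, MeasurableSet A → A ⊆ K ∩ S' → μ₁ A ≤ κ * μ₂ A) ?_ ?_ ?_ ?_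
      · refine ⟨∅, subset_rfl, MeasurableSet.empty, fun A _ hA => ?_⟩
        rw [inter_empty, subset_empty_iff] at hA
        simp [hA]
      · rintro s t hst ⟨S', hS', h'⟩
        exact ⟨S', hst.trans hS', h'⟩
      · rintro s t ⟨S', hS', hSm, hS⟩ ⟨T', hT', hTm, hT⟩
        refine ⟨S' ∪ T', union_subset_union hS' hT', hSm.union hTm, fun A hA hAs => ?_⟩
        rw [← measure_inter_add_sdiff A hSm, ← measure_inter_add_sdiff (μ := μ₂) A hSm, mul_add]
        refine add_le_add (hS _ (hA.inter hSm) ?_) (hT _ (hA.diff hSm) ?_)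
        · exact fun x hx => ⟨(hAs hx.1).1, hx.2⟩
        · exact fun x hx => ⟨(hAs hx.1).1, (hAs hx.1).2.resolve_left hx.2⟩
      · intro s hs
        obtain ⟨V, hV, hsV, hV'⟩ := h κ hκ s hs
        exact ⟨V, mem_nhdsWithin_of_mem_nhds (hV.mem_nhds hsV), V, subset_rfl, hV.measurableSet,
          hV'⟩
    obtain ⟨S', hKS, -, hS⟩ := h2
    exact hS A hA (subset_inter hAK (hAK.trans hKS))
  have h3 : Tendsto (fun κ : ℝ≥0∞ => κ * μ₂ A) (𝓝[>] 1) (𝓝 (1 * μ₂ A)) :=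
    ENNReal.Tendsto.mul_const (tendsto_id.mono_left nhdsWithin_le_nhds) (Or.inl one_ne_zero)
  rw [one_mul] at h3
  have : (𝓝[>] (1 : ℝ≥0∞)).NeBot := nhdsGT_neBot_of_exists_gt ⟨2, by norm_num⟩
  exact ge_of_tendsto h3 (eventually_mem_nhdsWithin.mono fun κ hκ => h1 κ hκ)

namespace Tube

variable {n : ℕ} {D : Set (E n)} (T : Tube D)

/-- The weight `1 / J` in the tube. -/
def weight (x : E n) : ℝ≥0∞ := ENNReal.ofReal (T.J (T.π x) (T.d x))⁻¹

theorem measurable_weight : Measurable T.weight :=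
  ((T.continuous_J.comp (T.contDiff_π.continuous.prodMk
    T.contDiff_d.continuous)).measurable.inv).ennreal_ofReal

/-- The map `x ↦ P(π x) + d(x) ν₀`, where `P` is the orthogonal projection to `ν₀^⊥`. -/
def flat (ν₀ : E n) (x : E n) : E n := perp ν₀ (T.π x) + T.d x • ν₀

def flatDeriv (ν₀ : E n) (x : E n) : E n →L[ℝ] E n :=
  (perp ν₀).comp (fderiv ℝ T.π x) + (innerSL ℝ (T.nu x)).smulRight ν₀

theorem hasFDerivAt_flat (ν₀ : E n) {x : E n} (hx : x ∈ tubeSet D T.δ) :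
    HasFDerivAt (T.flat ν₀) (T.flatDeriv ν₀ x) x :=
  ((perp ν₀).hasFDerivAt.comp x (T.hasFDerivAt_π x)).add ((T.hasFDerivAt_d hx).smul_const ν₀)

/-- The comparison of two tangent spaces. -/
def transition (ν₀ : E n) (s : E n) : ℝ :=
  ((perp ν₀).comp (perp (T.nu s)) + (innerSL ℝ (T.nu s)).smulRight ν₀).det

theorem continuous_transition (ν₀ : E n) : Continuous (T.transition ν₀) := by
  refine ContinuousLinearMap.continuous_det.comp ?_
  have h1 : Continuous T.nu := T.contDiff_nu.continuous
  have h2 : Continuous fun s => innerSL ℝ (T.nu s) := (innerSL ℝ).continuous.comp h1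
  have h3 : Continuous fun s => (innerSL ℝ (T.nu s)).smulRight (T.nu s) := by
    have := (ContinuousLinearMap.smulRightL ℝ (E n) (E n)).isBoundedBilinearMap.continuous
    exact this.comp (h2.prodMk h1)
  have h4 : Continuous fun s => (innerSL ℝ (T.nu s)).smulRight ν₀ := by
    have := (ContinuousLinearMap.smulRightL ℝ (E n) (E n)).isBoundedBilinearMap.continuous
    exact this.comp (h2.prodMk continuous_const)
  exact (continuous_const.clm_comp (continuous_const.sub h3)).add h4

theorem transition_self {s : E n} (hs : s ∈ frontier D) : T.transition (outerNormal D s) s = 1 := by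
  have h : (perp (outerNormal D s)).comp (perp (T.nu s)) +
      (innerSL ℝ (T.nu s)).smulRight (outerNormal D s) = 1 := by
    ext1 v
    rw [T.nu_eq hs]
    simp [inner_sub_right, real_inner_smul_right, T.norm_outerNormal s hs]
  rw [transition, h, clm_det_one]

/-- Composition with `1 + r A(s)` removes the dependence on `r`: it turns the derivative of `π` at
the shifted point into that at `s`, and it preserves the normal component. -/
theorem det_flatDeriv (ν₀ : E n) {s : E n} (hs : s ∈ frontier D) {r : ℝ} (hr : |r| < T.δ) :
    (T.flatDeriv ν₀ (s + r • outerNormal D s)).det * T.J s r = T.transition ν₀ s := by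
  rw [J, ← clm_det_mul, transition]
  congr 1
  ext1 v
  have h1 := congrArg (fun L => L v) (T.fderiv_π_shift hs hr)
  simp only [mul_apply_eq_comp] at h1
  have h2 : ⟪outerNormal D s, (1 + r • T.A s) v⟫_ℝ = ⟪outerNormal D s, v⟫_ℝ := by
    have := T.inner_nu_A (T.frontier_subset hs) v
    rw [T.nu_eq hs] at this
    simp [inner_add_right, real_inner_smul_right, this]
  have h3 : ∀ w, T.flatDeriv ν₀ (s + r • outerNormal D s) w
      = perp ν₀ (fderiv ℝ T.π (s + r • outerNormal D s) w) + ⟪outerNormal D s, w⟫_ℝ • ν₀ := by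
    intro w
    rw [flatDeriv, T.nu_apply s hs r hr]
    rfl
  rw [mul_apply_eq_comp, h3, h1, h2, T.fderiv_π_frontier hs, T.nu_eq hs]
  rfl

/-- The part of the tube over `A ⊆ ∂D` with `d ∈ I`. -/
def block (A : Set (E n)) (I : Set ℝ) : Set (E n) :=
  tubeSet D T.δ ∩ (T.π ⁻¹' A ∩ T.d ⁻¹' I)

theorem measurableSet_block {A : Set (E n)} {I : Set ℝ} (hA : MeasurableSet A)
    (hI : MeasurableSet I) : MeasurableSet (T.block A I) :=
  T.isOpen_tube.measurableSet.inter
    ((T.contDiff_π.continuous.measurable hA).inter (T.contDiff_d.continuous.measurable hI))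

theorem flat_image_block (ν₀ : E n) {A : Set (E n)} (hA : A ⊆ frontier D) {I : Set ℝ}
    (hI : I ⊆ Ioo (-T.δ) T.δ) : T.flat ν₀ '' T.block A I
      = (fun p : E n × ℝ => p.1 + p.2 • ν₀) '' ((perp ν₀ '' A) ×ˢ I) := by
  ext z
  constructor
  · rintro ⟨x, ⟨hx, hxA, hxI⟩, rfl⟩
    exact ⟨(perp ν₀ (T.π x), T.d x), ⟨⟨_, hxA, rfl⟩, hxI⟩, rfl⟩
  · rintro ⟨⟨_, r⟩, ⟨⟨s, hs, rfl⟩, hr⟩, rfl⟩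
    have hs' := hA hs
    have hr' : |r| < T.δ := abs_lt.2 (hI hr)
    refine ⟨s + r • outerNormal D s, ⟨T.mem_tube hs' hr', ?_, ?_⟩, ?_⟩
    · rwa [mem_preimage, T.π_apply s hs' r hr']
    · rwa [mem_preimage, T.d_apply s hs' r hr']
    · rw [flat, T.d_apply s hs' r hr', T.π_apply s hs' r hr']

/-- Secants of `∂D` near `s₀` are almost tangent. Since `d = 0` on `∂D`, strict differentiability of
`d` at `s₀` bounds the normal component of `s - s'` by `c ‖s - s'‖`. -/
theorem exists_local_biLipschitz (T : Tube D) {s₀ : E n} (hs₀ : s₀ ∈ frontier D) {c : ℝ} (hc : 0 < c) :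
    ∃ V, IsOpen V ∧ s₀ ∈ V ∧ ∀ s ∈ frontier D ∩ V, ∀ s' ∈ frontier D ∩ V,
      (1 - c) * ‖s - s'‖ ≤ ‖perp (outerNormal D s₀) (s - s')‖ := by
  have h1 : HasStrictFDerivAt T.d (innerSL ℝ (outerNormal D s₀)) s₀ := by
    have := T.contDiff_d.contDiffAt.hasStrictFDerivAt (x := s₀) (by simp)
    rwa [(T.hasFDerivAt_d (T.frontier_subset hs₀)).fderiv, T.nu_eq hs₀] at this
  have h2 := h1.isLittleO.def hc
  rw [nhds_prod_eq] at h2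
  obtain ⟨W, hW, hW'⟩ := mem_prod_self_iff.1 h2
  obtain ⟨V, hVW, hV, hsV⟩ := mem_nhds_iff.1 hW
  refine ⟨V, hV, hsV, fun s hs s' hs' => ?_⟩
  have h3 : ‖T.d s - T.d s' - innerSL ℝ (outerNormal D s₀) (s - s')‖ ≤ c * ‖s - s'‖ :=
    hW' (mk_mem_prod (hVW hs.2) (hVW hs'.2))
  simp only [T.d_eq hs.1, T.d_eq hs'.1, sub_zero, zero_sub, norm_neg, innerSL_apply_apply] at h3
  have h4 : s - s' = perp (outerNormal D s₀) (s - s') +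
      ⟪outerNormal D s₀, s - s'⟫_ℝ • outerNormal D s₀ := by simp
  have h5 : ‖s - s'‖ ≤ ‖perp (outerNormal D s₀) (s - s')‖ + ‖⟪outerNormal D s₀, s - s'⟫_ℝ‖ := by
    conv_lhs => rw [h4]
    refine (norm_add_le _ _).trans_eq ?_
    rw [norm_smul, T.norm_outerNormal s₀ hs₀, mul_one]
  linarith

/-- Local comparison of the surface measure and of the weighted volume in the tube. -/
theorem local_comparison {s₀ : E n} (hs₀ : s₀ ∈ frontier D) {κ : NNReal} (hκ : 1 < κ) :
    ∃ V, IsOpen V ∧ s₀ ∈ V ∧ ∀ A, MeasurableSet A → A ⊆ frontier D ∩ V → ∀ I, MeasurableSet I →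
      I ⊆ Ioo (-T.δ) T.δ →
      ∫⁻ x in T.block A I, T.weight x ≤ κ * ((μHE[n - 1] : Measure (E n)) A * volume I) ∧
      (μHE[n - 1] : Measure (E n)) A * volume I
        ≤ (κ : ℝ≥0∞) ^ n * (κ * ∫⁻ x in T.block A I, T.weight x) := by
  set ν₀ := outerNormal D s₀ with hν₀
  have hν₀1 : ‖ν₀‖ = 1 := T.norm_outerNormal s₀ hs₀
  have hκ' : (1 : ℝ) < κ := hκ
  have hκ0 : (0 : ℝ) < κ := by linarith
  -- With `c = 1 - κ⁻¹` the factor `1 - c` is `κ⁻¹`, so the projection to the tangent space at `s₀`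
  -- has a `κ`-Lipschitz inverse on the relevant part of `∂D`.
  obtain ⟨V₁, hV₁, hsV₁, hlip⟩ := T.exists_local_biLipschitz hs₀ (c := 1 - (κ : ℝ)⁻¹)
    (by have := inv_lt_one_of_one_lt₀ hκ'; linarith)
  let V₂ : Set (E n) := {s | T.transition ν₀ s < κ ∧ (κ : ℝ)⁻¹ < T.transition ν₀ s}
  have hV₂ : IsOpen V₂ := (isOpen_lt (T.continuous_transition ν₀) continuous_const).inter
    (isOpen_lt continuous_const (T.continuous_transition ν₀))
  have hsV₂ : s₀ ∈ V₂ := by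
    have : T.transition ν₀ s₀ = 1 := T.transition_self hs₀
    exact ⟨by rw [this]; exact hκ', by rw [this]; exact inv_lt_one_of_one_lt₀ hκ'⟩
  refine ⟨V₁ ∩ V₂, hV₁.inter hV₂, ⟨hsV₁, hsV₂⟩, fun A hA hAV I hI hIδ => ?_⟩
  have hAD : A ⊆ frontier D := fun s hs => (hAV hs).1
  have hlipA : ∀ s ∈ A, ∀ s' ∈ A, ‖s - s'‖ ≤ κ * ‖perp ν₀ (s - s')‖ := by
    intro s hs s' hs'
    have := hlip s ⟨hAD hs, (hAV hs).2.1⟩ s' ⟨hAD hs', (hAV hs').2.1⟩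
    rw [sub_sub_cancel, inv_mul_le_iff₀ hκ0] at this
    exact this
  have hinjA : InjOn (perp ν₀) A := by
    intro s hs s' hs' h
    have := hlipA s hs s' hs'
    rw [map_sub, h, sub_self, norm_zero, mul_zero] at this
    exact sub_eq_zero.1 (norm_le_zero_iff.1 this)
  have hinj : InjOn (T.flat ν₀) (T.block A I) := by
    intro x hx x' hx' h
    have h1 := congrArg (fun z => ⟪ν₀, z⟫_ℝ) h
    simp only [flat, inner_add_right, inner_perp hν₀1, real_inner_smul_right,
      real_inner_self_eq_norm_sq, hν₀1] at h1
    have h2 : T.d x = T.d x' := by linarith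
    have h3 : perp ν₀ (T.π x) = perp ν₀ (T.π x') := by
      have := h
      simp only [flat] at this
      rw [h2] at this
      exact add_right_cancel this
    rw [T.eq_of_mem hx.1, T.eq_of_mem hx'.1, h2, hinjA hx.2.1 hx'.2.1 h3]
  have hBm := T.measurableSet_block hA hI
  have hder : ∀ x ∈ T.block A I, HasFDerivWithinAt (T.flat ν₀) (T.flatDeriv ν₀ x) (T.block A I) x :=
    fun x hx => (T.hasFDerivAt_flat ν₀ hx.1).hasFDerivWithinAt
  -- The flattening map sends the block over `A` to the prism over the projection of `A`, whose
  -- volume is known exactly. It remains to compare the densities, and the measure of `A` with that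
  -- of its projection.
  have hcv := lintegral_abs_det_fderiv_eq_addHaar_image volume hBm hder hinj
  have himm : MeasurableSet (T.flat ν₀ '' T.block A I) :=
    hBm.image_of_continuousOn_injOn (fun x hx => (hder x hx).continuousWithinAt) hinj
  rw [T.flat_image_block ν₀ hAD hIδ] at himm hcv
  rw [volume_prism hν₀1 (by rintro _ ⟨w, -, rfl⟩; exact inner_perp hν₀1 w) hI himm] at hcv
  -- comparison of the Hausdorff measures
  have hH1 : (μHE[n - 1] : Measure (E n)) (perp ν₀ '' A) ≤ (μHE[n - 1] : Measure (E n)) A := by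
    have hL : LipschitzOnWith 1 (perp ν₀) A := by
      refine LipschitzOnWith.of_dist_le_mul fun s _ s' _ => ?_
      rw [dist_eq_norm, dist_eq_norm, ← map_sub, NNReal.coe_one, one_mul]
      exact norm_perp_le hν₀1 _
    simpa using euclideanHausdorffMeasure_image_le hL (n - 1)
  -- The Lipschitz bound gives the exponent `n - 1`; as `κ > 1`, it may be raised to `n`. The loss
  -- is irrelevant because `κ` tends to `1` in the end.
  have hH2 : (μHE[n - 1] : Measure (E n)) A
      ≤ (κ : ℝ≥0∞) ^ n * (μHE[n - 1] : Measure (E n)) (perp ν₀ '' A) := by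
    have hL : LipschitzOnWith κ (Function.invFunOn (perp ν₀) A) (perp ν₀ '' A) := by
      refine LipschitzOnWith.of_dist_le_mul ?_
      rintro _ ⟨s, hs, rfl⟩ _ ⟨s', hs', rfl⟩
      rw [hinjA.leftInvOn_invFunOn hs, hinjA.leftInvOn_invFunOn hs', dist_eq_norm, dist_eq_norm,
        ← map_sub]
      exact hlipA s hs s' hs'
    have h1 := euclideanHausdorffMeasure_image_le hL (n - 1)
    have h2 : Function.invFunOn (perp ν₀) A '' (perp ν₀ '' A) = A :=
      hinjA.leftInvOn_invFunOn.image_image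
    rw [h2] at h1
    refine h1.trans ?_
    gcongr
    · exact_mod_cast hκ.le
    · omega
  -- comparison of the densities
  have hdens : ∀ x ∈ T.block A I,
      T.weight x ≤ κ * ENNReal.ofReal |(T.flatDeriv ν₀ x).det| ∧
      ENNReal.ofReal |(T.flatDeriv ν₀ x).det| ≤ κ * T.weight x := by
    rintro x ⟨⟨s, hs, r, hr, rfl⟩, hxA, hxI⟩
    rw [mem_preimage, T.π_apply s hs r hr] at hxA
    have hJ := T.J_pos hs hr
    have hdet := T.det_flatDeriv ν₀ hs hr
    have htr := (hAV hxA).2.2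
    have htr0 : 0 < T.transition ν₀ s := lt_trans (by positivity) htr.2
    have habs : |(T.flatDeriv ν₀ (s + r • outerNormal D s)).det| = T.transition ν₀ s * (T.J s r)⁻¹ := by
      rw [← hdet, mul_inv_cancel_right₀ hJ.ne', abs_of_pos]
      exact pos_of_mul_pos_left (hdet ▸ htr0) hJ.le
    rw [weight, T.π_apply s hs r hr, T.d_apply s hs r hr, habs]
    have hJi : 0 < (T.J s r)⁻¹ := inv_pos.2 hJ
    have hκc : (κ : ℝ≥0∞) = ENNReal.ofReal κ := (ENNReal.ofReal_coe_nnreal).symm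
    rw [hκc, ← ENNReal.ofReal_mul hκ0.le, ← ENNReal.ofReal_mul hκ0.le]
    constructor
    · refine ENNReal.ofReal_le_ofReal ?_
      have h1 : 1 ≤ κ * T.transition ν₀ s := by
        have := htr.2.le
        rwa [inv_le_iff_one_le_mul₀' hκ0] at this
      calc (T.J s r)⁻¹ = 1 * (T.J s r)⁻¹ := (one_mul _).symm
        _ ≤ (κ * T.transition ν₀ s) * (T.J s r)⁻¹ := by gcongr
        _ = _ := mul_assoc _ _ _
    · refine ENNReal.ofReal_le_ofReal ?_
      gcongr
      exact htr.1.le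
  constructor
  · calc ∫⁻ x in T.block A I, T.weight x
        ≤ ∫⁻ x in T.block A I, κ * ENNReal.ofReal |(T.flatDeriv ν₀ x).det| :=
          setLIntegral_mono' hBm fun x hx => (hdens x hx).1
      _ = κ * ∫⁻ x in T.block A I, ENNReal.ofReal |(T.flatDeriv ν₀ x).det| :=
          lintegral_const_mul' _ _ ENNReal.coe_ne_top
      _ ≤ _ := by
          rw [hcv]
          gcongr
  · calc (μHE[n - 1] : Measure (E n)) A * volume I
        ≤ ((κ : ℝ≥0∞) ^ n * (μHE[n - 1] : Measure (E n)) (perp ν₀ '' A)) * volume I := by gcongr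
      _ = (κ : ℝ≥0∞) ^ n * ∫⁻ x in T.block A I, ENNReal.ofReal |(T.flatDeriv ν₀ x).det| := by
          rw [hcv, mul_assoc]
      _ ≤ (κ : ℝ≥0∞) ^ n * ∫⁻ x in T.block A I, κ * T.weight x := by
          gcongr 1
          exact setLIntegral_mono' hBm fun x hx => (hdens x hx).2
      _ = _ := by rw [lintegral_const_mul' _ _ ENNReal.coe_ne_top]

/-- The weighted volume in the tube, as a measure on `E n × ℝ`. -/
def blockMeasure : Measure (E n × ℝ) :=
  ((volume.restrict (tubeSet D T.δ)).withDensity T.weight).map (fun x => (T.π x, T.d x))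

theorem blockMeasure_prod {A : Set (E n)} {I : Set ℝ} (hA : MeasurableSet A)
    (hI : MeasurableSet I) : T.blockMeasure (A ×ˢ I) = ∫⁻ x in T.block A I, T.weight x := by
  have hm : Measurable fun x => (T.π x, T.d x) :=
    (T.contDiff_π.continuous.prodMk T.contDiff_d.continuous).measurable
  rw [blockMeasure, Measure.map_apply hm (hA.prod hI), withDensity_apply _ (hm (hA.prod hI)),
    Measure.restrict_restrict (hm (hA.prod hI)), inter_comm]
  rfl

/-- For fixed `I` both sides are measures in `A`. They are comparable near every point of the
compact set `∂D` with constants arbitrarily close to `1`, hence equal. -/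
theorem surfaceMeasure_mul_eq {A : Set (E n)} {I : Set ℝ} (hA : MeasurableSet A)
    (hI : MeasurableSet I) (hIδ : I ⊆ Ioo (-T.δ) T.δ) :
    surfaceMeasure D A * volume I = T.blockMeasure (A ×ˢ I) := by
  have hfm : MeasurableSet (frontier D) := isClosed_frontier.measurableSet
  -- the two measures on the boundary
  let μ₁ : Measure (E n) := (volume I) • (μHE[n - 1] : Measure (E n))
  let μ₂ : Measure (E n) := (T.blockMeasure.restrict (univ ×ˢ I)).map Prod.fst
  have hμ₂ : ∀ B, MeasurableSet B → μ₂ B = ∫⁻ x in T.block B I, T.weight x := by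
    intro B hB
    rw [← T.blockMeasure_prod hB hI, Measure.map_apply measurable_fst hB,
      Measure.restrict_apply (measurable_fst hB)]
    congr 1
    ext p; simp [mem_prod]
  -- One direction of `local_comparison` loses the factor `κ' ^ (n + 1)`, so `κ'` is chosen with
  -- this power below the prescribed `κ`.
  have hpow : ∀ κ : ℝ≥0∞, 1 < κ → ∃ κ' : NNReal, 1 < κ' ∧ (κ' : ℝ≥0∞) ≤ κ ∧
      (κ' : ℝ≥0∞) ^ n * κ' ≤ κ := by
    intro κ hκ
    have hc : Tendsto (fun x : NNReal => ((x ^ n * x : NNReal) : ℝ≥0∞)) (𝓝[>] 1)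
        (𝓝 ((1 ^ n * 1 : NNReal) : ℝ≥0∞)) := by
      have : Continuous fun x : NNReal => ((x ^ n * x : NNReal) : ℝ≥0∞) :=
        ENNReal.continuous_coe.comp (by fun_prop)
      exact (this.tendsto 1).mono_left nhdsWithin_le_nhds
    have h1 : ∀ᶠ x : NNReal in 𝓝[>] 1, ((x ^ n * x : NNReal) : ℝ≥0∞) < κ :=
      hc.eventually (gt_mem_nhds (by simpa using hκ))
    have : (𝓝[>] (1 : NNReal)).NeBot := nhdsGT_neBot_of_exists_gt ⟨2, by norm_num⟩
    obtain ⟨x, hx, hx1⟩ := (h1.and eventually_mem_nhdsWithin).exists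
    have hx1' : 1 < x := hx1
    refine ⟨x, hx1', ?_, by exact_mod_cast hx.le⟩
    refine le_trans ?_ hx.le
    have : 1 * x ≤ x ^ n * x := by gcongr; exact one_le_pow₀ hx1'.le
    exact_mod_cast (one_mul x) ▸ this
  have key1 : ∀ B, MeasurableSet B → B ⊆ frontier D → μ₁ B ≤ μ₂ B := by
    intro B hB hBD
    refine measure_le_of_locally_le T.isCompact_frontier (fun κ hκ s hs => ?_) hB hBD
    obtain ⟨κ', hκ', h1, h2⟩ := hpow κ hκ
    obtain ⟨V, hV, hsV, hVA⟩ := T.local_comparison hs hκ'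
    refine ⟨V, hV, hsV, fun A hA hAV => ?_⟩
    have := (hVA A hA hAV I hI hIδ).2
    rw [hμ₂ A hA]
    calc μ₁ A = (μHE[n - 1] : Measure (E n)) A * volume I := by
          simp [μ₁, mul_comm]
      _ ≤ _ := this
      _ ≤ _ := by rw [← mul_assoc]; gcongr
  have key2 : ∀ B, MeasurableSet B → B ⊆ frontier D → μ₂ B ≤ μ₁ B := by
    intro B hB hBD
    refine measure_le_of_locally_le T.isCompact_frontier (fun κ hκ s hs => ?_) hB hBD
    obtain ⟨κ', hκ', h1, h2⟩ := hpow κ hκ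
    obtain ⟨V, hV, hsV, hVA⟩ := T.local_comparison hs hκ'
    refine ⟨V, hV, hsV, fun A hA hAV => ?_⟩
    have := (hVA A hA hAV I hI hIδ).1
    rw [hμ₂ A hA]
    refine this.trans ?_
    calc (κ' : ℝ≥0∞) * ((μHE[n - 1] : Measure (E n)) A * volume I)
        ≤ κ * ((μHE[n - 1] : Measure (E n)) A * volume I) := by gcongr
      _ = _ := by simp [μ₁, mul_comm]
  have h1 := le_antisymm (key1 _ (hA.inter hfm) inter_subset_right)
    (key2 _ (hA.inter hfm) inter_subset_right)
  rw [hμ₂ _ (hA.inter hfm)] at h1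
  rw [T.blockMeasure_prod hA hI, surfaceMeasure, Measure.restrict_apply hA, mul_comm]
  have hblock : T.block A I = T.block (A ∩ frontier D) I := by
    ext x
    refine ⟨fun hx => ⟨hx.1, ⟨hx.2.1, T.π_mem hx.1⟩, hx.2.2⟩, fun hx => ⟨hx.1, hx.2.1.1, hx.2.2⟩⟩
  rw [hblock, ← h1]
  rfl

/-- Finiteness of the area is read off from one block: its volume is finite, the weight is bounded
on it by compactness, and the interval has positive length. -/
theorem surfaceMeasure_univ_lt_top (T : Tube D) : surfaceMeasure D univ < ⊤ := by
  have hδ := T.δ_pos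
  have hIδ : Ioo (-(T.δ / 2)) (T.δ / 2) ⊆ Ioo (-T.δ) T.δ :=
    Ioo_subset_Ioo (by linarith) (by linarith)
  have h1 := T.surfaceMeasure_mul_eq MeasurableSet.univ measurableSet_Ioo hIδ
  have hcont : ContinuousOn (fun p : E n × ℝ => (T.J p.1 p.2)⁻¹)
      (frontier D ×ˢ Icc (-(T.δ / 2)) (T.δ / 2)) := by
    refine T.continuous_J.continuousOn.inv₀ ?_
    rintro ⟨s, r⟩ ⟨hs, hr⟩
    exact T.J_ne_zero hs ((abs_le.2 hr).trans_lt (by linarith))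
  obtain ⟨C, hC⟩ := (T.isCompact_frontier.prod isCompact_Icc).exists_bound_of_continuousOn hcont
  have h2 : T.blockMeasure (univ ×ˢ Ioo (-(T.δ / 2)) (T.δ / 2)) < ⊤ := by
    rw [T.blockMeasure_prod MeasurableSet.univ measurableSet_Ioo]
    refine (setLIntegral_mono' (g := fun _ => ENNReal.ofReal C)
      (T.measurableSet_block MeasurableSet.univ measurableSet_Ioo) ?_).trans_lt ?_
    · rintro x ⟨hx, -, hxI⟩
      refine ENNReal.ofReal_le_ofReal ((le_abs_self _).trans ?_)
      exact hC (T.π x, T.d x) ⟨T.π_mem hx, Ioo_subset_Icc_self hxI⟩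
    · rw [setLIntegral_const]
      exact ENNReal.mul_lt_top ENNReal.ofReal_lt_top
        (((T.isBounded_tubeSet T.δ).subset inter_subset_left).measure_lt_top)
  rw [← h1] at h2
  by_contra hcon
  rw [not_lt, top_le_iff] at hcon
  rw [hcon, Real.volume_Ioo, ENNReal.top_mul] at h2
  · exact lt_irrefl _ h2
  · simp; linarith

theorem isFiniteMeasure_surfaceMeasure (T : Tube D) : IsFiniteMeasure (surfaceMeasure D) :=
  ⟨T.surfaceMeasure_univ_lt_top⟩

/-- Both measures agree on rectangles, and the factors are finite, so the product measure is
determined by this. -/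
theorem blockMeasure_eq :
    T.blockMeasure = (surfaceMeasure D).prod (volume.restrict (Ioo (-T.δ) T.δ)) := by
  have := T.isFiniteMeasure_surfaceMeasure
  symm
  refine Measure.prod_eq fun A I hA hI => ?_
  have hblock : T.block A I = T.block A (I ∩ Ioo (-T.δ) T.δ) := by
    ext x
    refine ⟨fun hx => ⟨hx.1, hx.2.1, ?_⟩, fun hx => ⟨hx.1, hx.2.1, ?_⟩⟩
    · exact ⟨hx.2.2, abs_lt.1 (T.abs_d_lt hx.1)⟩
    · exact (mem_preimage.1 hx.2.2).1
  rw [Measure.restrict_apply hI, T.surfaceMeasure_mul_eq hA (hI.inter measurableSet_Ioo)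
    inter_subset_right, T.blockMeasure_prod hA hI,
    T.blockMeasure_prod hA (hI.inter measurableSet_Ioo), hblock]

/-- The change of variables `x = s + r ν(s)`. -/
theorem lintegral_tube {F : E n → ℝ≥0∞} (hF : Measurable F) :
    ∫⁻ x in tubeSet D T.δ, F x = ∫⁻ p, F (p.1 + p.2 • T.nu p.1) * ENNReal.ofReal (T.J p.1 p.2)
      ∂((surfaceMeasure D).prod (volume.restrict (Ioo (-T.δ) T.δ))) := by
  have hm : Measurable fun x => (T.π x, T.d x) :=
    (T.contDiff_π.continuous.prodMk T.contDiff_d.continuous).measurable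
  have hc : Continuous fun p : E n × ℝ => p.1 + p.2 • T.nu p.1 :=
    continuous_fst.add (continuous_snd.smul (T.contDiff_nu.continuous.comp continuous_fst))
  have hG : Measurable fun p : E n × ℝ =>
      F (p.1 + p.2 • T.nu p.1) * ENNReal.ofReal (T.J p.1 p.2) :=
    (hF.comp hc.measurable).mul T.continuous_J.measurable.ennreal_ofReal
  rw [← T.blockMeasure_eq, blockMeasure, lintegral_map hG hm]
  have := lintegral_withDensity_eq_lintegral_mul (volume.restrict (tubeSet D T.δ))
    T.measurable_weight (hG.comp hm)
  refine Eq.trans ?_ this.symm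
  refine setLIntegral_congr_fun T.isOpen_tube.measurableSet fun x hx => ?_
  have hJ := T.J_pos (T.π_mem hx) (T.abs_d_lt hx)
  simp only [Pi.mul_apply, Function.comp]
  rw [T.nu_eq (T.π_mem hx), ← T.eq_of_mem hx, weight, mul_comm, mul_assoc,
    ← ENNReal.ofReal_mul hJ.le, mul_inv_cancel₀ hJ.ne', ENNReal.ofReal_one, mul_one]

end Tube

end

end ThinShell

/-! ### Integration over `∂D` and the divergence theorems. -/

namespace ThinShell

noncomputable section

section SurfaceMeasure

variable {n : ℕ} {D : Set (E n)}

theorem surfaceMeasure_restrict : (surfaceMeasure D).restrict (frontier D) = surfaceMeasure D := by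
  rw [surfaceMeasure, Measure.restrict_restrict isClosed_frontier.measurableSet, inter_self]

theorem ae_mem_frontier : ∀ᵐ s ∂(surfaceMeasure D), s ∈ frontier D :=
  ae_restrict_mem isClosed_frontier.measurableSet

/-- The measure `ds dr` on `∂D × I`. -/
abbrev prodMeasure (D : Set (E n)) (I : Set ℝ) : Measure (E n × ℝ) :=
  (surfaceMeasure D).prod (volume.restrict I)

variable {F : Type*} [NormedAddCommGroup F]

theorem exists_bound_surface (hc : IsCompact (frontier D)) {f : E n → F} (hf : Continuous f) :
    ∃ C, ∀ s ∈ frontier D, ‖f s‖ ≤ C :=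
  hc.exists_bound_of_continuousOn hf.continuousOn

theorem exists_bound_prod (hc : IsCompact (frontier D)) {f : E n × ℝ → F} (hf : Continuous f)
    (a b : ℝ) : ∃ C, ∀ p : E n × ℝ, p.1 ∈ frontier D ∧ p.2 ∈ Ioo a b → ‖f p‖ ≤ C := by
  obtain ⟨C, hC⟩ := (hc.prod (isCompact_Icc (a := a) (b := b))).exists_bound_of_continuousOn
    hf.continuousOn
  exact ⟨C, fun p hp => hC p ⟨hp.1, Ioo_subset_Icc_self hp.2⟩⟩

variable [IsFiniteMeasure (surfaceMeasure D)]

theorem prodMeasure_eq (I : Set ℝ) :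
    prodMeasure D I = ((surfaceMeasure D).prod volume).restrict (frontier D ×ˢ I) := by
  rw [← Measure.prod_restrict, surfaceMeasure_restrict]

theorem ae_mem_prod {I : Set ℝ} (hI : MeasurableSet I) :
    ∀ᵐ p ∂(prodMeasure D I), p.1 ∈ frontier D ∧ p.2 ∈ I := by
  rw [prodMeasure_eq]
  exact ae_restrict_mem (isClosed_frontier.measurableSet.prod hI)

theorem integrable_surface (hc : IsCompact (frontier D)) {f : E n → F} (hf : Continuous f) :
    Integrable f (surfaceMeasure D) := by
  obtain ⟨C, hC⟩ := exists_bound_surface hc hf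
  exact Integrable.of_bound hf.aestronglyMeasurable C (ae_mem_frontier.mono hC)

theorem memLp_prod (hc : IsCompact (frontier D)) {f : E n × ℝ → F} (hf : Continuous f)
    (a b : ℝ) (p : ℝ≥0∞) : MemLp f p (prodMeasure D (Ioo a b)) := by
  obtain ⟨C, hC⟩ := exists_bound_prod hc hf a b
  exact MemLp.of_bound hf.aestronglyMeasurable C ((ae_mem_prod measurableSet_Ioo).mono hC)

theorem integrable_prod (hc : IsCompact (frontier D)) {f : E n × ℝ → F} (hf : Continuous f)
    (a b : ℝ) : Integrable f (prodMeasure D (Ioo a b)) :=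
  memLp_one_iff_integrable.1 (memLp_prod hc hf a b 1)

theorem continuous_surface_integral [NormedSpace ℝ F] (hc : IsCompact (frontier D))
    {k : E n × ℝ → F} (hk : Continuous k) :
    Continuous fun r => ∫ s, k (s, r) ∂(surfaceMeasure D) := by
  have := continuous_parametric_integral_of_continuous (μ := surfaceMeasure D)
    (f := fun r s => k (s, r)) (hk.comp continuous_swap) hc
  rwa [surfaceMeasure_restrict] at this

theorem contDiff_deriv_snd [NormedSpace ℝ F] {k : E n × ℝ → F} (hk : ContDiff ℝ ∞ k) :
    ContDiff ℝ ∞ fun p : E n × ℝ => fderiv ℝ k p (0, 1) :=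
  (hk.fderiv_right (m := ∞) (by simp)).clm_apply contDiff_const

theorem hasDerivAt_snd [NormedSpace ℝ F] {k : E n × ℝ → F} (hk : ContDiff ℝ ∞ k) (s : E n)
    (r : ℝ) : HasDerivAt (fun r => k (s, r)) (fderiv ℝ k (s, r) (0, 1)) r := by
  have h1 : HasDerivAt (fun r : ℝ => (s, r)) ((0 : E n), (1 : ℝ)) r :=
    (hasDerivAt_const r s).prodMk (hasDerivAt_id r)
  exact (hk.differentiable (by simp) (s, r)).hasFDerivAt.comp_hasDerivAt r h1

theorem hasDerivAt_surface_integral [NormedSpace ℝ F] (hc : IsCompact (frontier D))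
    {k : E n × ℝ → F} (hk : ContDiff ℝ ∞ k) (r : ℝ) :
    HasDerivAt (fun r => ∫ s, k (s, r) ∂(surfaceMeasure D))
      (∫ s, fderiv ℝ k (s, r) (0, 1) ∂(surfaceMeasure D)) r := by
  have hk' := (contDiff_deriv_snd hk).continuous
  obtain ⟨C, hC⟩ := exists_bound_prod hc hk' (r - 1) (r + 1)
  refine (hasDerivAt_integral_of_dominated_loc_of_deriv_le (bound := fun _ => C)
    (Ioo_mem_nhds (by linarith : r - 1 < r) (by linarith : r < r + 1))
    (F := fun r s => k (s, r)) (F' := fun r s => fderiv ℝ k (s, r) (0, 1)) ?_ ?_ ?_ ?_ ?_ ?_).2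
  · exact Eventually.of_forall fun r =>
      (hk.continuous.comp (continuous_id.prodMk continuous_const)).aestronglyMeasurable
  · exact integrable_surface hc (hk.continuous.comp (continuous_id.prodMk continuous_const))
  · exact (hk'.comp (continuous_id.prodMk continuous_const)).aestronglyMeasurable
  · exact ae_mem_frontier.mono fun s hs x hx => hC (s, x) ⟨hs, hx⟩
  · exact integrable_const _
  · exact Eventually.of_forall fun s x _ => hasDerivAt_snd hk s x

end SurfaceMeasure

/-- The integral of a derivative of a compactly supported function vanishes. -/
theorem integral_fderiv_eq_zero {V F : Type*} [NormedAddCommGroup V] [NormedSpace ℝ V]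
    [FiniteDimensional ℝ V] [MeasurableSpace V] [BorelSpace V] (μ : Measure V) [μ.IsAddHaarMeasure]
    [NormedAddCommGroup F] [NormedSpace ℝ F] {g : V → F} (hg : ContDiff ℝ ∞ g)
    (hs : HasCompactSupport g) (v : V) : ∫ x, fderiv ℝ g x v ∂μ = 0 := by
  have h := integral_smul_fderiv_eq_neg_fderiv_smul_of_integrable (μ := μ) (𝕜 := ℝ)
    (f := fun _ => (1 : ℝ)) (g := g) (v := v) (by simp) ?_ ?_ (fun x _ => by fun_prop)
    (fun x _ => hg.differentiable (by simp) x)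
  · simpa using h
  · simp only [one_smul]
    have h1 : Continuous fun x => fderiv ℝ g x v :=
      (hg.continuous_fderiv (by simp)).clm_apply continuous_const
    exact h1.integrable_of_hasCompactSupport (hs.fderiv_apply (𝕜 := ℝ) v)
  · simpa using hg.continuous.integrable_of_hasCompactSupport hs

/-- A weak derivative of a `C¹` function is its derivative. -/
theorem hasDerivAt_of_weak {F : Type*} [NormedAddCommGroup F] [NormedSpace ℝ F] [CompleteSpace F]
    {f f' g : ℝ → F} (hf : ∀ r, HasDerivAt f (f' r) r) (hf' : Continuous f') (hg : Continuous g)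
    {a : ℝ} (h : ∀ θ : ℝ → ℝ, ContDiff ℝ ∞ θ → HasCompactSupport θ → tsupport θ ⊆ Ioo (-a) a →
      ∫ r, (deriv θ r • f r + θ r • g r) = 0) {r : ℝ} (hr : |r| < a) : HasDerivAt f (g r) r := by
  have hfc : Continuous f := continuous_iff_continuousAt.2 fun r => (hf r).continuousAt
  have key : ∀ᵐ x, x ∈ Ioo (-a) a → f' x - g x = 0 := by
    refine isOpen_Ioo.ae_eq_zero_of_integral_contDiff_smul_eq_zero
      ((hf'.sub hg).locallyIntegrable.locallyIntegrableOn _) fun θ hθ hθc hθs => ?_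
    have i1 : Integrable fun x => deriv θ x • f x :=
      ((hθ.continuous_deriv (by simp)).smul hfc).integrable_of_hasCompactSupport
        (hθc.deriv.smul_right)
    have i2 : Integrable fun x => θ x • f' x :=
      (hθ.continuous.smul hf').integrable_of_hasCompactSupport hθc.smul_right
    have i3 : Integrable fun x => θ x • g x :=
      (hθ.continuous.smul hg).integrable_of_hasCompactSupport hθc.smul_right
    have i4 : Integrable fun x => θ x • f x :=
      (hθ.continuous.smul hfc).integrable_of_hasCompactSupport hθc.smul_right
    have h1 := h θ hθ hθc hθs
    rw [integral_add i1 i3] at h1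
    have h2 : ∫ x, (θ x • f' x + deriv θ x • f x) = 0 := by
      refine integral_eq_zero_of_hasDerivAt_of_integrable (f := fun x => θ x • f x)
        (fun x => ?_) (i2.add i1) i4
      exact ((hθ.differentiable (by simp) x).hasDerivAt).smul (hf x)
    rw [integral_add i2 i1] at h2
    simp only [smul_sub]
    rw [integral_sub i2 i3, sub_eq_zero]
    have h3 := h1.trans h2.symm
    rw [add_comm] at h3
    exact (add_right_cancel h3).symm
  have h2 : EqOn (fun x => f' x - g x) (fun _ => 0) (Ioo (-a) a) := by
    refine Measure.eqOn_open_of_ae_eq (μ := (volume : Measure ℝ)) ?_ isOpen_Ioo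
      (hf'.sub hg).continuousOn continuousOn_const
    rw [Filter.EventuallyEq, ae_restrict_iff' measurableSet_Ioo]
    exact key
  have h3 := sub_eq_zero.1 (h2 (abs_lt.1 hr))
  rw [← h3]
  exact hf r

namespace Tube

variable {n : ℕ} {D : Set (E n)} (T : Tube D)

/-- The normal map `(s, r) ↦ s + r ν(s)`. -/
def normalMap (p : E n × ℝ) : E n := p.1 + p.2 • T.nu p.1

theorem contDiff_normalMap : ContDiff ℝ ∞ T.normalMap :=
  contDiff_fst.add (contDiff_snd.smul (T.contDiff_nu.comp contDiff_fst))

theorem normalMap_eq {s : E n} (hs : s ∈ frontier D) (r : ℝ) :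
    T.normalMap (s, r) = s + r • outerNormal D s := by rw [normalMap, T.nu_eq hs]

theorem contDiff_nu_apply (j : Fin n) : ContDiff ℝ ∞ fun s => T.nu s j :=
  contDiff_euclidean.1 T.contDiff_nu j

section

variable {F : Type*} [NormedAddCommGroup F] [NormedSpace ℝ F]

theorem contDiff_flux_integrand {φ : E n → F} (hφ : ContDiff ℝ ∞ φ) (j : Fin n) :
    ContDiff ℝ ∞ fun p : E n × ℝ => (T.J p.1 p.2 * T.nu p.1 j) • φ (T.normalMap p) :=
  (T.contDiff_J.mul ((T.contDiff_nu_apply j).comp contDiff_fst)).smul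
    (hφ.comp T.contDiff_normalMap)

theorem contDiff_partial {φ : E n → F} (hφ : ContDiff ℝ ∞ φ) (v : E n) :
    ContDiff ℝ ∞ fun x => fderiv ℝ φ x v :=
  (hφ.fderiv_right (m := ∞) (by simp)).clm_apply contDiff_const

end

/-- The Jacobian, as a density. -/
def jac (p : E n × ℝ) : ℝ≥0∞ := ENNReal.ofReal (T.J p.1 p.2)

theorem measurable_jac : Measurable T.jac := T.continuous_J.measurable.ennreal_ofReal

variable [IsFiniteMeasure (surfaceMeasure D)]

theorem measurePreserving_normalMap {a : ℝ} (ha : a ≤ T.δ) :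
    MeasurePreserving T.normalMap ((prodMeasure D (Ioo (-a) a)).withDensity T.jac)
      (volume.restrict (tubeSet D a)) := by
  refine ⟨T.contDiff_normalMap.continuous.measurable, ?_⟩
  ext A hA
  have hmt : MeasurableSet (tubeSet D a) := (T.isOpen_tubeSet ha).measurableSet
  have hm := T.contDiff_normalMap.continuous.measurable
  have hsub : tubeSet D a ⊆ tubeSet D T.δ := by
    rw [T.tubeSet_eq ha]; exact inter_subset_left
  rw [Measure.map_apply hm hA, withDensity_apply _ (hm hA), Measure.restrict_apply hA]
  have h1 := T.lintegral_tube (F := (A ∩ tubeSet D a).indicator 1)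
    (measurable_one.indicator (hA.inter hmt))
  rw [lintegral_indicator_one (hA.inter hmt), Measure.restrict_apply (hA.inter hmt),
    inter_eq_left.2 (inter_subset_right.trans hsub)] at h1
  change _ = ∫⁻ p, _ ∂(prodMeasure D (Ioo (-T.δ) T.δ)) at h1
  rw [h1, prodMeasure_eq, prodMeasure_eq, Measure.restrict_restrict (hm hA)]
  have hset : MeasurableSet (frontier D ×ˢ Ioo (-T.δ) T.δ) :=
    isClosed_frontier.measurableSet.prod measurableSet_Ioo
  have hset' : MeasurableSet (T.normalMap ⁻¹' A ∩ frontier D ×ˢ Ioo (-a) a) :=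
    (hm hA).inter (isClosed_frontier.measurableSet.prod measurableSet_Ioo)
  rw [← lintegral_indicator hset', ← lintegral_indicator hset]
  congr 1
  ext p
  by_cases hp : p ∈ frontier D ×ˢ Ioo (-T.δ) T.δ
  · rw [indicator_of_mem hp]
    obtain ⟨s, r⟩ := p
    have hs : s ∈ frontier D := hp.1
    have hr : |r| < T.δ := abs_lt.2 hp.2
    have hiff : s + r • T.nu s ∈ A ∩ tubeSet D a ↔
        (s, r) ∈ T.normalMap ⁻¹' A ∩ frontier D ×ˢ Ioo (-a) a := by
      rw [T.nu_eq hs, mem_inter_iff, T.tubeSet_eq ha, mem_inter_iff, mem_ofPred_eq,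
        T.d_apply s hs r hr, mem_inter_iff, mem_preimage, T.normalMap_eq hs, mem_prod, mem_Ioo,
        ← abs_lt]
      exact ⟨fun h => ⟨h.1, hs, h.2.2⟩, fun h => ⟨h.1, T.mem_tube hs hr, h.2.2⟩⟩
    by_cases hA' : s + r • T.nu s ∈ A ∩ tubeSet D a
    · simp only [indicator_of_mem hA', indicator_of_mem (hiff.1 hA'), Pi.one_apply, one_mul]
      rfl
    · simp only [indicator_of_notMem hA', indicator_of_notMem (fun h => hA' (hiff.2 h)), zero_mul]
  · rw [indicator_of_notMem hp, indicator_of_notMem]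
    intro h
    exact hp ⟨h.2.1, by
      have := h.2.2
      exact ⟨by linarith [this.1], by linarith [this.2]⟩⟩

variable {F : Type*} [NormedAddCommGroup F] [NormedSpace ℝ F]

theorem integral_tube {a : ℝ} (ha : a ≤ T.δ) {g : E n → F}
    (hg : AEStronglyMeasurable g (volume.restrict (tubeSet D a))) :
    ∫ x in tubeSet D a, g x
      = ∫ p, T.J p.1 p.2 • g (T.normalMap p) ∂(prodMeasure D (Ioo (-a) a)) := by
  have hmp := T.measurePreserving_normalMap ha
  rw [← hmp.map_eq, integral_map hmp.measurable.aemeasurable (by rwa [hmp.map_eq]),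
    integral_withDensity_eq_integral_toReal_smul T.measurable_jac
      (Eventually.of_forall fun _ => ENNReal.ofReal_lt_top)]
  refine integral_congr_ae ?_
  filter_upwards [ae_mem_prod measurableSet_Ioo] with p hp
  have hr : |p.2| < T.δ := (abs_lt.2 hp.2).trans_le ha
  simp only [jac]
  rw [ENNReal.toReal_ofReal (T.J_pos hp.1 hr).le]

theorem integral_tube_continuous {a : ℝ} (ha : a ≤ T.δ) {g : E n → F} (hg : Continuous g) :
    ∫ x in tubeSet D a, g x
      = ∫ r in Ioo (-a) a, ∫ s, T.J s r • g (T.normalMap (s, r)) ∂(surfaceMeasure D) := by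
  rw [T.integral_tube ha hg.aestronglyMeasurable]
  refine integral_prod_symm _ (integrable_prod T.isCompact_frontier ?_ _ _)
  exact T.continuous_J.smul (hg.comp T.contDiff_normalMap.continuous)

/-- The flux through the parallel surface at signed distance `r`. -/
def flux (φ : E n → F) (j : Fin n) (r : ℝ) : F :=
  ∫ s, (T.J s r * T.nu s j) • φ (T.normalMap (s, r)) ∂(surfaceMeasure D)

/-- The divergence theorem between parallel surfaces, in differential form. -/
theorem hasDerivAt_flux [CompleteSpace F] {φ : E n → F} (hφ : ContDiff ℝ ∞ φ) (j : Fin n) {r : ℝ}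
    (hr : |r| < T.δ / 2) : HasDerivAt (T.flux φ j)
      (∫ s, T.J s r • fderiv ℝ φ (T.normalMap (s, r)) (stdVec j) ∂(surfaceMeasure D)) r := by
  have hδ := T.δ_pos
  have ha : T.δ / 2 ≤ T.δ := by linarith
  set a := T.δ / 2
  have hk := T.contDiff_flux_integrand hφ j
  have hφ' := (contDiff_partial hφ (stdVec j)).continuous
  have hgc : Continuous fun p : E n × ℝ =>
      T.J p.1 p.2 • fderiv ℝ φ (T.normalMap p) (stdVec j) :=
    T.continuous_J.smul (hφ'.comp T.contDiff_normalMap.continuous)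
  -- The flux is `C¹` and the claimed derivative is continuous in `r`, so equality may be tested
  -- against `θ(r)`. Integrated over `r`, it becomes the vanishing of the integral of `∂_j (θ(d) φ)`
  -- over the whole space. The derivative `f'` under the integral only serves to know that the flux
  -- is `C¹`.
  refine hasDerivAt_of_weak (a := a)
    (f' := fun r => ∫ s, fderiv ℝ (fun p : E n × ℝ => (T.J p.1 p.2 * T.nu p.1 j) •
      φ (T.normalMap p)) (s, r) (0, 1) ∂(surfaceMeasure D))
    (g := fun r => ∫ s, T.J s r • fderiv ℝ φ (T.normalMap (s, r)) (stdVec j) ∂(surfaceMeasure D))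
    (fun r => hasDerivAt_surface_integral T.isCompact_frontier hk r)
    (continuous_surface_integral T.isCompact_frontier (contDiff_deriv_snd hk).continuous)
    (continuous_surface_integral T.isCompact_frontier hgc) (fun θ hθ hθc hθs => ?_) hr
  -- the test function on the whole space
  let g : E n → F := fun x => T.cut x • (θ (T.d x) • φ x)
  have hθd : ContDiff ℝ ∞ fun x => θ (T.d x) := hθ.comp T.contDiff_d
  have hg : ContDiff ℝ ∞ g := T.contDiff_cut.smul (hθd.smul hφ)
  have hgs : HasCompactSupport g := T.hasCompactSupport_cut.smul_right
  have h0 := integral_fderiv_eq_zero volume hg hgs (stdVec j)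
  -- the derivative inside of the tube
  let g' : E n → F := fun x => (deriv θ (T.d x) * T.nu x j) • φ x
    + θ (T.d x) • fderiv ℝ φ x (stdVec j)
  have hin : ∀ x ∈ tubeSet D a, fderiv ℝ g x (stdVec j) = g' x := by
    intro x hx
    have hxδ : x ∈ tubeSet D T.δ := (T.tubeSet_eq ha ▸ hx).1
    have e1 : g =ᶠ[𝓝 x] fun x => θ (T.d x) • φ x := by
      filter_upwards [(T.isOpen_tubeSet ha).mem_nhds hx] with y hy
      simp [g, T.cut_eq_one y hy]
    have e2 : HasFDerivAt (fun x => θ (T.d x)) (deriv θ (T.d x) • innerSL ℝ (T.nu x)) x :=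
      ((hθ.differentiable (by simp) _).hasDerivAt).comp_hasFDerivAt x (T.hasFDerivAt_d hxδ)
    have e3 := e2.smul (hφ.differentiable (by simp) x).hasFDerivAt
    have e4 : HasFDerivAt (fun x => θ (T.d x) • φ x) _ x := e3
    rw [e1.fderiv_eq, e4.fderiv]
    simp only [add_apply, smul_apply, ContinuousLinearMap.smulRight_apply, innerSL_apply_apply,
      g', smul_eq_mul]
    rw [add_comm, stdVec, EuclideanSpace.inner_single_right]
    simp
  have hout : ∀ x ∉ tubeSet D a, fderiv ℝ g x (stdVec j) = 0 := by
    intro x hx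
    have : g =ᶠ[𝓝 x] fun _ => 0 := by
      by_cases hxc : x ∈ tsupport T.cut
      · have hxδ := T.tsupport_cut hxc
        have hxd : T.d x ∉ tsupport θ := fun h => hx (by
          rw [T.tubeSet_eq ha]
          exact ⟨hxδ, abs_lt.2 (hθs h)⟩)
        have := T.contDiff_d.continuous.continuousAt.eventually
          (notMem_tsupport_iff_eventuallyEq.1 hxd)
        filter_upwards [this] with y hy
        simp only [Pi.zero_apply] at hy
        simp [g, hy]
      · filter_upwards [notMem_tsupport_iff_eventuallyEq.1 hxc] with y hy
        simp only [Pi.zero_apply] at hy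
        simp [g, hy]
    rw [this.fderiv_eq]
    simp
  have hmt : MeasurableSet (tubeSet D a) := (T.isOpen_tubeSet ha).measurableSet
  have h1 : ∫ x in tubeSet D a, g' x = 0 := by
    rw [← h0, ← setIntegral_eq_integral_of_forall_compl_eq_zero (s := tubeSet D a) hout]
    exact setIntegral_congr_fun hmt fun x hx => (hin x hx).symm
  have hg'c : Continuous g' :=
    (((hθ.continuous_deriv (by simp)).comp T.contDiff_d.continuous).mul
      (T.contDiff_nu_apply j).continuous).smul hφ.continuous |>.add
      (hθd.continuous.smul hφ')
  rw [T.integral_tube_continuous ha hg'c] at h1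
  rw [← setIntegral_eq_integral_of_forall_compl_eq_zero (s := Ioo (-a) a), ← h1]
  · refine setIntegral_congr_fun measurableSet_Ioo fun r hr => ?_
    have hr' : |r| < T.δ := (abs_lt.2 hr).trans_le ha
    beta_reduce
    rw [← integral_smul, ← integral_smul, ← integral_add]
    · refine integral_congr_ae ?_
      filter_upwards [ae_mem_frontier] with s hs
      simp only [g']
      rw [T.normalMap_eq hs, T.d_apply s hs r hr', T.nu_apply s hs r hr', T.nu_eq hs]
      simp only [smul_add, smul_smul]
      congr 2 <;> ring
    · exact (integrable_surface T.isCompact_frontier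
        (hk.continuous.comp (continuous_id.prodMk continuous_const))).smul _
    · exact (integrable_surface T.isCompact_frontier
        (hgc.comp (continuous_id.prodMk continuous_const))).smul _
  · intro r hr
    have h1 : r ∉ tsupport θ := fun h => hr (hθs h)
    have h2 : r ∉ tsupport (deriv θ) := fun h => h1 (tsupport_deriv_subset (𝕜 := ℝ) h)
    rw [image_eq_zero_of_notMem_tsupport h1, image_eq_zero_of_notMem_tsupport h2]
    simp

/-- The divergence theorem in the shell. -/
theorem integral_fderiv_tube [CompleteSpace F] {φ : E n → F} (hφ : ContDiff ℝ ∞ φ) (j : Fin n)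
    {ε : ℝ} (hε0 : 0 < ε) (hε : ε < T.δ / 2) :
    ∫ x in tubeSet D ε, fderiv ℝ φ x (stdVec j) = T.flux φ j ε - T.flux φ j (-ε) := by
  have hδ := T.δ_pos
  have hφ' := (contDiff_partial hφ (stdVec j)).continuous
  have hgc : Continuous fun p : E n × ℝ =>
      T.J p.1 p.2 • fderiv ℝ φ (T.normalMap p) (stdVec j) :=
    T.continuous_J.smul (hφ'.comp T.contDiff_normalMap.continuous)
  rw [T.integral_tube_continuous (by linarith) hφ', ← integral_Ioc_eq_integral_Ioo,
    ← intervalIntegral.integral_of_le (by linarith)]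
  refine intervalIntegral.integral_eq_sub_of_hasDerivAt (fun r hr => ?_)
    ((continuous_surface_integral T.isCompact_frontier hgc).intervalIntegrable (-ε) ε)
  rw [uIcc_of_le (by linarith)] at hr
  exact T.hasDerivAt_flux hφ j ((abs_le.2 hr).trans_lt hε)

/-- The divergence theorem on `∂D`. -/
theorem integral_fderiv_surface [CompleteSpace F] {φ : E n → F} (hφ : ContDiff ℝ ∞ φ)
    (j : Fin n) :
    ∫ s, fderiv ℝ φ s (stdVec j) ∂(surfaceMeasure D) =
      ∫ s, (T.nu s j) • (T.h s • φ s + fderiv ℝ φ s (T.nu s)) ∂(surfaceMeasure D) := by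
  have h0 : |(0 : ℝ)| < T.δ / 2 := by have := T.δ_pos; simp; linarith
  -- The derivative of the flux at `r = 0` is computed twice: by the bulk formula, and under the
  -- integral by the product rule, where `∂_r J = h`.
  have h1 := T.hasDerivAt_flux hφ j h0
  have h2 := hasDerivAt_surface_integral T.isCompact_frontier (T.contDiff_flux_integrand hφ j) 0
  have h3 := h1.unique h2
  have hm0 : ∀ s, T.normalMap (s, 0) = s := fun s => by simp [normalMap]
  simp only [J_zero, one_smul, hm0] at h3
  rw [h3]
  refine integral_congr_ae ?_
  filter_upwards [ae_mem_frontier] with s hs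
  have e1 := hasDerivAt_snd (T.contDiff_flux_integrand hφ j) s 0
  have e2 : HasDerivAt (fun r : ℝ => T.normalMap (s, r)) (T.nu s) 0 := by
    simpa [normalMap] using ((hasDerivAt_id (0 : ℝ)).smul_const (T.nu s)).const_add s
  have e3 : HasDerivAt (fun r : ℝ => φ (T.normalMap (s, r))) (fderiv ℝ φ s (T.nu s)) 0 := by
    have := (hφ.differentiable (by simp) (T.normalMap (s, 0))).hasFDerivAt.comp_hasDerivAt 0 e2
    simp only [normalMap, zero_smul, add_zero] at this
    exact this
  have e4 : HasDerivAt (T.J s) (T.h s) 0 := by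
    simpa using T.hasDerivAt_J hs (r := 0) (by simpa using T.δ_pos)
  have e5 := ((e4.mul_const (T.nu s j)).smul e3)
  have e6 := e1.unique e5
  rw [e6]
  simp [hm0, smul_smul, mul_comm, add_comm]

end Tube

end

end ThinShell

/-! ### Multiplication and weighted composition operators in `L²`. -/

namespace ThinShell

noncomputable section

section SquareIntegrable

variable {X F G : Type*} [MeasurableSpace X] [NormedAddCommGroup F] [NormedAddCommGroup G]

/-- The class of `f` in `L²(μ)` (and `0` if `f` is not square integrable). -/
def toL2 (μ : Measure X) (f : X → F) : Lp F 2 μ :=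
  open Classical in if h : MemLp f 2 μ then h.toLp f else 0

variable {μ : Measure X}

theorem toL2_of_memLp {f : X → F} (h : MemLp f 2 μ) : toL2 μ f = h.toLp f := by
  rw [toL2, dif_pos h]

theorem coeFn_toL2 {f : X → F} (h : MemLp f 2 μ) : toL2 μ f =ᵐ[μ] f := by
  rw [toL2_of_memLp h]
  exact h.coeFn_toLp

theorem eq_toL2 {f : X → F} {u : Lp F 2 μ} (h : u =ᵐ[μ] f) : u = toL2 μ f := by
  have hf : MemLp f 2 μ := (memLp_congr_ae h).1 (Lp.memLp u)
  exact Lp.ext (h.trans (coeFn_toL2 hf).symm)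

theorem toL2_congr {f g : X → F} (h : f =ᵐ[μ] g) : toL2 μ f = toL2 μ g := by
  by_cases hf : MemLp f 2 μ
  · exact eq_toL2 ((coeFn_toL2 hf).trans h)
  · rw [toL2, toL2, dif_neg hf, dif_neg fun hg => hf ((memLp_congr_ae h).2 hg)]

theorem toL2_coe (u : Lp F 2 μ) : toL2 μ u = u := (eq_toL2 EventuallyEq.rfl).symm

theorem toL2_add {f g : X → F} (hf : MemLp f 2 μ) (hg : MemLp g 2 μ) :
    toL2 μ (fun x => f x + g x) = toL2 μ f + toL2 μ g := by
  rw [toL2_of_memLp hf, toL2_of_memLp hg, ← MemLp.toLp_add]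
  exact toL2_of_memLp (hf.add hg)

theorem toL2_sub {f g : X → F} (hf : MemLp f 2 μ) (hg : MemLp g 2 μ) :
    toL2 μ (fun x => f x - g x) = toL2 μ f - toL2 μ g := by
  rw [toL2_of_memLp hf, toL2_of_memLp hg, ← MemLp.toLp_sub]
  exact toL2_of_memLp (hf.sub hg)

theorem toL2_sum {ι : Type*} (S : Finset ι) {f : ι → X → F} (hf : ∀ i, MemLp (f i) 2 μ) :
    toL2 μ (fun x => ∑ i ∈ S, f i x) = ∑ i ∈ S, toL2 μ (f i) := by
  classical
  induction S using Finset.induction_on with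
  | empty =>
    simp only [Finset.sum_empty]
    exact (eq_toL2 (Lp.coeFn_zero F 2 μ)).symm
  | insert a S ha ih =>
    simp only [Finset.sum_insert ha]
    rw [toL2_add (hf a) (memLp_finsetSum S fun i _ => hf i), ih]

theorem norm_toL2 {f : X → F} (hf : MemLp f 2 μ) : ‖toL2 μ f‖ = (eLpNorm f 2 μ).toReal := by
  rw [toL2_of_memLp hf, Lp.norm_toLp]

theorem tendsto_toL2_iff {f : ℕ → X → F} (hf : ∀ k, MemLp (f k) 2 μ) {u : Lp F 2 μ} :
    Tendsto (fun k => toL2 μ (f k)) atTop (𝓝 u) ↔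
      Tendsto (fun k => eLpNorm (fun x => f k x - u x) 2 μ) atTop (𝓝 0) := by
  rw [Lp.tendsto_Lp_iff_tendsto_eLpNorm']
  refine tendsto_congr fun k => eLpNorm_congr_ae ?_
  filter_upwards [coeFn_toL2 (hf k)] with x hx
  simp [hx]

variable [InnerProductSpace ℝ F] in
theorem inner_toL2 {f g : X → F} (hf : MemLp f 2 μ) (hg : MemLp g 2 μ) :
    ⟪toL2 μ f, toL2 μ g⟫_ℝ = ∫ x, ⟪f x, g x⟫_ℝ ∂μ := by
  rw [L2.inner_def]
  refine integral_congr_ae ?_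
  filter_upwards [coeFn_toL2 hf, coeFn_toL2 hg] with x h1 h2
  rw [h1, h2]

variable [NormedSpace ℝ F] [NormedSpace ℝ G]

/-- `M` acts on `L²(μ)` by pointwise multiplication. -/
def IsBoundedField (μ : Measure X) (M : X → F →L[ℝ] G) : Prop :=
  AEStronglyMeasurable M μ ∧ ∃ C, ∀ᵐ x ∂μ, ‖M x‖ ≤ C

theorem IsBoundedField.memLp {M : X → F →L[ℝ] G} (h : IsBoundedField μ M) {u : X → F}
    (hu : MemLp u 2 μ) : MemLp (fun x => M x (u x)) 2 μ := by
  obtain ⟨hM, C, hC⟩ := h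
  refine MemLp.of_le_mul (c := C) hu ?_ ?_
  · exact (ContinuousLinearMap.apply ℝ G).flip.aestronglyMeasurable_comp₂ hM hu.1
  · filter_upwards [hC] with x hx
    exact (M x).le_of_opNorm_le hx _

open Classical in
/-- The operator of pointwise multiplication with a bounded field of linear maps (and `0` for
other fields). -/
def mulOp (μ : Measure X) (M : X → F →L[ℝ] G) : Lp F 2 μ →L[ℝ] Lp G 2 μ :=
  if h : IsBoundedField μ M then
    LinearMap.mkContinuousOfExistsBound
      { toFun := fun u => toL2 μ fun x => M x (u x)
        map_add' := fun u v => by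
          rw [← toL2_add (h.memLp (Lp.memLp u)) (h.memLp (Lp.memLp v))]
          refine toL2_congr ?_
          filter_upwards [Lp.coeFn_add u v] with x hx
          rw [hx, Pi.add_apply, map_add]
        map_smul' := fun c u => by
          refine (eq_toL2 ?_).symm
          filter_upwards [Lp.coeFn_smul c u, Lp.coeFn_smul c (toL2 μ fun x => M x (u x)),
            coeFn_toL2 (h.memLp (Lp.memLp u))] with x h1 h2 h3
          simp [h1, h2, h3] }
      (by
        obtain ⟨C, hC⟩ := h.2
        refine ⟨C, fun u => Lp.norm_le_mul_norm_of_ae_le_mul ?_⟩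
        filter_upwards [coeFn_toL2 (h.memLp (Lp.memLp u)), hC] with x h1 h2
        simp only [LinearMap.coe_mk, AddHom.coe_mk, h1]
        exact (M x).le_of_opNorm_le h2 _)
  else 0

theorem mulOp_apply {M : X → F →L[ℝ] G} (h : IsBoundedField μ M) (u : Lp F 2 μ) :
    mulOp μ M u = toL2 μ fun x => M x (u x) := by
  rw [mulOp, dif_pos h]
  rfl

theorem coeFn_mulOp {M : X → F →L[ℝ] G} (h : IsBoundedField μ M) (u : Lp F 2 μ) :
    mulOp μ M u =ᵐ[μ] fun x => M x (u x) := by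
  rw [mulOp_apply h]
  exact coeFn_toL2 (h.memLp (Lp.memLp u))

theorem mulOp_toL2 {M : X → F →L[ℝ] G} (h : IsBoundedField μ M) {f : X → F} (hf : MemLp f 2 μ) :
    mulOp μ M (toL2 μ f) = toL2 μ fun x => M x (f x) := by
  rw [mulOp_apply h]
  refine toL2_congr ?_
  filter_upwards [coeFn_toL2 hf] with x hx
  rw [hx]

theorem norm_mulOp_le {M : X → F →L[ℝ] G} (hM : AEStronglyMeasurable M μ) {C : ℝ}
    (hC : ∀ᵐ x ∂μ, ‖M x‖ ≤ C) (u : Lp F 2 μ) : ‖mulOp μ M u‖ ≤ C * ‖u‖ := by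
  have h : IsBoundedField μ M := ⟨hM, C, hC⟩
  refine Lp.norm_le_mul_norm_of_ae_le_mul ?_
  filter_upwards [coeFn_mulOp h u, hC] with x h1 h2
  rw [h1]
  exact (M x).le_of_opNorm_le h2 _

/-- Multiplication with a scalar function. -/
abbrev smulOp (F : Type*) [NormedAddCommGroup F] [NormedSpace ℝ F] (μ : Measure X) (c : X → ℝ) :
    Lp F 2 μ →L[ℝ] Lp F 2 μ :=
  mulOp μ fun x => c x • ContinuousLinearMap.id ℝ F

theorem isBoundedField_smul {c : X → ℝ} (hc : AEStronglyMeasurable c μ) {C : ℝ}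
    (hC : ∀ᵐ x ∂μ, |c x| ≤ C) : IsBoundedField μ fun x => c x • ContinuousLinearMap.id ℝ F := by
  refine ⟨hc.smul_const _, C, ?_⟩
  filter_upwards [hC] with x hx
  rw [norm_smul, Real.norm_eq_abs]
  have h1 : ‖ContinuousLinearMap.id ℝ F‖ ≤ 1 := ContinuousLinearMap.norm_id_le
  nlinarith [abs_nonneg (c x)]

end SquareIntegrable

section CompactMeasure

/-- A finite measure which is carried by a compact set. -/
class IsCompactMeasure {X : Type*} [TopologicalSpace X] [MeasurableSpace X] (μ : Measure X) :
    Prop where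
  lt_top : μ univ < ⊤
  exists_compact : ∃ K, IsCompact K ∧ ∀ᵐ x ∂μ, x ∈ K

variable {X F G : Type*} [TopologicalSpace X] [MeasurableSpace X] [NormedAddCommGroup F]
  [NormedAddCommGroup G] {μ : Measure X} [hμ : IsCompactMeasure μ]

theorem ae_bound_of_continuous {f : X → F} (hf : Continuous f) : ∃ C, ∀ᵐ x ∂μ, ‖f x‖ ≤ C := by
  obtain ⟨K, hK, hKμ⟩ := hμ.exists_compact
  obtain ⟨C, hC⟩ := hK.exists_bound_of_continuousOn hf.continuousOn
  exact ⟨C, hKμ.mono hC⟩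

variable [OpensMeasurableSpace X] [SecondCountableTopology X]

theorem memLp_of_continuous {f : X → F} (hf : Continuous f) : MemLp f 2 μ := by
  have : IsFiniteMeasure μ := ⟨hμ.lt_top⟩
  obtain ⟨C, hC⟩ := ae_bound_of_continuous (μ := μ) hf
  exact MemLp.of_bound hf.aestronglyMeasurable C hC

theorem integrable_of_continuous {f : X → F} (hf : Continuous f) : Integrable f μ := by
  have : IsFiniteMeasure μ := ⟨hμ.lt_top⟩
  obtain ⟨C, hC⟩ := ae_bound_of_continuous (μ := μ) hf
  exact Integrable.of_bound hf.aestronglyMeasurable C hC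

variable [NormedSpace ℝ F] [NormedSpace ℝ G]

theorem isBoundedField_of_continuous {M : X → F →L[ℝ] G} (hM : Continuous M) :
    IsBoundedField μ M :=
  ⟨hM.aestronglyMeasurable, ae_bound_of_continuous hM⟩

theorem isBoundedField_smul_of_continuous {c : X → ℝ} (hc : Continuous c) :
    IsBoundedField μ fun x => c x • ContinuousLinearMap.id ℝ F :=
  isBoundedField_of_continuous (hc.smul continuous_const)

theorem smulOp_toL2 {c : X → ℝ} (hc : Continuous c) {f : X → F} (hf : Continuous f) :
    smulOp F μ c (toL2 μ f) = toL2 μ fun x => c x • f x :=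
  mulOp_toL2 (isBoundedField_smul_of_continuous hc) (memLp_of_continuous hf)

theorem mulOp_toL2_of_continuous {M : X → F →L[ℝ] G} (hM : Continuous M) {f : X → F}
    (hf : Continuous f) : mulOp μ M (toL2 μ f) = toL2 μ fun x => M x (f x) :=
  mulOp_toL2 (isBoundedField_of_continuous hM) (memLp_of_continuous hf)

end CompactMeasure

section WeightedComposition

variable {X Y F : Type*} [MeasurableSpace X] [MeasurableSpace Y] [NormedAddCommGroup F]
  [NormedSpace ℝ F] {μ : Measure X} {ν : Measure Y}
  {Φ : X → Y} {w : X → ℝ}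

/-- Strict positivity of `w` makes `μ` absolutely continuous with respect to `w² μ`, so null sets of
`ν` pull back to null sets of `μ`. -/
theorem quasiMeasurePreserving_of_weight
    (hΦ : MeasurePreserving Φ (μ.withDensity fun x => ENNReal.ofReal (w x ^ 2)) ν)
    (hw : Measurable w) (hw0 : ∀ᵐ x ∂μ, 0 < w x) : Measure.QuasiMeasurePreserving Φ μ ν := by
  refine hΦ.quasiMeasurePreserving.mono_left ?_
  refine withDensity_absolutelyContinuous' (hw.pow_const 2).ennreal_ofReal.aemeasurable ?_
  filter_upwards [hw0] with x hx
  simp only [ne_eq, ENNReal.ofReal_eq_zero, not_le]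
  positivity

theorem eLpNorm_weighted_comp
    (hΦ : MeasurePreserving Φ (μ.withDensity fun x => ENNReal.ofReal (w x ^ 2)) ν)
    (hw : Measurable w) (hw0 : ∀ᵐ x ∂μ, 0 < w x) {u : Y → F} (hu : AEStronglyMeasurable u ν) :
    eLpNorm (fun x => w x • u (Φ x)) 2 μ = eLpNorm u 2 ν := by
  rw [eLpNorm_eq_lintegral_rpow_enorm_toReal (by norm_num) (by norm_num),
    eLpNorm_eq_lintegral_rpow_enorm_toReal (by norm_num) (by norm_num)]
  congr 1
  have hm : AEMeasurable (fun y => ‖u y‖ₑ ^ (2 : ℝ≥0∞).toReal) ν := hu.enorm.pow_const _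
  have hq := quasiMeasurePreserving_of_weight hΦ hw hw0
  rw [← hΦ.map_eq, lintegral_map' (by rwa [hΦ.map_eq]) hΦ.measurable.aemeasurable,
    lintegral_withDensity_eq_lintegral_mul₀ (g := fun x => ‖u (Φ x)‖ₑ ^ (2 : ℝ≥0∞).toReal) (hw.pow_const 2).ennreal_ofReal.aemeasurable
      (hm.comp_quasiMeasurePreserving hq)]
  refine lintegral_congr_ae ?_
  filter_upwards [hw0] with x hx
  simp only [Pi.mul_apply, enorm_smul]
  rw [ENNReal.mul_rpow_of_nonneg _ _ (by positivity), Real.enorm_of_nonneg hx.le,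
    ENNReal.ofReal_pow hx.le]
  norm_num

/-- Composition with a map which transports `w² μ` to `ν`, followed by multiplication with `w`, is
unitary. -/
theorem exists_weighted_comp [NormedSpace ℂ F] [SMulCommClass ℝ ℂ F] {Ψ : Y → X}
    (hΦ : MeasurePreserving Φ (μ.withDensity fun x => ENNReal.ofReal (w x ^ 2)) ν)
    (hw : Measurable w) (hw0 : ∀ᵐ x ∂μ, 0 < w x) (hΨ : Measurable Ψ) (hΨΦ : ∀ᵐ x ∂μ, Ψ (Φ x) = x) :
    ∃ U : Lp F 2 ν ≃ₗᵢ[ℂ] Lp F 2 μ, ∀ u, U u =ᵐ[μ] fun x => w x • u (Φ x) := by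
  have hq := quasiMeasurePreserving_of_weight hΦ hw hw0
  have hmem : ∀ u : Lp F 2 ν, MemLp (fun x => w x • u (Φ x)) 2 μ := fun u =>
    ⟨hw.aestronglyMeasurable.smul ((Lp.aestronglyMeasurable u).comp_quasiMeasurePreserving hq), by
      rw [eLpNorm_weighted_comp hΦ hw hw0 (Lp.aestronglyMeasurable u)]
      exact Lp.eLpNorm_lt_top u⟩
  let L : Lp F 2 ν →ₗᵢ[ℂ] Lp F 2 μ :=
    { toFun := fun u => toL2 μ fun x => w x • u (Φ x)
      map_add' := fun u v => by
        rw [← toL2_add (hmem u) (hmem v)]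
        refine toL2_congr ?_
        filter_upwards [hq.ae (Lp.coeFn_add u v)] with x hx
        rw [hx, Pi.add_apply, smul_add]
      map_smul' := fun c u => by
        refine (eq_toL2 ?_).symm
        filter_upwards [hq.ae (Lp.coeFn_smul c u),
          Lp.coeFn_smul c (toL2 μ fun x => w x • u (Φ x)), coeFn_toL2 (hmem u)] with x h1 h2 h3
        simp only [RingHom.id_apply, h2, Pi.smul_apply, h3, h1]
        rw [smul_comm]
      norm_map' := fun u => by
        change ‖toL2 μ fun x => w x • u (Φ x)‖ = ‖u‖
        rw [norm_toL2 (hmem u), eLpNorm_weighted_comp hΦ hw hw0 (Lp.aestronglyMeasurable u),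
          Lp.norm_def] }
  have hL : ∀ u, L u =ᵐ[μ] fun x => w x • u (Φ x) := fun u => coeFn_toL2 (hmem u)
  -- The preimage of `g` is `g / w` transported by the left inverse `Ψ`; it is square integrable
  -- because the norm identity holds for every measurable function.
  have hsurj : Function.Surjective L := by
    intro g
    let u : Y → F := fun y => (w (Ψ y))⁻¹ • g (Ψ y)
    have hum : AEStronglyMeasurable u ν :=
      (((hw.comp hΨ).inv).aestronglyMeasurable).smul
        ((Lp.stronglyMeasurable g).comp_measurable hΨ).aestronglyMeasurable
    have hug : (fun x => w x • u (Φ x)) =ᵐ[μ] g := by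
      filter_upwards [hw0, hΨΦ] with x h1 h2
      simp only [u, h2]
      rw [smul_smul, mul_inv_cancel₀ h1.ne', one_smul]
    have hu : MemLp u 2 ν := ⟨hum, by
      rw [← eLpNorm_weighted_comp hΦ hw hw0 hum, eLpNorm_congr_ae hug]
      exact Lp.eLpNorm_lt_top g⟩
    refine ⟨hu.toLp u, Lp.ext ((hL _).trans (EventuallyEq.trans ?_ hug))⟩
    filter_upwards [hq.ae hu.coeFn_toLp] with x hx
    rw [hx]
  exact ⟨LinearIsometryEquiv.ofSurjective L hsurj, hL⟩

end WeightedComposition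

end

end ThinShell

/-! ### The unitary map to the cylinder, and the boundary of the shell. -/

namespace ThinShell

noncomputable section

/-- A smooth function on `ℝ` which is the square root on `[1/2, ∞)`. -/
def smoothSqrt (x : ℝ) : ℝ := √x * Real.smoothTransition (4 * x - 1)

theorem smoothSqrt_of_le {x : ℝ} (hx : 1 / 2 ≤ x) : smoothSqrt x = √x := by
  rw [smoothSqrt, Real.smoothTransition.one_of_one_le (by linarith), mul_one]

theorem contDiff_smoothSqrt : ContDiff ℝ ∞ smoothSqrt := by
  rw [contDiff_iff_contDiffAt]
  intro x
  rcases lt_or_ge x (1 / 4) with hx | hx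
  · have : smoothSqrt =ᶠ[𝓝 x] fun _ => 0 := by
      filter_upwards [gt_mem_nhds hx] with y hy
      rw [smoothSqrt, Real.smoothTransition.zero_of_nonpos (by linarith), mul_zero]
    exact contDiffAt_const.congr_of_eventuallyEq this
  · have h1 : ContDiffAt ℝ ∞ (fun x : ℝ => √x) x := Real.contDiffAt_sqrt (by linarith)
    have h2 : ContDiff ℝ ∞ fun x : ℝ => Real.smoothTransition (4 * x - 1) :=
      Real.smoothTransition.contDiff.comp ((contDiff_const.mul contDiff_id).sub contDiff_const)
    exact h1.mul h2.contDiffAt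

section Scaling

theorem lintegral_scale {ε : ℝ} (hε : 0 < ε) {k : ℝ → ℝ≥0∞} (hk : Measurable k) :
    ∫⁻ t in Ioo (-1 : ℝ) 1, ENNReal.ofReal ε * k (ε * t) = ∫⁻ r in Ioo (-ε) ε, k r := by
  have hpre : (fun t => ε * t) ⁻¹' Ioo (-ε) ε = Ioo (-1 : ℝ) 1 := by
    ext t
    simp only [mem_preimage, mem_Ioo]
    constructor
    · rintro ⟨h1, h2⟩
      exact ⟨by nlinarith, by nlinarith⟩
    · rintro ⟨h1, h2⟩
      exact ⟨by nlinarith, by nlinarith⟩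
  have hm : Measurable fun t : ℝ => ε * t := measurable_const_mul ε
  conv_rhs => rw [← Real.smul_map_volume_mul_left hε.ne', abs_of_pos hε]
  rw [Measure.restrict_smul, lintegral_smul_measure, Measure.restrict_map hm measurableSet_Ioo,
    lintegral_map hk hm, hpre, smul_eq_mul]
  exact lintegral_const_mul _ (hk.comp hm)

variable {n : ℕ} {D : Set (E n)}

theorem lintegral_prod_scale {ε : ℝ} (hε : 0 < ε) {k : E n × ℝ → ℝ≥0∞} (hk : Measurable k) :
    ∫⁻ p, ENNReal.ofReal ε * k (p.1, ε * p.2) ∂(cylMeasure D)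
      = ∫⁻ p, k p ∂(prodMeasure D (Ioo (-ε) ε)) := by
  have hm : Measurable fun p : E n × ℝ => (p.1, ε * p.2) :=
    measurable_fst.prodMk (measurable_snd.const_mul ε)
  have hk' : Measurable fun p : E n × ℝ => ENNReal.ofReal ε * k (p.1, ε * p.2) :=
    (hk.comp hm).const_mul _
  rw [cylMeasure, prodMeasure, lintegral_prod _ hk'.aemeasurable, lintegral_prod _ hk.aemeasurable]
  refine lintegral_congr fun s => ?_
  exact lintegral_scale hε (hk.comp measurable_prodMk_left)

theorem measurePreserving_scale {ε : ℝ} (hε : 0 < ε) {g : E n × ℝ → ℝ≥0∞} (hg : Measurable g) :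
    MeasurePreserving (fun p : E n × ℝ => (p.1, ε * p.2))
      ((cylMeasure D).withDensity fun p => ENNReal.ofReal ε * g (p.1, ε * p.2))
      ((prodMeasure D (Ioo (-ε) ε)).withDensity g) := by
  have hm : Measurable fun p : E n × ℝ => (p.1, ε * p.2) :=
    measurable_fst.prodMk (measurable_snd.const_mul ε)
  refine ⟨hm, ?_⟩
  ext A hA
  rw [Measure.map_apply hm hA, withDensity_apply _ (hm hA), withDensity_apply _ hA,
    ← lintegral_indicator (hm hA), ← lintegral_indicator hA,
    ← lintegral_prod_scale hε (hg.indicator hA)]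
  refine lintegral_congr fun p => ?_
  by_cases hp : (p.1, ε * p.2) ∈ A
  · rw [indicator_of_mem hp, indicator_of_mem (by exact hp)]
  · rw [indicator_of_notMem hp, indicator_of_notMem (by exact hp), mul_zero]

end Scaling

theorem shell_eq {n : ℕ} {D : Set (E n)} {ε : ℝ} (hε : 0 < ε) : shell D ε = tubeSet D ε := by
  ext x
  constructor
  · rintro ⟨⟨s, t⟩, ⟨hs, ht⟩, rfl⟩
    refine ⟨s, hs, ε * t, ?_, rfl⟩
    rw [abs_mul, abs_of_pos hε]
    exact mul_lt_of_lt_one_right hε (abs_lt.2 ht)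
  · rintro ⟨s, hs, r, hr, rfl⟩
    refine ⟨(s, r / ε), ⟨hs, ?_⟩, ?_⟩
    · change r / ε ∈ Ioo (-1 : ℝ) 1
      rw [mem_Ioo, ← abs_lt, abs_div, abs_of_pos hε]
      exact (div_lt_one hε).2 hr
    · simp [tubeMap, mul_div_cancel₀ _ hε.ne']

namespace Tube

variable {n : ℕ} {D : Set (E n)} (T : Tube D)

theorem isCompactMeasure_surfaceMeasure (T : Tube D) : IsCompactMeasure (surfaceMeasure D) :=
  ⟨T.surfaceMeasure_univ_lt_top, frontier D, T.isCompact_frontier, ae_mem_frontier⟩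

theorem isCompactMeasure_cylMeasure (T : Tube D) : IsCompactMeasure (cylMeasure D) := by
  have := T.isFiniteMeasure_surfaceMeasure
  refine ⟨?_, frontier D ×ˢ Icc (-1) 1, T.isCompact_frontier.prod isCompact_Icc, ?_⟩
  · rw [cylMeasure]
    exact measure_lt_top _ _
  · filter_upwards [ae_mem_prod (D := D) (I := Ioo (-1 : ℝ) 1) measurableSet_Ioo] with p hp
    exact ⟨hp.1, Ioo_subset_Icc_self hp.2⟩

theorem isCompactMeasure_tubeSet {ε : ℝ} (hε : ε ≤ T.δ) :
    IsCompactMeasure (volume.restrict (tubeSet D ε)) := by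
  have hb := T.isBounded_tubeSet ε
  refine ⟨?_, closure (tubeSet D ε), hb.isCompact_closure, ?_⟩
  · rw [Measure.restrict_apply_univ]
    exact hb.measure_lt_top
  · exact (ae_restrict_mem (T.isOpen_tubeSet hε).measurableSet).mono fun x hx => subset_closure hx

/-- The map `(s, t) ↦ s + ε t ν(s)`. -/
def cylMap (ε : ℝ) (p : E n × ℝ) : E n := T.normalMap (p.1, ε * p.2)

theorem contDiff_cylMap (ε : ℝ) : ContDiff ℝ ∞ (T.cylMap ε) :=
  T.contDiff_normalMap.comp (contDiff_fst.prodMk (contDiff_const.mul contDiff_snd))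

/-- The weight of the unitary map: a smooth function which is `√(ε J)` on the cylinder. -/
def rootWeight (ε : ℝ) (p : E n × ℝ) : ℝ := √ε * smoothSqrt (T.J p.1 (ε * p.2))

theorem contDiff_J_scaled (ε : ℝ) : ContDiff ℝ ∞ fun p : E n × ℝ => T.J p.1 (ε * p.2) :=
  T.contDiff_J.comp (contDiff_fst.prodMk (contDiff_const.mul contDiff_snd))

theorem contDiff_rootWeight (ε : ℝ) : ContDiff ℝ ∞ (T.rootWeight ε) :=
  contDiff_const.mul (contDiff_smoothSqrt.comp (T.contDiff_J_scaled ε))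

theorem rootWeight_eq {ε : ℝ} {p : E n × ℝ} (hJ : 1 / 2 < T.J p.1 (ε * p.2)) :
    T.rootWeight ε p = √ε * √(T.J p.1 (ε * p.2)) := by rw [rootWeight, smoothSqrt_of_le hJ.le]

theorem rootWeight_sq {ε : ℝ} (hε : 0 < ε) {p : E n × ℝ} (hJ : 1 / 2 < T.J p.1 (ε * p.2)) :
    T.rootWeight ε p ^ 2 = ε * T.J p.1 (ε * p.2) := by
  rw [T.rootWeight_eq hJ, mul_pow, Real.sq_sqrt hε.le, Real.sq_sqrt (by linarith)]

theorem rootWeight_pos {ε : ℝ} (hε : 0 < ε) {p : E n × ℝ} (hJ : 1 / 2 < T.J p.1 (ε * p.2)) :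
    0 < T.rootWeight ε p := by
  rw [T.rootWeight_eq hJ]
  exact mul_pos (Real.sqrt_pos.2 hε) (Real.sqrt_pos.2 (by linarith))

/-- A smooth function on `∂D × ℝ` changes by `O(r)` along the second variable. -/
theorem exists_bound_sub {F : Type*} [NormedAddCommGroup F] [NormedSpace ℝ F] (T : Tube D)
    {k : E n × ℝ → F} (hk : ContDiff ℝ ∞ k) :
    ∃ C, 0 ≤ C ∧ ∀ s ∈ frontier D, ∀ r : ℝ, |r| < 1 → ‖k (s, r) - k (s, 0)‖ ≤ C * |r| := by
  obtain ⟨C, hC⟩ := exists_bound_prod T.isCompact_frontier (contDiff_deriv_snd hk).continuous (-1) 1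
  refine ⟨max C 0, le_max_right _ _, fun s hs r hr => ?_⟩
  have h := (convex_Ioo (-1 : ℝ) 1).norm_image_sub_le_of_norm_hasDerivWithin_le
    (f := fun r => k (s, r)) (fun x _ => (hasDerivAt_snd hk s x).hasDerivWithinAt)
    (fun x hx => (hC (s, x) ⟨hs, hx⟩).trans (le_max_left C 0)) (x := 0) (y := r) (by simp)
    (abs_lt.1 hr)
  simpa using h

/-- `J = 1` at `r = 0` and `J` is Lipschitz in `r`. The threshold `1/2` is the one above which
`smoothSqrt` is the square root. -/
theorem exists_half_lt_J : ∃ ε₁ > 0, ∀ s ∈ frontier D, ∀ r : ℝ, |r| ≤ ε₁ → 1 / 2 < T.J s r := by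
  obtain ⟨C, hC0, hC⟩ := T.exists_bound_sub T.contDiff_J
  refine ⟨min (1 / 2) (1 / (4 * (C + 1))), by positivity, fun s hs r hr => ?_⟩
  have h1 := hC s hs r ((hr.trans (min_le_left _ _)).trans_lt (by norm_num))
  have h2 : (C + 1) * |r| ≤ 1 / 4 := by
    have := hr.trans (min_le_right _ _)
    rw [le_div_iff₀ (by positivity)] at this
    linarith
  simp only [J_zero, Real.norm_eq_abs] at h1
  have h3 := (abs_le.1 h1).1
  nlinarith [abs_nonneg r]

section

variable [IsFiniteMeasure (surfaceMeasure D)]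

theorem measurePreserving_cylMap {ε : ℝ} (hε : 0 < ε) (hεδ : ε ≤ T.δ)
    (hJ : ∀ s ∈ frontier D, ∀ r : ℝ, |r| ≤ ε → 1 / 2 < T.J s r) :
    MeasurePreserving (T.cylMap ε)
      ((cylMeasure D).withDensity fun p => ENNReal.ofReal (T.rootWeight ε p ^ 2))
      (volume.restrict (tubeSet D ε)) := by
  have h := (T.measurePreserving_normalMap hεδ).comp (measurePreserving_scale hε T.measurable_jac)
  refine ⟨h.measurable, ?_⟩
  rw [← h.map_eq]
  refine congrArg₂ _ rfl (withDensity_congr_ae ?_)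
  filter_upwards [ae_mem_prod (D := D) (I := Ioo (-1 : ℝ) 1) measurableSet_Ioo] with p hp
  have hr : |ε * p.2| ≤ ε := by
    rw [abs_mul, abs_of_pos hε]
    exact mul_le_of_le_one_right hε.le (abs_lt.2 hp.2).le
  rw [T.rootWeight_sq hε (hJ _ hp.1 _ hr), ENNReal.ofReal_mul hε.le]
  rfl

/-- The unitary map from the shell to the cylinder. -/
theorem exists_unitary {N : ℕ} {ε : ℝ} (hε : 0 < ε) (hεδ : ε ≤ T.δ)
    (hJ : ∀ s ∈ frontier D, ∀ r : ℝ, |r| ≤ ε → 1 / 2 < T.J s r) :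
    ∃ U : L2Domain n N (tubeSet D ε) ≃ₗᵢ[ℂ] L2Cyl n N D,
      ∀ u, U u =ᵐ[cylMeasure D] fun p => T.rootWeight ε p • u (T.cylMap ε p) := by
  have hcyl : ∀ᵐ p ∂(cylMeasure D), p.1 ∈ frontier D ∧ p.2 ∈ Ioo (-1 : ℝ) 1 :=
    ae_mem_prod measurableSet_Ioo
  have hbd : ∀ t ∈ Ioo (-1 : ℝ) 1, |ε * t| < ε := fun t ht => by
    rw [abs_mul, abs_of_pos hε]
    exact mul_lt_of_lt_one_right hε (abs_lt.2 ht)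
  refine exists_weighted_comp (Ψ := fun x => (T.π x, T.d x / ε))
    (T.measurePreserving_cylMap hε hεδ hJ) (T.contDiff_rootWeight ε).continuous.measurable ?_
    (T.contDiff_π.continuous.prodMk (T.contDiff_d.continuous.div_const ε)).measurable ?_
  · filter_upwards [hcyl] with p hp
    exact T.rootWeight_pos hε (hJ _ hp.1 _ (hbd _ hp.2).le)
  · filter_upwards [hcyl] with p hp
    have hr := (hbd _ hp.2).trans_le hεδ
    rw [cylMap, T.normalMap_eq hp.1, T.π_apply _ hp.1 _ hr, T.d_apply _ hp.1 _ hr,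
      mul_div_cancel_left₀ _ hε.ne']

end

section Boundary

theorem hasGradientAt_d {x : E n} (hx : x ∈ tubeSet D T.δ) (σ ε : ℝ) :
    HasGradientAt (fun x => σ * T.d x - ε) (σ • T.nu x) x := by
  rw [hasGradientAt_iff_hasFDerivAt]
  refine (((T.hasFDerivAt_d hx).const_mul σ).sub_const ε).congr_fderiv ?_
  ext v
  simp

/-- The defining functions `± d - ε` of the shell. -/
theorem isLocalDefiningFunction_tubeSet {ε : ℝ} (hε : ε < T.δ) (hε0 : 0 < ε) {σ : ℝ}
    (hσ : σ = 1 ∨ σ = -1) {s : E n} (hs : s ∈ frontier D) :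
    IsLocalDefiningFunction (tubeSet D ε) (T.normalMap (s, σ * ε))
      (tubeSet D T.δ ∩ {x | -ε < σ * T.d x}) (fun x => σ * T.d x - ε) := by
  have hσ2 : σ * σ = 1 := by rcases hσ with rfl | rfl <;> norm_num
  have hr : |σ * ε| < T.δ := by
    rcases hσ with rfl | rfl <;> simpa [abs_of_pos hε0] using hε
  refine ⟨T.isOpen_tube.inter (isOpen_lt continuous_const
    (continuous_const.mul T.contDiff_d.continuous)), ⟨?_, ?_⟩,
    ((contDiff_const.mul T.contDiff_d).sub contDiff_const).contDiffOn, fun y hy => ?_,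
    fun y hy => ?_⟩
  · rw [T.normalMap_eq hs]
    exact T.mem_tube hs hr
  · simp only [mem_ofPred_eq]
    rw [T.normalMap_eq hs, T.d_apply s hs _ hr, ← mul_assoc, hσ2]
    linarith
  · rw [(T.hasGradientAt_d hy.1 σ ε).gradient]
    refine smul_ne_zero (by rcases hσ with rfl | rfl <;> norm_num) ?_
    rw [← norm_ne_zero_iff, T.norm_nu hy.1]
    exact one_ne_zero
  · rw [T.tubeSet_eq hε.le]
    have h2 : -ε < σ * T.d y := hy.2
    simp only [mem_inter_iff, hy.1, true_and, mem_ofPred_eq, abs_lt]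
    rcases hσ with rfl | rfl
    · constructor
      · rintro ⟨h3, h4⟩; linarith
      · intro h; exact ⟨by linarith, by linarith⟩
    · constructor
      · rintro ⟨h3, h4⟩; linarith
      · intro h; exact ⟨by linarith, by linarith⟩

/-- On the component `d = σ ε` the function `σ d - ε` defines the shell, so the outward normal is `σ
ν`. This sign produces the opposite boundary conditions at the two ends of the cylinder. -/
theorem normalMap_mem_frontier {ε : ℝ} (hε : ε < T.δ) (hε0 : 0 < ε) {σ : ℝ}
    (hσ : σ = 1 ∨ σ = -1) {s : E n} (hs : s ∈ frontier D) :
    T.normalMap (s, σ * ε) ∈ frontier (tubeSet D ε) ∧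
      outerNormal (tubeSet D ε) (T.normalMap (s, σ * ε)) = σ • outerNormal D s := by
  have hσ2 : σ * σ = 1 := by rcases hσ with rfl | rfl <;> norm_num
  have hr : |σ * ε| < T.δ := by
    rcases hσ with rfl | rfl <;> simpa [abs_of_pos hε0] using hε
  have hdef := T.isLocalDefiningFunction_tubeSet hε hε0 hσ hs
  have hf : T.normalMap (s, σ * ε) ∈ frontier (tubeSet D ε) := by
    rw [hdef.mem_frontier_iff hdef.2.1, T.normalMap_eq hs, T.d_apply s hs _ hr, ← mul_assoc, hσ2]
    ring
  refine ⟨hf, ?_⟩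
  have hx := hdef.2.1.1
  rw [hdef.outerNormal_eq hf, (T.hasGradientAt_d hx σ ε).gradient, norm_smul, T.norm_nu hx,
    T.normalMap_eq hs, T.nu_apply s hs _ hr]
  rcases hσ with rfl | rfl <;> simp

/-- The shift along the normals is bounded below on surface measures. -/
theorem exists_map_surfaceMeasure_le {ε : ℝ} (hε : ε < T.δ) (hε0 : 0 < ε) {σ : ℝ}
    (hσ : σ = 1 ∨ σ = -1) :
    ∃ C : ℝ≥0∞, C ≠ ⊤ ∧ (surfaceMeasure D).map (fun s => T.normalMap (s, σ * ε)) ≤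
      C • surfaceMeasure (tubeSet D ε) := by
  have hr : |σ * ε| < T.δ := by
    rcases hσ with rfl | rfl <;> simpa [abs_of_pos hε0] using hε
  -- The extended projection `π` has compact support, hence is globally Lipschitz, and it inverts
  -- the shift. A `K`-Lipschitz map increases the Hausdorff measure at most by `K ^ (n - 1)`.
  obtain ⟨K, hK⟩ := T.contDiff_π.lipschitzWith_of_hasCompactSupport T.hasCompactSupport_π (by simp)
  have hm : Measurable fun s => T.normalMap (s, σ * ε) :=
    (T.contDiff_normalMap.continuous.comp (continuous_id.prodMk continuous_const)).measurable
  refine ⟨(K : ℝ≥0∞) ^ (n - 1), by finiteness, Measure.le_iff.2 fun A hA => ?_⟩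
  rw [Measure.map_apply hm hA, Measure.smul_apply, smul_eq_mul, surfaceMeasure, surfaceMeasure,
    Measure.restrict_apply (hm hA), Measure.restrict_apply hA]
  refine le_trans (measure_mono ?_)
    (euclideanHausdorffMeasure_image_le (hK.lipschitzOnWith (s := A ∩ frontier (tubeSet D ε)))
      (n - 1))
  rintro s ⟨hsA, hs⟩
  refine ⟨_, ⟨hsA, (T.normalMap_mem_frontier hε hε0 hσ hs).1⟩, ?_⟩
  beta_reduce
  rw [T.normalMap_eq hs, T.π_apply s hs _ hr]

theorem ae_normalMap {ε : ℝ} (hε : ε < T.δ) (hε0 : 0 < ε) {σ : ℝ} (hσ : σ = 1 ∨ σ = -1)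
    {P : E n → Prop} (hP : ∀ᵐ x ∂(surfaceMeasure (tubeSet D ε)), P x) :
    ∀ᵐ s ∂(surfaceMeasure D), P (T.normalMap (s, σ * ε)) := by
  have hm : Measurable fun s => T.normalMap (s, σ * ε) :=
    (T.contDiff_normalMap.continuous.comp (continuous_id.prodMk continuous_const)).measurable
  obtain ⟨C, -, h⟩ := T.exists_map_surfaceMeasure_le hε hε0 hσ
  exact ae_of_ae_map hm.aemeasurable
    ((Measure.absolutelyContinuous_of_le_smul h).ae_le hP)

variable {F : Type*} [NormedAddCommGroup F] [IsCompactMeasure (surfaceMeasure D)]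

/-- Convergence of the traces on the boundary of the shell, in terms of `∂D`. -/
theorem tendsto_trace_shift {ε : ℝ} (hε : ε < T.δ) (hε0 : 0 < ε) {σ : ℝ} (hσ : σ = 1 ∨ σ = -1)
    {f : ℕ → E n → F} (hf : ∀ k, Continuous (f k)) {τ : Lp F 2 (surfaceMeasure (tubeSet D ε))}
    (h : Tendsto (fun k => eLpNorm (fun x => f k x - τ x) 2 (surfaceMeasure (tubeSet D ε))) atTop
      (𝓝 0)) :
    ∃ τ' : Lp F 2 (surfaceMeasure D),
      τ' =ᵐ[surfaceMeasure D] (fun s => τ (T.normalMap (s, σ * ε))) ∧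
      Tendsto (fun k => toL2 (surfaceMeasure D) fun s => f k (T.normalMap (s, σ * ε))) atTop
        (𝓝 τ') := by
  have hc : Continuous fun s => T.normalMap (s, σ * ε) :=
    T.contDiff_normalMap.continuous.comp (continuous_id.prodMk continuous_const)
  have hm := hc.measurable
  obtain ⟨C, hC, hle⟩ := T.exists_map_surfaceMeasure_le hε hε0 hσ
  have hτ : MemLp (fun s => τ (T.normalMap (s, σ * ε))) 2 (surfaceMeasure D) := by
    have h1 := (Lp.memLp τ).of_measure_le_smul hC hle
    exact h1.comp_of_map hm.aemeasurable
  refine ⟨toL2 _ fun s => τ (T.normalMap (s, σ * ε)), coeFn_toL2 hτ, ?_⟩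
  have hfk : ∀ k, MemLp (fun s => f k (T.normalMap (s, σ * ε))) 2 (surfaceMeasure D) := fun k =>
    memLp_of_continuous ((hf k).comp hc)
  rw [tendsto_toL2_iff hfk]
  have hlim : Tendsto (fun k => C ^ (1 / (2 : ℝ≥0∞)).toReal •
      eLpNorm (fun x => f k x - τ x) 2 (surfaceMeasure (tubeSet D ε))) atTop (𝓝 0) := by
    have h2 : C ^ (1 / (2 : ℝ≥0∞)).toReal ≠ ⊤ := ENNReal.rpow_ne_top_of_nonneg ENNReal.toReal_nonneg hC
    simpa using ENNReal.Tendsto.const_mul h (Or.inr h2)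
  refine tendsto_of_tendsto_of_tendsto_of_le_of_le tendsto_const_nhds hlim (fun _ => zero_le)
    fun k => ?_
  refine le_trans (le_of_eq ?_) (eLpNorm_le_of_measure_le_smul hle)
  have h3 : AEStronglyMeasurable (fun x => f k x - τ x)
      ((surfaceMeasure D).map fun s => T.normalMap (s, σ * ε)) :=
    (hf k).aestronglyMeasurable.sub ((Lp.memLp τ).of_measure_le_smul hC hle).1
  rw [eLpNorm_map_measure h3 hm.aemeasurable]
  refine eLpNorm_congr_ae ?_
  filter_upwards [coeFn_toL2 hτ] with s hs
  simp [hs]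

end Boundary

end Tube

end

end ThinShell

/-! ### Clifford multiplication, the tangential Dirac operator and its boundary form. -/

namespace ThinShell

noncomputable section

/-- Symmetric operators which satisfy the Clifford relations. -/
structure IsCliffordFamily {n : ℕ} {F : Type*} [NormedAddCommGroup F] [InnerProductSpace ℝ F]
    (B : Fin n → F →L[ℝ] F) : Prop where
  symm : ∀ j v w, ⟪B j v, w⟫_ℝ = ⟪v, B j w⟫_ℝ
  anti : ∀ j k v, B j (B k v) + B k (B j v) = if j = k then (2 : ℝ) • v else 0

variable {n : ℕ} {F : Type*} [NormedAddCommGroup F] [InnerProductSpace ℝ F]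

/-- The Clifford multiplication with a vector. -/
def cliff (B : Fin n → F →L[ℝ] F) (x : E n) : F →L[ℝ] F := ∑ j, x j • B j

/-- The operator `∑ B_k ∂_k`. -/
def diracGrad (B : Fin n → F →L[ℝ] F) (f : E n → F) (x : E n) : F :=
  ∑ k, B k (fderiv ℝ f x (stdVec k))

theorem cliff_apply (B : Fin n → F →L[ℝ] F) (x : E n) (v : F) :
    cliff B x v = ∑ j, x j • B j v := by
  simp [cliff, sum_apply]

theorem sum_smul_stdVec (v : E n) : ∑ j, v j • (stdVec j : E n) = v := by
  have := (EuclideanSpace.basisFun (Fin n) ℝ).sum_repr v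
  simpa [stdVec] using this

theorem clm_apply_eq_sum {G : Type*} [NormedAddCommGroup G] [NormedSpace ℝ G] (L : E n →L[ℝ] G)
    (v : E n) : L v = ∑ j, v j • L (stdVec j) := by
  conv_lhs => rw [← sum_smul_stdVec v]
  simp only [map_sum, map_smul]

theorem inner_eq_sum (v w : E n) : ⟪v, w⟫_ℝ = ∑ j, v j * w j := by
  rw [PiLp.inner_apply]
  exact Finset.sum_congr rfl fun j _ => by simp [mul_comm]

theorem contDiff_cliff (B : Fin n → F →L[ℝ] F) : ContDiff ℝ ∞ (cliff B) := by
  refine ContDiff.sum fun j _ => ?_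
  have h : ContDiff ℝ ∞ fun x : E n => x j := contDiff_euclidean.1 contDiff_id j
  exact h.smul contDiff_const

theorem contDiff_diracGrad (B : Fin n → F →L[ℝ] F) {f : E n → F} (hf : ContDiff ℝ ∞ f) :
    ContDiff ℝ ∞ (diracGrad B f) :=
  ContDiff.sum fun k _ => (B k).contDiff.comp (Tube.contDiff_partial hf _)

theorem hasFDerivAt_cliff (B : Fin n → F →L[ℝ] F) {X : E n → E n} {X' : E n →L[ℝ] E n}
    {f : E n → F} {f' : E n →L[ℝ] F} {x : E n} (hX : HasFDerivAt X X' x)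
    (hf : HasFDerivAt f f' x) (v : E n) :
    fderiv ℝ (fun x => cliff B (X x) (f x)) x v = cliff B (X' v) (f x) + cliff B (X x) (f' v) := by
  have h1 : HasFDerivAt (fun x => cliff B (X x) (f x))
      (∑ j, (X x j • (B j ∘L f') +
        ((EuclideanSpace.proj j : E n →L[ℝ] ℝ) ∘L X').smulRight (B j (f x)))) x := by
    have : (fun x => cliff B (X x) (f x)) = fun x => ∑ j, X x j • B j (f x) := by
      ext x; rw [cliff_apply]
    rw [this]
    refine HasFDerivAt.fun_sum fun j _ => ?_
    have e1 : HasFDerivAt (fun x => X x j) ((EuclideanSpace.proj j : E n →L[ℝ] ℝ) ∘L X') x :=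
      (EuclideanSpace.proj j : E n →L[ℝ] ℝ).hasFDerivAt.comp x hX
    have e2 : HasFDerivAt (fun x => B j (f x)) (B j ∘L f') x := (B j).hasFDerivAt.comp x hf
    exact e1.smul e2
  rw [h1.fderiv, cliff_apply, cliff_apply, ← Finset.sum_add_distrib, sum_apply]
  refine Finset.sum_congr rfl fun j _ => ?_
  simp [add_comm]

namespace IsCliffordFamily

variable {B : Fin n → F →L[ℝ] F}

theorem inner_cliff (hB : IsCliffordFamily B) (x : E n) (v w : F) : ⟪cliff B x v, w⟫_ℝ = ⟪v, cliff B x w⟫_ℝ := by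
  simp only [cliff_apply, sum_inner, inner_sum, real_inner_smul_left, real_inner_smul_right,
    hB.symm]

theorem cliff_anti (hB : IsCliffordFamily B) (x y : E n) (v : F) :
    cliff B x (cliff B y v) + cliff B y (cliff B x v) = (2 * ⟪x, y⟫_ℝ) • v := by
  have h1 : cliff B x (cliff B y v) = ∑ j, ∑ k, (x j * y k) • B j (B k v) := by
    simp only [cliff_apply, map_sum, map_smul, Finset.smul_sum, smul_smul]
    rw [Finset.sum_comm]
    simp only [mul_comm (y _)]
  have h2 : cliff B y (cliff B x v) = ∑ j, ∑ k, (x j * y k) • B k (B j v) := by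
    simp only [cliff_apply, map_sum, map_smul, Finset.smul_sum, smul_smul]
  rw [h1, h2, ← Finset.sum_add_distrib]
  simp only [← Finset.sum_add_distrib, ← smul_add, hB.anti, smul_ite, smul_zero,
    Finset.sum_ite_eq, Finset.mem_univ, if_true, smul_smul]
  rw [← Finset.sum_smul, inner_eq_sum, Finset.mul_sum]
  simp only [mul_comm]

theorem cliff_cliff (hB : IsCliffordFamily B) (x : E n) (v : F) : cliff B x (cliff B x v) = ⟪x, x⟫_ℝ • v := by
  have h := hB.cliff_anti x x v
  rw [← two_smul ℝ, mul_smul] at h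
  exact smul_right_injective F (two_ne_zero (α := ℝ)) h

/-- The Clifford contraction of a symmetric operator is its trace. -/
theorem sum_symm (hB : IsCliffordFamily B) (c : Fin n → Fin n → F) (hc : ∀ j k, c j k = c k j) :
    ∑ j, ∑ k, B j (B k (c j k)) = ∑ j, c j j := by
  have h1 : ∑ j, ∑ k, B j (B k (c j k)) = ∑ j, ∑ k, B k (B j (c j k)) := by
    rw [Finset.sum_comm]
    exact Finset.sum_congr rfl fun j _ => Finset.sum_congr rfl fun k _ => by rw [hc]
  have h2 : (2 : ℝ) • ∑ j, ∑ k, B j (B k (c j k)) = (2 : ℝ) • ∑ j, c j j := by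
    conv_lhs => rw [two_smul]
    nth_rewrite 2 [h1]
    simp only [← Finset.sum_add_distrib, hB.anti, Finset.sum_ite_eq, Finset.mem_univ, if_true,
      Finset.smul_sum]
  exact smul_right_injective F (two_ne_zero (α := ℝ)) h2

end IsCliffordFamily

namespace Tube

variable {D : Set (E n)} (T : Tube D) {B : Fin n → F →L[ℝ] F}

/-- The tangential Dirac operator on the parallel surfaces. -/
def tangDirac (B : Fin n → F →L[ℝ] F) (f : E n → F) (x : E n) : F :=
  cliff B (T.nu x) (diracGrad B f x) - fderiv ℝ f x (T.nu x)

theorem contDiff_tangDirac (B : Fin n → F →L[ℝ] F) {f : E n → F} (hf : ContDiff ℝ ∞ f) :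
    ContDiff ℝ ∞ (T.tangDirac B f) :=
  (((contDiff_cliff B).comp T.contDiff_nu).clm_apply (contDiff_diracGrad B hf)).sub
    ((hf.fderiv_right (m := ∞) (by simp)).clm_apply T.contDiff_nu)

/-- `K` anticommutes with `B(ν)` up to curvature. Differentiating `ν` gives the Clifford contraction
of the symmetric operator `A`, that is its trace `h`; moving `B_k` past `B(ν)` produces `2 ∂_ν`; and
`A ν = 0` removes the normal derivative of `ν`. -/
theorem tangDirac_cliff (hB : IsCliffordFamily B) {f : E n → F} (hf : ContDiff ℝ ∞ f) {x : E n}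
    (hx : x ∈ tubeSet D T.δ) :
    T.tangDirac B (fun x => cliff B (T.nu x) (f x)) x
      = T.h x • cliff B (T.nu x) (f x) - cliff B (T.nu x) (T.tangDirac B f x) := by
  have hd := hasFDerivAt_cliff B (T.hasFDerivAt_nu x) (hf.differentiable (by simp) x).hasFDerivAt
  have h1 : diracGrad B (fun x => cliff B (T.nu x) (f x)) x
      = T.h x • f x + (2 : ℝ) • fderiv ℝ f x (T.nu x) - cliff B (T.nu x) (diracGrad B f x) := by
    have e1 : ∑ k, B k (cliff B (T.A x (stdVec k)) (f x)) = T.h x • f x := by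
      have := hB.sum_symm (fun j k => T.A x (stdVec j) k • f x) fun j k => by
        have := T.inner_A_comm hx (stdVec j) (stdVec k)
        simp only [stdVec, EuclideanSpace.inner_single_right, EuclideanSpace.inner_single_left]
          at this
        simp only [stdVec]
        congr 1
        simpa using this
      simp only [cliff_apply, map_sum, map_smul] at this ⊢
      rw [this, T.h_eq_sum, Finset.sum_smul]
    have e2 : ∑ k, B k (cliff B (T.nu x) (fderiv ℝ f x (stdVec k)))
        = (2 : ℝ) • fderiv ℝ f x (T.nu x) - cliff B (T.nu x) (diracGrad B f x) := by
      rw [eq_sub_iff_add_eq, diracGrad, map_sum, ← Finset.sum_add_distrib,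
        clm_apply_eq_sum (fderiv ℝ f x) (T.nu x), Finset.smul_sum]
      refine Finset.sum_congr rfl fun k _ => ?_
      have h := hB.cliff_anti (stdVec k) (T.nu x) (fderiv ℝ f x (stdVec k))
      have hk : ∀ v, cliff B (stdVec k) v = B k v := fun v => by
        rw [cliff_apply, Finset.sum_eq_single k]
        · simp [stdVec]
        · intro j _ hj
          simp [stdVec, hj]
        · simp
      rw [hk, hk, stdVec, EuclideanSpace.inner_single_left] at h
      rw [stdVec, h, smul_smul]
      simp
    rw [diracGrad]
    simp only [hd, map_add, Finset.sum_add_distrib]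
    rw [e1, e2]
    abel
  rw [tangDirac, h1, hd, T.A_nu hx, tangDirac]
  have h0 : cliff B (0 : E n) (f x) = 0 := by simp [cliff_apply]
  rw [h0, map_sub, map_sub, map_add, map_smul, map_smul, two_smul]
  abel

/-- `K` differentiates only tangentially: a gradient of `χ` along `ν` contributes `c B(ν) B(ν) f - c
f = 0`. -/
theorem tangDirac_smul (hB : IsCliffordFamily B) {f : E n → F} (hf : ContDiff ℝ ∞ f)
    {χ : E n → ℝ} {c : ℝ} {x : E n} (hx : x ∈ tubeSet D T.δ)
    (hχ : HasFDerivAt χ (c • innerSL ℝ (T.nu x)) x) :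
    T.tangDirac B (fun x => χ x • f x) x = χ x • T.tangDirac B f x := by
  have hd : ∀ v, fderiv ℝ (fun x => χ x • f x) x v
      = χ x • fderiv ℝ f x v + (c * ⟪T.nu x, v⟫_ℝ) • f x := fun v => by
    have h1 : HasFDerivAt (fun x => χ x • f x) _ x :=
      hχ.smul (hf.differentiable (by simp) x).hasFDerivAt
    rw [h1.fderiv]
    simp
  have h1 : diracGrad B (fun x => χ x • f x) x
      = χ x • diracGrad B f x + c • cliff B (T.nu x) (f x) := by
    simp only [diracGrad, hd, map_add, map_smul, Finset.sum_add_distrib, Finset.smul_sum,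
      cliff_apply, smul_smul]
    congr 1
    refine Finset.sum_congr rfl fun k _ => ?_
    simp [stdVec, EuclideanSpace.inner_single_right]
  rw [tangDirac, h1, hd, map_add, map_smul, map_smul, hB.cliff_cliff, T.inner_nu_nu hx, tangDirac,
    smul_sub, one_smul, mul_one]
  abel

end Tube

section Integral

namespace Tube

variable {D : Set (E n)} (T : Tube D) {B : Fin n → F →L[ℝ] F}

/-- The integral over the parallel surface at signed distance `r`. -/
def levelIntegral (ψ : E n → ℝ) (r : ℝ) : ℝ :=
  ∫ s, T.J s r * ψ (T.normalMap (s, r)) ∂(surfaceMeasure D)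

/-- The difference of the integrals over the two components of the boundary of the shell. -/
def bdry (ε : ℝ) (ψ : E n → ℝ) : ℝ := T.levelIntegral ψ ε - T.levelIntegral ψ (-ε)

theorem continuous_shift (r : ℝ) : Continuous fun s => T.normalMap (s, r) :=
  T.contDiff_normalMap.continuous.comp (continuous_id.prodMk continuous_const)

theorem continuous_J_left (r : ℝ) : Continuous fun s => T.J s r :=
  T.continuous_J.comp (continuous_id.prodMk continuous_const)

theorem levelIntegral_congr {ψ ψ' : E n → ℝ} {r : ℝ} (hr : |r| < T.δ)
    (h : ∀ x ∈ tubeSet D T.δ, T.d x = r → ψ x = ψ' x) :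
    T.levelIntegral ψ r = T.levelIntegral ψ' r := by
  refine integral_congr_ae ?_
  filter_upwards [ae_mem_frontier] with s hs
  rw [T.normalMap_eq hs, h _ (T.mem_tube hs hr) (T.d_apply s hs r hr)]

variable [IsCompactMeasure (surfaceMeasure D)]

theorem integrable_level {ψ : E n → ℝ} (hψ : Continuous ψ) (r : ℝ) :
    Integrable (fun s => T.J s r * ψ (T.normalMap (s, r))) (surfaceMeasure D) :=
  integrable_of_continuous ((T.continuous_J_left r).mul (hψ.comp (T.continuous_shift r)))

theorem levelIntegral_add {ψ ψ' : E n → ℝ} (hψ : Continuous ψ) (hψ' : Continuous ψ') (r : ℝ) :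
    T.levelIntegral (fun x => ψ x + ψ' x) r = T.levelIntegral ψ r + T.levelIntegral ψ' r := by
  rw [levelIntegral, levelIntegral, levelIntegral,
    ← integral_add (T.integrable_level hψ r) (T.integrable_level hψ' r)]
  simp only [mul_add]

theorem levelIntegral_inner {f g : E n → F} (hf : Continuous f) (hg : Continuous g) (r : ℝ) :
    T.levelIntegral (fun x => ⟪f x, g x⟫_ℝ) r =
      ⟪toL2 (surfaceMeasure D) fun s => T.J s r • f (T.normalMap (s, r)),
        toL2 (surfaceMeasure D) fun s => g (T.normalMap (s, r))⟫_ℝ := by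
  have h1 : Continuous fun s => f (T.normalMap (s, r)) := hf.comp (T.continuous_shift r)
  have h2 : Continuous fun s => g (T.normalMap (s, r)) := hg.comp (T.continuous_shift r)
  have h3 : Continuous fun s => T.J s r • f (T.normalMap (s, r)) := (T.continuous_J_left r).smul h1
  rw [inner_toL2 (memLp_of_continuous h3) (memLp_of_continuous h2)]
  simp only [real_inner_smul_left]
  rfl

/-- The divergence theorem in the shell, for a vector field. -/
theorem integral_div_tube {φ : Fin n → E n → ℝ} (hφ : ∀ j, ContDiff ℝ ∞ (φ j)) {ε : ℝ}
    (hε0 : 0 < ε) (hε : ε < T.δ / 2) :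
    ∫ x in tubeSet D ε, ∑ j, fderiv ℝ (φ j) x (stdVec j)
      = T.bdry ε fun x => ∑ j, T.nu x j * φ j x := by
  have hδ := T.δ_pos
  have := T.isCompactMeasure_tubeSet (ε := ε) (by linarith)
  have : IsFiniteMeasure (surfaceMeasure D) := T.isFiniteMeasure_surfaceMeasure
  rw [integral_finsetSum _ fun j _ =>
    integrable_of_continuous (contDiff_partial (hφ j) (stdVec j)).continuous]
  have h : ∀ r : ℝ, |r| < T.δ →
      ∑ j, T.flux (φ j) j r = T.levelIntegral (fun x => ∑ j, T.nu x j * φ j x) r := by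
    intro r hr
    simp only [flux, smul_eq_mul]
    rw [← integral_finsetSum]
    · refine integral_congr_ae ?_
      filter_upwards [ae_mem_frontier] with s hs
      rw [Finset.mul_sum]
      refine Finset.sum_congr rfl fun j _ => ?_
      rw [T.normalMap_eq hs, T.nu_apply s hs r hr, T.nu_eq hs, mul_assoc]
    · intro j _
      exact integrable_of_continuous (((T.continuous_J_left r).mul
        (T.contDiff_nu_apply j).continuous).mul ((hφ j).continuous.comp (T.continuous_shift r)))
  rw [bdry, ← h ε (by rw [abs_of_pos hε0]; linarith),
    ← h (-ε) (by rw [abs_neg, abs_of_pos hε0]; linarith), ← Finset.sum_sub_distrib]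
  exact Finset.sum_congr rfl fun j _ => T.integral_fderiv_tube (hφ j) j hε0 hε

/-- The difference of the Dirac form and the Dirichlet form is a boundary term. -/
theorem integral_dirac_sub (hB : IsCliffordFamily B) {a b : E n → F} (ha : ContDiff ℝ ∞ a)
    (hb : ContDiff ℝ ∞ b) {ε : ℝ} (hε0 : 0 < ε) (hε : ε < T.δ / 2) :
    ∫ x in tubeSet D ε, (⟪diracGrad B a x, diracGrad B b x⟫_ℝ
        - ∑ j, ⟪fderiv ℝ a x (stdVec j), fderiv ℝ b x (stdVec j)⟫_ℝ)
      = T.bdry ε fun x => ⟪a x, T.tangDirac B b x⟫_ℝ := by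
  -- The field `X_j = B_j ∑ B_k ∂_k b - ∂_j b` is divergence free, by the symmetry of the second
  -- derivatives, and its normal component is `K b`. Hence the divergence of `⟨a, X⟩` is the
  -- integrand.
  let X : Fin n → E n → F := fun j x => B j (diracGrad B b x) - fderiv ℝ b x (stdVec j)
  have hX : ∀ j, ContDiff ℝ ∞ (X j) := fun j =>
    ((B j).contDiff.comp (contDiff_diracGrad B hb)).sub (contDiff_partial hb _)
  have h := T.integral_div_tube (φ := fun j x => ⟪a x, X j x⟫_ℝ) (fun j => ha.inner ℝ (hX j))
    hε0 hε
  have e1 : (fun x => ∑ j, T.nu x j * ⟪a x, X j x⟫_ℝ) = fun x => ⟪a x, T.tangDirac B b x⟫_ℝ := by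
    ext x
    simp only [← real_inner_smul_right, ← inner_sum]
    rw [tangDirac, cliff_apply, clm_apply_eq_sum (fderiv ℝ b x), ← Finset.sum_sub_distrib]
    simp only [X, smul_sub]
  rw [← e1, ← h]
  congr 1
  ext x
  have hb2 : HasFDerivAt (fderiv ℝ b) (fderiv ℝ (fderiv ℝ b) x) x :=
    ((hb.fderiv_right (m := ∞) (by simp)).differentiable (by simp) x).hasFDerivAt
  have hbp : ∀ k, HasFDerivAt (fun x => fderiv ℝ b x (stdVec k))
      ((fderiv ℝ (fderiv ℝ b) x).flip (stdVec k)) x := fun k => by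
    refine (hb2.clm_apply (hasFDerivAt_const (stdVec k) x)).congr_fderiv ?_
    ext v
    simp
  have hX' : ∀ j, fderiv ℝ (X j) x (stdVec j)
      = ∑ k, B j (B k (fderiv ℝ (fderiv ℝ b) x (stdVec j) (stdVec k)))
        - fderiv ℝ (fderiv ℝ b) x (stdVec j) (stdVec j) := fun j => by
    have h1 : HasFDerivAt (diracGrad B b)
        (∑ k, B k ∘L (fderiv ℝ (fderiv ℝ b) x).flip (stdVec k)) x :=
      HasFDerivAt.fun_sum fun k _ => (B k).hasFDerivAt.comp x (hbp k)
    have h2 : HasFDerivAt (X j) _ x := ((B j).hasFDerivAt.comp x h1).sub (hbp j)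
    rw [h2.fderiv]
    simp [sum_apply]
  have hsymm : IsSymmSndFDerivAt ℝ b x :=
    hb.contDiffAt.isSymmSndFDerivAt (by simp; exact WithTop.coe_le_coe.2 le_top)
  have h0 : ∑ j, fderiv ℝ (X j) x (stdVec j) = 0 := by
    simp only [hX']
    rw [Finset.sum_sub_distrib, hB.sum_symm _ fun j k => hsymm _ _, sub_self]
  have h3 : ∀ j, fderiv ℝ (fun x => ⟪a x, X j x⟫_ℝ) x (stdVec j)
      = ⟪a x, fderiv ℝ (X j) x (stdVec j)⟫_ℝ + ⟪fderiv ℝ a x (stdVec j), X j x⟫_ℝ := fun j =>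
    fderiv_inner_apply ℝ (ha.differentiable (by simp) x) ((hX j).differentiable (by simp) x) _
  simp only [h3, Finset.sum_add_distrib]
  rw [← inner_sum, h0, inner_zero_right, zero_add]
  simp only [X, inner_sub_right, Finset.sum_sub_distrib, ← hB.symm]
  rw [← sum_inner, diracGrad]

/-- Both sides equal the same volume integral, which is symmetric in `a` and `b`. Only the
difference over the two components is treated; cutoffs separate them later. -/
theorem bdry_tangDirac_comm (hB : IsCliffordFamily B) {a b : E n → F} (ha : ContDiff ℝ ∞ a)
    (hb : ContDiff ℝ ∞ b) {ε : ℝ} (hε0 : 0 < ε) (hε : ε < T.δ / 2) :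
    T.bdry ε (fun x => ⟪a x, T.tangDirac B b x⟫_ℝ)
      = T.bdry ε fun x => ⟪T.tangDirac B a x, b x⟫_ℝ := by
  rw [← T.integral_dirac_sub hB ha hb hε0 hε]
  refine Eq.trans ?_ ((T.integral_dirac_sub hB hb ha hε0 hε).trans ?_)
  · simp only [real_inner_comm (diracGrad B b _), real_inner_comm (fderiv ℝ b _ _)]
  · simp only [real_inner_comm (b _)]

end Tube

end Integral

end

end ThinShell

/-! ### From smooth functions to `H¹` functions with infinite mass boundary conditions. -/

namespace ThinShell

noncomputable section

section DiracForm

variable {n : ℕ} {X F : Type*} [MeasurableSpace X] [NormedAddCommGroup F] [InnerProductSpace ℝ F]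

/-- The operator `(g_j) ↦ ∑ B_j g_j` in `L²`. -/
def diracL2 (μ : Measure X) (B : Fin n → F →L[ℝ] F) (g : Fin n → Lp F 2 μ) : Lp F 2 μ :=
  ∑ j, mulOp μ (fun _ => B j) (g j)

/-- The difference of the Dirac form and the Dirichlet form. -/
def dform (μ : Measure X) (B : Fin n → F →L[ℝ] F) (g g' : Fin n → Lp F 2 μ) : ℝ :=
  ⟪diracL2 μ B g, diracL2 μ B g'⟫_ℝ - ∑ j, ⟪g j, g' j⟫_ℝ

variable {μ : Measure X} {B : Fin n → F →L[ℝ] F}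

theorem continuous_diracL2 : Continuous (diracL2 μ B) := by
  unfold diracL2
  fun_prop

theorem continuous_dform {Y : Type*} [TopologicalSpace Y] {g g' : Y → Fin n → Lp F 2 μ}
    (hg : Continuous g) (hg' : Continuous g') : Continuous fun y => dform μ B (g y) (g' y) := by
  have h := continuous_diracL2 (μ := μ) (B := B)
  unfold dform
  fun_prop

theorem diracL2_add (g g' : Fin n → Lp F 2 μ) :
    diracL2 μ B (g + g') = diracL2 μ B g + diracL2 μ B g' := by
  simp [diracL2, Finset.sum_add_distrib]

theorem diracL2_sub (g g' : Fin n → Lp F 2 μ) :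
    diracL2 μ B (g - g') = diracL2 μ B g - diracL2 μ B g' := by
  simp [diracL2, Finset.sum_sub_distrib]

theorem dform_comm (g g' : Fin n → Lp F 2 μ) : dform μ B g g' = dform μ B g' g := by
  simp only [dform, real_inner_comm (diracL2 μ B g), real_inner_comm (g _)]

theorem dform_add_left (g g' k : Fin n → Lp F 2 μ) :
    dform μ B (g + g') k = dform μ B g k + dform μ B g' k := by
  simp only [dform, diracL2_add, inner_add_left, Pi.add_apply, Finset.sum_add_distrib]
  ring

theorem dform_sub_left (g g' k : Fin n → Lp F 2 μ) :
    dform μ B (g - g') k = dform μ B g k - dform μ B g' k := by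
  simp only [dform, diracL2_sub, inner_sub_left, Pi.sub_apply, Finset.sum_sub_distrib]
  ring

theorem dform_add_sub (g g' : Fin n → Lp F 2 μ) :
    dform μ B (g + g') (g - g') = dform μ B g g - dform μ B g' g' := by
  rw [dform_add_left, dform_comm g, dform_comm g', dform_sub_left, dform_sub_left, dform_comm g' g]
  ring

end DiracForm

namespace Tube

variable {n : ℕ} {D : Set (E n)} {F : Type*} [NormedAddCommGroup F]

section

variable (D F) in
/-- The data of a function in the shell: the function, its gradient, and its traces on the outer
and the inner boundary components. -/
abbrev JetSpace (ε : ℝ) : Type _ :=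
  Lp F 2 (volume.restrict (tubeSet D ε)) × (Fin n → Lp F 2 (volume.restrict (tubeSet D ε))) ×
    Lp F 2 (surfaceMeasure D) × Lp F 2 (surfaceMeasure D)

variable [InnerProductSpace ℝ F] (T : Tube D)

/-- The data of a smooth function. -/
def jet (ε : ℝ) (f : E n → F) : JetSpace D F ε :=
  (toL2 _ f, fun j => toL2 _ fun x => fderiv ℝ f x (stdVec j),
    toL2 _ fun s => f (T.normalMap (s, ε)), toL2 _ fun s => f (T.normalMap (s, -ε)))

variable (F) in
/-- The closure of the data of smooth functions. -/
def jets (ε : ℝ) : Set (JetSpace D F ε) := closure {p | ∃ f, ContDiff ℝ ∞ f ∧ p = T.jet ε f}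

/-- Density principle: an identity which is continuous in the function, its gradient and its two
traces needs to be checked on smooth functions only. No derivative on the boundary may occur in it.
-/
theorem eq_of_mem_jets {ε : ℝ} {Y : Type*} [TopologicalSpace Y] [T2Space Y]
    {Φ Ψ : JetSpace D F ε → Y} (hΦ : Continuous Φ) (hΨ : Continuous Ψ)
    (h : ∀ f, ContDiff ℝ ∞ f → Φ (T.jet ε f) = Ψ (T.jet ε f)) {p : JetSpace D F ε}
    (hp : p ∈ T.jets F ε) : Φ p = Ψ p := by
  have hsub : T.jets F ε ⊆ {p | Φ p = Ψ p} :=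
    closure_minimal (by rintro p ⟨f, hf, rfl⟩; exact h f hf) (isClosed_eq hΦ hΨ)
  exact hsub hp

theorem map_mem_jets {ε : ℝ} {Φ : JetSpace D F ε → JetSpace D F ε} (hΦ : Continuous Φ)
    (h : ∀ f, ContDiff ℝ ∞ f → ∃ g, ContDiff ℝ ∞ g ∧ Φ (T.jet ε f) = T.jet ε g)
    {p : JetSpace D F ε} (hp : p ∈ T.jets F ε) : Φ p ∈ T.jets F ε := by
  refine map_mem_closure hΦ hp ?_
  rintro p ⟨f, hf, rfl⟩
  exact h f hf

end

variable [InnerProductSpace ℝ F] (T : Tube D) {B : Fin n → F →L[ℝ] F} {ε : ℝ}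

/-- The gradient of `χ u`, where `χ = (d + ε) / (2 ε)`. -/
def cutGrad (ε : ℝ) (p : JetSpace D F ε) (j : Fin n) : Lp F 2 (volume.restrict (tubeSet D ε)) :=
  smulOp F _ (fun x => (T.d x + ε) / (2 * ε)) (p.2.1 j)
    + smulOp F _ (fun x => T.nu x j / (2 * ε)) p.1

/-- The data of `B(ν) u`. -/
def cliffJet (B : Fin n → F →L[ℝ] F) (ε : ℝ) (p : JetSpace D F ε) : JetSpace D F ε :=
  (mulOp _ (fun x => cliff B (T.nu x)) p.1,
    fun j => mulOp _ (fun x => cliff B (T.nu x)) (p.2.1 j)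
      + mulOp _ (fun x => cliff B (T.A x (stdVec j))) p.1,
    mulOp _ (fun x => cliff B (T.nu x)) p.2.2.1, mulOp _ (fun x => cliff B (T.nu x)) p.2.2.2)

theorem continuous_cutGrad : Continuous (T.cutGrad (F := F) ε) := by
  unfold cutGrad
  fun_prop

theorem continuous_cliffJet : Continuous (T.cliffJet B ε) := by
  unfold cliffJet
  fun_prop

theorem continuous_cliff_nu (B : Fin n → F →L[ℝ] F) : Continuous fun x => cliff B (T.nu x) :=
  ((contDiff_cliff B).comp T.contDiff_nu).continuous

theorem continuous_cliff_A (B : Fin n → F →L[ℝ] F) (v : E n) :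
    Continuous fun x => cliff B (T.A x v) :=
  ((contDiff_cliff B).comp (T.contDiff_A.clm_apply contDiff_const)).continuous

theorem contDiff_cliff_nu (B : Fin n → F →L[ℝ] F) {f : E n → F} (hf : ContDiff ℝ ∞ f) :
    ContDiff ℝ ∞ fun x => cliff B (T.nu x) (f x) :=
  ((contDiff_cliff B).comp T.contDiff_nu).clm_apply hf

theorem contDiff_cutoff (ε : ℝ) : ContDiff ℝ ∞ fun x => (T.d x + ε) / (2 * ε) :=
  (T.contDiff_d.add contDiff_const).div_const _

/-- The boundary term with the mean curvature. -/
def curvTerm (ε : ℝ) (p : JetSpace D F ε) : ℝ :=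
  ⟪smulOp F _ (fun s => T.J s ε * T.h (T.normalMap (s, ε))) p.2.2.1, p.2.2.1⟫_ℝ
    - ⟪smulOp F _ (fun s => T.J s (-ε) * T.h (T.normalMap (s, -ε))) p.2.2.2, p.2.2.2⟫_ℝ

theorem curvTerm_jet [IsCompactMeasure (surfaceMeasure D)] {f : E n → F} (hf : ContDiff ℝ ∞ f) :
    T.curvTerm ε (T.jet ε f) = T.bdry ε fun x => T.h x * ⟪f x, f x⟫_ℝ := by
  have key : ∀ r, ⟪smulOp F _ (fun s => T.J s r * T.h (T.normalMap (s, r)))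
      (toL2 (surfaceMeasure D) fun s => f (T.normalMap (s, r))),
      toL2 (surfaceMeasure D) fun s => f (T.normalMap (s, r))⟫_ℝ
      = T.levelIntegral (fun x => T.h x * ⟪f x, f x⟫_ℝ) r := fun r => by
    have h1 : Continuous fun s => f (T.normalMap (s, r)) :=
      hf.continuous.comp (T.continuous_shift r)
    have h2 : Continuous fun s => T.J s r * T.h (T.normalMap (s, r)) :=
      (T.continuous_J_left r).mul (T.contDiff_h.continuous.comp (T.continuous_shift r))
    have h3 : Continuous fun s => (T.J s r * T.h (T.normalMap (s, r))) • f (T.normalMap (s, r)) :=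
      h2.smul h1
    rw [smulOp_toL2 h2 h1, inner_toL2 (memLp_of_continuous h3) (memLp_of_continuous h1),
      levelIntegral]
    simp only [real_inner_smul_left, mul_assoc]
  rw [curvTerm, bdry, ← key, ← key]
  rfl

variable [IsCompactMeasure (volume.restrict (tubeSet D ε))]

theorem diracL2_jet {f : E n → F} (hf : ContDiff ℝ ∞ f) :
    diracL2 _ B (T.jet ε f).2.1 = toL2 _ (diracGrad B f) := by
  have h := fun v => (contDiff_partial hf v).continuous
  have h' : ∀ j, Continuous fun x => B j (fderiv ℝ f x (stdVec j)) := fun j =>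
    (B j).continuous.comp (h _)
  have := toL2_sum (μ := volume.restrict (tubeSet D ε)) Finset.univ
    (f := fun j x => B j (fderiv ℝ f x (stdVec j))) fun j => memLp_of_continuous (h' j)
  refine Eq.trans ?_ this.symm
  exact Finset.sum_congr rfl fun j _ => mulOp_toL2_of_continuous continuous_const (h _)

theorem cutGrad_jet (hεδ : ε ≤ T.δ) {f : E n → F} (hf : ContDiff ℝ ∞ f) :
    T.cutGrad ε (T.jet ε f) = (T.jet ε fun x => ((T.d x + ε) / (2 * ε)) • f x).2.1 := by
  funext j
  have hc1 := (T.contDiff_cutoff ε).continuous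
  have hc2 : Continuous fun x => T.nu x j / (2 * ε) := (T.contDiff_nu_apply j).continuous.div_const _
  have h := (contDiff_partial hf (stdVec j)).continuous
  simp only [cutGrad, jet]
  have h1 : Continuous fun x => ((T.d x + ε) / (2 * ε)) • fderiv ℝ f x (stdVec j) := hc1.smul h
  have h2 : Continuous fun x => (T.nu x j / (2 * ε)) • f x := hc2.smul hf.continuous
  rw [smulOp_toL2 hc1 h, smulOp_toL2 hc2 hf.continuous,
    ← toL2_add (memLp_of_continuous h1) (memLp_of_continuous h2)]
  refine toL2_congr ?_
  filter_upwards [ae_restrict_mem (T.isOpen_tubeSet hεδ).measurableSet] with x hx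
  have hxδ : x ∈ tubeSet D T.δ := (T.tubeSet_eq hεδ ▸ hx).1
  have h1 : HasFDerivAt (fun x => ((T.d x + ε) / (2 * ε)) • f x) _ x :=
    (((T.hasFDerivAt_d hxδ).add_const ε).mul_const (2 * ε)⁻¹).smul
      (hf.differentiable (by simp) x).hasFDerivAt
  rw [h1.fderiv]
  simp [stdVec, EuclideanSpace.inner_single_right, div_eq_inv_mul, mul_comm]

variable [IsCompactMeasure (surfaceMeasure D)]

theorem jet_add {f g : E n → F} (hf : ContDiff ℝ ∞ f) (hg : ContDiff ℝ ∞ g) :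
    T.jet ε (fun x => f x + g x) = T.jet ε f + T.jet ε g := by
  have h := fun v => (contDiff_partial hf v).continuous
  have h' := fun v => (contDiff_partial hg v).continuous
  have e1 : ∀ x v, fderiv ℝ (fun x => f x + g x) x v = fderiv ℝ f x v + fderiv ℝ g x v :=
    fun x v => by
      rw [fderiv_fun_add (hf.differentiable (by simp) x) (hg.differentiable (by simp) x)]; rfl
  have hs : ∀ r, Continuous fun s => f (T.normalMap (s, r)) := fun r =>
    hf.continuous.comp (T.continuous_shift r)
  have hs' : ∀ r, Continuous fun s => g (T.normalMap (s, r)) := fun r =>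
    hg.continuous.comp (T.continuous_shift r)
  refine Prod.ext ?_ (Prod.ext (funext fun j => ?_) (Prod.ext ?_ ?_))
  · exact toL2_add (memLp_of_continuous hf.continuous) (memLp_of_continuous hg.continuous)
  · simp only [jet, e1]
    exact toL2_add (memLp_of_continuous (h _)) (memLp_of_continuous (h' _))
  · exact toL2_add (memLp_of_continuous (hs _)) (memLp_of_continuous (hs' _))
  · exact toL2_add (memLp_of_continuous (hs _)) (memLp_of_continuous (hs' _))

theorem jet_sub {f g : E n → F} (hf : ContDiff ℝ ∞ f) (hg : ContDiff ℝ ∞ g) :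
    T.jet ε (fun x => f x - g x) = T.jet ε f - T.jet ε g := by
  rw [eq_sub_iff_add_eq, ← T.jet_add (hf.sub hg) hg]
  simp

theorem cliffJet_jet (hε0 : 0 < ε) (hεδ : ε < T.δ) {f : E n → F} (hf : ContDiff ℝ ∞ f) :
    T.cliffJet B ε (T.jet ε f) = T.jet ε fun x => cliff B (T.nu x) (f x) := by
  have hc1 := T.continuous_cliff_nu B
  have hs : ∀ r, Continuous fun s => f (T.normalMap (s, r)) := fun r =>
    hf.continuous.comp (T.continuous_shift r)
  have htr : ∀ r : ℝ, |r| < T.δ → toL2 (surfaceMeasure D)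
      (fun s => cliff B (T.nu s) (f (T.normalMap (s, r)))) = toL2 (surfaceMeasure D)
      fun s => cliff B (T.nu (T.normalMap (s, r))) (f (T.normalMap (s, r))) := fun r hr => by
    refine toL2_congr ?_
    filter_upwards [ae_mem_frontier] with s hs
    rw [T.normalMap_eq hs, T.nu_apply s hs r hr, T.nu_eq hs]
  have hr : |ε| < T.δ := by rwa [abs_of_pos hε0]
  refine Prod.ext ?_ (Prod.ext (funext fun j => ?_) (Prod.ext ?_ ?_))
  · exact mulOp_toL2_of_continuous hc1 hf.continuous
  · have hc2 := T.continuous_cliff_A B (stdVec j)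
    have h := (contDiff_partial hf (stdVec j)).continuous
    simp only [cliffJet, jet]
    rw [mulOp_toL2_of_continuous hc1 h, mulOp_toL2_of_continuous hc2 hf.continuous, ← toL2_add
      (memLp_of_continuous (hc1.clm_apply h)) (memLp_of_continuous (hc2.clm_apply hf.continuous))]
    congr 1
    funext x
    rw [hasFDerivAt_cliff B (T.hasFDerivAt_nu x) (hf.differentiable (by simp) x).hasFDerivAt,
      add_comm]
  · exact (mulOp_toL2_of_continuous hc1 (hs ε)).trans (htr ε hr)
  · exact (mulOp_toL2_of_continuous hc1 (hs (-ε))).trans (htr (-ε) (by rwa [abs_neg]))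

theorem dform_jet (hB : IsCliffordFamily B) (hε0 : 0 < ε) (hε : ε < T.δ / 2) {a b : E n → F}
    (ha : ContDiff ℝ ∞ a) (hb : ContDiff ℝ ∞ b) :
    dform _ B (T.jet ε a).2.1 (T.jet ε b).2.1
      = T.bdry ε fun x => ⟪a x, T.tangDirac B b x⟫_ℝ := by
  have h := fun v => (contDiff_partial ha v).continuous
  have h' := fun v => (contDiff_partial hb v).continuous
  have hd := (contDiff_diracGrad B ha).continuous
  have hd' := (contDiff_diracGrad B hb).continuous
  have hi : ∀ j, Continuous fun x => ⟪fderiv ℝ a x (stdVec j), fderiv ℝ b x (stdVec j)⟫_ℝ :=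
    fun j => (h _).inner (h' _)
  rw [← T.integral_dirac_sub hB ha hb hε0 hε, integral_sub
    (integrable_of_continuous (hd.inner hd'))
    (integrable_of_continuous (continuous_finsetSum _ fun j _ => hi j)),
    integral_finsetSum _ fun j _ => integrable_of_continuous (hi j), dform, T.diracL2_jet ha,
    T.diracL2_jet hb, inner_toL2 (memLp_of_continuous hd) (memLp_of_continuous hd')]
  congr 1
  exact Finset.sum_congr rfl fun j _ =>
    inner_toL2 (memLp_of_continuous (h _)) (memLp_of_continuous (h' _))

/-- Here `K` is moved to the first factor, where it commutes with the cutoff; the cutoff is `1` on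
the outer and `0` on the inner component. The result contains `b` only through its outer trace, so
for smooth `a` it extends to all jets in the second argument. -/
theorem dform_cutGrad (hB : IsCliffordFamily B) (hε0 : 0 < ε) (hε : ε < T.δ / 2) {a b : E n → F}
    (ha : ContDiff ℝ ∞ a) (hb : ContDiff ℝ ∞ b) :
    dform _ B (T.cutGrad ε (T.jet ε a)) (T.jet ε b).2.1 =
      T.levelIntegral (fun x => ⟪T.tangDirac B a x, b x⟫_ℝ) ε := by
  have hδ := T.δ_pos
  have hχa : ContDiff ℝ ∞ fun x => ((T.d x + ε) / (2 * ε)) • a x := (T.contDiff_cutoff ε).smul ha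
  have hK : ∀ x ∈ tubeSet D T.δ, T.tangDirac B (fun x => ((T.d x + ε) / (2 * ε)) • a x) x
      = ((T.d x + ε) / (2 * ε)) • T.tangDirac B a x := fun x hx =>
    T.tangDirac_smul hB ha (χ := fun x => (T.d x + ε) / (2 * ε)) hx
      (((T.hasFDerivAt_d hx).add_const ε).mul_const (2 * ε)⁻¹)
  have hr : |ε| < T.δ := by rw [abs_of_pos hε0]; linarith
  rw [T.cutGrad_jet (by linarith) ha, T.dform_jet hB hε0 hε hχa hb,
    T.bdry_tangDirac_comm hB hχa hb hε0 hε, bdry,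
    T.levelIntegral_congr (r := ε) (ψ' := fun x => ⟪T.tangDirac B a x, b x⟫_ℝ) hr,
    T.levelIntegral_congr (r := -ε) (ψ' := fun _ => 0) (by rwa [abs_neg])]
  · simp [levelIntegral]
  · intro x hx hd
    rw [hK x hx, hd]
    simp
  · intro x hx hd
    rw [hK x hx, hd, ← two_mul, div_self (by positivity), one_smul]

/-- The complementary piece: `K` stays on `b`, and `1 - χ` leaves only the inner component. Now `a`
enters through its trace alone, so the identity extends to all jets in the first argument. -/
theorem dform_sub_cutGrad (hB : IsCliffordFamily B) (hε0 : 0 < ε) (hε : ε < T.δ / 2)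
    {a b : E n → F} (ha : ContDiff ℝ ∞ a) (hb : ContDiff ℝ ∞ b) :
    dform _ B ((T.jet ε a).2.1 - T.cutGrad ε (T.jet ε a)) (T.jet ε b).2.1 =
      -T.levelIntegral (fun x => ⟪T.tangDirac B b x, a x⟫_ℝ) (-ε) := by
  have hδ := T.δ_pos
  have hχa : ContDiff ℝ ∞ fun x => ((T.d x + ε) / (2 * ε)) • a x := (T.contDiff_cutoff ε).smul ha
  have hr : |ε| < T.δ := by rw [abs_of_pos hε0]; linarith
  rw [dform_sub_left, T.cutGrad_jet (by linarith) ha, T.dform_jet hB hε0 hε hχa hb,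
    T.dform_jet hB hε0 hε ha hb, bdry, bdry,
    T.levelIntegral_congr (r := ε) (ψ := fun x => ⟪((T.d x + ε) / (2 * ε)) • a x,
      T.tangDirac B b x⟫_ℝ) (ψ' := fun x => ⟪a x, T.tangDirac B b x⟫_ℝ) hr,
    T.levelIntegral_congr (r := -ε) (ψ := fun x => ⟪((T.d x + ε) / (2 * ε)) • a x,
      T.tangDirac B b x⟫_ℝ) (ψ' := fun _ => 0) (by rwa [abs_neg])]
  · simp [levelIntegral, real_inner_comm (a _)]
  · intro x hx hd
    rw [hd]
    simp
  · intro x hx hd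
    rw [hd, ← two_mul, div_self (by positivity), one_smul]

/-- On the boundary `⟨B(ν) a, K B(ν) a⟩ + ⟨a, K a⟩ = h |a|²` pointwise, by `tangDirac_cliff` and
`B(ν)² = 1`; all derivatives cancel. -/
theorem dform_cliffJet_add (hB : IsCliffordFamily B) (hε0 : 0 < ε) (hε : ε < T.δ / 2)
    {a : E n → F} (ha : ContDiff ℝ ∞ a) :
    dform _ B (T.cliffJet B ε (T.jet ε a)).2.1 (T.cliffJet B ε (T.jet ε a)).2.1
      + dform _ B (T.jet ε a).2.1 (T.jet ε a).2.1 = T.curvTerm ε (T.jet ε a) := by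
  have hδ := T.δ_pos
  have hca := T.contDiff_cliff_nu B ha
  have hKa := (T.contDiff_tangDirac B ha).continuous
  have hKca := (T.contDiff_tangDirac B hca).continuous
  have hr : |ε| < T.δ := by rw [abs_of_pos hε0]; linarith
  rw [T.cliffJet_jet hε0 (by linarith) ha, T.dform_jet hB hε0 hε hca hca,
    T.dform_jet hB hε0 hε ha ha, T.curvTerm_jet ha, bdry, bdry, bdry, sub_add_sub_comm,
    ← T.levelIntegral_add (hca.continuous.inner hKca) (ha.continuous.inner hKa),
    ← T.levelIntegral_add (hca.continuous.inner hKca) (ha.continuous.inner hKa)]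
  have key : ∀ x ∈ tubeSet D T.δ,
      ⟪cliff B (T.nu x) (a x), T.tangDirac B (fun x => cliff B (T.nu x) (a x)) x⟫_ℝ
        + ⟪a x, T.tangDirac B a x⟫_ℝ = T.h x * ⟪a x, a x⟫_ℝ := fun x hx => by
    rw [T.tangDirac_cliff hB ha hx, inner_sub_right, hB.inner_cliff, hB.inner_cliff, map_smul,
      hB.cliff_cliff, hB.cliff_cliff, T.inner_nu_nu hx, one_smul, one_smul, real_inner_smul_right]
    ring
  rw [T.levelIntegral_congr hr fun x hx _ => key x hx,
    T.levelIntegral_congr (r := -ε) (by rwa [abs_neg]) fun x hx _ => key x hx]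

/-- The Dirac form and the Dirichlet form differ by a curvature term on the functions which satisfy
the infinite mass boundary conditions. -/
theorem two_mul_dform (hB : IsCliffordFamily B) (hε0 : 0 < ε) (hε : ε < T.δ / 2)
    {p : JetSpace D F ε} (hp : p ∈ T.jets F ε)
    (h1 : mulOp _ (fun x => cliff B (T.nu x)) p.2.2.1 = p.2.2.1)
    (h2 : mulOp _ (fun x => cliff B (T.nu x)) p.2.2.2 = -p.2.2.2) :
    2 * dform _ B p.2.1 p.2.1 = T.curvTerm ε p := by
  have hδ := T.δ_pos
  have hcl := T.continuous_cliffJet (B := B) (ε := ε)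
  have hcut := T.continuous_cutGrad (F := F) (ε := ε)
  have hsnd : Continuous fun p : JetSpace D F ε => p.2.1 := by fun_prop
  -- By the boundary conditions `z = B(ν) u + u` has zero inner trace and `v = B(ν) u - u` zero
  -- outer trace. As the form is symmetric, its value at `(z, v)` is its value at `B(ν) u` minus its
  -- value at `u`.
  have hz : T.cliffJet B ε p + p ∈ T.jets F ε :=
    T.map_mem_jets (Φ := fun p => T.cliffJet B ε p + p) (hcl.add continuous_id) (fun f hf =>
      ⟨_, (T.contDiff_cliff_nu B hf).add hf, by
        rw [T.cliffJet_jet hε0 (by linarith) hf, T.jet_add (T.contDiff_cliff_nu B hf) hf]⟩) hp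
  have hv : T.cliffJet B ε p - p ∈ T.jets F ε :=
    T.map_mem_jets (Φ := fun p => T.cliffJet B ε p - p) (hcl.sub continuous_id) (fun f hf =>
      ⟨_, (T.contDiff_cliff_nu B hf).sub hf, by
        rw [T.cliffJet_jet hε0 (by linarith) hf, T.jet_sub (T.contDiff_cliff_nu B hf) hf]⟩) hp
  set z := T.cliffJet B ε p + p with hzdef
  set v := T.cliffJet B ε p - p with hvdef
  have hz0 : z.2.2.2 = 0 := by simp [hzdef, cliffJet, h2]
  have hv0 : v.2.2.1 = 0 := by simp [hvdef, cliffJet, h1]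
  -- Two limits in succession: with smooth first argument the form is a pairing with the outer trace
  -- of `v`, which is zero; then the first argument is approximated.
  have s1 : dform _ B (T.cutGrad ε z) v.2.1 = 0 := by
    refine T.eq_of_mem_jets (Φ := fun z => dform _ B (T.cutGrad ε z) v.2.1) (Ψ := fun _ => 0)
      (continuous_dform hcut continuous_const) continuous_const (fun a ha => ?_) hz
    have hKa := (T.contDiff_tangDirac B ha).continuous
    have := T.eq_of_mem_jets (Φ := fun v => dform _ B (T.cutGrad ε (T.jet ε a)) v.2.1)
      (Ψ := fun v => ⟪toL2 (surfaceMeasure D) fun s => T.J s ε • T.tangDirac B a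
        (T.normalMap (s, ε)), v.2.2.1⟫_ℝ)
      (continuous_dform continuous_const hsnd) (by fun_prop)
      (fun b hb => by
        rw [T.dform_cutGrad hB hε0 hε ha hb, T.levelIntegral_inner hKa hb.continuous]
        rfl) hv
    simpa [hv0] using this
  -- The same with the roles exchanged: the smooth argument is the second one, and the inner trace
  -- of `z` vanishes.
  have s2 : dform _ B (z.2.1 - T.cutGrad ε z) v.2.1 = 0 := by
    refine T.eq_of_mem_jets (Φ := fun v => dform _ B (z.2.1 - T.cutGrad ε z) v.2.1)
      (Ψ := fun _ => 0) (continuous_dform continuous_const hsnd)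
      continuous_const (fun b hb => ?_) hv
    have hKb := (T.contDiff_tangDirac B hb).continuous
    have := T.eq_of_mem_jets (Φ := fun z => dform _ B (z.2.1 - T.cutGrad ε z) (T.jet ε b).2.1)
      (Ψ := fun z => -⟪toL2 (surfaceMeasure D) fun s => T.J s (-ε) • T.tangDirac B b
        (T.normalMap (s, -ε)), z.2.2.2⟫_ℝ)
      (continuous_dform (hsnd.sub hcut) continuous_const)
      (by fun_prop)
      (fun a ha => by
        rw [T.dform_sub_cutGrad hB hε0 hε ha hb, T.levelIntegral_inner hKb ha.continuous]
        rfl) hz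
    simpa [hz0] using this
  have s3 : dform _ B z.2.1 v.2.1 = 0 := by
    rw [dform_sub_left, s1, sub_zero] at s2
    exact s2
  have s4 : dform _ B z.2.1 v.2.1 = dform _ B (T.cliffJet B ε p).2.1 (T.cliffJet B ε p).2.1
      - dform _ B p.2.1 p.2.1 := dform_add_sub _ _
  have s5 : dform _ B (T.cliffJet B ε p).2.1 (T.cliffJet B ε p).2.1 + dform _ B p.2.1 p.2.1
      = T.curvTerm ε p := by
    refine T.eq_of_mem_jets (Φ := fun p => dform _ B (T.cliffJet B ε p).2.1
      (T.cliffJet B ε p).2.1 + dform _ B p.2.1 p.2.1) (Ψ := T.curvTerm ε) ?_ ?_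
      (fun a ha => T.dform_cliffJet_add hB hε0 hε ha) hp
    · exact (continuous_dform (hsnd.comp hcl) (hsnd.comp hcl)).add (continuous_dform hsnd hsnd)
    · unfold curvTerm
      fun_prop
  linarith

end Tube

end

end ThinShell

/-! ### Completion of the square in the normal direction, and the mass term. -/

namespace ThinShell

noncomputable section

section

variable {X F : Type*} [MeasurableSpace X] {μ : Measure X} [NormedAddCommGroup F]

theorem coeFn_sum {ι : Type*} (S : Finset ι) (u : ι → Lp F 2 μ) :
    (∑ i ∈ S, u i : Lp F 2 μ) =ᵐ[μ] fun x => ∑ i ∈ S, u i x := by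
  have h := toL2_sum S fun i => Lp.memLp (u i)
  simp only [toL2_coe] at h
  rw [← h]
  exact coeFn_toL2 (memLp_finsetSum S fun i _ => Lp.memLp (u i))

theorem integrable_norm_sq (u : Lp F 2 μ) : Integrable (fun x => ‖u x‖ ^ 2) μ :=
  (Lp.memLp u).integrable_norm_pow (by norm_num)

theorem norm_sq_eq_integral [InnerProductSpace ℝ F] (u : Lp F 2 μ) :
    ‖u‖ ^ 2 = ∫ x, ‖u x‖ ^ 2 ∂μ := by
  rw [← real_inner_self_eq_norm_sq, L2.inner_def]
  simp only [real_inner_self_eq_norm_sq]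

end

namespace Tube

variable {n : ℕ} {D : Set (E n)} {F : Type*} [NormedAddCommGroup F] [InnerProductSpace ℝ F]
  (T : Tube D) {B : Fin n → F →L[ℝ] F} {ε : ℝ}

/-- The derivative along the normals. -/
def normalDer (p : JetSpace D F ε) : Lp F 2 (volume.restrict (tubeSet D ε)) :=
  ∑ k, smulOp F _ (fun x => T.nu x k) (p.2.1 k)

/-- The tangential partial derivatives. -/
def tangDer (p : JetSpace D F ε) (j : Fin n) : Lp F 2 (volume.restrict (tubeSet D ε)) :=
  p.2.1 j - smulOp F _ (fun x => T.nu x j) (T.normalDer p)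

/-- The derivative of the mean curvature of the parallel surfaces along the normals. -/
def dh (x : E n) : ℝ := fderiv ℝ T.h x (T.nu x)

/-- The effective potential. -/
def potential (x : E n) : ℝ := T.h x ^ 2 / 4 + T.dh x / 2

theorem contDiff_dh : ContDiff ℝ ∞ T.dh :=
  (T.contDiff_h.fderiv_right (m := ∞) (by simp)).clm_apply T.contDiff_nu

theorem contDiff_potential : ContDiff ℝ ∞ T.potential :=
  ((T.contDiff_h.pow 2).div_const 4).add (T.contDiff_dh.div_const 2)

theorem continuous_normalDer : Continuous (T.normalDer (F := F) (ε := ε)) := by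
  unfold normalDer
  fun_prop

theorem continuous_tangDer : Continuous (T.tangDer (F := F) (ε := ε)) := by
  have := T.continuous_normalDer (F := F) (ε := ε)
  unfold tangDer
  fun_prop

/-- The integral of the squared trace, over both boundary components. -/
def bdryTerm (ε : ℝ) (p : JetSpace D F ε) : ℝ :=
  ⟪smulOp F _ (fun s => T.J s ε) p.2.2.1, p.2.2.1⟫_ℝ
    + ⟪smulOp F _ (fun s => T.J s (-ε)) p.2.2.2, p.2.2.2⟫_ℝ

section

variable [IsCompactMeasure (volume.restrict (tubeSet D ε))]

theorem continuous_nu_apply (j : Fin n) : Continuous fun x => T.nu x j :=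
  (T.contDiff_nu_apply j).continuous

theorem normalDer_jet {f : E n → F} (hf : ContDiff ℝ ∞ f) :
    T.normalDer (T.jet ε f) = toL2 _ fun x => fderiv ℝ f x (T.nu x) := by
  have h := fun v => (contDiff_partial hf v).continuous
  have h' : ∀ j, Continuous fun x => T.nu x j • fderiv ℝ f x (stdVec j) := fun j =>
    (T.continuous_nu_apply j).smul (h _)
  have e : (fun x => fderiv ℝ f x (T.nu x)) = fun x => ∑ j, T.nu x j • fderiv ℝ f x (stdVec j) :=
    funext fun x => clm_apply_eq_sum _ _
  rw [e, toL2_sum Finset.univ fun j => memLp_of_continuous (h' j)]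
  exact Finset.sum_congr rfl fun j _ => smulOp_toL2 (T.continuous_nu_apply j) (h _)

theorem coeFn_normalDer (p : JetSpace D F ε) :
    T.normalDer p =ᵐ[volume.restrict (tubeSet D ε)] fun x => ∑ k, T.nu x k • p.2.1 k x := by
  have h1 : ∀ k, smulOp F (volume.restrict (tubeSet D ε)) (fun x => T.nu x k) (p.2.1 k)
      =ᵐ[volume.restrict (tubeSet D ε)] fun x => T.nu x k • p.2.1 k x := fun k =>
    coeFn_mulOp (isBoundedField_smul_of_continuous (T.continuous_nu_apply k)) _
  have h2 := eventually_all.2 h1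
  unfold normalDer
  filter_upwards [coeFn_sum Finset.univ fun k => smulOp F (volume.restrict (tubeSet D ε))
    (fun x => T.nu x k) (p.2.1 k), h2] with x hx hx2
  rw [hx]
  exact Finset.sum_congr rfl fun k _ => hx2 k

theorem coeFn_tangDer (p : JetSpace D F ε) (j : Fin n) :
    T.tangDer p j =ᵐ[volume.restrict (tubeSet D ε)]
      fun x => p.2.1 j x - T.nu x j • ∑ k, T.nu x k • p.2.1 k x := by
  unfold tangDer
  filter_upwards [Lp.coeFn_sub (p.2.1 j) (smulOp F (volume.restrict (tubeSet D ε))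
    (fun x => T.nu x j) (T.normalDer p)), coeFn_mulOp (isBoundedField_smul_of_continuous
    (T.continuous_nu_apply j)) (T.normalDer p), T.coeFn_normalDer p] with x h1 h2 h3
  rw [h1, Pi.sub_apply, h2, h3]
  rfl

theorem sum_norm_sq_eq (hεδ : ε ≤ T.δ) (p : JetSpace D F ε) :
    ∑ j, ‖p.2.1 j‖ ^ 2 = ∑ j, ‖T.tangDer p j‖ ^ 2 + ‖T.normalDer p‖ ^ 2 := by
  simp only [norm_sq_eq_integral]
  rw [← integral_finsetSum _ fun j _ => integrable_norm_sq _,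
    ← integral_finsetSum _ fun j _ => integrable_norm_sq _, ← integral_add
      (integrable_finsetSum _ fun j _ => integrable_norm_sq _) (integrable_norm_sq _)]
  refine integral_congr_ae ?_
  filter_upwards [T.coeFn_normalDer p, eventually_all.2 (T.coeFn_tangDer p),
    ae_restrict_mem (T.isOpen_tubeSet hεδ).measurableSet] with x h1 h2 hx
  have hν := T.inner_nu_nu (T.tubeSet_eq hεδ ▸ hx).1
  rw [inner_eq_sum] at hν
  simp only [h1, h2]
  set N := ∑ k, T.nu x k • p.2.1 k x with hN
  have e : ∀ j, ‖p.2.1 j x - T.nu x j • N‖ ^ 2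
      = ‖p.2.1 j x‖ ^ 2 - 2 * ⟪T.nu x j • p.2.1 j x, N⟫_ℝ + T.nu x j * T.nu x j * ‖N‖ ^ 2 := by
    intro j
    rw [norm_sub_sq_real, norm_smul, mul_pow, Real.norm_eq_abs, sq_abs, real_inner_smul_right,
      real_inner_smul_left]
    ring
  simp only [e]
  rw [Finset.sum_add_distrib, Finset.sum_sub_distrib, ← Finset.sum_mul, hν, ← Finset.mul_sum,
    ← sum_inner, ← hN, real_inner_self_eq_norm_sq]
  ring

end

variable [IsCompactMeasure (surfaceMeasure D)] [IsCompactMeasure (volume.restrict (tubeSet D ε))]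

/-- The curvature term as an integral over the shell. -/
theorem curvTerm_eq (hε0 : 0 < ε) (hε : ε < T.δ / 2) {p : JetSpace D F ε} (hp : p ∈ T.jets F ε) :
    T.curvTerm ε p = ⟪smulOp F _ (fun x => T.h x ^ 2 + T.dh x) p.1, p.1⟫_ℝ
      + 2 * ⟪smulOp F _ T.h p.1, T.normalDer p⟫_ℝ := by
  have hδ := T.δ_pos
  have hnd := T.continuous_normalDer (F := F) (ε := ε)
  refine T.eq_of_mem_jets (Φ := T.curvTerm ε)
    (Ψ := fun p => ⟪smulOp F _ (fun x => T.h x ^ 2 + T.dh x) p.1, p.1⟫_ℝ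
      + 2 * ⟪smulOp F _ T.h p.1, T.normalDer p⟫_ℝ)
    (by unfold curvTerm; fun_prop) (by fun_prop) (fun f hf => ?_) hp
  have hφ : ContDiff ℝ ∞ fun x => T.h x * ⟪f x, f x⟫_ℝ := T.contDiff_h.mul (hf.inner ℝ hf)
  -- The field is `h |f|² ν`, with divergence `(h² + ∂_ν h) |f|² + 2 h ⟨f, ∂_ν f⟩`.
  have h := T.integral_div_tube (φ := fun j x => T.nu x j * (T.h x * ⟪f x, f x⟫_ℝ))
    (fun j => (T.contDiff_nu_apply j).mul hφ) hε0 hε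
  have hc1 : Continuous fun x => T.h x ^ 2 + T.dh x :=
    (T.contDiff_h.continuous.pow 2).add T.contDiff_dh.continuous
  have hc2 : Continuous fun x => (T.h x ^ 2 + T.dh x) • f x := hc1.smul hf.continuous
  have hc3 : Continuous fun x => T.h x • f x := T.contDiff_h.continuous.smul hf.continuous
  have hc4 : Continuous fun x => fderiv ℝ f x (T.nu x) :=
    (hf.continuous_fderiv (by simp)).clm_apply T.contDiff_nu.continuous
  rw [T.curvTerm_jet hf, T.normalDer_jet hf]
  have hj : (T.jet ε f).1 = toL2 _ f := rfl
  rw [hj, smulOp_toL2 hc1 hf.continuous, smulOp_toL2 T.contDiff_h.continuous hf.continuous,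
    inner_toL2 (memLp_of_continuous hc2) (memLp_of_continuous hf.continuous),
    inner_toL2 (memLp_of_continuous hc3) (memLp_of_continuous hc4), ← integral_const_mul,
    ← integral_add (integrable_of_continuous (hc2.inner hf.continuous))
      ((integrable_of_continuous (hc3.inner hc4)).const_mul 2)]
  have hr : |ε| < T.δ := by rw [abs_of_pos hε0]; linarith
  -- The extended field `ν` is known to have length `1` only inside the tube, so `∑ ν_j² = 1` is
  -- used on the two level surfaces alone.
  have hb : T.bdry ε (fun x => T.h x * ⟪f x, f x⟫_ℝ)
      = T.bdry ε fun x => ∑ j, T.nu x j * (T.nu x j * (T.h x * ⟪f x, f x⟫_ℝ)) := by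
    have key : ∀ x ∈ tubeSet D T.δ, T.h x * ⟪f x, f x⟫_ℝ
        = ∑ j, T.nu x j * (T.nu x j * (T.h x * ⟪f x, f x⟫_ℝ)) := fun x hx => by
      have := T.inner_nu_nu hx
      rw [inner_eq_sum] at this
      simp only [← mul_assoc]
      rw [← Finset.sum_mul, ← Finset.sum_mul, this, one_mul]
    rw [bdry, bdry, T.levelIntegral_congr hr fun x hx _ => key x hx,
      T.levelIntegral_congr (r := -ε) (by rwa [abs_neg]) fun x hx _ => key x hx]
  rw [hb, ← h]
  congr 1
  funext x
  have hνj : ∀ j, HasFDerivAt (fun x => T.nu x j)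
      ((EuclideanSpace.proj j : E n →L[ℝ] ℝ) ∘L T.A x) x := fun j =>
    (EuclideanSpace.proj j : E n →L[ℝ] ℝ).hasFDerivAt.comp x (T.hasFDerivAt_nu x)
  have hf' := (hf.differentiable (by simp) x).hasFDerivAt
  have hh' := (T.contDiff_h.differentiable (by simp) x).hasFDerivAt
  have e : ∀ j, fderiv ℝ (fun x => T.nu x j * (T.h x * ⟪f x, f x⟫_ℝ)) x (stdVec j)
      = T.A x (stdVec j) j * (T.h x * ⟪f x, f x⟫_ℝ)
        + T.nu x j • (fderiv ℝ (fun x => T.h x * ⟪f x, f x⟫_ℝ) x (stdVec j)) := fun j => by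
    have h1 : HasFDerivAt (fun x => T.nu x j * (T.h x * ⟪f x, f x⟫_ℝ)) _ x :=
      (hνj j).mul (hφ.differentiable (by simp) x).hasFDerivAt
    rw [h1.fderiv]
    simp
    ring
  have e2 : fderiv ℝ (fun x => T.h x * ⟪f x, f x⟫_ℝ) x (T.nu x)
      = T.dh x * ⟪f x, f x⟫_ℝ + T.h x * (2 * ⟪f x, fderiv ℝ f x (T.nu x)⟫_ℝ) := by
    have h1 : HasFDerivAt (fun x => T.h x * ⟪f x, f x⟫_ℝ) _ x := hh'.mul (hf'.inner ℝ hf')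
    rw [h1.fderiv]
    simp [real_inner_comm (f x), dh]
    ring
  simp only [e, Finset.sum_add_distrib]
  rw [← clm_apply_eq_sum, e2, ← Finset.sum_mul, ← T.h_eq_sum]
  simp only [real_inner_smul_left]
  ring

/-- The quadratic form of the massless Dirac operator. -/
theorem norm_diracL2_sq (hB : IsCliffordFamily B) (hε0 : 0 < ε) (hε : ε < T.δ / 2)
    {p : JetSpace D F ε} (hp : p ∈ T.jets F ε)
    (h1 : mulOp _ (fun x => cliff B (T.nu x)) p.2.2.1 = p.2.2.1)
    (h2 : mulOp _ (fun x => cliff B (T.nu x)) p.2.2.2 = -p.2.2.2) :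
    ‖diracL2 _ B p.2.1‖ ^ 2 = ∑ j, ‖T.tangDer p j‖ ^ 2
      + ‖T.normalDer p + (1 / 2 : ℝ) • smulOp F _ T.h p.1‖ ^ 2
      + ⟪smulOp F _ T.potential p.1, p.1⟫_ℝ := by
  have hδ := T.δ_pos
  have e1 := T.two_mul_dform hB hε0 hε hp h1 h2
  rw [T.curvTerm_eq hε0 hε hp, dform, real_inner_self_eq_norm_sq] at e1
  simp only [real_inner_self_eq_norm_sq] at e1
  rw [T.sum_norm_sq_eq (by linarith) p] at e1
  have hh := T.contDiff_h.continuous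
  have hp1 : Continuous fun x => T.h x ^ 2 / 4 + T.dh x / 2 := T.contDiff_potential.continuous
  have hq : Continuous fun x => T.h x ^ 2 / 4 := (hh.pow 2).div_const 4
  -- `h² + ∂_ν h` is twice the potential plus `h²/2`; after halving, the remainder `h²/4` completes
  -- the square of `∂_ν u` with the cross term `h ⟨u, ∂_ν u⟩`.
  have e2 : ⟪smulOp F _ (fun x => T.h x ^ 2 + T.dh x) p.1, p.1⟫_ℝ
      = 2 * ⟪smulOp F _ T.potential p.1, p.1⟫_ℝ + (1 / 2) * ‖smulOp F _ T.h p.1‖ ^ 2 := by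
    have f1 : smulOp F (volume.restrict (tubeSet D ε)) (fun x => T.h x ^ 2 + T.dh x) p.1
        = (2 : ℝ) • smulOp F _ T.potential p.1
          + (1 / 2 : ℝ) • smulOp F _ T.h (smulOp F _ T.h p.1) := by
      refine Lp.ext ?_
      filter_upwards [coeFn_mulOp (isBoundedField_smul_of_continuous (F := F)
        ((hh.pow 2).add T.contDiff_dh.continuous)) p.1,
        coeFn_mulOp (isBoundedField_smul_of_continuous hp1) p.1,
        coeFn_mulOp (isBoundedField_smul_of_continuous hh) p.1,
        coeFn_mulOp (isBoundedField_smul_of_continuous hh) (smulOp F _ T.h p.1),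
        Lp.coeFn_add ((2 : ℝ) • smulOp F (volume.restrict (tubeSet D ε)) T.potential p.1)
          ((1 / 2 : ℝ) • smulOp F _ T.h (smulOp F _ T.h p.1)),
        Lp.coeFn_smul (2 : ℝ) (smulOp F (volume.restrict (tubeSet D ε)) T.potential p.1),
        Lp.coeFn_smul (1 / 2 : ℝ) (smulOp F (volume.restrict (tubeSet D ε)) T.h
          (smulOp F _ T.h p.1))] with x g1 g2 g3 g4 g5 g6 g7
      rw [g5, Pi.add_apply, g6, g7, Pi.smul_apply, Pi.smul_apply, g4, g3]
      refine g1.trans ?_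
      have g2' : (smulOp F (volume.restrict (tubeSet D ε)) T.potential p.1) x
          = (T.h x ^ 2 / 4 + T.dh x / 2) • p.1 x := g2
      rw [g2']
      simp only [smul_apply, ContinuousLinearMap.id_apply, smul_smul, ← add_smul, Pi.add_apply,
        Pi.pow_apply]
      congr 1
      ring
    have f2 : ⟪smulOp F _ T.h (smulOp F _ T.h p.1), p.1⟫_ℝ = ‖smulOp F _ T.h p.1‖ ^ 2 := by
      rw [← real_inner_self_eq_norm_sq, L2.inner_def, L2.inner_def]
      refine integral_congr_ae ?_
      filter_upwards [coeFn_mulOp (isBoundedField_smul_of_continuous hh) p.1,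
        coeFn_mulOp (isBoundedField_smul_of_continuous hh) (smulOp F _ T.h p.1)] with x g1 g2
      rw [g2, g1]
      simp only [smul_apply, ContinuousLinearMap.id_apply, real_inner_smul_left,
        real_inner_smul_right]
    rw [f1, inner_add_left, real_inner_smul_left, real_inner_smul_left, f2]
  rw [e2] at e1
  rw [norm_add_sq_real, real_inner_smul_right, norm_smul, mul_pow, real_inner_comm]
  norm_num
  linarith

/-- The boundary term of the mass. -/
theorem two_mul_inner_diracL2 (hB : IsCliffordFamily B) (hε0 : 0 < ε) (hε : ε < T.δ / 2)
    {p : JetSpace D F ε} (hp : p ∈ T.jets F ε)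
    (h1 : mulOp _ (fun x => cliff B (T.nu x)) p.2.2.1 = p.2.2.1)
    (h2 : mulOp _ (fun x => cliff B (T.nu x)) p.2.2.2 = -p.2.2.2) :
    2 * ⟪diracL2 _ B p.2.1, p.1⟫_ℝ = T.bdryTerm ε p := by
  have hδ := T.δ_pos
  have hd := continuous_diracL2 (μ := volume.restrict (tubeSet D ε)) (B := B)
  -- This identity holds for all jets. Only afterwards are the boundary conditions inserted; the
  -- sign `-1` on the inner component cancels the sign of the divergence theorem, and both
  -- components contribute positively.
  have key : 2 * ⟪diracL2 _ B p.2.1, p.1⟫_ℝ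
      = ⟪smulOp F _ (fun s => T.J s ε) p.2.2.1, mulOp _ (fun x => cliff B (T.nu x)) p.2.2.1⟫_ℝ
        - ⟪smulOp F _ (fun s => T.J s (-ε)) p.2.2.2,
          mulOp _ (fun x => cliff B (T.nu x)) p.2.2.2⟫_ℝ := by
    refine T.eq_of_mem_jets (Φ := fun p => 2 * ⟪diracL2 _ B p.2.1, p.1⟫_ℝ)
      (Ψ := fun p => ⟪smulOp F _ (fun s => T.J s ε) p.2.2.1,
        mulOp _ (fun x => cliff B (T.nu x)) p.2.2.1⟫_ℝ
        - ⟪smulOp F _ (fun s => T.J s (-ε)) p.2.2.2,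
          mulOp _ (fun x => cliff B (T.nu x)) p.2.2.2⟫_ℝ) (by fun_prop) (by fun_prop)
      (fun f hf => ?_) hp
    have hφ : ∀ j, ContDiff ℝ ∞ fun x => B j (f x) := fun j => (B j).contDiff.comp hf
    have h := T.integral_div_tube (φ := fun j x => ⟪f x, B j (f x)⟫_ℝ)
      (fun j => hf.inner ℝ (hφ j)) hε0 hε
    have hdg := (contDiff_diracGrad B hf).continuous
    rw [T.diracL2_jet hf]
    have hj : (T.jet ε f).1 = toL2 _ f := rfl
    rw [hj, inner_toL2 (memLp_of_continuous hdg) (memLp_of_continuous hf.continuous)]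
    have key : ∀ r : ℝ, |r| < T.δ → ⟪smulOp F _ (fun s => T.J s r)
        (toL2 (surfaceMeasure D) fun s => f (T.normalMap (s, r))),
        mulOp _ (fun x => cliff B (T.nu x))
        (toL2 (surfaceMeasure D) fun s => f (T.normalMap (s, r)))⟫_ℝ
        = T.levelIntegral (fun x => ∑ j, T.nu x j * ⟪f x, B j (f x)⟫_ℝ) r := fun r hr => by
      have h1 : Continuous fun s => f (T.normalMap (s, r)) :=
        hf.continuous.comp (T.continuous_shift r)
      have h3 : Continuous fun s => T.J s r • f (T.normalMap (s, r)) :=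
        (T.continuous_J_left r).smul h1
      have h4 : Continuous fun s => cliff B (T.nu s) (f (T.normalMap (s, r))) :=
        (T.continuous_cliff_nu B).clm_apply h1
      rw [smulOp_toL2 (T.continuous_J_left r) h1,
        mulOp_toL2_of_continuous (T.continuous_cliff_nu B) h1,
        inner_toL2 (memLp_of_continuous h3) (memLp_of_continuous h4), levelIntegral]
      refine integral_congr_ae ?_
      filter_upwards [ae_mem_frontier] with s hs
      rw [T.normalMap_eq hs, T.nu_apply s hs r hr, T.nu_eq hs, cliff_apply, inner_sum,
        Finset.mul_sum]
      refine Finset.sum_congr rfl fun j _ => ?_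
      rw [real_inner_smul_left, real_inner_smul_right]
    have hr : |ε| < T.δ := by rw [abs_of_pos hε0]; linarith
    refine Eq.trans ?_ (congrArg₂ (· - ·) (key ε hr) (key (-ε) (by rwa [abs_neg]))).symm
    refine Eq.trans ?_ h
    rw [← integral_const_mul]
    congr 1
    funext x
    have h3 : ∀ j, fderiv ℝ (fun x => ⟪f x, B j (f x)⟫_ℝ) x (stdVec j)
        = 2 * ⟪B j (fderiv ℝ f x (stdVec j)), f x⟫_ℝ := fun j => by
      have hf' := (hf.differentiable (by simp) x)
      have hBf : HasFDerivAt (fun x => B j (f x)) (B j ∘L fderiv ℝ f x) x :=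
        (B j).hasFDerivAt.comp x hf'.hasFDerivAt
      rw [fderiv_inner_apply ℝ hf' hBf.differentiableAt, hBf.fderiv, ← hB.symm,
        real_inner_comm]
      simp only [ContinuousLinearMap.comp_apply]
      ring
    simp only [h3, diracGrad, sum_inner, Finset.mul_sum]
  rw [key, h1, h2, bdryTerm, inner_neg_right]
  ring

end Tube

end

end ThinShell

/-! ### Weak derivatives on the cylinder. -/

namespace ThinShell

noncomputable section

section IntegralContinuity

variable {X F : Type*} [MeasurableSpace X] [TopologicalSpace X] {μ : Measure X}
  [NormedAddCommGroup F] [hμ : IsCompactMeasure μ]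

theorem integrable_of_L2 (w : Lp F 2 μ) : Integrable w μ := by
  have : IsFiniteMeasure μ := ⟨hμ.lt_top⟩
  exact (Lp.memLp w).integrable (by norm_num)

variable [NormedSpace ℝ F]

variable (μ F) in
theorem continuous_integral_L2 : Continuous fun w : Lp F 2 μ => ∫ x, w x ∂μ := by
  have : IsFiniteMeasure μ := ⟨hμ.lt_top⟩
  let L : Lp F 2 μ →ₗ[ℝ] F :=
    { toFun := fun w => ∫ x, w x ∂μ
      map_add' := fun u v => by
        rw [← integral_add (integrable_of_L2 u) (integrable_of_L2 v)]
        exact integral_congr_ae (Lp.coeFn_add u v)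
      map_smul' := fun c u => by
        rw [RingHom.id_apply, ← integral_smul]
        exact integral_congr_ae (Lp.coeFn_smul c u) }
  refine (L.mkContinuousOfExistsBound ⟨(μ univ ^ (1 - 1 / 2 : ℝ)).toReal, fun w => ?_⟩).continuous
  have h1 := eLpNorm_le_eLpNorm_mul_rpow_measure_univ (p := 1) (q := 2) (by norm_num)
    (Lp.aestronglyMeasurable w)
  have hfin : μ univ ^ (1 / (1 : ℝ≥0∞).toReal - 1 / (2 : ℝ≥0∞).toReal) ≠ ⊤ :=
    ENNReal.rpow_ne_top_of_nonneg (by norm_num) hμ.lt_top.ne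
  have h2 := ENNReal.toReal_mono (ENNReal.mul_ne_top (Lp.eLpNorm_ne_top w) hfin) h1
  rw [ENNReal.toReal_mul, ← Lp.norm_def, mul_comm] at h2
  refine le_trans ?_ (h2.trans (le_of_eq ?_))
  · refine (norm_integral_le_integral_norm _).trans (le_of_eq ?_)
    rw [integral_norm_eq_lintegral_enorm (Lp.aestronglyMeasurable w), eLpNorm_one_eq_lintegral_enorm]
  · norm_num

variable [OpensMeasurableSpace X] [SecondCountableTopology X]

theorem integral_smulOp {c : X → ℝ} (hc : Continuous c) (w : Lp F 2 μ) :
    ∫ x, smulOp F μ c w x ∂μ = ∫ x, c x • w x ∂μ :=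
  integral_congr_ae (coeFn_mulOp (isBoundedField_smul_of_continuous hc) w)

theorem continuous_integral_smul {c : X → ℝ} (hc : Continuous c) :
    Continuous fun w : Lp F 2 μ => ∫ x, c x • w x ∂μ := by
  simp only [← integral_smulOp hc]
  exact (continuous_integral_L2 F μ).comp (smulOp F μ c).continuous

theorem integrable_smul_L2 {c : X → ℝ} (hc : Continuous c) (w : Lp F 2 μ) :
    Integrable (fun x => c x • w x) μ :=
  (integrable_of_L2 (smulOp F μ c w)).congr
    (coeFn_mulOp (isBoundedField_smul_of_continuous hc) w)

theorem integral_smul_toL2 {c : X → ℝ} {f : X → F} (hf : Continuous f) :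
    ∫ x, c x • toL2 μ f x ∂μ = ∫ x, c x • f x ∂μ := by
  refine integral_congr_ae ?_
  filter_upwards [coeFn_toL2 (memLp_of_continuous (μ := μ) hf)] with x hx
  rw [hx]

end IntegralContinuity

section Cylinder

variable {n N : ℕ} {D : Set (E n)} {F : Type*} [NormedAddCommGroup F]

theorem ae_mem_cyl [IsFiniteMeasure (surfaceMeasure D)] :
    ∀ᵐ p ∂(cylMeasure D), p.1 ∈ frontier D ∧ p.2 ∈ Ioo (-1 : ℝ) 1 := ae_mem_prod measurableSet_Ioo

variable [NormedSpace ℝ F]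

theorem hasFDerivAt_fst {k : E n × ℝ → F} (hk : ContDiff ℝ ∞ k) (y : E n) (t : ℝ) :
    HasFDerivAt (fun y => k (y, t)) (fderiv ℝ k (y, t) ∘L ContinuousLinearMap.inl ℝ (E n) ℝ) y := by
  have h1 : HasFDerivAt (fun y : E n => (y, t)) (ContinuousLinearMap.inl ℝ (E n) ℝ) y :=
    hasFDerivAt_prodMk_left y t
  exact (hk.differentiable (by simp) (y, t)).hasFDerivAt.comp y h1

theorem fderiv_fst {k : E n × ℝ → F} (hk : ContDiff ℝ ∞ k) (p : E n × ℝ) (v : E n) :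
    fderiv ℝ (fun y => k (y, p.2)) p.1 v = fderiv ℝ k p (v, 0) := by
  rw [(hasFDerivAt_fst hk p.1 p.2).fderiv]
  simp

theorem deriv_snd {k : E n × ℝ → F} (hk : ContDiff ℝ ∞ k) (p : E n × ℝ) :
    deriv (fun t => k (p.1, t)) p.2 = fderiv ℝ k p (0, 1) :=
  (hasDerivAt_snd hk p.1 p.2).deriv

theorem contDiff_fderiv_fst {k : E n × ℝ → F} (hk : ContDiff ℝ ∞ k) {v : E n × ℝ → E n}
    (hv : ContDiff ℝ ∞ v) : ContDiff ℝ ∞ fun p => fderiv ℝ k p (v p, 0) :=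
  (hk.fderiv_right (m := ∞) (by simp)).clm_apply (hv.prodMk contDiff_const)

theorem contDiff_slice {k : E n × ℝ → F} (hk : ContDiff ℝ ∞ k) (t : ℝ) :
    ContDiff ℝ ∞ fun y => k (y, t) := hk.comp (contDiff_id.prodMk contDiff_const)

/-- The tangential part of the `j`-th canonical basis vector. -/
def Tube.tangVec (T : Tube D) (j : Fin n) (x : E n) : E n := stdVec j - T.nu x j • T.nu x

theorem Tube.contDiff_tangVec (T : Tube D) (j : Fin n) : ContDiff ℝ ∞ (T.tangVec j) :=
  contDiff_const.sub ((T.contDiff_nu_apply j).smul T.contDiff_nu)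

theorem Tube.inner_tangVec (T : Tube D) (j : Fin n) {x : E n} (hx : x ∈ tubeSet D T.δ) :
    ⟪T.tangVec j x, T.nu x⟫_ℝ = 0 := by
  rw [tangVec, inner_sub_left, real_inner_smul_left, T.inner_nu_nu hx, stdVec,
    EuclideanSpace.inner_single_left]
  simp

/-- The components of the surface gradient of a smooth function. -/
def Tube.gradTan (T : Tube D) (W : E n × ℝ → F) (j : Fin n)
    (p : E n × ℝ) : F := fderiv ℝ W p (T.tangVec j p.1, 0)

theorem Tube.contDiff_gradTan (T : Tube D)
    {W : E n × ℝ → F} (hW : ContDiff ℝ ∞ W) (j : Fin n) : ContDiff ℝ ∞ (T.gradTan W j) :=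
  contDiff_fderiv_fst hW ((T.contDiff_tangVec j).comp contDiff_fst)

/-- The tangential divergence of a smooth vector field. -/
def Tube.tangDiv (T : Tube D) (X : E n × ℝ → E n) (p : E n × ℝ) : ℝ :=
  (∑ j, fderiv ℝ X p (stdVec j, 0) j) - ⟪fderiv ℝ X p (T.nu p.1, 0), T.nu p.1⟫_ℝ

theorem Tube.continuous_tangDiv (T : Tube D) {X : E n × ℝ → E n} (hX : ContDiff ℝ ∞ X) :
    Continuous (T.tangDiv X) := by
  have hXν := contDiff_fderiv_fst hX (v := fun p => T.nu p.1) (T.contDiff_nu.comp contDiff_fst)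
  refine Continuous.sub (continuous_finsetSum _ fun j _ => ?_)
    (hXν.continuous.inner (T.contDiff_nu.continuous.comp continuous_fst))
  exact (contDiff_euclidean.1 (contDiff_fderiv_fst hX (v := fun _ => stdVec j) contDiff_const)
    j).continuous

theorem Tube.surfDiv_eq (T : Tube D) {X : E n × ℝ → E n} (hX : ContDiff ℝ ∞ X) {p : E n × ℝ}
    (hp : p.1 ∈ frontier D) : surfDiv D X p = T.tangDiv X p := by
  rw [surfDiv, ← T.nu_eq hp]
  simp only [fderiv_fst hX]
  rfl

variable [IsFiniteMeasure (surfaceMeasure D)] [CompleteSpace F]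

/-- The fundamental theorem of calculus along the cylinder. -/
theorem integral_cyl_dt (hc : IsCompact (frontier D)) {k : E n × ℝ → F} (hk : ContDiff ℝ ∞ k) :
    ∫ p, fderiv ℝ k p (0, 1) ∂(cylMeasure D)
      = ∫ s, k (s, 1) ∂(surfaceMeasure D) - ∫ s, k (s, -1) ∂(surfaceMeasure D) := by
  have hk' := (contDiff_deriv_snd hk).continuous
  rw [cylMeasure, integral_prod_symm _ (integrable_prod hc hk' (-1) 1),
    ← integral_Ioc_eq_integral_Ioo, ← intervalIntegral.integral_of_le (by norm_num)]
  exact intervalIntegral.integral_eq_sub_of_hasDerivAt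
    (fun r _ => hasDerivAt_surface_integral hc hk r)
    ((continuous_surface_integral hc hk').intervalIntegrable _ _)

end Cylinder

section Uniqueness

variable {n N : ℕ} {D : Set (E n)} [IsFiniteMeasure (surfaceMeasure D)]
  [IsCompactMeasure (cylMeasure D)]

theorem L2Cyl_eq_of_test {g g' : L2Cyl n N D}
    (h : ∀ ψ : E n × ℝ → ℝ, ContDiff ℝ ∞ ψ → HasCompactSupport ψ →
      tsupport ψ ⊆ univ ×ˢ Ioo (-1 : ℝ) 1 →
      ∫ p, ψ p • g p ∂(cylMeasure D) = ∫ p, ψ p • g' p ∂(cylMeasure D)) : g = g' := by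
  have h0 : ∀ᵐ p ∂(cylMeasure D), p ∈ univ ×ˢ Ioo (-1 : ℝ) 1 → g p - g' p = 0 := by
    refine (isOpen_univ.prod isOpen_Ioo).ae_eq_zero_of_integral_contDiff_smul_eq_zero
      (((integrable_of_L2 g).sub (integrable_of_L2 g')).locallyIntegrable.locallyIntegrableOn _)
      fun ψ hψ hψc hψs => ?_
    simp only [smul_sub]
    rw [integral_sub (integrable_smul_L2 hψ.continuous g) (integrable_smul_L2 hψ.continuous g'),
      h ψ hψ hψc hψs, sub_self]
  refine Lp.ext ?_
  filter_upwards [h0, ae_mem_cyl (D := D)] with p hp hp'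
  exact sub_eq_zero.1 (hp ⟨mem_univ _, hp'.2⟩)

theorem IsWeakDt.unique {w h h' : L2Cyl n N D} (hh : IsWeakDt w h) (hh' : IsWeakDt w h') :
    h = h' :=
  L2Cyl_eq_of_test fun ψ h1 h2 h3 => neg_injective ((hh ψ h1 h2 h3).symm.trans (hh' ψ h1 h2 h3))

theorem weakDt_eq {w h : L2Cyl n N D} (hh : IsWeakDt w h) : weakDt w = h := by
  have hex : ∃ h, IsWeakDt w h := ⟨h, hh⟩
  rw [weakDt, dif_pos hex]
  exact hex.choose_spec.unique hh

/-- Test fields `ψ (e_j - ν_j ν)` are tangent, and tangency of the gradient itself cancels the term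
with `ν_j ν`. So the pairing isolates the `j`-th component. -/
theorem IsWeakSurfGrad.unique (T : Tube D) {w : L2Cyl n N D} {G G' : Fin n → L2Cyl n N D}
    (hG : IsWeakSurfGrad w G) (hG' : IsWeakSurfGrad w G') : G = G' := by
  funext j
  refine L2Cyl_eq_of_test fun ψ h1 h2 h3 => ?_
  let X : E n × ℝ → E n := fun p => ψ p • T.tangVec j p.1
  have hX : ContDiff ℝ ∞ X := h1.smul ((T.contDiff_tangVec j).comp contDiff_fst)
  have hXc : HasCompactSupport X := h2.smul_right
  have hXs : tsupport X ⊆ univ ×ˢ Ioo (-1 : ℝ) 1 := (tsupport_smul_subset_left ψ _).trans h3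
  have hXt : ∀ p : E n × ℝ, p.1 ∈ frontier D → ⟪X p, outerNormal D p.1⟫_ℝ = 0 := fun p hp => by
    rw [← T.nu_eq hp, real_inner_smul_left, T.inner_tangVec j (T.frontier_subset hp), mul_zero]
  have key : ∀ G : Fin n → L2Cyl n N D,
      (∀ᵐ p ∂(cylMeasure D), ∑ k, outerNormal D p.1 k • G k p = 0) →
      ∫ p, ∑ k, X p k • G k p ∂(cylMeasure D) = ∫ p, ψ p • G j p ∂(cylMeasure D) := by
    intro G hGt
    refine integral_congr_ae ?_
    filter_upwards [hGt, ae_mem_cyl (D := D)] with p hp hp'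
    rw [← T.nu_eq hp'.1] at hp
    have e : ∀ k, X p k • G k p
        = ψ p • ((stdVec j : E n) k • G k p - T.nu p.1 j • (T.nu p.1 k • G k p)) := fun k => by
      simp only [X, Tube.tangVec, PiLp.smul_apply, PiLp.sub_apply, smul_eq_mul, smul_sub,
        smul_smul, ← sub_smul]
      congr 1
      ring
    simp only [e]
    rw [← Finset.smul_sum, Finset.sum_sub_distrib, ← Finset.smul_sum, hp, smul_zero, sub_zero]
    congr 1
    simp [stdVec]
  rw [← key G hG.1, ← key G' hG'.1]
  exact neg_injective ((hG.2 X hX hXc hXs hXt).symm.trans (hG'.2 X hX hXc hXs hXt))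

theorem surfGrad_eq (T : Tube D) {w : L2Cyl n N D} {G : Fin n → L2Cyl n N D}
    (hG : IsWeakSurfGrad w G) : surfGrad w = G := by
  have hex : ∃ G, IsWeakSurfGrad w G := ⟨G, hG⟩
  rw [surfGrad, dif_pos hex]
  exact hex.choose_spec.unique T hG

end Uniqueness

section Smooth

variable {n N : ℕ} {D : Set (E n)} (T : Tube D)

theorem Tube.classicalSurfGrad_eq {W : E n × ℝ → Spinor N} (hW : ContDiff ℝ ∞ W) (j : Fin n)
    {p : E n × ℝ} (hp : p.1 ∈ frontier D) : classicalSurfGrad D W j p = T.gradTan W j p := by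
  rw [classicalSurfGrad, ← T.nu_eq hp, fderiv_fst hW]
  rfl

variable [IsFiniteMeasure (surfaceMeasure D)] [IsCompactMeasure (cylMeasure D)]

theorem Tube.isWeakDt_smooth (T : Tube D) {W : E n × ℝ → Spinor N} (hW : ContDiff ℝ ∞ W) :
    IsWeakDt (D := D) (toL2 _ W) (toL2 _ fun p => fderiv ℝ W p (0, 1)) := by
  intro ψ h1 h2 h3
  have hW' := (contDiff_deriv_snd hW).continuous
  have hψ' := (contDiff_deriv_snd h1).continuous
  rw [integral_smul_toL2 hW.continuous, integral_smul_toL2 hW']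
  have hk : ContDiff ℝ ∞ fun p => ψ p • W p := h1.smul hW
  have h := integral_cyl_dt (D := D) T.isCompact_frontier hk
  have hz : ∀ s : E n, ∀ t : ℝ, t ∉ Ioo (-1 : ℝ) 1 → ψ (s, t) = 0 := fun s t ht =>
    image_eq_zero_of_notMem_tsupport fun hmem => ht (h3 hmem).2
  have e : ∀ p, fderiv ℝ (fun p => ψ p • W p) p (0, 1)
      = ψ p • fderiv ℝ W p (0, 1) + fderiv ℝ ψ p (0, 1) • W p := fun p => by
    have h1 : HasFDerivAt (fun p => ψ p • W p) _ p :=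
      (h1.differentiable (by simp) p).hasFDerivAt.smul (hW.differentiable (by simp) p).hasFDerivAt
    rw [h1.fderiv]
    simp
  have c1 : Continuous fun p => ψ p • fderiv ℝ W p (0, 1) := h1.continuous.smul hW'
  have c2 : Continuous fun p => fderiv ℝ ψ p (0, 1) • W p := hψ'.smul hW.continuous
  simp only [e, hz _ 1 (by simp), hz _ (-1) (by simp), zero_smul, integral_zero, sub_zero] at h
  rw [integral_add (integrable_of_continuous c1) (integrable_of_continuous c2)] at h
  simp only [deriv_snd h1]
  exact eq_neg_of_add_eq_zero_right h

/-- On each slice the divergence theorem on `∂D` is applied to the functions `X_j W`. The terms with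
`h` and with `∂_ν W` carry the factor `⟨X, ν⟩ = 0`; what remains is `⟨∂_ν X, ν⟩ W`, exactly the
correction in the surface divergence. -/
theorem Tube.isWeakSurfGrad_smooth {W : E n × ℝ → Spinor N} (hW : ContDiff ℝ ∞ W) :
    IsWeakSurfGrad (D := D) (toL2 _ W) fun j => toL2 _ (T.gradTan W j) := by
  have hG : ∀ j, (toL2 (cylMeasure D) (T.gradTan W j)) =ᵐ[cylMeasure D] T.gradTan W j := fun j =>
    coeFn_toL2 (memLp_of_continuous (T.contDiff_gradTan hW j).continuous)
  have hsum : ∀ p : E n × ℝ, ∀ v : E n, ∑ j, v j • T.gradTan W j p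
      = fderiv ℝ W p (v, 0) - ⟪v, T.nu p.1⟫_ℝ • fderiv ℝ W p (T.nu p.1, 0) := fun p v => by
    have e : ∀ j, T.gradTan W j p
        = fderiv ℝ W p (stdVec j, 0) - T.nu p.1 j • fderiv ℝ W p (T.nu p.1, 0) := fun j => by
      have : (T.tangVec j p.1, (0 : ℝ))
          = ((stdVec j : E n), (0 : ℝ)) - T.nu p.1 j • (T.nu p.1, (0 : ℝ)) := by
        simp [tangVec]
      rw [gradTan, this, map_sub, map_smul]
    simp only [e, smul_sub, smul_smul]
    rw [Finset.sum_sub_distrib, ← Finset.sum_smul, ← inner_eq_sum]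
    congr 1
    exact (clm_apply_eq_sum (fderiv ℝ W p ∘L ContinuousLinearMap.inl ℝ (E n) ℝ) v).symm
  refine ⟨?_, fun X h1 h2 h3 h4 => ?_⟩
  · filter_upwards [eventually_all.2 hG, ae_mem_cyl (D := D)] with p hp hp'
    simp only [hp]
    rw [← T.nu_eq hp'.1, hsum, T.inner_nu_nu (T.frontier_subset hp'.1), one_smul, sub_self]
  have hXj : ∀ j, ContDiff ℝ ∞ fun p => X p j := fun j => contDiff_euclidean.1 h1 j
  have hXj' : ∀ j p v, fderiv ℝ (fun p => X p j) p v = fderiv ℝ X p v j := fun j p v => by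
    have : HasFDerivAt (fun p => X p j) ((EuclideanSpace.proj j : E n →L[ℝ] ℝ) ∘L fderiv ℝ X p) p :=
      (EuclideanSpace.proj j : E n →L[ℝ] ℝ).hasFDerivAt.comp p
        (h1.differentiable (by simp) p).hasFDerivAt
    rw [this.fderiv]
    rfl
  have hdvc := T.continuous_tangDiv h1
  have hdW : Continuous fun p => fderiv ℝ W p (X p, 0) := (contDiff_fderiv_fst hW h1).continuous
  have eL : ∫ p, surfDiv D X p • toL2 (cylMeasure D) W p ∂(cylMeasure D)
      = ∫ p, T.tangDiv X p • W p ∂(cylMeasure D) := by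
    refine integral_congr_ae ?_
    filter_upwards [ae_mem_cyl (D := D), coeFn_toL2 (memLp_of_continuous (μ := cylMeasure D)
      hW.continuous)] with p hp hpW
    rw [hpW, T.surfDiv_eq h1 hp.1]
  have eR : ∫ p, ∑ j, X p j • toL2 (cylMeasure D) (T.gradTan W j) p ∂(cylMeasure D)
      = ∫ p, fderiv ℝ W p (X p, 0) ∂(cylMeasure D) := by
    refine integral_congr_ae ?_
    filter_upwards [ae_mem_cyl (D := D), eventually_all.2 hG] with p hp hpG
    simp only [hpG]
    rw [hsum, T.nu_eq hp.1, h4 p hp.1, zero_smul, sub_zero]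
  have c1 : Continuous fun p => T.tangDiv X p • W p := hdvc.smul hW.continuous
  have c3 : Continuous fun p => T.tangDiv X p • W p + fderiv ℝ W p (X p, 0) := c1.add hdW
  rw [eL, eR, eq_neg_iff_add_eq_zero, ← integral_add (integrable_of_continuous c1)
    (integrable_of_continuous hdW), cylMeasure, integral_prod_symm _
    (integrable_prod T.isCompact_frontier c3 (-1) 1)]
  refine integral_eq_zero_of_ae (Eventually.of_forall fun t => ?_)
  -- the divergence theorem on each slice
  have hφ : ∀ j, ContDiff ℝ ∞ fun y => X (y, t) j • W (y, t) := fun j =>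
    (contDiff_slice (hXj j) t).smul (contDiff_slice hW t)
  have hdφ : ∀ j y v, fderiv ℝ (fun y => X (y, t) j • W (y, t)) y v
      = X (y, t) j • fderiv ℝ W (y, t) (v, 0) + fderiv ℝ X (y, t) (v, 0) j • W (y, t) := by
    intro j y v
    have h5 : HasFDerivAt (fun y => X (y, t) j • W (y, t)) _ y :=
      (hasFDerivAt_fst (hXj j) y t).smul (hasFDerivAt_fst hW y t)
    rw [h5.fderiv]
    simp [hXj']
  have hstep := fun j => T.integral_fderiv_surface (hφ j) j
  have hi1 : ∀ j, Integrable (fun s => fderiv ℝ (fun y => X (y, t) j • W (y, t)) s (stdVec j))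
      (surfaceMeasure D) := fun j =>
    integrable_surface T.isCompact_frontier (contDiff_partial (hφ j) _).continuous
  have hi2 : ∀ j, Integrable (fun s => T.nu s j • (T.h s • (X (s, t) j • W (s, t))
      + fderiv ℝ (fun y => X (y, t) j • W (y, t)) s (T.nu s))) (surfaceMeasure D) := fun j => by
    refine integrable_surface T.isCompact_frontier ?_
    have c2 := (((hφ j).continuous_fderiv (by simp)).clm_apply T.contDiff_nu.continuous)
    exact (T.continuous_nu_apply j).smul ((T.contDiff_h.continuous.smul (hφ j).continuous).add c2)
  have htot : ∫ s, ∑ j, fderiv ℝ (fun y => X (y, t) j • W (y, t)) s (stdVec j) ∂(surfaceMeasure D)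
      = ∫ s, ∑ j, T.nu s j • (T.h s • (X (s, t) j • W (s, t))
      + fderiv ℝ (fun y => X (y, t) j • W (y, t)) s (T.nu s)) ∂(surfaceMeasure D) := by
    rw [integral_finsetSum _ fun j _ => hi1 j, integral_finsetSum _ fun j _ => hi2 j]
    exact Finset.sum_congr rfl fun j _ => hstep j
  rw [← sub_eq_zero, ← integral_sub (integrable_finsetSum _ fun j _ => hi1 j)
    (integrable_finsetSum _ fun j _ => hi2 j)] at htot
  refine Eq.trans (integral_congr_ae ?_) htot
  filter_upwards [ae_mem_frontier] with s hs
  have hXν0 : ∑ j, T.nu s j * X (s, t) j = 0 := by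
    rw [← inner_eq_sum, real_inner_comm, T.nu_eq hs]
    exact h4 (s, t) hs
  simp only [hdφ, smul_add, Finset.sum_add_distrib, smul_smul]
  have e1 : ∑ j, X (s, t) j • fderiv ℝ W (s, t) (stdVec j, 0) = fderiv ℝ W (s, t) (X (s, t), 0) :=
    (clm_apply_eq_sum (fderiv ℝ W (s, t) ∘L ContinuousLinearMap.inl ℝ (E n) ℝ) (X (s, t))).symm
  have e2 : ∑ j, (T.nu s j * (T.h s * X (s, t) j)) • W (s, t) = 0 := by
    have : ∀ j, T.nu s j * (T.h s * X (s, t) j) = T.h s * (T.nu s j * X (s, t) j) := fun j => by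
      ring
    rw [← Finset.sum_smul]
    simp only [this]
    rw [← Finset.mul_sum, hXν0, mul_zero, zero_smul]
  have e3 : ∑ j, (T.nu s j * X (s, t) j) • fderiv ℝ W (s, t) (T.nu s, 0) = 0 := by
    rw [← Finset.sum_smul, hXν0, zero_smul]
  have e4 : T.tangDiv X (s, t) = ∑ j, fderiv ℝ X (s, t) (stdVec j, 0) j
      - ∑ j, T.nu s j * fderiv ℝ X (s, t) (T.nu s, 0) j := by
    rw [tangDiv, inner_eq_sum]
    simp only [mul_comm]
  rw [e1, e2, e3, e4, sub_smul, Finset.sum_smul, Finset.sum_smul]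
  abel

end Smooth

end

end ThinShell

/-! ### Limits of smooth functions on the cylinder, and traces at its ends. -/

namespace ThinShell

noncomputable section

namespace Tube

variable {n N : ℕ} {D : Set (E n)} (T : Tube D) [IsFiniteMeasure (surfaceMeasure D)]

theorem classicalSurfGrad_ae_eq {W : E n × ℝ → Spinor N} (hW : ContDiff ℝ ∞ W) (j : Fin n) :
    classicalSurfGrad D W j =ᵐ[cylMeasure D] T.gradTan W j := by
  filter_upwards [ae_mem_cyl (D := D)] with p hp
  exact T.classicalSurfGrad_eq hW j hp.1

variable [IsCompactMeasure (cylMeasure D)]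

/-- The sequence `W` of smooth functions converges to `w`, together with its derivatives, which
converge to `G` and `H`. -/
structure ConvergesH1 (W : ℕ → E n × ℝ → Spinor N) (w : L2Cyl n N D) (G : Fin n → L2Cyl n N D)
    (H : L2Cyl n N D) : Prop where
  contDiff : ∀ k, ContDiff ℝ ∞ (W k)
  tendsto : Tendsto (fun k => toL2 (cylMeasure D) (W k)) atTop (𝓝 w)
  tendsto_grad : ∀ j, Tendsto (fun k => toL2 (cylMeasure D) (T.gradTan (W k) j)) atTop (𝓝 (G j))
  tendsto_dt : Tendsto (fun k => toL2 (cylMeasure D) fun p => fderiv ℝ (W k) p (0, 1)) atTop (𝓝 H)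

namespace ConvergesH1

variable {T} {W : ℕ → E n × ℝ → Spinor N} {w : L2Cyl n N D} {G : Fin n → L2Cyl n N D}
  {H : L2Cyl n N D}

theorem isWeakDt (h : T.ConvergesH1 W w G H) : IsWeakDt w H := by
  intro ψ h1 h2 h3
  simp only [deriv_snd h1]
  have e : ∀ k, ∫ p, fderiv ℝ ψ p (0, 1) • toL2 (cylMeasure D) (W k) p ∂(cylMeasure D)
      = -∫ p, ψ p • toL2 (cylMeasure D) (fun p => fderiv ℝ (W k) p (0, 1)) p ∂(cylMeasure D) :=
    fun k => by
      have := T.isWeakDt_smooth (h.contDiff k) ψ h1 h2 h3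
      simpa only [deriv_snd h1] using this
  refine tendsto_nhds_unique (((continuous_integral_smul
    (contDiff_deriv_snd h1).continuous).tendsto w).comp h.tendsto) ?_
  refine Tendsto.congr (fun k => (e k).symm) ?_
  exact (((continuous_integral_smul h1.continuous).tendsto H).comp h.tendsto_dt).neg

/-- Tangency and the integral identity are both closed under `L²` convergence, because they involve
only continuous coefficients. -/
theorem isWeakSurfGrad (h : T.ConvergesH1 W w G H) : IsWeakSurfGrad w G := by
  have hνc : ∀ j, Continuous fun p : E n × ℝ => T.nu p.1 j := fun j =>
    (T.continuous_nu_apply j).comp continuous_fst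
  have hco : ∀ G : Fin n → L2Cyl n N D,
      (∑ j, smulOp (Spinor N) (cylMeasure D) (fun p => T.nu p.1 j) (G j) : L2Cyl n N D)
        =ᵐ[cylMeasure D] fun p => ∑ j, outerNormal D p.1 j • G j p := fun G => by
    filter_upwards [coeFn_sum Finset.univ fun j => smulOp (Spinor N) (cylMeasure D)
      (fun p => T.nu p.1 j) (G j), eventually_all.2 fun j => coeFn_mulOp
      (isBoundedField_smul_of_continuous (F := Spinor N) (μ := cylMeasure D) (hνc j)) (G j),
      ae_mem_cyl (D := D)] with p h1 h2 h3
    rw [h1]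
    refine Finset.sum_congr rfl fun j _ => (h2 j).trans ?_
    rw [T.nu_eq h3.1]
    rfl
  refine ⟨?_, fun X h1 h2 h3 h4 => ?_⟩
  · have h0 : ∑ j, smulOp (Spinor N) (cylMeasure D) (fun p => T.nu p.1 j) (G j) = 0 := by
      refine tendsto_nhds_unique (tendsto_finsetSum _ fun j _ =>
        ((smulOp (Spinor N) (cylMeasure D) (fun p => T.nu p.1 j)).continuous.tendsto (G j)).comp
          (h.tendsto_grad j)) ?_
      refine tendsto_const_nhds.congr fun k => ?_
      refine Lp.ext ?_
      filter_upwards [Lp.coeFn_zero (Spinor N) 2 (cylMeasure D),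
        hco fun j => toL2 (cylMeasure D) (T.gradTan (W k) j),
        (T.isWeakSurfGrad_smooth (h.contDiff k)).1] with p g1 g2 g3
      rw [g1, Pi.zero_apply]
      exact (g2.trans g3).symm
    filter_upwards [hco G, Lp.coeFn_zero (Spinor N) 2 (cylMeasure D)] with p g1 g2
    rw [← g1, h0, g2, Pi.zero_apply]
  have hXj : ∀ j, Continuous fun p => X p j := fun j => (contDiff_euclidean.1 h1 j).continuous
  have eL : ∀ w : L2Cyl n N D, ∫ p, surfDiv D X p • w p ∂(cylMeasure D)
      = ∫ p, T.tangDiv X p • w p ∂(cylMeasure D) := fun w => by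
    refine integral_congr_ae ?_
    filter_upwards [ae_mem_cyl (D := D)] with p hp
    rw [T.surfDiv_eq h1 hp.1]
  have eR : ∀ G : Fin n → L2Cyl n N D, ∫ p, ∑ j, X p j • G j p ∂(cylMeasure D)
      = ∑ j, ∫ p, X p j • G j p ∂(cylMeasure D) := fun G =>
    integral_finsetSum _ fun j _ => integrable_smul_L2 (hXj j) (G j)
  rw [eL, eR]
  refine tendsto_nhds_unique (((continuous_integral_smul
    (T.continuous_tangDiv h1)).tendsto w).comp h.tendsto) ?_
  have e : ∀ k, ∫ p, T.tangDiv X p • toL2 (cylMeasure D) (W k) p ∂(cylMeasure D)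
      = -∑ j, ∫ p, X p j • toL2 (cylMeasure D) (T.gradTan (W k) j) p ∂(cylMeasure D) := fun k => by
    rw [← eL, ← eR]
    exact (T.isWeakSurfGrad_smooth (h.contDiff k)).2 X h1 h2 h3 h4
  refine Tendsto.congr (fun k => (e k).symm) (Tendsto.neg (tendsto_finsetSum _ fun j _ => ?_))
  exact ((continuous_integral_smul (hXj j)).tendsto (G j)).comp (h.tendsto_grad j)

theorem memH1Cyl (h : T.ConvergesH1 W w G H) : MemH1Cyl w :=
  ⟨⟨G, h.isWeakSurfGrad⟩, ⟨H, h.isWeakDt⟩⟩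

theorem surfGrad_eq (h : T.ConvergesH1 W w G H) : surfGrad w = G :=
  ThinShell.surfGrad_eq T h.isWeakSurfGrad

theorem weakDt_eq (h : T.ConvergesH1 W w G H) : weakDt w = H := ThinShell.weakDt_eq h.isWeakDt

end ConvergesH1

variable [IsCompactMeasure (surfaceMeasure D)]

/-- The squared trace in terms of the function and its derivative. -/
theorem trace_identity (T : Tube D) {W : E n × ℝ → Spinor N} (hW : ContDiff ℝ ∞ W) {t₀ : ℝ}
    (ht : t₀ = -1 ∨ t₀ = 1) :
    2 * ‖toL2 (surfaceMeasure D) fun s => W (s, t₀)‖ ^ 2 = ‖toL2 (cylMeasure D) W‖ ^ 2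
      + 2 * ⟪smulOp (Spinor N) (cylMeasure D) (fun p => p.2 + t₀) (toL2 (cylMeasure D) W),
        toL2 (cylMeasure D) fun p => fderiv ℝ W p (0, 1)⟫_ℝ := by
  have hW' := (contDiff_deriv_snd hW).continuous
  have hc : Continuous fun p : E n × ℝ => p.2 + t₀ := continuous_snd.add continuous_const
  have c1 : Continuous fun p => (p.2 + t₀) • W p := hc.smul hW.continuous
  have c2 : Continuous fun s : E n => W (s, t₀) := (contDiff_slice hW t₀).continuous
  -- The factor `t + t₀` vanishes at the end `-t₀` and equals `2 t₀` at `t₀`, so the fundamental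
  -- theorem of calculus retains only the wanted end, with the factor `2` for either sign.
  have hk : ContDiff ℝ ∞ fun p : E n × ℝ => (p.2 + t₀) * ⟪W p, W p⟫_ℝ :=
    (contDiff_snd.add contDiff_const).mul (hW.inner ℝ hW)
  have h := integral_cyl_dt (D := D) T.isCompact_frontier hk
  have e : ∀ p, fderiv ℝ (fun p : E n × ℝ => (p.2 + t₀) * ⟪W p, W p⟫_ℝ) p (0, 1)
      = ⟪W p, W p⟫_ℝ + 2 * ⟪(p.2 + t₀) • W p, fderiv ℝ W p (0, 1)⟫_ℝ := fun p => by
    have hp := (hW.differentiable (by simp) p).hasFDerivAt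
    have h1 : HasFDerivAt (fun p : E n × ℝ => (p.2 + t₀) * ⟪W p, W p⟫_ℝ) _ p :=
      ((hasFDerivAt_snd (𝕜 := ℝ) (p := p)).add_const t₀).mul (hp.inner ℝ hp)
    rw [h1.fderiv, real_inner_smul_left]
    simp [real_inner_comm (W p)]
    ring
  simp only [e] at h
  rw [← real_inner_self_eq_norm_sq, ← real_inner_self_eq_norm_sq, smulOp_toL2 hc hW.continuous,
    inner_toL2 (memLp_of_continuous c2) (memLp_of_continuous c2),
    inner_toL2 (memLp_of_continuous hW.continuous) (memLp_of_continuous hW.continuous),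
    inner_toL2 (memLp_of_continuous c1) (memLp_of_continuous hW'), ← integral_const_mul,
    ← integral_const_mul, ← integral_add
      (integrable_of_continuous (hW.continuous.inner hW.continuous))
      ((integrable_of_continuous (c1.inner hW')).const_mul 2), h]
  rcases ht with rfl | rfl
  · simp only [add_neg_cancel, zero_mul, integral_zero, zero_sub, ← integral_neg]
    congr 1
    funext s
    ring
  · simp only [neg_add_cancel, zero_mul, integral_zero, sub_zero]
    congr 1
    funext s
    ring

/-- The identity above controls the trace by the function and its `t`-derivative; no tangential
derivative is needed. -/
theorem tendsto_trace_zero (T : Tube D) {W : ℕ → E n × ℝ → Spinor N}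
    (hW : ∀ k, ContDiff ℝ ∞ (W k))
    {t₀ : ℝ} (ht : t₀ = -1 ∨ t₀ = 1)
    (h1 : Tendsto (fun k => toL2 (cylMeasure D) (W k)) atTop (𝓝 0))
    (h2 : Tendsto (fun k => toL2 (cylMeasure D) fun p => fderiv ℝ (W k) p (0, 1)) atTop (𝓝 0)) :
    Tendsto (fun k => toL2 (surfaceMeasure D) fun s => W k (s, t₀)) atTop (𝓝 0) := by
  rw [tendsto_zero_iff_norm_tendsto_zero]
  have h3 : Tendsto (fun k => 2 * ‖toL2 (surfaceMeasure D) fun s => W k (s, t₀)‖ ^ 2) atTop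
      (𝓝 0) := by
    simp only [T.trace_identity (hW _) ht]
    have h4 := (h1.norm.pow 2).add ((((smulOp (Spinor N) (cylMeasure D)
      (fun p => p.2 + t₀)).continuous.tendsto 0).comp h1 |>.inner h2).const_mul 2)
    simpa [Function.comp_def] using h4
  have h5 := (h3.div_const 2).sqrt
  simp only [mul_div_cancel_left₀ _ (two_ne_zero (α := ℝ)), zero_div, Real.sqrt_zero,
    Real.sqrt_sq (norm_nonneg _)] at h5
  exact h5

theorem isEndTrace_iff {w : L2Cyl n N D} {t₀ : ℝ} {τ : L2Boundary n N D} :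
    IsEndTrace w t₀ τ ↔ MemH1Cyl w ∧ ∃ W, T.ConvergesH1 W w (surfGrad w) (weakDt w) ∧
      Tendsto (fun k => toL2 (surfaceMeasure D) fun s => W k (s, t₀)) atTop (𝓝 τ) := by
  have hcv : ∀ W : ℕ → E n × ℝ → Spinor N, (∀ k, ContDiff ℝ ∞ (W k)) →
      ((Tendsto (fun k => eLpNorm (fun p => W k p - w p) 2 (cylMeasure D)) atTop (𝓝 0) ∧
      (∀ j, Tendsto (fun k => eLpNorm (fun p => classicalSurfGrad D (W k) j p - surfGrad w j p) 2
        (cylMeasure D)) atTop (𝓝 0)) ∧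
      Tendsto (fun k => eLpNorm (fun p => deriv (fun t => W k (p.1, t)) p.2 - weakDt w p) 2
        (cylMeasure D)) atTop (𝓝 0) ∧
      Tendsto (fun k => eLpNorm (fun s => W k (s, t₀) - τ s) 2 (surfaceMeasure D)) atTop (𝓝 0)) ↔
      T.ConvergesH1 W w (surfGrad w) (weakDt w) ∧
      Tendsto (fun k => toL2 (surfaceMeasure D) fun s => W k (s, t₀)) atTop (𝓝 τ)) := by
    intro W hW
    have e1 := tendsto_toL2_iff (μ := cylMeasure D) (u := w) fun k =>
      memLp_of_continuous (hW k).continuous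
    have e2 : ∀ j, Tendsto (fun k => toL2 (cylMeasure D) (T.gradTan (W k) j)) atTop
        (𝓝 (surfGrad w j)) ↔ Tendsto (fun k => eLpNorm (fun p => classicalSurfGrad D (W k) j p
          - surfGrad w j p) 2 (cylMeasure D)) atTop (𝓝 0) := fun j => by
      rw [tendsto_toL2_iff fun k => memLp_of_continuous (T.contDiff_gradTan (hW k) j).continuous]
      refine tendsto_congr fun k => eLpNorm_congr_ae ?_
      filter_upwards [T.classicalSurfGrad_ae_eq (hW k) j] with p hp
      rw [hp]
    have e3 := tendsto_toL2_iff (μ := cylMeasure D) (u := weakDt w) fun k =>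
      memLp_of_continuous (contDiff_deriv_snd (hW k)).continuous
    have e4 := tendsto_toL2_iff (μ := surfaceMeasure D) (u := τ) fun k =>
      memLp_of_continuous (contDiff_slice (hW k) t₀).continuous
    simp only [deriv_snd (hW _)]
    constructor
    · rintro ⟨g1, g2, g3, g4⟩
      exact ⟨⟨hW, e1.2 g1, fun j => (e2 j).2 (g2 j), e3.2 g3⟩, e4.2 g4⟩
    · rintro ⟨g, g4⟩
      exact ⟨e1.1 g.tendsto, fun j => (e2 j).1 (g.tendsto_grad j), e3.1 g.tendsto_dt, e4.1 g4⟩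
  refine and_congr_right fun _ => exists_congr fun W => ?_
  constructor
  · rintro ⟨hW, g⟩
    exact (hcv W hW).1 g
  · rintro ⟨g, g'⟩
    exact ⟨g.contDiff, (hcv W g.contDiff).2 ⟨g, g'⟩⟩

/-- The difference of two approximating sequences tends to zero together with its `t`-derivative,
hence so do its traces. -/
theorem isEndTrace_unique (T : Tube D) {w : L2Cyl n N D} {t₀ : ℝ} (ht : t₀ = -1 ∨ t₀ = 1)
    {τ τ' : L2Boundary n N D} (h : IsEndTrace w t₀ τ) (h' : IsEndTrace w t₀ τ') : τ = τ' := by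
  obtain ⟨-, W, hW, hτ⟩ := T.isEndTrace_iff.1 h
  obtain ⟨-, W', hW', hτ'⟩ := T.isEndTrace_iff.1 h'
  have hd : ∀ k, ContDiff ℝ ∞ fun p => W k p - W' k p := fun k =>
    (hW.contDiff k).sub (hW'.contDiff k)
  have e3 : ∀ k p, fderiv ℝ (fun p => W k p - W' k p) p (0, 1)
      = fderiv ℝ (W k) p (0, 1) - fderiv ℝ (W' k) p (0, 1) := fun k p => by
    rw [fderiv_fun_sub ((hW.contDiff k).differentiable (by simp) p)
      ((hW'.contDiff k).differentiable (by simp) p)]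
    rfl
  have h0 := T.tendsto_trace_zero hd ht
    (by
      have := hW.tendsto.sub hW'.tendsto
      rw [sub_self] at this
      refine this.congr fun k => (toL2_sub ?_ ?_).symm
      · exact memLp_of_continuous (hW.contDiff k).continuous
      · exact memLp_of_continuous (hW'.contDiff k).continuous)
    (by
      have := hW.tendsto_dt.sub hW'.tendsto_dt
      rw [sub_self] at this
      simp only [e3]
      refine this.congr fun k => (toL2_sub ?_ ?_).symm
      · exact memLp_of_continuous (contDiff_deriv_snd (hW.contDiff k)).continuous
      · exact memLp_of_continuous (contDiff_deriv_snd (hW'.contDiff k)).continuous)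
  have h1 : Tendsto (fun k => toL2 (surfaceMeasure D) fun s => W k (s, t₀) - W' k (s, t₀)) atTop
      (𝓝 (τ - τ')) := by
    refine (hτ.sub hτ').congr fun k => (toL2_sub ?_ ?_).symm
    · exact memLp_of_continuous (contDiff_slice (hW.contDiff k) t₀).continuous
    · exact memLp_of_continuous (contDiff_slice (hW'.contDiff k) t₀).continuous
  exact sub_eq_zero.1 (tendsto_nhds_unique h1 h0)

theorem endTrace_eq (T : Tube D) {w : L2Cyl n N D} {t₀ : ℝ} (ht : t₀ = -1 ∨ t₀ = 1)
    {τ : L2Boundary n N D} (h : IsEndTrace w t₀ τ) : endTrace w t₀ = τ := by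
  have hex : ∃ τ, IsEndTrace w t₀ τ := ⟨τ, h⟩
  rw [endTrace, dif_pos hex]
  exact T.isEndTrace_unique ht hex.choose_spec h

theorem ConvergesH1.isEndTrace {T : Tube D} {W : ℕ → E n × ℝ → Spinor N} {w : L2Cyl n N D}
    {G : Fin n → L2Cyl n N D} {H : L2Cyl n N D} (h : T.ConvergesH1 W w G H) {t₀ : ℝ}
    {τ : L2Boundary n N D}
    (hτ : Tendsto (fun k => toL2 (surfaceMeasure D) fun s => W k (s, t₀)) atTop (𝓝 τ)) :
    IsEndTrace w t₀ τ := by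
  refine T.isEndTrace_iff.2 ⟨h.memH1Cyl, W, ?_, hτ⟩
  rw [h.surfGrad_eq, h.weakDt_eq]
  exact h

end Tube

end

end ThinShell

/-! ### Derivatives of the transformed functions. -/

namespace ThinShell

noncomputable section

namespace Tube

variable {n : ℕ} {D : Set (E n)} (T : Tube D) {ε : ℝ}

theorem fderiv_cylMap (p : E n × ℝ) (v : E n) (τ : ℝ) :
    fderiv ℝ (T.cylMap ε) p (v, τ)
      = v + (ε * p.2) • T.A p.1 v + (ε * τ) • T.nu p.1 := by
  have h1 : HasFDerivAt (fun q : E n × ℝ => T.nu q.1) (T.A p.1 ∘L ContinuousLinearMap.fst ℝ _ _) p :=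
    (T.hasFDerivAt_nu p.1).comp p _root_.hasFDerivAt_fst
  have h2 : HasFDerivAt (fun q : E n × ℝ => ε * q.2) (ε • ContinuousLinearMap.snd ℝ (E n) ℝ) p :=
    (hasFDerivAt_snd (𝕜 := ℝ) (p := p)).const_mul ε
  have h3 : HasFDerivAt (fun q : E n × ℝ => q.1 + (ε * q.2) • T.nu q.1) _ p :=
    (_root_.hasFDerivAt_fst (𝕜 := ℝ) (p := p)).add (h2.smul h1)
  have h4 : T.cylMap ε = fun q : E n × ℝ => q.1 + (ε * q.2) • T.nu q.1 := rfl
  rw [h4, h3.fderiv]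
  simp [add_assoc]

/-- The weight has the logarithmic derivative `J' / (2 J)`. -/
theorem fderiv_rootWeight (hε : 0 < ε) {p : E n × ℝ} (hJ : 1 / 2 < T.J p.1 (ε * p.2))
    (v : E n × ℝ) : fderiv ℝ (T.rootWeight ε) p v = T.rootWeight ε p *
      (fderiv ℝ (fun p : E n × ℝ => T.J p.1 (ε * p.2)) p v / (2 * T.J p.1 (ε * p.2))) := by
  have h1 := ((T.contDiff_rootWeight ε).differentiable (by simp) p).hasFDerivAt
  have h2 := ((T.contDiff_J_scaled ε).differentiable (by simp) p).hasFDerivAt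
  -- The relation `w² = ε J` is differentiated instead of the square root, then divided by `2 w`.
  have h3 : (fun q => T.rootWeight ε q ^ 2) =ᶠ[𝓝 p]
      fun q : E n × ℝ => ε * T.J q.1 (ε * q.2) := by
    filter_upwards [(T.contDiff_J_scaled ε).continuous.continuousAt.eventually_const_lt hJ] with q hq
    exact T.rootWeight_sq hε hq
  have h4 := congrArg (fun L => L v) (((h2.const_mul ε).congr_of_eventuallyEq h3).unique (h1.pow 2))
  have hw := T.rootWeight_pos hε hJ
  have hs := T.rootWeight_sq hε hJ
  simp only [smul_apply, smul_eq_mul, Nat.add_one_sub_one, pow_one, nsmul_eq_mul, Nat.cast_ofNat]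
    at h4
  generalize fderiv ℝ (T.rootWeight ε) p v = x at h4 ⊢
  generalize fderiv ℝ (fun p : E n × ℝ => T.J p.1 (ε * p.2)) p v = y at h4 ⊢
  have hJ0 : T.J p.1 (ε * p.2) ≠ 0 := by linarith
  rw [← mul_div_assoc, eq_div_iff (mul_ne_zero two_ne_zero hJ0)]
  refine mul_left_cancel₀ hw.ne' ?_
  linear_combination (-T.J p.1 (ε * p.2)) * h4 - y * hs

theorem fderiv_J_scaled_fst (p : E n × ℝ) (v : E n) :
    fderiv ℝ (fun p : E n × ℝ => T.J p.1 (ε * p.2)) p (v, 0)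
      = fderiv ℝ (fun p : E n × ℝ => T.J p.1 p.2) (p.1, ε * p.2) (v, 0) := by
  rw [← fderiv_fst (T.contDiff_J_scaled ε), ← fderiv_fst T.contDiff_J]

theorem fderiv_J_scaled_snd {p : E n × ℝ} (hs : p.1 ∈ frontier D) (hr : |ε * p.2| < T.δ) :
    fderiv ℝ (fun p : E n × ℝ => T.J p.1 (ε * p.2)) p (0, 1)
      = ε * T.h (T.cylMap ε p) * T.J p.1 (ε * p.2) := by
  rw [← deriv_snd (T.contDiff_J_scaled ε)]
  have h1 : HasDerivAt (fun t : ℝ => ε * t) ε p.2 := by simpa using (hasDerivAt_id p.2).const_mul ε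
  have h2 := (T.hasDerivAt_J hs hr).comp p.2 h1
  refine h2.deriv.trans ?_
  rw [cylMap, T.normalMap_eq hs]
  ring

/-- The logarithmic tangential derivative of the weight. -/
def logDer (ε : ℝ) (j : Fin n) (p : E n × ℝ) : ℝ :=
  fderiv ℝ (fun p : E n × ℝ => T.J p.1 (ε * p.2)) p (T.tangVec j p.1, 0)
    / (2 * T.J p.1 (ε * p.2))

theorem measurable_logDer (j : Fin n) : Measurable (T.logDer ε j) :=
  (T.contDiff_gradTan (T.contDiff_J_scaled ε) j).continuous.measurable.div
    ((T.contDiff_J_scaled ε).continuous.measurable.const_mul 2)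

/-- `J` is identically `1` at `r = 0`, so its tangential derivatives vanish there and are `O(r)`;
the denominator `2 J` exceeds `1`. -/
theorem exists_logDer_le : ∃ C, 0 ≤ C ∧ ∀ ε : ℝ, 0 < ε → ε ≤ 1 →
    (∀ s ∈ frontier D, ∀ r : ℝ, |r| ≤ ε → 1 / 2 < T.J s r) →
    ∀ j, ∀ p : E n × ℝ, p.1 ∈ frontier D → p.2 ∈ Ioo (-1 : ℝ) 1 → |T.logDer ε j p| ≤ C * ε := by
  have h0 : ∀ j (s : E n), T.gradTan (fun p : E n × ℝ => T.J p.1 p.2) j (s, 0) = 0 := fun j s => by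
    rw [gradTan, ← fderiv_fst T.contDiff_J]
    simp
  choose C hC0 hC using fun j => T.exists_bound_sub (T.contDiff_gradTan T.contDiff_J j)
  refine ⟨∑ j, C j, Finset.sum_nonneg fun j _ => hC0 j, fun ε hε hε1 hJ j p hs ht => ?_⟩
  have hr : |ε * p.2| < ε := by
    rw [abs_mul, abs_of_pos hε]
    exact mul_lt_of_lt_one_right hε (abs_lt.2 ht)
  have h1 := hC j p.1 hs (ε * p.2) (hr.trans_le hε1)
  rw [h0, sub_zero, Real.norm_eq_abs] at h1
  have h2 := hJ p.1 hs _ hr.le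
  rw [logDer, fderiv_J_scaled_fst, abs_div, abs_of_pos (by linarith : 0 < 2 * T.J p.1 (ε * p.2))]
  refine (div_le_self (abs_nonneg _) (by linarith)).trans (h1.trans ?_)
  exact mul_le_mul (Finset.single_le_sum (fun j _ => hC0 j) (Finset.mem_univ j)) hr.le
    (abs_nonneg _) (Finset.sum_nonneg fun j _ => hC0 j)

/-- The coefficients of the differential of the normal map. -/
def shiftCoeff (ε : ℝ) (j k : Fin n) (p : E n × ℝ) : ℝ := ε * p.2 * T.A p.1 (stdVec j) k

theorem continuous_shiftCoeff (j k : Fin n) : Continuous (T.shiftCoeff ε j k) := by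
  have h : Continuous fun x => T.A x (stdVec j) k :=
    (contDiff_euclidean.1 (T.contDiff_A.clm_apply contDiff_const) k).continuous
  exact (continuous_const.mul continuous_snd).mul (h.comp continuous_fst)

theorem exists_shiftCoeff_le : ∃ C, 0 ≤ C ∧ ∀ ε : ℝ, 0 < ε →
    ∀ j k, ∀ p : E n × ℝ, p.1 ∈ frontier D → p.2 ∈ Ioo (-1 : ℝ) 1 →
      |T.shiftCoeff ε j k p| ≤ C * ε := by
  have h := fun j k => exists_bound_surface T.isCompact_frontier
    (contDiff_euclidean.1 (T.contDiff_A.clm_apply (contDiff_const (c := stdVec j))) k).continuous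
  choose C hC using h
  refine ⟨∑ j, ∑ k, |C j k|, by positivity, fun ε hε j k p hs ht => ?_⟩
  have h1 : |T.A p.1 (stdVec j) k| ≤ ∑ j, ∑ k, |C j k| := by
    refine (hC j k p.1 hs).trans ((le_abs_self _).trans ?_)
    refine (Finset.single_le_sum (f := fun k => |C j k|) (fun k _ => abs_nonneg _)
      (Finset.mem_univ k)).trans ?_
    exact Finset.single_le_sum (f := fun j => ∑ k, |C j k|) (fun j _ => by positivity)
      (Finset.mem_univ j)
  have h2 : |ε * p.2| ≤ ε := by
    rw [abs_mul, abs_of_pos hε]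
    exact mul_le_of_le_one_right hε.le (abs_lt.2 ht).le
  rw [shiftCoeff, abs_mul, mul_comm]
  exact mul_le_mul h1 h2 (abs_nonneg _) (by positivity)

variable {F : Type*} [NormedAddCommGroup F] [NormedSpace ℝ F]

/-- The transformation of functions in the shell to functions on the cylinder. -/
def pullback (ε : ℝ) (f : E n → F) (p : E n × ℝ) : F := T.rootWeight ε p • f (T.cylMap ε p)

theorem contDiff_pullback {f : E n → F} (hf : ContDiff ℝ ∞ f) : ContDiff ℝ ∞ (T.pullback ε f) :=
  (T.contDiff_rootWeight ε).smul (hf.comp (T.contDiff_cylMap ε))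

theorem continuous_pullback {f : E n → F} (hf : Continuous f) : Continuous (T.pullback ε f) :=
  (T.contDiff_rootWeight ε).continuous.smul (hf.comp (T.contDiff_cylMap ε).continuous)

theorem fderiv_pullback {f : E n → F} (hf : ContDiff ℝ ∞ f) (hε : 0 < ε) {p : E n × ℝ}
    (hJ : 1 / 2 < T.J p.1 (ε * p.2)) (v : E n × ℝ) :
    fderiv ℝ (T.pullback ε f) p v
      = T.rootWeight ε p • fderiv ℝ f (T.cylMap ε p) (fderiv ℝ (T.cylMap ε) p v)
        + (fderiv ℝ (fun p : E n × ℝ => T.J p.1 (ε * p.2)) p v / (2 * T.J p.1 (ε * p.2)))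
          • T.pullback ε f p := by
  have h1 := ((T.contDiff_rootWeight ε).differentiable (by simp) p).hasFDerivAt
  have h2 := ((T.contDiff_cylMap ε).differentiable (by simp) p).hasFDerivAt
  have h3 := (hf.differentiable (by simp) (T.cylMap ε p)).hasFDerivAt
  have h4 : HasFDerivAt (T.pullback ε f) _ p := h1.smul (h3.comp p h2)
  rw [h4.fderiv]
  simp only [add_apply, smul_apply, ContinuousLinearMap.comp_apply,
    ContinuousLinearMap.smulRight_apply, T.fderiv_rootWeight hε hJ, pullback, smul_smul]
  rw [mul_comm (T.rootWeight ε p)]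

theorem nu_cylMap {p : E n × ℝ} (hs : p.1 ∈ frontier D) (hr : |ε * p.2| < T.δ) :
    T.nu (T.cylMap ε p) = T.nu p.1 := by
  rw [cylMap, T.normalMap_eq hs, T.nu_apply _ hs _ hr, T.nu_eq hs]

/-- The normal map sends a tangent vector `v` to `v + ε t A v`. Since `A` annihilates `ν` and takes
values orthogonal to `ν`, the correction is a combination of tangential vectors, so no normal
derivative of `f` enters; it would be too large. -/
theorem gradTan_pullback {f : E n → F} (hf : ContDiff ℝ ∞ f) (hε : 0 < ε) {p : E n × ℝ}
    (hs : p.1 ∈ frontier D) (hr : |ε * p.2| < T.δ) (hJ : 1 / 2 < T.J p.1 (ε * p.2)) (j : Fin n) :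
    T.gradTan (T.pullback ε f) j p
      = T.pullback ε (fun x => fderiv ℝ f x (T.tangVec j x)) p
        + ∑ k, T.shiftCoeff ε j k p • T.pullback ε (fun x => fderiv ℝ f x (T.tangVec k x)) p
        + T.logDer ε j p • T.pullback ε f p := by
  have hsT := T.frontier_subset hs
  have e0 : ∀ k, T.tangVec k (T.cylMap ε p) = T.tangVec k p.1 := fun k => by
    rw [tangVec, tangVec, T.nu_cylMap hs hr]
  have e1 : T.A p.1 (T.tangVec j p.1) = ∑ k, T.A p.1 (stdVec j) k • T.tangVec k p.1 := by
    have h1 : T.A p.1 (T.tangVec j p.1) = T.A p.1 (stdVec j) := by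
      rw [tangVec, map_sub, map_smul, T.A_nu hsT, smul_zero, sub_zero]
    have h2 := T.inner_nu_A hsT (stdVec j)
    rw [real_inner_comm, inner_eq_sum] at h2
    rw [h1]
    simp only [tangVec, smul_sub, Finset.sum_sub_distrib, sum_smul_stdVec, smul_smul]
    rw [← Finset.sum_smul, h2, zero_smul, sub_zero]
  rw [gradTan, T.fderiv_pullback hf hε hJ, T.fderiv_cylMap, mul_zero, zero_smul, add_zero, e1]
  simp only [pullback, e0, map_add, map_smul, map_sum, smul_add, Finset.smul_sum, smul_smul,
    shiftCoeff, logDer]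
  congr 2
  refine Finset.sum_congr rfl fun k _ => ?_
  congr 1
  ring

/-- By `∂_r J = h J` the logarithmic derivative of `√J` is `h/2`. This is the combination that
appears in the completed square of `norm_diracL2_sq`, so the normal term needs no error estimate. -/
theorem fderiv_pullback_snd {f : E n → F} (hf : ContDiff ℝ ∞ f) (hε : 0 < ε) {p : E n × ℝ}
    (hs : p.1 ∈ frontier D) (hr : |ε * p.2| < T.δ) (hJ : 1 / 2 < T.J p.1 (ε * p.2)) :
    fderiv ℝ (T.pullback ε f) p (0, 1) = ε •
      T.pullback ε (fun x => fderiv ℝ f x (T.nu x) + (1 / 2 : ℝ) • T.h x • f x) p := by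
  have hJ0 : T.J p.1 (ε * p.2) ≠ 0 := by linarith
  rw [T.fderiv_pullback hf hε hJ, T.fderiv_cylMap, T.fderiv_J_scaled_snd hs hr]
  simp only [pullback, T.nu_cylMap hs hr, map_zero, smul_zero, add_zero, zero_add, mul_one,
    map_smul, smul_add, smul_smul]
  congr 1
  · congr 1
    ring
  · congr 1
    field_simp

end Tube

end

end ThinShell

/-! ### Transport of jets to the cylinder, and the error of the surface gradient. -/

namespace ThinShell

noncomputable section

namespace Tube

/-- The shell of half-width `ε` is thin, compared to the curvatures. -/
structure IsThin {n : ℕ} {D : Set (E n)} (T : Tube D) (ε : ℝ) : Prop where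
  pos : 0 < ε
  le_one : ε ≤ 1
  lt : ε < T.δ / 2
  half_lt_J : ∀ s ∈ frontier D, ∀ r : ℝ, |r| ≤ ε → 1 / 2 < T.J s r

theorem exists_isThin {n : ℕ} {D : Set (E n)} (T : Tube D) :
    ∃ ε₀ > 0, ∀ ε, 0 < ε → ε < ε₀ → T.IsThin ε := by
  obtain ⟨ε₁, h1, hJ⟩ := T.exists_half_lt_J
  have := T.δ_pos
  refine ⟨min (min 1 (T.δ / 2)) ε₁, by positivity, fun ε hε hlt => ?_⟩
  simp only [lt_min_iff] at hlt
  exact ⟨hε, hlt.1.1.le, hlt.1.2, fun s hs r hr => hJ s hs r (hr.trans hlt.2.le)⟩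

namespace IsThin

variable {n : ℕ} {D : Set (E n)} {T : Tube D} {ε : ℝ}

theorem lt_δ (h : T.IsThin ε) : ε < T.δ := by
  have := h.lt
  have := h.pos
  linarith

theorem abs_lt (h : T.IsThin ε) {t : ℝ} (ht : t ∈ Ioo (-1 : ℝ) 1) : |ε * t| < ε := by
  rw [abs_mul, abs_of_pos h.pos]
  exact mul_lt_of_lt_one_right h.pos (_root_.abs_lt.2 ht)

theorem half_lt (h : T.IsThin ε) {p : E n × ℝ} (hs : p.1 ∈ frontier D)
    (ht : p.2 ∈ Ioo (-1 : ℝ) 1) : 1 / 2 < T.J p.1 (ε * p.2) :=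
  h.half_lt_J _ hs _ (h.abs_lt ht).le

variable [IsFiniteMeasure (surfaceMeasure D)]

theorem ae_cyl (h : T.IsThin ε) : ∀ᵐ p ∂(cylMeasure D), p.1 ∈ frontier D ∧
    p.2 ∈ Ioo (-1 : ℝ) 1 ∧ |ε * p.2| < T.δ ∧ 1 / 2 < T.J p.1 (ε * p.2) := by
  filter_upwards [ae_mem_prod (D := D) (I := Ioo (-1 : ℝ) 1) measurableSet_Ioo] with p hp
  exact ⟨hp.1, hp.2, (h.abs_lt hp.2).trans h.lt_δ, h.half_lt hp.1 hp.2⟩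

theorem quasiMeasurePreserving (h : T.IsThin ε) : Measure.QuasiMeasurePreserving (T.cylMap ε)
    (cylMeasure D) (volume.restrict (tubeSet D ε)) := by
  refine quasiMeasurePreserving_of_weight
    (T.measurePreserving_cylMap h.pos h.lt_δ.le h.half_lt_J)
    (T.contDiff_rootWeight ε).continuous.measurable ?_
  filter_upwards [h.ae_cyl] with p hp
  exact T.rootWeight_pos h.pos hp.2.2.2

end IsThin

variable {n : ℕ} {D : Set (E n)} (T : Tube D) {ε : ℝ}
  {F : Type*} [NormedAddCommGroup F] [InnerProductSpace ℝ F]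

section

variable [IsFiniteMeasure (surfaceMeasure D)] [IsCompactMeasure (volume.restrict (tubeSet D ε))]

/-- `U` is the transformation of functions in the shell to functions on the cylinder. -/
def IsPullback (ε : ℝ) (U : Lp F 2 (volume.restrict (tubeSet D ε)) →L[ℝ] Lp F 2 (cylMeasure D)) :
    Prop :=
  ∀ u, U u =ᵐ[cylMeasure D] T.pullback ε u

variable {T} {U : Lp F 2 (volume.restrict (tubeSet D ε)) →L[ℝ] Lp F 2 (cylMeasure D)}

theorem IsPullback.apply_toL2 (hU : T.IsPullback ε U) (h : T.IsThin ε) {f : E n → F}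
    (hf : Continuous f) : U (toL2 _ f) = toL2 _ (T.pullback ε f) := by
  refine eq_toL2 ?_
  filter_upwards [hU (toL2 _ f), h.quasiMeasurePreserving.ae (coeFn_toL2 (memLp_of_continuous hf))]
    with p h1 h2
  rw [h1, pullback, h2, pullback]

theorem IsPullback.apply_smulOp (hU : T.IsPullback ε U) (h : T.IsThin ε)
    [IsCompactMeasure (cylMeasure D)] {c : E n → ℝ} (hc : Continuous c)
    (u : Lp F 2 (volume.restrict (tubeSet D ε))) :
    U (smulOp F _ c u) = smulOp F _ (fun p => c (T.cylMap ε p)) (U u) := by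
  refine Lp.ext ?_
  have h0 := coeFn_mulOp (isBoundedField_smul_of_continuous (F := F)
    (μ := volume.restrict (tubeSet D ε)) hc) u
  filter_upwards [hU (smulOp F _ c u), hU u, h.quasiMeasurePreserving.ae h0,
    coeFn_mulOp (isBoundedField_smul_of_continuous (F := F) (μ := cylMeasure D)
      (hc.comp (T.contDiff_cylMap ε).continuous)) (U u)] with p h1 h2 h3 h4
  rw [h1, pullback, h3]
  refine Eq.trans ?_ h4.symm
  simp only [smul_apply, ContinuousLinearMap.id_apply, h2, pullback, Function.comp_apply]
  rw [smul_comm]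

end

theorem tangDer_jet [IsCompactMeasure (volume.restrict (tubeSet D ε))] {f : E n → F}
    (hf : ContDiff ℝ ∞ f) (j : Fin n) :
    T.tangDer (T.jet ε f) j = toL2 _ fun x => fderiv ℝ f x (T.tangVec j x) := by
  have h1 := (contDiff_partial hf (stdVec j)).continuous
  have h2 : Continuous fun x => fderiv ℝ f x (T.nu x) :=
    ((hf.fderiv_right (m := ∞) (by simp)).clm_apply T.contDiff_nu).continuous
  have h3 : Continuous fun x => T.nu x j • fderiv ℝ f x (T.nu x) :=
    (T.continuous_nu_apply j).smul h2
  rw [tangDer, T.normalDer_jet hf, smulOp_toL2 (T.continuous_nu_apply j) h2]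
  refine (toL2_sub (memLp_of_continuous h1) (memLp_of_continuous h3)).symm.trans ?_
  simp only [tangVec, map_sub, map_smul]

section

variable (U : Lp F 2 (volume.restrict (tubeSet D ε)) →L[ℝ] Lp F 2 (cylMeasure D))

/-- The difference between the surface gradient of the transformed function and the transformed
tangential gradient. -/
def gradErr (p : JetSpace D F ε) (j : Fin n) : Lp F 2 (cylMeasure D) :=
  ∑ k, smulOp F _ (T.shiftCoeff ε j k) (U (T.tangDer p k)) + smulOp F _ (T.logDer ε j) (U p.1)

theorem continuous_gradErr (j : Fin n) : Continuous fun p => T.gradErr U p j := by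
  have := T.continuous_tangDer (F := F) (ε := ε)
  unfold gradErr
  fun_prop

end

section

variable [IsFiniteMeasure (surfaceMeasure D)]

variable {T} in
theorem IsThin.isBoundedField_logDer (h : T.IsThin ε) (j : Fin n) :
    IsBoundedField (cylMeasure D) fun p => T.logDer ε j p • ContinuousLinearMap.id ℝ F := by
  obtain ⟨C, -, hC⟩ := T.exists_logDer_le
  refine isBoundedField_smul (C := C * ε) (T.measurable_logDer j).aestronglyMeasurable ?_
  filter_upwards [h.ae_cyl] with p hp
  exact hC ε h.pos h.le_one h.half_lt_J j p hp.1 hp.2.1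

/-- The norm of the error term. -/
theorem exists_gradErr_le (T : Tube D) : ∃ C, 0 ≤ C ∧ ∀ ε, T.IsThin ε →
    ∀ U : Lp F 2 (volume.restrict (tubeSet D ε)) →L[ℝ] Lp F 2 (cylMeasure D),
    (∀ u, ‖U u‖ = ‖u‖) → ∀ (p : JetSpace D F ε) (j : Fin n),
      ‖T.gradErr U p j‖ ≤ C * ε * (∑ k, ‖T.tangDer p k‖ + ‖p.1‖) := by
  obtain ⟨C₁, hC₁, h1⟩ := T.exists_shiftCoeff_le
  obtain ⟨C₂, hC₂, h2⟩ := T.exists_logDer_le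
  refine ⟨C₁ + C₂, by positivity, fun ε h U hU p j => ?_⟩
  have hid : ‖ContinuousLinearMap.id ℝ F‖ ≤ 1 := ContinuousLinearMap.norm_id_le
  have key : ∀ (c : E n × ℝ → ℝ) (C : ℝ) (w : Lp F 2 (cylMeasure D)), Measurable c → 0 ≤ C →
      (∀ᵐ p ∂(cylMeasure D), |c p| ≤ C) → ‖smulOp F _ c w‖ ≤ C * ‖w‖ := by
    intro c C w hm hC0 hc
    refine norm_mulOp_le (hm.aestronglyMeasurable.smul_const _) ?_ w
    filter_upwards [hc] with p hp
    rw [norm_smul, Real.norm_eq_abs]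
    exact (mul_le_of_le_one_right (abs_nonneg _) hid).trans hp
  have hs : ‖∑ k, smulOp F _ (T.shiftCoeff ε j k) (U (T.tangDer p k))‖
      ≤ ∑ k, C₁ * ε * ‖T.tangDer p k‖ := by
    refine (norm_sum_le _ _).trans (Finset.sum_le_sum fun k _ => ?_)
    rw [← hU (T.tangDer p k)]
    refine key _ _ _ (T.continuous_shiftCoeff j k).measurable (by have := h.pos; positivity) ?_
    filter_upwards [h.ae_cyl] with q hq
    exact h1 ε h.pos j k q hq.1 hq.2.1
  have hl : ‖smulOp F _ (T.logDer ε j) (U p.1)‖ ≤ C₂ * ε * ‖p.1‖ := by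
    rw [← hU p.1]
    refine key _ _ _ (T.measurable_logDer j) (by have := h.pos; positivity) ?_
    filter_upwards [h.ae_cyl] with q hq
    exact h2 ε h.pos h.le_one h.half_lt_J j q hq.1 hq.2.1
  rw [← Finset.mul_sum] at hs
  refine (norm_add_le _ _).trans ((add_le_add hs hl).trans ?_)
  have := h.pos
  have h3 : 0 ≤ ∑ k, ‖T.tangDer p k‖ := Finset.sum_nonneg fun k _ => norm_nonneg _
  have h4 : 0 ≤ C₂ * ε * ∑ k, ‖T.tangDer p k‖ := by positivity
  have h5 : 0 ≤ C₁ * ε * ‖p.1‖ := by positivity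
  linarith

variable [IsCompactMeasure (cylMeasure D)] [IsCompactMeasure (volume.restrict (tubeSet D ε))] {T}
  {U : Lp F 2 (volume.restrict (tubeSet D ε)) →L[ℝ] Lp F 2 (cylMeasure D)}

/-- The pointwise formula of `gradTan_pullback`, read in `L²`. The coefficient `logDer` is a
quotient which is merely measurable and bounded almost everywhere, so its term is handled as a
bounded field. -/
theorem IsPullback.gradTan_eq (hU : T.IsPullback ε U) (h : T.IsThin ε) {f : E n → F}
    (hf : ContDiff ℝ ∞ f) (j : Fin n) :
    toL2 (cylMeasure D) (T.gradTan (T.pullback ε f) j)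
      = U (T.tangDer (T.jet ε f) j) + T.gradErr U (T.jet ε f) j := by
  have h1 : ∀ k, Continuous fun x => fderiv ℝ f x (T.tangVec k x) := fun k =>
    ((hf.fderiv_right (m := ∞) (by simp)).clm_apply (T.contDiff_tangVec k)).continuous
  have e1 : (T.jet ε f).1 = toL2 _ f := rfl
  have h2 : ∀ k, MemLp (T.pullback ε fun x => fderiv ℝ f x (T.tangVec k x)) 2 (cylMeasure D) :=
    fun k => memLp_of_continuous (T.continuous_pullback (h1 k))
  have h3 : ∀ k, Continuous fun p => T.shiftCoeff ε j k p •
      T.pullback ε (fun x => fderiv ℝ f x (T.tangVec k x)) p := fun k =>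
    (T.continuous_shiftCoeff j k).smul (T.continuous_pullback (h1 k))
  have h4 : MemLp (T.pullback ε f) 2 (cylMeasure D) :=
    memLp_of_continuous (T.continuous_pullback hf.continuous)
  have h5 : MemLp (fun p => T.logDer ε j p • T.pullback ε f p) 2 (cylMeasure D) :=
    (h.isBoundedField_logDer (F := F) j).memLp h4
  have e2 : ∀ k, U (T.tangDer (T.jet ε f) k)
      = toL2 _ (T.pullback ε fun x => fderiv ℝ f x (T.tangVec k x)) := fun k => by
    rw [T.tangDer_jet hf, hU.apply_toL2 h (h1 k)]
  have e3 : ∀ k, smulOp F _ (T.shiftCoeff ε j k) (U (T.tangDer (T.jet ε f) k)) = toL2 _ fun p =>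
      T.shiftCoeff ε j k p • T.pullback ε (fun x => fderiv ℝ f x (T.tangVec k x)) p := fun k => by
    rw [e2]
    exact smulOp_toL2 (T.continuous_shiftCoeff j k) (T.continuous_pullback (h1 k))
  have e4 : smulOp F _ (T.logDer ε j) (U (T.jet ε f).1)
      = toL2 _ fun p => T.logDer ε j p • T.pullback ε f p := by
    rw [e1, hU.apply_toL2 h hf.continuous]
    exact mulOp_toL2 (h.isBoundedField_logDer j) h4
  have h6 : MemLp (fun p => ∑ k, T.shiftCoeff ε j k p •
      T.pullback ε (fun x => fderiv ℝ f x (T.tangVec k x)) p) 2 (cylMeasure D) :=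
    memLp_of_continuous (continuous_finsetSum Finset.univ fun k _ => h3 k)
  have h7 : MemLp (fun p => ∑ k, T.shiftCoeff ε j k p •
      T.pullback ε (fun x => fderiv ℝ f x (T.tangVec k x)) p + T.logDer ε j p • T.pullback ε f p)
      2 (cylMeasure D) := h6.add h5
  rw [gradErr, e2, e4, Finset.sum_congr rfl fun k _ => e3 k,
    ← toL2_sum Finset.univ fun k => memLp_of_continuous (h3 k), ← toL2_add h6 h5,
    ← toL2_add (h2 j) h7]
  refine toL2_congr ?_
  filter_upwards [h.ae_cyl] with p hp
  rw [T.gradTan_pullback hf h.pos hp.1 hp.2.2.1 hp.2.2.2, add_assoc]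

theorem IsPullback.fderiv_snd_eq (hU : T.IsPullback ε U) (h : T.IsThin ε) {f : E n → F}
    (hf : ContDiff ℝ ∞ f) :
    (toL2 (cylMeasure D) fun p => fderiv ℝ (T.pullback ε f) p (0, 1))
      = ε • U (T.normalDer (T.jet ε f) + (1 / 2 : ℝ) • smulOp F _ T.h (T.jet ε f).1) := by
  have h2 : Continuous fun x => fderiv ℝ f x (T.nu x) :=
    ((hf.fderiv_right (m := ∞) (by simp)).clm_apply T.contDiff_nu).continuous
  have h3 : Continuous fun x => T.h x • f x := T.contDiff_h.continuous.smul hf.continuous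
  have h4 : Continuous fun x => (1 / 2 : ℝ) • T.h x • f x := continuous_const.smul h3
  have h5 : Continuous fun x => fderiv ℝ f x (T.nu x) + (1 / 2 : ℝ) • T.h x • f x := h2.add h4
  have e1 : (T.jet ε f).1 = toL2 _ f := rfl
  have e2 : ((1 / 2 : ℝ) • toL2 (volume.restrict (tubeSet D ε)) fun x => T.h x • f x)
      = toL2 _ fun x => (1 / 2 : ℝ) • T.h x • f x := by
    refine eq_toL2 ?_
    filter_upwards [Lp.coeFn_smul (1 / 2 : ℝ) (toL2 (volume.restrict (tubeSet D ε))
      fun x => T.h x • f x), coeFn_toL2 (μ := volume.restrict (tubeSet D ε))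
      (memLp_of_continuous h3)] with x g1 g2
    rw [g1, Pi.smul_apply, g2]
  rw [T.normalDer_jet hf, e1, smulOp_toL2 T.contDiff_h.continuous hf.continuous, e2,
    ← toL2_add (memLp_of_continuous h2) (memLp_of_continuous h4), hU.apply_toL2 h h5]
  symm
  refine eq_toL2 ?_
  filter_upwards [Lp.coeFn_smul ε (toL2 (cylMeasure D) (T.pullback ε fun x =>
    fderiv ℝ f x (T.nu x) + (1 / 2 : ℝ) • T.h x • f x)), coeFn_toL2 (μ := cylMeasure D)
    (memLp_of_continuous (T.continuous_pullback h5)), h.ae_cyl] with p g1 g2 hp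
  rw [g1, Pi.smul_apply, g2, T.fderiv_pullback_snd hf h.pos hp.1 hp.2.2.1 hp.2.2.2]

end

section

variable {N : ℕ} [IsFiniteMeasure (surfaceMeasure D)] [IsCompactMeasure (cylMeasure D)]
  [IsCompactMeasure (volume.restrict (tubeSet D ε))] {T}
  {U : Lp (Spinor N) 2 (volume.restrict (tubeSet D ε)) →L[ℝ] Lp (Spinor N) 2 (cylMeasure D)}

/-- All three limits are continuous expressions in the jet, hence obtained by applying them to the
approximating sequence. This identifies the weak derivatives of the transformed function. -/
theorem IsPullback.convergesH1 (hU : T.IsPullback ε U) (h : T.IsThin ε)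
    {f : ℕ → E n → Spinor N} (hf : ∀ k, ContDiff ℝ ∞ (f k)) {p : JetSpace D (Spinor N) ε}
    (hp : Tendsto (fun k => T.jet ε (f k)) atTop (𝓝 p)) :
    T.ConvergesH1 (fun k => T.pullback ε (f k)) (U p.1)
      (fun j => U (T.tangDer p j) + T.gradErr U p j)
      (ε • U (T.normalDer p + (1 / 2 : ℝ) • smulOp (Spinor N) _ T.h p.1)) where
  contDiff k := T.contDiff_pullback (hf k)
  tendsto := by
    have h1 : Continuous fun p : JetSpace D (Spinor N) ε => U p.1 := by fun_prop
    refine ((h1.tendsto p).comp hp).congr fun k => ?_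
    exact hU.apply_toL2 h (hf k).continuous
  tendsto_grad j := by
    have h1 := T.continuous_tangDer (F := Spinor N) (ε := ε)
    have h2 := T.continuous_gradErr U j
    have h3 : Continuous fun p : JetSpace D (Spinor N) ε =>
      U (T.tangDer p j) + T.gradErr U p j := by fun_prop
    refine ((h3.tendsto p).comp hp).congr fun k => ?_
    exact (hU.gradTan_eq h (hf k) j).symm
  tendsto_dt := by
    have h1 := T.continuous_normalDer (F := Spinor N) (ε := ε)
    have h3 : Continuous fun p : JetSpace D (Spinor N) ε =>
      ε • U (T.normalDer p + (1 / 2 : ℝ) • smulOp (Spinor N) _ T.h p.1) := by fun_prop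
    refine ((h3.tendsto p).comp hp).congr fun k => ?_
    exact (hU.fderiv_snd_eq h (hf k)).symm

end

theorem continuous_rootWeight_left (T : Tube D) (ε t : ℝ) : Continuous fun s => T.rootWeight ε (s, t) :=
  (T.contDiff_rootWeight ε).continuous.comp (continuous_id.prodMk continuous_const)

section

variable [IsCompactMeasure (surfaceMeasure D)] {T}

theorem tendsto_pullback_one {f : ℕ → E n → F} (hf : ∀ k, ContDiff ℝ ∞ (f k))
    {p : JetSpace D F ε} (hp : Tendsto (fun k => T.jet ε (f k)) atTop (𝓝 p)) :
    Tendsto (fun k => toL2 (surfaceMeasure D) fun s => T.pullback ε (f k) (s, 1)) atTop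
      (𝓝 (smulOp F _ (fun s => T.rootWeight ε (s, 1)) p.2.2.1)) := by
  have h1 : Continuous fun p : JetSpace D F ε =>
    smulOp F (surfaceMeasure D) (fun s => T.rootWeight ε (s, 1)) p.2.2.1 := by fun_prop
  refine ((h1.tendsto p).comp hp).congr fun k => ?_
  refine (smulOp_toL2 (T.continuous_rootWeight_left ε 1)
    ((hf k).continuous.comp (T.continuous_shift ε))).trans ?_
  simp only [pullback, cylMap, mul_one, Function.comp_def]

theorem tendsto_pullback_neg_one {f : ℕ → E n → F} (hf : ∀ k, ContDiff ℝ ∞ (f k))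
    {p : JetSpace D F ε} (hp : Tendsto (fun k => T.jet ε (f k)) atTop (𝓝 p)) :
    Tendsto (fun k => toL2 (surfaceMeasure D) fun s => T.pullback ε (f k) (s, -1)) atTop
      (𝓝 (smulOp F _ (fun s => T.rootWeight ε (s, -1)) p.2.2.2)) := by
  have h1 : Continuous fun p : JetSpace D F ε =>
    smulOp F (surfaceMeasure D) (fun s => T.rootWeight ε (s, -1)) p.2.2.2 := by fun_prop
  refine ((h1.tendsto p).comp hp).congr fun k => ?_
  refine (smulOp_toL2 (T.continuous_rootWeight_left ε (-1))
    ((hf k).continuous.comp (T.continuous_shift (-ε)))).trans ?_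
  simp only [pullback, cylMap, mul_neg, mul_one, Function.comp_def]

/-- The norm of the end traces in terms of the boundary values. -/
theorem IsThin.norm_rootWeight_sq (h : T.IsThin ε) {σ : ℝ} (hσ : σ = 1 ∨ σ = -1)
    (τ : Lp F 2 (surfaceMeasure D)) :
    ‖smulOp F _ (fun s => T.rootWeight ε (s, σ)) τ‖ ^ 2
      = ε * ⟪smulOp F _ (fun s => T.J s (ε * σ)) τ, τ⟫_ℝ := by
  rw [norm_sq_eq_integral, L2.inner_def, ← integral_const_mul]
  refine integral_congr_ae ?_
  filter_upwards [coeFn_mulOp (isBoundedField_smul_of_continuous (F := F) (μ := surfaceMeasure D)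
    (T.continuous_rootWeight_left ε σ)) τ,
    coeFn_mulOp (isBoundedField_smul_of_continuous (F := F) (μ := surfaceMeasure D)
    (T.continuous_J_left (ε * σ))) τ, ae_mem_frontier] with s h1 h2 hs
  have hr : |ε * σ| ≤ ε := by rcases hσ with rfl | rfl <;> simp [abs_of_pos h.pos]
  rw [h1, h2]
  simp only [smul_apply, ContinuousLinearMap.id_apply, norm_smul, mul_pow, Real.norm_eq_abs,
    sq_abs, real_inner_smul_left, real_inner_self_eq_norm_sq]
  rw [T.rootWeight_sq (p := (s, σ)) h.pos (h.half_lt_J s hs _ hr), mul_assoc]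

end

end Tube

end

end ThinShell

/-! ### Approximation of a function with a trace. -/

namespace ThinShell

noncomputable section

namespace Tube

variable {n N : ℕ} {D : Set (E n)} {T : Tube D} {ε : ℝ}

/-- A function with a trace is the limit of smooth functions, with the derivatives and the boundary
values. -/
theorem IsThin.exists_jet [IsCompactMeasure (surfaceMeasure D)]
    [IsCompactMeasure (volume.restrict (tubeSet D ε))] (h : T.IsThin ε)
    {u : L2Domain n N (tubeSet D ε)} {τ : L2Boundary n N (tubeSet D ε)} (hτ : IsTrace u τ) :
    ∃ (f : ℕ → E n → Spinor N) (p : JetSpace D (Spinor N) ε), (∀ k, ContDiff ℝ ∞ (f k)) ∧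
      Tendsto (fun k => T.jet ε (f k)) atTop (𝓝 p) ∧ p.1 = u ∧ p.2.1 = weakPartial u ∧
      p.2.2.1 =ᵐ[surfaceMeasure D] (fun s => τ (T.normalMap (s, ε))) ∧
      p.2.2.2 =ᵐ[surfaceMeasure D] fun s => τ (T.normalMap (s, -ε)) := by
  obtain ⟨-, f, hf, h1, h2, h3⟩ := hτ
  obtain ⟨τ₁, e1, t1⟩ := T.tendsto_trace_shift h.lt_δ h.pos (Or.inl rfl)
    (fun k => (hf k).continuous) h3
  obtain ⟨τ₂, e2, t2⟩ := T.tendsto_trace_shift h.lt_δ h.pos (Or.inr rfl)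
    (fun k => (hf k).continuous) h3
  rw [one_mul] at e1 t1
  rw [neg_one_mul] at e2 t2
  refine ⟨f, (u, weakPartial u, τ₁, τ₂), hf, ?_, rfl, rfl, e1, e2⟩
  refine Tendsto.prodMk_nhds ?_ (Tendsto.prodMk_nhds (tendsto_pi_nhds.2 fun j => ?_)
    (Tendsto.prodMk_nhds t1 t2))
  · exact (tendsto_toL2_iff fun k => memLp_of_continuous (hf k).continuous).2 h1
  · exact (tendsto_toL2_iff fun k =>
      memLp_of_continuous (contDiff_partial (hf k) _).continuous).2 (h2 j)

end Tube

end

end ThinShell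

/-! ### Principal curvatures and the effective potential. -/

namespace ThinShell

noncomputable section

theorem esymm_one_eq_sum {R : Type*} [CommRing R] (s : Multiset R) : s.esymm 1 = s.sum := by
  simp [Multiset.esymm, Multiset.powersetCard_one]

theorem two_mul_esymm_two {R : Type*} [CommRing R] (s : Multiset R) :
    2 * s.esymm 2 = s.sum ^ 2 - (s.map fun x => x ^ 2).sum := by
  induction s using Multiset.induction with
  | empty => simp [Multiset.esymm, Multiset.powersetCard_zero_right]
  | cons a s ih =>
    have h : (a ::ₘ s).esymm 2 = s.esymm 2 + a * s.esymm 1 := by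
      simp only [Multiset.esymm, Multiset.powersetCard_cons, Multiset.map_add, Multiset.sum_add,
        Multiset.map_map, Function.comp_def, Multiset.prod_cons, Multiset.sum_map_mul_left]
    rw [h, esymm_one_eq_sum, mul_add, ih]
    simp only [Multiset.sum_cons, Multiset.map_cons]
    ring

theorem trace_eq_sum {n : ℕ} (L : E n →ₗ[ℝ] E n) :
    LinearMap.trace ℝ (E n) L = ∑ j, L (stdVec j) j := by
  rw [LinearMap.trace_eq_matrix_trace ℝ (EuclideanSpace.basisFun (Fin n) ℝ).toBasis]
  simp [Matrix.trace, LinearMap.toMatrix_apply, stdVec]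

/-- The power sums of the eigenvalues of a symmetric operator. -/
theorem roots_charpoly_sums {V : Type*} [NormedAddCommGroup V] [InnerProductSpace ℝ V]
    [FiniteDimensional ℝ V] {S : V →ₗ[ℝ] V} (hS : S.IsSymmetric) :
    S.charpoly.roots.sum = LinearMap.trace ℝ V S ∧
      (S.charpoly.roots.map fun x => x ^ 2).sum = LinearMap.trace ℝ V (S ∘ₗ S) := by
  have hr := hS.roots_charpoly_eq_eigenvalues rfl
  have hm := hS.toMatrix_eigenvectorBasis rfl
  rw [hr]
  rw [LinearMap.trace_eq_matrix_trace ℝ (hS.eigenvectorBasis rfl).toBasis,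
    LinearMap.trace_eq_matrix_trace ℝ (hS.eigenvectorBasis rfl).toBasis,
    LinearMap.toMatrix_comp _ (hS.eigenvectorBasis rfl).toBasis, hm]
  simp [Matrix.trace, Matrix.diagonal_mul_diagonal, Finset.sum, pow_two, Function.comp_def]

namespace Tube

variable {n : ℕ} {D : Set (E n)} (T : Tube D)

/-- A derivative within `∂D` is not unique as a linear map on `E n`. On a tangent vector `v` it is
nevertheless determined, by the curve `t ↦ π(s + t v)` in `∂D` with velocity `v`. -/
theorem fderivWithin_outerNormal {s : E n} (hs : s ∈ frontier D) {v : E n}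
    (hv : ⟪outerNormal D s, v⟫_ℝ = 0) :
    fderivWithin ℝ (outerNormal D) (frontier D) s v = T.A s v := by
  have hA : HasFDerivWithinAt (outerNormal D) (T.A s) (frontier D) s :=
    (T.hasFDerivAt_nu s).hasFDerivWithinAt.congr (fun x hx => (T.nu_eq hx).symm) (T.nu_eq hs).symm
  have hL := hA.differentiableWithinAt.hasFDerivWithinAt
  have hγ : HasDerivAt (fun t : ℝ => T.π (s + t • v)) v 0 := by
    have h1 : HasDerivAt (fun t : ℝ => s + t • v) v 0 := by
      simpa using ((hasDerivAt_id (0 : ℝ)).smul_const v).const_add s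
    have h2 : HasFDerivAt T.π (fderiv ℝ T.π s) (s + (0 : ℝ) • v) := by
      rw [zero_smul, add_zero]
      exact T.hasFDerivAt_π s
    have h3 := h2.comp_hasDerivAt (0 : ℝ) h1
    rwa [T.fderiv_π_frontier hs, perp_apply, hv, zero_smul, sub_zero] at h3
  have hO : IsOpen {t : ℝ | s + t • v ∈ tubeSet D T.δ} :=
    T.isOpen_tube.preimage (by fun_prop)
  have h0 : (0 : ℝ) ∈ {t : ℝ | s + t • v ∈ tubeSet D T.δ} := by
    simpa using T.frontier_subset hs
  have hmaps : MapsTo (fun t : ℝ => T.π (s + t • v)) {t : ℝ | s + t • v ∈ tubeSet D T.δ}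
      (frontier D) := fun t ht => T.π_mem ht
  have hγ0 : T.π (s + (0 : ℝ) • v) = s := by rw [zero_smul, add_zero, T.π_eq hs]
  have key : ∀ L : E n →L[ℝ] E n, HasFDerivWithinAt (outerNormal D) L (frontier D) s →
      HasDerivWithinAt (outerNormal D ∘ fun t : ℝ => T.π (s + t • v)) (L v)
        {t : ℝ | s + t • v ∈ tubeSet D T.δ} 0 := fun L hL =>
    hL.comp_hasDerivWithinAt_of_eq (0 : ℝ) hγ.hasDerivWithinAt hmaps hγ0.symm
  exact ((key _ hL).hasDerivAt (hO.mem_nhds h0)).unique ((key _ hA).hasDerivAt (hO.mem_nhds h0))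

theorem inner_outerNormal_tangent {s : E n} (v : tangentSpaceAt D s) :
    ⟪outerNormal D s, (v : E n)⟫_ℝ = 0 :=
  Submodule.mem_orthogonal_singleton_iff_inner_right.1 v.2

theorem coe_shapeOperator {s : E n} (hs : s ∈ frontier D) (v : tangentSpaceAt D s) :
    (shapeOperator D s v : E n) = T.A s v := by
  have hsT := T.frontier_subset hs
  have hmem : T.A s v ∈ tangentSpaceAt D s := by
    rw [Submodule.mem_orthogonal_singleton_iff_inner_right, ← T.nu_eq hs, T.inner_nu_A hsT]
  have h : shapeOperator D s v = (tangentSpaceAt D s).orthogonalProjectionOnto (T.A s v) := by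
    rw [← T.fderivWithin_outerNormal hs (inner_outerNormal_tangent v)]
    rfl
  rw [h]
  exact congrArg Subtype.val
    (Submodule.orthogonalProjectionOnto_mem_subspace_eq_self (⟨_, hmem⟩ : tangentSpaceAt D s))

theorem isSymmetric_shapeOperator (T : Tube D) {s : E n} (hs : s ∈ frontier D) :
    (shapeOperator D s).IsSymmetric := fun v w => by
  rw [Submodule.coe_inner, Submodule.coe_inner, T.coe_shapeOperator hs, T.coe_shapeOperator hs,
    T.inner_A_comm (T.frontier_subset hs)]

/-- As `A ν = 0`, the operator `A` factors through the projection to the tangent space; cyclicity of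
the trace then removes the inclusion and the projection. -/
theorem trace_shapeOperator {s : E n} (hs : s ∈ frontier D) :
    LinearMap.trace ℝ _ (shapeOperator D s) = LinearMap.trace ℝ _ (T.A s : E n →ₗ[ℝ] E n) ∧
    LinearMap.trace ℝ _ (shapeOperator D s ∘ₗ shapeOperator D s)
      = LinearMap.trace ℝ _ ((T.A s : E n →ₗ[ℝ] E n) ∘ₗ (T.A s : E n →ₗ[ℝ] E n)) := by
  have hsT := T.frontier_subset hs
  set P : E n →ₗ[ℝ] tangentSpaceAt D s :=
    ((tangentSpaceAt D s).orthogonalProjectionOnto : E n →L[ℝ] _).toLinearMap with hP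
  set ι := (tangentSpaceAt D s).subtype with hι
  have h1 : P ∘ₗ ι = LinearMap.id := by
    ext1 v
    exact Submodule.orthogonalProjectionOnto_mem_subspace_eq_self v
  have h2 : ∀ v, T.A s (P v : E n) = T.A s v := fun v => by
    have h3 : v - P v ∈ (tangentSpaceAt D s)ᗮ :=
      Submodule.sub_starProjection_mem_orthogonal v
    rw [Submodule.orthogonal_orthogonal, Submodule.mem_span_singleton] at h3
    obtain ⟨c, hc⟩ := h3
    have h4 : T.A s (v - P v) = 0 := by
      rw [← hc, map_smul, ← T.nu_eq hs, T.A_nu hsT, smul_zero]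
    rw [map_sub, sub_eq_zero] at h4
    exact h4.symm
  have key : ∀ S : tangentSpaceAt D s →ₗ[ℝ] tangentSpaceAt D s,
      LinearMap.trace ℝ _ (ι ∘ₗ (S ∘ₗ P)) = LinearMap.trace ℝ _ S := fun S => by
    rw [LinearMap.trace_comp_comm', LinearMap.comp_assoc, h1, LinearMap.comp_id]
  rw [← key, ← key]
  refine ⟨congrArg _ ?_, congrArg _ ?_⟩
  · ext1 v
    exact (T.coe_shapeOperator hs (P v)).trans (h2 v)
  · ext1 v
    refine (T.coe_shapeOperator hs _).trans ?_
    rw [T.coe_shapeOperator hs, h2]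
    rfl

/-- Differentiating `A_shift` at `r = 0` gives the Riccati equation `∂_ν A = -A²`; take traces. -/
theorem dh_eq {s : E n} (hs : s ∈ frontier D) :
    T.dh s = -LinearMap.trace ℝ _ ((T.A s : E n →ₗ[ℝ] E n) ∘ₗ (T.A s : E n →ₗ[ℝ] E n)) := by
  have hl : HasDerivAt (fun r : ℝ => s + r • outerNormal D s) (outerNormal D s) 0 := by
    simpa using ((hasDerivAt_id (0 : ℝ)).smul_const (outerNormal D s)).const_add s
  have h0 : s + (0 : ℝ) • outerNormal D s = s := by simp
  have hA : HasDerivAt (fun r : ℝ => T.A (s + r • outerNormal D s))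
      (fderiv ℝ T.A s (outerNormal D s)) 0 := by
    have h1 := (T.contDiff_A.differentiable (by simp) s).hasFDerivAt
    rw [← h0] at h1
    have h2 := h1.comp_hasDerivAt (0 : ℝ) hl
    rwa [h0] at h2
  have e1 : ∀ v, fderiv ℝ T.A s (outerNormal D s) v = -T.A s (T.A s v) := fun v => by
    have hv : HasDerivAt (fun r : ℝ => v + r • T.A s v) (T.A s v) 0 := by
      simpa using ((hasDerivAt_id (0 : ℝ)).smul_const (T.A s v)).const_add v
    have h1 := hA.clm_apply hv
    have h2 : (fun r : ℝ => T.A (s + r • outerNormal D s) (v + r • T.A s v)) =ᶠ[𝓝 0]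
        fun _ => T.A s v := by
      filter_upwards [Metric.ball_mem_nhds (0 : ℝ) T.δ_pos] with r hr
      rw [mem_ball_zero_iff, Real.norm_eq_abs] at hr
      have := congrArg (fun L => L v) (T.A_shift hs hr)
      simpa using this
    have h3 := h1.unique ((hasDerivAt_const (0 : ℝ) (T.A s v)).congr_of_eventuallyEq h2)
    simp only [zero_smul, add_zero] at h3
    exact eq_neg_of_add_eq_zero_left h3
  have h3 : HasDerivAt (fun r : ℝ => T.h (s + r • outerNormal D s)) (T.dh s) 0 := by
    have h1 := (T.contDiff_h.differentiable (by simp) s).hasFDerivAt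
    rw [← h0] at h1
    have h2 := h1.comp_hasDerivAt (0 : ℝ) hl
    rw [h0] at h2
    rw [dh, T.nu_eq hs]
    exact h2
  have h4 : HasDerivAt (fun r : ℝ => T.h (s + r • outerNormal D s))
      (∑ j, fderiv ℝ T.A s (outerNormal D s) (stdVec j) j) 0 := by
    simp only [h_eq_sum]
    refine HasDerivAt.fun_sum fun j _ => ?_
    have h5 := hA.clm_apply (hasDerivAt_const (0 : ℝ) (stdVec j : E n))
    have h6 := ((EuclideanSpace.proj j : E n →L[ℝ] ℝ).hasFDerivAt).comp_hasDerivAt (0 : ℝ) h5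
    rw [map_zero, add_zero] at h6
    exact h6
  rw [h3.unique h4, trace_eq_sum]
  simp [e1]

/-- The effective potential in terms of the mean curvatures. -/
theorem potential_eq {s : E n} (hs : s ∈ frontier D) :
    T.potential s = meanCurvature D 2 s - meanCurvature D 1 s ^ 2 / 4 := by
  obtain ⟨h1, h2⟩ := roots_charpoly_sums (T.isSymmetric_shapeOperator hs)
  obtain ⟨h3, h4⟩ := T.trace_shapeOperator hs
  have h5 := two_mul_esymm_two (principalCurvatures D s)
  have h6 := esymm_one_eq_sum (principalCurvatures D s)
  have h7 := T.dh_eq hs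
  -- With `h = H_1` and `tr A² = H_1² - 2 H_2`, the potential is `H_1²/4 - (H_1² - 2 H_2)/2 = H_2 -
  -- H_1²/4`.
  simp only [meanCurvature, principalCurvatures, potential, h] at *
  rw [h7, h6, h1, h3]
  rw [h1, h2, h3, h4] at h5
  linear_combination (-1 / 2 : ℝ) * h5

/-- The effective potential varies by `O(ε)` in the shell. -/
theorem exists_potential_sub_le : ∃ C, 0 ≤ C ∧ ∀ s ∈ frontier D, ∀ r : ℝ, |r| < 1 →
    |T.potential (T.normalMap (s, r)) - (meanCurvature D 2 s - meanCurvature D 1 s ^ 2 / 4)|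
      ≤ C * |r| := by
  obtain ⟨C, h0, hC⟩ := T.exists_bound_sub (T.contDiff_potential.comp T.contDiff_normalMap)
  refine ⟨C, h0, fun s hs r hr => ?_⟩
  have h1 := hC s hs r hr
  have h2 : T.normalMap (s, 0) = s := by simp [normalMap]
  rwa [Function.comp_apply, Function.comp_apply, h2, T.potential_eq hs, Real.norm_eq_abs] at h1

end Tube

end

end ThinShell

/-! ### Dirac matrices and reduction to a Clifford family. -/

namespace ThinShell

noncomputable section

section Matrices

variable {n N : ℕ} {α : Fin (n + 1) → Matrix (Fin N) (Fin N) ℂ}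

theorem spinor_inner_real (v w : Spinor N) : ⟪v, w⟫_ℝ = (⟪v, w⟫_ℂ).re := by
  rw [PiLp.inner_apply, PiLp.inner_apply, Complex.re_sum]
  rfl

theorem act_mul (A B : Matrix (Fin N) (Fin N) ℂ) (v : Spinor N) :
    act (A * B) v = act A (act B v) := by
  rw [act, map_mul]
  rfl

theorem act_smul (c : ℂ) (A : Matrix (Fin N) (Fin N) ℂ) (v : Spinor N) :
    act (c • A) v = c • act A v := by
  rw [act, map_smul]
  rfl

theorem act_sum {ι : Type*} (S : Finset ι) (A : ι → Matrix (Fin N) (Fin N) ℂ) (v : Spinor N) :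
    act (∑ i ∈ S, A i) v = ∑ i ∈ S, act (A i) v := by
  rw [act, map_sum, sum_apply]

theorem inner_act {A : Matrix (Fin N) (Fin N) ℂ} (hA : A.IsHermitian) (v w : Spinor N) :
    ⟪act A v, w⟫_ℝ = ⟪v, act A w⟫_ℝ := by
  have h : ContinuousLinearMap.adjoint (act A) = act A := by
    rw [← ContinuousLinearMap.star_eq_adjoint, ← map_star]
    exact congrArg _ hA
  rw [spinor_inner_real, spinor_inner_real]
  conv_rhs => rw [← h, ContinuousLinearMap.adjoint_inner_right]

namespace IsDiracFamily

theorem sq (hα : IsDiracFamily α) (j : Fin (n + 1)) : α j * α j = 1 := by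
  have h := hα.2 j j
  rw [if_pos rfl, ← two_smul ℂ] at h
  have h2 : (2 : Matrix (Fin N) (Fin N) ℂ) = (2 : ℂ) • 1 := by
    rw [two_smul, one_add_one_eq_two]
  rw [h2] at h
  exact smul_right_injective _ (two_ne_zero (α := ℂ)) h

theorem anticomm (hα : IsDiracFamily α) {j k : Fin (n + 1)} (h : j ≠ k) :
    α j * α k = -(α k * α j) := by
  have h1 := hα.2 j k
  rw [if_neg h] at h1
  exact eq_neg_of_add_eq_zero_left h1

end IsDiracFamily

/-- The matrices `-i α_{n+1} α_j`. -/
def bdryGen (α : Fin (n + 1) → Matrix (Fin N) (Fin N) ℂ) (j : Fin n) : Matrix (Fin N) (Fin N) ℂ :=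
  (-Complex.I) • (α (Fin.last n) * α j.castSucc)

theorem IsDiracFamily.last_anticomm (hα : IsDiracFamily α) (j : Fin n) :
    α j.castSucc * α (Fin.last n) = -(α (Fin.last n) * α j.castSucc) :=
  hα.anticomm (Fin.castSucc_lt_last j).ne

theorem isHermitian_bdryGen (hα : IsDiracFamily α) (j : Fin n) : (bdryGen α j).IsHermitian := by
  rw [Matrix.IsHermitian, bdryGen, Matrix.conjTranspose_smul, Matrix.conjTranspose_mul,
    (hα.1 _).eq, (hα.1 _).eq, hα.last_anticomm]
  simp

/-- Moving `α_{n+1}` past `α_j` gives a sign, which the factor `(-i)²` compensates. So the `B_j`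
inherit the anticommutation relations of the `α_j`. -/
theorem bdryGen_mul (hα : IsDiracFamily α) (j k : Fin n) :
    bdryGen α j * bdryGen α k = α j.castSucc * α k.castSucc := by
  have h : α (Fin.last n) * α j.castSucc * (α (Fin.last n) * α k.castSucc)
      = -(α j.castSucc * α k.castSucc) := by
    rw [mul_assoc, ← mul_assoc (α j.castSucc), hα.last_anticomm, neg_mul, mul_neg, mul_assoc,
      ← mul_assoc, hα.sq, one_mul]
  rw [bdryGen, bdryGen, smul_mul_smul_comm, h]
  simp

theorem last_mul_bdryGen (hα : IsDiracFamily α) (j : Fin n) :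
    α (Fin.last n) * bdryGen α j = (-Complex.I) • α j.castSucc := by
  rw [bdryGen, mul_smul_comm, ← mul_assoc, hα.sq, one_mul]

/-- The operators `-i α_{n+1} α_j`. -/
def bdryOp (α : Fin (n + 1) → Matrix (Fin N) (Fin N) ℂ) (j : Fin n) : Spinor N →L[ℝ] Spinor N :=
  (act (bdryGen α j)).restrictScalars ℝ

theorem isCliffordFamily_bdryOp (hα : IsDiracFamily α) : IsCliffordFamily (bdryOp α) where
  symm j v w := inner_act (isHermitian_bdryGen hα j) v w
  anti j k v := by
    change act (bdryGen α j) (act (bdryGen α k) v) + act (bdryGen α k) (act (bdryGen α j) v) = _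
    rw [← act_mul, ← act_mul, bdryGen_mul hα, bdryGen_mul hα, ← add_apply, ← map_add, hα.2]
    simp only [Fin.castSucc_inj]
    split_ifs
    · have h : (2 : Matrix (Fin N) (Fin N) ℂ) = 1 + 1 := one_add_one_eq_two.symm
      rw [h, map_add, map_one, two_smul]
      rfl
    · simp

theorem cliff_bdryOp (α : Fin (n + 1) → Matrix (Fin N) (Fin N) ℂ) (x : E n) (v : Spinor N) :
    cliff (bdryOp α) x v = act (bdryMatrix α x) v := by
  have h : bdryMatrix α x = ∑ j, ((x j : ℝ) : ℂ) • bdryGen α j := by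
    rw [bdryMatrix, Gam, Finset.mul_sum, Finset.smul_sum]
    refine Finset.sum_congr rfl fun j _ => ?_
    rw [bdryGen, mul_smul_comm, smul_comm]
  rw [cliff_apply, h, act_sum]
  refine Finset.sum_congr rfl fun j _ => ?_
  rw [act_smul]
  rfl

theorem norm_act_last (hα : IsDiracFamily α) (v : Spinor N) : ‖act (α (Fin.last n)) v‖ = ‖v‖ := by
  have h : ⟪act (α (Fin.last n)) v, act (α (Fin.last n)) v⟫_ℝ = ⟪v, v⟫_ℝ := by
    rw [inner_act (hα.1 _), ← act_mul, hα.sq, act, map_one]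
    rfl
  rwa [real_inner_self_eq_norm_sq, real_inner_self_eq_norm_sq,
    pow_left_inj₀ (norm_nonneg _) (norm_nonneg _) two_ne_zero] at h

end Matrices

section Operator

variable {n N : ℕ} {α : Fin (n + 1) → Matrix (Fin N) (Fin N) ℂ} {Ω : Set (E n)}

/-- The Dirac operator is `α_{n+1} (∑ B_j ∂_j + m)`, and `α_{n+1}` preserves the norm. In this form
the mass is a scalar. -/
theorem norm_diracOp (hα : IsDiracFamily α) (m : ℝ) (u : L2Domain n N Ω) :
    ‖diracOp α m u‖ = ‖diracL2 _ (bdryOp α) (weakPartial u) + m • u‖ := by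
  rw [Lp.norm_def, Lp.norm_def]
  congr 1
  refine eLpNorm_congr_norm_ae ?_
  have h1 : ∀ j, mulOp (volume.restrict Ω) (fun _ => bdryOp α j) (weakPartial u j)
      =ᵐ[volume.restrict Ω] fun x => bdryOp α j (weakPartial u j x) := fun j =>
    coeFn_mulOp (M := fun _ => bdryOp α j)
      ⟨stronglyMeasurable_const.aestronglyMeasurable, ‖bdryOp α j‖, by simp⟩ _
  unfold diracOp diracL2
  filter_upwards [Lp.coeFn_add ((-Complex.I) • ∑ j : Fin n, (act (α j.castSucc)).compLp
      (weakPartial u j)) ((m : ℂ) • (act (α (Fin.last n))).compLp u),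
    Lp.coeFn_smul (-Complex.I) (∑ j : Fin n, (act (α j.castSucc)).compLp (weakPartial u j)),
    Lp.coeFn_smul (m : ℂ) ((act (α (Fin.last n))).compLp u),
    coeFn_sum Finset.univ fun j : Fin n => (act (α j.castSucc)).compLp (weakPartial u j),
    eventually_all.2 fun j : Fin n => (act (α j.castSucc)).coeFn_compLp (weakPartial u j),
    (act (α (Fin.last n))).coeFn_compLp u,
    Lp.coeFn_add (∑ j, mulOp (volume.restrict Ω) (fun _ => bdryOp α j) (weakPartial u j)) (m • u),
    Lp.coeFn_smul m u,
    coeFn_sum Finset.univ fun j => mulOp (volume.restrict Ω) (fun _ => bdryOp α j)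
      (weakPartial u j), eventually_all.2 h1] with x e1 e2 e3 e4 e5 e6 e7 e8 e9 e10
  rw [e1, e7, Pi.add_apply, Pi.add_apply, e2, e3, e8, e9, Pi.smul_apply, Pi.smul_apply,
    Pi.smul_apply, e4, e6, ← norm_act_last hα (∑ j, _ + _)]
  simp only [e5, e10, map_add, map_sum, Finset.smul_sum]
  congr 2
  · refine Finset.sum_congr rfl fun j _ => ?_
    change _ = act (α (Fin.last n)) (act (bdryGen α j) _)
    rw [← act_mul, last_mul_bdryGen hα, act_smul]
  · exact (map_smul (act (α (Fin.last n))) (m : ℂ) (u x)).symm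

end Operator

end

end ThinShell

/-! ### Perturbation estimates and the transfer of the boundary condition. -/

namespace ThinShell

noncomputable section

/-- The squared norms of a family of vectors change little under small perturbations. -/
theorem abs_sum_norm_sq_sub_le {n : ℕ} {V : Type*} [NormedAddCommGroup V] {a e : Fin n → V}
    {C ε b : ℝ} (hε : 0 < ε) (hε1 : ε ≤ 1)
    (he : ∀ j, ‖e j‖ ≤ C * ε * (∑ k, ‖a k‖ + b)) :
    |∑ j, ‖a j + e j‖ ^ 2 - ∑ j, ‖a j‖ ^ 2|
      ≤ (1 + 4 * n * (n + 1) * C ^ 2) * ε * (∑ j, ‖a j‖ ^ 2 + b ^ 2) := by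
  set X := ∑ j, ‖a j‖ ^ 2 with hX
  have hX0 : 0 ≤ X := Finset.sum_nonneg fun j _ => by positivity
  have hn : (0 : ℝ) ≤ n := by positivity
  -- Cauchy–Schwarz for the sum over the `n` indices.
  have hs : (∑ k, ‖a k‖ + b) ^ 2 ≤ 2 * (n + 1) * (X + b ^ 2) := by
    have h1 := sq_sum_le_card_mul_sum_sq (s := Finset.univ) (f := fun k => ‖a k‖)
    rw [Finset.card_univ, Fintype.card_fin, ← hX] at h1
    nlinarith [sq_nonneg (∑ k, ‖a k‖ - b), sq_nonneg b, mul_nonneg hn (sq_nonneg b)]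
  have he2 : ∀ j, ‖e j‖ ^ 2 ≤ ε * (ε * (2 * (n + 1) * C ^ 2 * (X + b ^ 2))) := fun j => by
    have h1 : ‖e j‖ ^ 2 ≤ (C * ε * (∑ k, ‖a k‖ + b)) ^ 2 :=
      pow_le_pow_left₀ (norm_nonneg _) (he j) 2
    have h2 := mul_le_mul_of_nonneg_left hs (sq_nonneg (C * ε))
    calc _ ≤ _ := h1
      _ = (C * ε) ^ 2 * (∑ k, ‖a k‖ + b) ^ 2 := by ring
      _ ≤ _ := h2
      _ = _ := by ring
  set M := 2 * (n + 1) * C ^ 2 * (X + b ^ 2) with hM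
  have hM0 : 0 ≤ M := by positivity
  have hj : ∀ j, |‖a j + e j‖ ^ 2 - ‖a j‖ ^ 2| ≤ ε * ‖a j‖ ^ 2 + 2 * (ε * M) := fun j => by
    have h1 := abs_le.1 (abs_norm_sub_norm_le (a j + e j) (a j))
    rw [add_sub_cancel_left] at h1
    -- Young's inequality `2 x y ≤ ε x² + y² / ε`. The square of the error has two powers of `ε`, so
    -- one of them is left after the division.
    have h3 : 2 * (‖a j‖ * ‖e j‖) ≤ ε * ‖a j‖ ^ 2 + ε * M := by
      have h4 : ε * (2 * (‖a j‖ * ‖e j‖)) ≤ ε * (ε * ‖a j‖ ^ 2 + ε * M) := by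
        nlinarith [sq_nonneg (ε * ‖a j‖ - ‖e j‖), he2 j]
      exact le_of_mul_le_mul_left h4 hε
    have h5 : ‖e j‖ ^ 2 ≤ ε * M := (he2 j).trans (mul_le_of_le_one_left (by positivity) hε1)
    have h6 := norm_nonneg (a j)
    have h7 := norm_nonneg (e j)
    have h8 := norm_nonneg (a j + e j)
    rw [abs_le]
    constructor <;> nlinarith
  rw [← Finset.sum_sub_distrib]
  refine (Finset.abs_sum_le_sum_abs _ _).trans ((Finset.sum_le_sum fun j _ => hj j).trans ?_)
  rw [Finset.sum_add_distrib, ← Finset.mul_sum, ← hX, Finset.sum_const, Finset.card_univ,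
    Fintype.card_fin, nsmul_eq_mul, hM]
  have : 0 ≤ ε * b ^ 2 := by positivity
  nlinarith

theorem abs_inner_smulOp_sub_le {n N : ℕ} {D : Set (E n)} {c d : E n × ℝ → ℝ} (hc : Continuous c)
    [IsCompactMeasure (cylMeasure D)] {C : ℝ} (h : ∀ᵐ p ∂(cylMeasure D), |c p - d p| ≤ C)
    (hd : AEStronglyMeasurable d (cylMeasure D)) (w : L2Cyl n N D) :
    |⟪smulOp (Spinor N) _ c w, w⟫_ℝ - ∫ p, d p * ‖w p‖ ^ 2 ∂(cylMeasure D)| ≤ C * ‖w‖ ^ 2 := by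
  have h1 : ⟪smulOp (Spinor N) _ c w, w⟫_ℝ = ∫ p, c p * ‖w p‖ ^ 2 ∂(cylMeasure D) := by
    rw [L2.inner_def]
    refine integral_congr_ae ?_
    filter_upwards [coeFn_mulOp (isBoundedField_smul_of_continuous (F := Spinor N)
      (μ := cylMeasure D) hc) w] with p hp
    rw [hp]
    simp only [smul_apply, ContinuousLinearMap.id_apply, real_inner_smul_left,
      real_inner_self_eq_norm_sq]
  obtain ⟨C₁, hC₁⟩ := ae_bound_of_continuous (μ := cylMeasure D) hc
  have hi := integrable_norm_sq w
  have hi1 : Integrable (fun p => c p * ‖w p‖ ^ 2) (cylMeasure D) :=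
    hi.bdd_mul hc.aestronglyMeasurable hC₁
  have hi2 : Integrable (fun p => d p * ‖w p‖ ^ 2) (cylMeasure D) := by
    refine hi.bdd_mul (c := C + C₁) hd ?_
    filter_upwards [h, hC₁] with p g1 g2
    rw [Real.norm_eq_abs] at g2 ⊢
    rw [abs_le] at *
    constructor <;> linarith
  rw [h1, ← integral_sub hi1 hi2, norm_sq_eq_integral, ← integral_const_mul,
    ← Real.norm_eq_abs]
  refine norm_integral_le_of_norm_le (hi.const_mul C) ?_
  filter_upwards [h] with p hp
  rw [← sub_mul, norm_mul, Real.norm_eq_abs, Real.norm_of_nonneg (by positivity)]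
  exact mul_le_mul_of_nonneg_right hp (by positivity)

namespace Tube

variable {n N : ℕ} {D : Set (E n)} {T : Tube D} {ε : ℝ}
  {α : Fin (n + 1) → Matrix (Fin N) (Fin N) ℂ}

/-- The boundary condition in terms of `∂D`. -/
theorem IsThin.cliff_trace (h : T.IsThin ε) {σ : ℝ} (hσ : σ = 1 ∨ σ = -1)
    {τ : L2Boundary n N (tubeSet D ε)} (hτ : ∀ᵐ x ∂(surfaceMeasure (tubeSet D ε)),
      act (bdryMatrix α (outerNormal (tubeSet D ε) x)) (τ x) = τ x)
    {q : L2Boundary n N D} (hq : q =ᵐ[surfaceMeasure D] fun s => τ (T.normalMap (s, σ * ε))) :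
    ∀ᵐ s ∂(surfaceMeasure D), cliff (bdryOp α) (T.nu s) (q s) = σ • q s := by
  filter_upwards [hq, T.ae_normalMap h.lt_δ h.pos hσ hτ, ae_mem_frontier] with s h1 h2 hs
  rw [(T.normalMap_mem_frontier h.lt_δ h.pos hσ hs).2, ← cliff_bdryOp, ← h1, ← T.nu_eq hs] at h2
  -- The outward normal is `σ ν`, so the condition reads `σ B(ν) q = q`; multiply by `σ`, using `σ²
  -- = 1`.
  have h3 : cliff (bdryOp α) (σ • T.nu s) (q s) = σ • cliff (bdryOp α) (T.nu s) (q s) := by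
    simp only [cliff_apply, PiLp.smul_apply, smul_eq_mul, Finset.smul_sum, smul_smul]
  rw [h3] at h2
  conv_rhs => rw [← h2, smul_smul]
  rcases hσ with rfl | rfl <;> simp

theorem mulOp_cliff_eq [IsCompactMeasure (surfaceMeasure D)] {σ : ℝ} {q : L2Boundary n N D}
    (h : ∀ᵐ s ∂(surfaceMeasure D), cliff (bdryOp α) (T.nu s) (q s) = σ • q s) :
    mulOp _ (fun x => cliff (bdryOp α) (T.nu x)) q = σ • q := by
  refine Lp.ext ?_
  filter_upwards [coeFn_mulOp (isBoundedField_of_continuous (μ := surfaceMeasure D)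
    (T.continuous_cliff_nu (bdryOp α))) q, Lp.coeFn_smul σ q, h] with s h1 h2 h3
  rw [h1, h2, h3, Pi.smul_apply]

theorem smulOp_bdry [IsCompactMeasure (surfaceMeasure D)] {σ : ℝ} {q : L2Boundary n N D}
    (h : ∀ᵐ s ∂(surfaceMeasure D), cliff (bdryOp α) (T.nu s) (q s) = σ • q s)
    {c : E n → ℝ} (hc : Continuous c) : ∀ᵐ s ∂(surfaceMeasure D),
      act (bdryMatrix α (outerNormal D s)) (smulOp (Spinor N) _ c q s)
        = (σ : ℂ) • smulOp (Spinor N) _ c q s := by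
  filter_upwards [coeFn_mulOp (isBoundedField_smul_of_continuous (F := Spinor N)
    (μ := surfaceMeasure D) hc) q, h, ae_mem_frontier] with s h1 h2 hs
  rw [h1, ← cliff_bdryOp, ← T.nu_eq hs]
  simp only [smul_apply, ContinuousLinearMap.id_apply, map_smul, h2]
  rw [smul_comm]
  rfl

end Tube

end

end ThinShell

/-! ### Comparison of the quadratic forms. -/

namespace ThinShell

noncomputable section

namespace Tube

variable {n N : ℕ} {D : Set (E n)} {α : Fin (n + 1) → Matrix (Fin N) (Fin N) ℂ}

/-- The curvature terms of the two forms differ by `O(ε)`. -/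
theorem exists_abs_potential_sub_le [IsFiniteMeasure (surfaceMeasure D)]
    [IsCompactMeasure (cylMeasure D)] (T : Tube D) (N : ℕ) :
    ∃ C, 0 ≤ C ∧ ∀ ε, T.IsThin ε → IsCompactMeasure (volume.restrict (tubeSet D ε)) →
      ∀ U : Lp (Spinor N) 2 (volume.restrict (tubeSet D ε)) →ₗᵢ[ℝ] L2Cyl n N D,
      T.IsPullback ε U.toContinuousLinearMap → ∀ u,
      |⟪smulOp (Spinor N) _ T.potential u, u⟫_ℝ
        - ∫ p, (meanCurvature D 2 p.1 - meanCurvature D 1 p.1 ^ 2 / 4) * ‖U u p‖ ^ 2 ∂(cylMeasure D)|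
          ≤ C * ε * ‖u‖ ^ 2 := by
  obtain ⟨C, hC0, hC⟩ := T.exists_potential_sub_le
  refine ⟨C, hC0, fun ε h hc U hU u => ?_⟩
  have hV := T.contDiff_potential.continuous
  have e1 : ⟪smulOp (Spinor N) _ T.potential u, u⟫_ℝ
      = ⟪smulOp (Spinor N) _ (fun p => T.potential (T.cylMap ε p)) (U u), U u⟫_ℝ := by
    rw [← U.inner_map_map]
    exact congrArg (fun w => ⟪w, U u⟫_ℝ) (hU.apply_smulOp h hV u)
  rw [e1, ← U.norm_map u]
  have hb := h.pos
  refine abs_inner_smulOp_sub_le (hV.comp (T.contDiff_cylMap ε).continuous) ?_ ?_ (U u)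
  · filter_upwards [h.ae_cyl] with p hp
    have hr := h.abs_lt hp.2.1
    refine (hC p.1 hp.1 (ε * p.2) (hr.trans_le h.le_one)).trans ?_
    exact mul_le_mul_of_nonneg_left hr.le hC0
  -- The mean curvatures are defined through roots of a polynomial; their measurability comes from
  -- the agreement with the smooth potential on `∂D`.
  · have hV1 : Continuous fun p : E n × ℝ => T.potential p.1 := hV.comp continuous_fst
    refine hV1.aestronglyMeasurable.congr ?_
    filter_upwards [h.ae_cyl] with p hp
    rw [T.potential_eq hp.1]

/-- The tangential terms of the two forms differ by `O(ε)`. -/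
theorem exists_abs_tangDer_sub_le [IsFiniteMeasure (surfaceMeasure D)] (T : Tube D) (N : ℕ) :
    ∃ K, 0 < K ∧ ∀ ε, T.IsThin ε →
      ∀ U : Lp (Spinor N) 2 (volume.restrict (tubeSet D ε)) →L[ℝ] L2Cyl n N D,
      (∀ u, ‖U u‖ = ‖u‖) → ∀ p : JetSpace D (Spinor N) ε,
      |∑ j, ‖U (T.tangDer p j) + T.gradErr U p j‖ ^ 2 - ∑ j, ‖T.tangDer p j‖ ^ 2|
        ≤ K * ε * (∑ j, ‖T.tangDer p j‖ ^ 2 + ‖p.1‖ ^ 2) := by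
  obtain ⟨C, hC0, hC⟩ := exists_gradErr_le (F := Spinor N) T
  refine ⟨1 + 4 * n * (n + 1) * C ^ 2, by positivity, fun ε h U hU p => ?_⟩
  have e1 : ∀ k, ‖U (T.tangDer p k)‖ = ‖T.tangDer p k‖ := fun k => hU _
  have e2 := abs_sum_norm_sq_sub_le (a := fun k => U (T.tangDer p k))
    (e := fun j => T.gradErr U p j) (C := C) (b := ‖p.1‖) h.pos h.le_one (fun j => by
      simp only [e1]
      exact hC ε h U hU p j)
  simpa only [e1] using e2

/-- The comparison of the quadratic forms, in terms of their parts. -/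
theorem form_bounds {X Y Z P Q S Bd K L m ε : ℝ} (hε : 0 < ε) (hK : 0 < K) (hL : 0 ≤ L)
    (hKε : K * ε ≤ 1 / 2) (hX : 0 ≤ X) (hY : 0 ≤ Y) (hS : 0 ≤ S) (hB : 0 ≤ Bd)
    (h1 : |Y - X| ≤ K * ε * (X + S)) (h2 : |P - Q| ≤ L * ε * S) :
    (1 + -1 * (2 * K + L) * ε) * Y + Q + Z + (m + -1 * (2 * K + L) * ε ^ 2) * Bd
        + (m ^ 2 + -1 * (2 * K + L) * ε) * S ≤ X + Z + P + m * Bd + m ^ 2 * S ∧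
      X + Z + P + m * Bd + m ^ 2 * S ≤ (1 + 1 * (2 * K + L) * ε) * Y + Q + Z
        + (m + 1 * (2 * K + L) * ε ^ 2) * Bd + (m ^ 2 + 1 * (2 * K + L) * ε) * S := by
  obtain ⟨x1, x2⟩ := abs_le.1 h1
  obtain ⟨y1, y2⟩ := abs_le.1 h2
  -- The forms contain `Y`, while the error is measured by `X`. Since `K ε ≤ 1/2`, the error can be
  -- absorbed and measured by `Y` at the cost of a factor `2`; this is the origin of `2 K` in the
  -- constant.
  have hXS : X + S ≤ 2 * (Y + S) := by
    have := mul_le_mul_of_nonneg_right hKε (add_nonneg hX hS)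
    linarith
  have k1 : K * ε * (X + S) ≤ 2 * (K * ε * (Y + S)) := by
    have := mul_le_mul_of_nonneg_left hXS (mul_nonneg hK.le hε.le)
    linarith
  -- The boundary part is reproduced exactly, so its correction is only a nonnegative surplus, which
  -- has the right sign on both sides.
  have k2 : 0 ≤ (2 * K + L) * ε ^ 2 * Bd := by positivity
  have k3 : 0 ≤ L * ε * Y := by positivity
  have k4 : 0 ≤ K * ε * S := by positivity
  constructor <;> linarith

set_option maxHeartbeats 1000000 in
/-- The comparison of the Dirac operator in the shell with the forms on the cylinder. -/
theorem comparison (T : Tube D) (hα : IsDiracFamily α) {m : ℝ} :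
    ∃ ε₀ > 0, ∃ c > 0, ∀ ε ∈ Ioo (0 : ℝ) ε₀,
      ∃ U : L2Domain n N (tubeSet D ε) ≃ₗᵢ[ℂ] L2Cyl n N D,
        ∀ u : L2Domain n N (tubeSet D ε), MemDomDirac α u →
          MemDomForm α (U u) ∧
          cForm m c ε (-1) (U u) ≤ ‖diracOp α m u‖ ^ 2 ∧
          ‖diracOp α m u‖ ^ 2 ≤ cForm m c ε 1 (U u) := by
  have i1 := T.isFiniteMeasure_surfaceMeasure
  have i2 := T.isCompactMeasure_surfaceMeasure
  have i3 := T.isCompactMeasure_cylMeasure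
  obtain ⟨ε₁, hε₁, hthin⟩ := T.exists_isThin
  obtain ⟨K, hK0, hK⟩ := T.exists_abs_tangDer_sub_le N
  obtain ⟨L, hL0, hL⟩ := T.exists_abs_potential_sub_le N
  -- The bound `1 / (2 K)` ensures `K ε ≤ 1/2` as required by `form_bounds`, which also dictates `c
  -- = 2 K + L`.
  refine ⟨min ε₁ (1 / (2 * K)), by positivity, 2 * K + L, by positivity, fun ε hε => ?_⟩
  have h : T.IsThin ε := hthin ε hε.1 (hε.2.trans_le (min_le_left _ _))
  have i4 := T.isCompactMeasure_tubeSet h.lt_δ.le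
  have hKε : K * ε ≤ 1 / 2 := by
    have h1 := hε.2.le.trans (min_le_right _ _)
    rw [le_div_iff₀ (by positivity)] at h1
    linarith
  obtain ⟨U, hU⟩ := T.exists_unitary (N := N) h.pos h.lt_δ.le h.half_lt_J
  refine ⟨U, fun u hu => ?_⟩
  obtain ⟨-, τ, hτ, hbc⟩ := hu
  obtain ⟨f, p, hf, hp, rfl, hp2, hp3, hp4⟩ := h.exists_jet hτ
  -- The same map viewed over `ℝ`, since the jet calculus uses real inner products.
  let V : Lp (Spinor N) 2 (volume.restrict (tubeSet D ε)) →ₗᵢ[ℝ] L2Cyl n N D :=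
    { toLinearMap := (U.toLinearEquiv.toLinearMap).restrictScalars ℝ
      norm_map' := U.norm_map }
  have hV : T.IsPullback ε V.toContinuousLinearMap := hU
  have hmem : p ∈ T.jets (Spinor N) ε :=
    mem_closure_of_tendsto hp (Eventually.of_forall fun k => ⟨f k, hf k, rfl⟩)
  have b1 := h.cliff_trace (α := α) (Or.inl rfl) hbc (q := p.2.2.1) (by rwa [one_mul])
  have b2 := h.cliff_trace (α := α) (Or.inr rfl) hbc (q := p.2.2.2) (by rwa [neg_one_mul])
  have hcv := hV.convergesH1 h hf hp
  have t1 := hcv.isEndTrace (tendsto_pullback_one hf hp)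
  have t2 := hcv.isEndTrace (tendsto_pullback_neg_one hf hp)
  have hdom : MemDomForm α (U p.1) := by
    refine ⟨hcv.memH1Cyl, fun t₀ ht => ?_⟩
    rcases ht with rfl | rfl
    · exact ⟨_, t2, smulOp_bdry b2 (T.continuous_rootWeight_left ε (-1))⟩
    · exact ⟨_, t1, smulOp_bdry b1 (T.continuous_rootWeight_left ε 1)⟩
  refine ⟨hdom, ?_⟩
  -- the Dirac operator
  have c1 := mulOp_cliff_eq b1
  have c2 := mulOp_cliff_eq b2
  rw [one_smul] at c1
  rw [neg_one_smul] at c2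
  have hB := isCliffordFamily_bdryOp hα
  have d1 := T.norm_diracL2_sq hB h.pos h.lt hmem c1 c2
  have d2 := T.two_mul_inner_diracL2 hB h.pos h.lt hmem c1 c2
  have d3 : ‖diracOp α m p.1‖ ^ 2 = ‖diracL2 _ (bdryOp α) p.2.1‖ ^ 2
      + m * (2 * ⟪diracL2 _ (bdryOp α) p.2.1, p.1⟫_ℝ) + m ^ 2 * ‖p.1‖ ^ 2 := by
    rw [norm_diracOp hα, ← hp2, norm_add_sq_real, real_inner_smul_right, norm_smul, mul_pow,
      Real.norm_eq_abs, sq_abs]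
    ring
  rw [d1, d2] at d3
  -- the form
  have f1 : surfGrad (U p.1) = _ := hcv.surfGrad_eq
  have f2 : weakDt (U p.1) = _ := hcv.weakDt_eq
  have f3 : endTrace (U p.1) 1 = _ := T.endTrace_eq (Or.inr rfl) t1
  have f4 : endTrace (U p.1) (-1) = _ := T.endTrace_eq (Or.inl rfl) t2
  have g1 := h.norm_rootWeight_sq (Or.inl rfl) p.2.2.1
  have g2 := h.norm_rootWeight_sq (Or.inr rfl) p.2.2.2
  rw [mul_one] at g1
  rw [mul_neg, mul_one] at g2
  have g3 : ‖endTrace (U p.1) (-1)‖ ^ 2 + ‖endTrace (U p.1) 1‖ ^ 2 = ε * T.bdryTerm ε p := by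
    rw [f3, f4, g1, g2, bdryTerm]
    ring
  have g4 : ‖weakDt (U p.1)‖ ^ 2
      = ε ^ 2 * ‖T.normalDer p + (1 / 2 : ℝ) • smulOp (Spinor N) _ T.h p.1‖ ^ 2 := by
    rw [f2, norm_smul, mul_pow, Real.norm_eq_abs, sq_abs]
    exact congrArg (fun x => ε ^ 2 * x ^ 2) (V.norm_map _)
  have g5 : |∑ j, ‖surfGrad (U p.1) j‖ ^ 2 - ∑ j, ‖T.tangDer p j‖ ^ 2|
      ≤ K * ε * (∑ j, ‖T.tangDer p j‖ ^ 2 + ‖p.1‖ ^ 2) := by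
    rw [f1]
    exact hK ε h V.toContinuousLinearMap V.norm_map p
  have g6 := hL ε h i4 V hV p.1
  have g7 : ‖U p.1‖ = ‖p.1‖ := U.norm_map _
  have hpos := h.pos
  have hB0 : 0 ≤ T.bdryTerm ε p := by
    have : 0 ≤ ε * T.bdryTerm ε p := by 
      rw [← g3]
      exact add_nonneg (sq_nonneg _) (sq_nonneg _)
    exact nonneg_of_mul_nonneg_right this hpos
  -- The powers of `ε` cancel: the normal term has `ε⁻² ε²`, and the end traces contribute `ε⁻² (m ε
  -- ± c ε³) ε = m ± c ε²` times the boundary integral in the shell.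
  have hform : ∀ c sgn : ℝ, cForm m c ε sgn (U p.1)
      = (1 + sgn * c * ε) * (∑ j, ‖surfGrad (U p.1) j‖ ^ 2)
        + (∫ q, (meanCurvature D 2 q.1 - meanCurvature D 1 q.1 ^ 2 / 4) * ‖V p.1 q‖ ^ 2
          ∂(cylMeasure D))
        + ‖T.normalDer p + (1 / 2 : ℝ) • smulOp (Spinor N) _ T.h p.1‖ ^ 2
        + (m + sgn * c * ε ^ 2) * T.bdryTerm ε p + (m ^ 2 + sgn * c * ε) * ‖p.1‖ ^ 2 := by
    intro c sgn
    rw [cForm, g3, g4, g7]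
    have : (U p.1 : E n × ℝ → Spinor N) = V p.1 := rfl
    rw [this]
    have hε0 := hpos.ne'
    field_simp
    ring_nf
  rw [hform, hform, d3]
  exact form_bounds hpos hK0 hL0 hKε (Finset.sum_nonneg fun j _ => by positivity)
    (Finset.sum_nonneg fun j _ => by positivity) (by positivity) hB0 g5 g6

end Tube

end

end ThinShell

open ThinShell
theorem proposition3p2 (n : ℕ) (hn : 2 ≤ n)
    (D : Set (E n)) (hD : IsSmoothBoundedDomain D)
    (α : Fin (n + 1) → Matrix (Fin (2 ^ ((n + 1) / 2))) (Fin (2 ^ ((n + 1) / 2))) ℂ)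
    (hα : IsDiracFamily α) (m : ℝ) (hm : 0 ≤ m) :
    ∃ ε₀ > 0, ∃ c > 0, ∀ ε ∈ Ioo (0 : ℝ) ε₀,
      ∃ U : L2Domain n (2 ^ ((n + 1) / 2)) (shell D ε) ≃ₗᵢ[ℂ] L2Cyl n (2 ^ ((n + 1) / 2)) D,
        ∀ u : L2Domain n (2 ^ ((n + 1) / 2)) (shell D ε), MemDomDirac α u →
          MemDomForm α (U u) ∧
          cForm m c ε (-1) (U u) ≤ ‖diracOp α m u‖ ^ 2 ∧
          ‖diracOp α m u‖ ^ 2 ≤ cForm m c ε 1 (U u) := by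
  obtain ⟨T⟩ := hD.nonempty_tube
  obtain ⟨ε₀, hε₀, c, hc, h⟩ := T.comparison hα (m := m)
  refine ⟨ε₀, hε₀, c, hc, fun ε hε => ?_⟩
  rw [shell_eq hε.1]
  exact h ε hε
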